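/- **Setting.** A tabular episodic MDP has finite non-empty sets of $S$ states and $A$ actions, horizon $H\ge 1$, transition probabilities $P_h(\cdot\mid s,a)$ and, for each $(h,s,a)$, a cost distribution on $[0,1]$ with mean $c_h(s,a)$, $1\le h\le H$. For a policy $\pi$ let $V_h^\pi(s)=\mathbb E[\sum_{h'=h}^H c_{h'}(s_{h'},a_{h'})\mid s_h=s,\pi,P]$ and $V_h^*(s)=\min_\pi V_h^\pi(s)$. The learner knows neither $P$ nor the costs. In each episode $k=1,\dots,K$ it starts from the fixed state $s_1$, plays a policy $\pi^k$, and observes only the visited states, the actions, and the costs of the visited pairs (bandit feedback). $\mathrm{Regret}(K)=\sum_{k=1}^K\big(V_1^{\pi^k}(s_1)-V_1^*(s_1)\big)$. **Algorithm RPO-SAT** with confidence level $\delta\in(0,1)$. Put $\delta'=\delta/5$, $T=HK$, $C_0=\sqrt{S^3AH^3}$, $L=\ln\frac{2SAHK}{\delta'}$, $L_c=\ln\frac{2SAHT}{\delta'}$, $L_p=\ln\frac{3SAHT}{\delta'}$. Start with $\pi^1$ uniform and $V^{\mathrm{ref}}=0$. After the rollout of episode $k$ let $n_h^k(s)$, $n=n_h^k(s,a)$,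 $\bar c_h^k$, $\bar P_h^k$ be the visit counts, the empirical mean costs and the empirical transition probabilities of the episodes $1,\dots,k$. Put $V^k_{H+1}=V^{\mathrm{ref}}_{H+1}=0$ and, for $h=H,\dots,1$, $$Q_h^k(s,a)=\max\{\bar c_h^k(s,a)+\textstyle\sum_y\bar P_h^k(y\mid s,a)V_{h+1}^k(y)-b_h^k(s,a),\,0\},\qquad V_h^k(s)=\sum_a\pi_h^k(a\mid s)Q_h^k(s,a)$$ (with $Q_h^k(s,a)=0$ if $n=0$), where the bonus is $b_h^k(s,a)=\min\Big\{u_h^k(s,a),\ \sqrt{\tfrac{2L_c}{n}}+H\sqrt{\tfrac{4SL_p}{n}}\Big\}$ and $$\begin{aligned}u_h^k(s,a)=&\sqrt{\tfrac{2L_c}{n}}+\sqrt{\tfrac{6\,\mathbb V_{Y\sim\bar P_h^k(\cdot\mid s,a)}V^{\mathrm{ref}}_{h+1}(Y)\,L}{n}}+\sqrt{\tfrac{4HL}{Sn}}+\tfrac{8\sqrt{SH^2}L}{3n}\\&+\sum_y\Big(\sqrt{\tfrac{2\bar P_h^k(y\mid s,a)(1-\bar P_h^k(y\mid s,a))L}{n-1}}+\tfrac{7L}{3n}\Big)\big|V_{h+1}^k(y)-V_{h+1}^{\mathrm{ref}}(y)\big|\\&+\sqrt{\tfrac{4HL_p}{n}}+\tfrac{7SHL}{3n}+\tfrac{2S^{3/2}A^{1/4}H^{7/4}K^{1/4}\sqrt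 L}{n}\end{aligned}$$ (for $n=1$ the square roots with $n-1$ are read as $0$). Then, for all $h,s$, $$\pi_h^{k+1}(\cdot\mid s)=\operatorname*{arg\,min}_{x\in\Delta_{\mathcal A}}\ \eta_k\langle Q_h^k(s,\cdot),x-\pi_h^k(\cdot\mid s)\rangle+\|x-\pi_h^k(\cdot\mid s)\|_2^2,$$ and for all $(h,s)$ with $n_h^k(s)\ge C_0\sqrt k$ the reference value is reset to $V_h^{\mathrm{ref}}(s)=\frac1{n_h^k(s)}\sum_{i\le k}V_h^i(s)\mathbf 1[s_h^i=s]$. **Theorem.** For all $0<c_1\le c_2$ there are constants $C,K_0>0$ and exponents $r,q\in\mathbb N$, depending only on $c_1,c_2$, such that the following holds for every tabular episodic MDP, every $\delta\in(0,1)$, every number of episodes $K\ge K_0(SAH/\delta)^q$ and all non-increasing step sizes with $c_1/\sqrt{H^2At}\le\eta_t\le c_2/\sqrt{H^2At}$ for $1\le t\le K$. With probability at least $1-\delta$, $$\mathrm{Regret}(K)\le C\,\Big(\ln\tfrac{SAHK}{\delta}\Big)^r\Big(\sqrt{SAH^3K}+\sqrt{AH^4K}+S^{5/2}A^{5/4}H^{3/2}K^{1/4}\Big).$$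 In particular, if $S>H$, then with probability at least $1-\delta$ the regret is at most $C\,(\ln\frac{SAHK}{\delta})^r\sqrt{SAH^3K}$. -/

import Mathlib

open MeasureTheory Finset

namespace RPOSAT

/-- A time-inhomogeneous tabular MDP with random costs in `[0,1]`. Steps are numbered from `0`;
with horizon `H` only the steps `h < H` are ever used. -/
structure MDP (S A : Type*) [Fintype S] where
  /-- `P h s a y` is the probability to move from `s` to `y` when `a` is played at step `h`. -/
  P : ℕ → S → A → S → ℝ
  P_mem : ∀ h s a, P h s a ∈ stdSimplex ℝ S
  /-- the distribution of the random cost of `(s, a)` at step `h` -/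
  costLaw : ℕ → S → A → Measure ℝ
  costLaw_prob : ∀ h s a, IsProbabilityMeasure (costLaw h s a)
  costLaw_Icc : ∀ h s a, ∀ᵐ x ∂(costLaw h s a), x ∈ Set.Icc (0 : ℝ) 1

/-- A stochastic policy: a probability vector over actions for every step and state. -/
def IsPolicy {S A : Type*} [Fintype A] (π : ℕ → S → A → ℝ) : Prop :=
  ∀ h s, π h s ∈ stdSimplex ℝ A

section Values

variable {S A : Type*} [Fintype S] [Fintype A] [DecidableEq S]

/-- The expected cost `c_h(s, a)`. -/
noncomputable def MDP.c (M : MDP S A) (h : ℕ) (s : S) (a : A) : ℝ := ∫ x, x ∂(M.costLaw h s a)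

/-- Probability that the `n` state-action pairs visited at the steps `h, …, h + n - 1` are `τ`,
when the state at step `h` is `s` and the policy `π` is followed. -/
noncomputable def MDP.trajProb (M : MDP S A) (π : ℕ → S → A → ℝ) :
    (n : ℕ) → ℕ → S → (Fin n → S × A) → ℝ
  | 0, _, _, _ => 1
  | n + 1, h, s, τ =>
      (if (τ 0).1 = s then π h s (τ 0).2 else 0) *
        ∑ y, M.P h s (τ 0).2 y * M.trajProb π n (h + 1) y (Fin.tail τ)

/-- The value function `V_h^π(s)`: the expected total cost of the steps `h, …, H - 1` when the
state at step `h` is `s` and `π` is followed. -/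
noncomputable def MDP.value (M : MDP S A) (H : ℕ) (π : ℕ → S → A → ℝ) (h : ℕ) (s : S) : ℝ :=
  ∑ τ : Fin (H - h) → S × A,
    M.trajProb π (H - h) h s τ * ∑ j : Fin (H - h), M.c (h + j) (τ j).1 (τ j).2

/-- The optimal value function `V_h^*(s) = min_π V_h^π(s)`. -/
noncomputable def MDP.optValue (M : MDP S A) (H : ℕ) (h : ℕ) (s : S) : ℝ :=
  ⨅ π : {π : ℕ → S → A → ℝ // IsPolicy π}, M.value H π.1 h s

end Values

/-- What is observed in one episode: the states at the steps `0, …, H`, the actions and the costs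
of the played state-action pairs at the steps `0, …, H - 1` (other entries are never used). -/
structure Episode (S A : Type*) where
  state : ℕ → S
  action : ℕ → A
  cost : ℕ → ℝ

/-- The inputs of the algorithm: horizon, number of episodes, confidence level, step sizes. -/
structure Params where
  H : ℕ
  K : ℕ
  δ : ℝ
  η : ℕ → ℝ

section MirrorDescent

variable {A : Type*} [Fintype A]

/-- The objective of one step of mirror descent with squared Euclidean regularization. -/
noncomputable def mdObjective (η : ℝ) (q p x : A → ℝ) : ℝ :=
  η * ∑ a, q a * (x a - p a) + ∑ a, (x a - p a) ^ 2

theorem exists_mdStep [Nonempty A] (η : ℝ) (q p : A → ℝ) :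
    ∃ x ∈ stdSimplex ℝ A, IsMinOn (mdObjective η q p) (stdSimplex ℝ A) x := by
  classical
  refine (isCompact_stdSimplex ℝ A).exists_isMinOn
    ⟨_, single_mem_stdSimplex ℝ (Classical.arbitrary A)⟩ (Continuous.continuousOn ?_)
  unfold mdObjective
  fun_prop

/-- The (unique) minimizer over the probability simplex of
`x ↦ η ⟨q, x - p⟩ + ‖x - p‖₂²`. -/
noncomputable def mdStep [Nonempty A] (η : ℝ) (q p : A → ℝ) : A → ℝ :=
  Classical.choose (exists_mdStep η q p)

end MirrorDescent

section Algorithm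

variable {S A : Type*} [Fintype S] [Fintype A] [DecidableEq S] [DecidableEq A]

/-! Counters and empirical model. The episodes are numbered from `1`; `D i` is the data of episode
`i`, and every quantity with index `k` uses the data of the episodes `1, …, k`. -/

/-- `n_h^k(s)` -/
def visitS (D : ℕ → Episode S A) (k h : ℕ) (s : S) : ℕ :=
  #{i ∈ Icc 1 k | (D i).state h = s}

/-- `n_h^k(s, a)` -/
def visitSA (D : ℕ → Episode S A) (k h : ℕ) (s : S) (a : A) : ℕ :=
  #{i ∈ Icc 1 k | (D i).state h = s ∧ (D i).action h = a}

/-- `n_h^k(s, a, y)` -/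
def visitSAS (D : ℕ → Episode S A) (k h : ℕ) (s : S) (a : A) (y : S) : ℕ :=
  #{i ∈ Icc 1 k | (D i).state h = s ∧ (D i).action h = a ∧ (D i).state (h + 1) = y}

/-- Empirical mean cost. -/
noncomputable def cBar (D : ℕ → Episode S A) (k h : ℕ) (s : S) (a : A) : ℝ :=
  (∑ i ∈ Icc 1 k with (D i).state h = s ∧ (D i).action h = a, (D i).cost h) / visitSA D k h s a

/-- Empirical transition probabilities. -/
noncomputable def PBar (D : ℕ → Episode S A) (k h : ℕ) (s : S) (a : A) (y : S) : ℝ :=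
  (visitSAS D k h s a y : ℝ) / visitSA D k h s a

/-- Variance of `f(Y)` for `Y` with weights `w`. -/
noncomputable def variance (w f : S → ℝ) : ℝ := ∑ y, w y * (f y - ∑ z, w z * f z) ^ 2

/-- `ln (m S A H N / δ')` with `δ' = δ / 5`. -/
noncomputable def logTerm (S A : Type*) [Fintype S] [Fintype A] (p : Params) (m N : ℝ) : ℝ :=
  Real.log (m * Fintype.card S * Fintype.card A * p.H * N / (p.δ / 5))

/-- `C₀ = √(S³ A H³)` -/
noncomputable def C0 (S A : Type*) [Fintype S] [Fintype A] (p : Params) : ℝ :=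
  √((Fintype.card S : ℝ) ^ 3 * Fintype.card A * (p.H : ℝ) ^ 3)

/-- Confidence width for the mean cost from `n` observations (`T = H K` is the number of steps). -/
noncomputable def costWidth (S A : Type*) [Fintype S] [Fintype A] (p : Params) (n : ℝ) : ℝ :=
  √(2 * logTerm S A p 2 (p.H * p.K) / n)

/-- The crude bonus, which does not use the reference value. -/
noncomputable def coarseBonus (S A : Type*) [Fintype S] [Fintype A] (p : Params) (n : ℝ) : ℝ :=
  costWidth S A p n + p.H * √(4 * Fintype.card S * logTerm S A p 3 (p.H * p.K) / n)

/-- The reference-based bonus `u`, from `n` visits, empirical transition probabilities `w`, the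
estimated value `V` and the reference value `Vref` at the next step. -/
noncomputable def refBonus (p : Params) (A : Type*) [Fintype A] (n : ℝ) (w V Vref : S → ℝ) : ℝ :=
  let L : ℝ := logTerm S A p 2 p.K
  let cS : ℝ := Fintype.card S
  let cA : ℝ := Fintype.card A
  let H : ℝ := p.H
  costWidth S A p n
  + (√(6 * variance w Vref * L / n) + √(4 * H * L / (cS * n)) + 8 * √(cS * H ^ 2) * L / (3 * n))
  + ∑ y, (√(2 * w y * (1 - w y) * L / (n - 1)) + 7 * L / (3 * n)) * |V y - Vref y|
  + (√(4 * H * logTerm S A p 3 (p.H * p.K) / n) + 7 * cS * H * L / (3 * n)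
      + 2 * cS ^ (3 / 2 : ℝ) * cA ^ (1 / 4 : ℝ) * H ^ (7 / 4 : ℝ) * (p.K : ℝ) ^ (1 / 4 : ℝ) * √L / n)

/-- The bonus `b_h^k(s, a)`, where `V` is the estimated value at step `h + 1`. -/
noncomputable def bonus (p : Params) (D : ℕ → Episode S A) (k h : ℕ) (V Vref : S → ℝ)
    (s : S) (a : A) : ℝ :=
  min (refBonus p A (visitSA D k h s a) (PBar D k h s a) V Vref)
    (coarseBonus S A p (visitSA D k h s a))

/-- The optimistic estimate `Q_h^k(s, a)` from the estimate `V` of the value at step `h + 1`.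
A pair that was never visited gets the estimate `0` (as with an infinite bonus): then
`cBar`, `PBar` and, by the convention `x / 0 = 0`, every term of the bonus are `0`. -/
noncomputable def qStep (p : Params) (D : ℕ → Episode S A) (k h : ℕ) (V Vref : S → ℝ)
    (s : S) (a : A) : ℝ :=
  max (cBar D k h s a + ∑ y, PBar D k h s a y * V y - bonus p D k h V Vref s a) 0

/-- Policy evaluation of `π` in episode `k`, backwards: the estimated value with `m` steps to go,
that is, at step `H - m`. -/
noncomputable def evalToGo (p : Params) (D : ℕ → Episode S A) (k : ℕ) (π : ℕ → S → A → ℝ)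
    (Vref : ℕ → S → ℝ) : ℕ → S → ℝ
  | 0, _ => 0
  | m + 1, s =>
      let h := p.H - (m + 1)
      ∑ a, qStep p D k h (evalToGo p D k π Vref m) (Vref (h + 1)) s a * π h s a

/-- The estimated value `V_h^k`. -/
noncomputable def evalV (p : Params) (D : ℕ → Episode S A) (k : ℕ) (π : ℕ → S → A → ℝ)
    (Vref : ℕ → S → ℝ) (h : ℕ) : S → ℝ :=
  evalToGo p D k π Vref (p.H - h)

/-- The estimated `Q_h^k`. -/
noncomputable def evalQ (p : Params) (D : ℕ → Episode S A) (k : ℕ) (π : ℕ → S → A → ℝ)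
    (Vref : ℕ → S → ℝ) (h : ℕ) : S → A → ℝ :=
  qStep p D k h (evalV p D k π Vref (h + 1)) (Vref (h + 1))

/-- The memory of the algorithm between two episodes: the policy for the next episode, the
reference value, and the sums `∑_{i ≤ k} V_h^i(s) 1[s_h^i = s]`. -/
structure AlgState (S A : Type*) where
  policy : ℕ → S → A → ℝ
  vref : ℕ → S → ℝ
  vsum : ℕ → S → ℝ

/-- Initially the policy is uniform and the reference value is zero. -/
noncomputable def AlgState.init (S A : Type*) [Fintype A] : AlgState S A where
  policy := fun _ _ _ => 1 / (Fintype.card A : ℝ)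
  vref := fun _ _ => 0
  vsum := fun _ _ => 0

/-- The computations after the rollout of episode `k`: policy evaluation, policy improvement, and
update of the reference value at the pairs `(h, s)` with `n_h^k(s) ≥ C₀ √k`. -/
noncomputable def AlgState.update [Nonempty A] (p : Params) (D : ℕ → Episode S A) (k : ℕ)
    (σ : AlgState S A) : AlgState S A :=
  let V := evalV p D k σ.policy σ.vref
  let Q := evalQ p D k σ.policy σ.vref
  let vsum' := fun h s => σ.vsum h s + if (D k).state h = s then V h s else 0
  { policy := fun h s => mdStep (p.η k) (Q h s) (σ.policy h s)
    vref := fun h s =>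
      if C0 S A p * √(k : ℝ) ≤ visitS D k h s then vsum' h s / visitS D k h s else σ.vref h s
    vsum := vsum' }

/-- The memory of the algorithm after the episodes `1, …, k`. -/
noncomputable def run [Nonempty A] (p : Params) (D : ℕ → Episode S A) : ℕ → AlgState S A
  | 0 => AlgState.init S A
  | k + 1 => (run p D k).update p D (k + 1)

/-- The policy `π^k` played in episode `k ≥ 1`; it depends only on the data of the episodes
`1, …, k - 1`. -/
noncomputable def policyAt [Nonempty A] (p : Params) (D : ℕ → Episode S A) (k : ℕ) :
    ℕ → S → A → ℝ :=
  (run p D (k - 1)).policy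

/-- `Regret(K) = ∑_{k=1}^K (V_1^{π^k}(s₁) - V_1^*(s₁))` for the observed data `D`. -/
noncomputable def regret [Nonempty A] (M : MDP S A) (p : Params) (s₁ : S)
    (D : ℕ → Episode S A) : ℝ :=
  ∑ k ∈ Icc 1 p.K, (M.value p.H (policyAt p D k) 0 s₁ - M.optValue p.H 0 s₁)

end Algorithm

section Interaction

variable {S A Ω : Type*}

/-- The information available when the action of step `h` of episode `k` has to be chosen: all
earlier episodes, the states up to step `h`, and the actions and costs before step `h`. -/
abbrev history (H : ℕ) (X : ℕ → Ω → Episode S A) (k h : ℕ) : MeasurableSpace Ω :=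
  (⨆ i ∈ Finset.Ico 1 k, ⨆ j ∈ Finset.range (H + 1),
      MeasurableSpace.comap (fun ω => (X i ω).state j) ⊤) ⊔
  (⨆ i ∈ Finset.Ico 1 k, ⨆ j ∈ Finset.range H,
      MeasurableSpace.comap (fun ω => (X i ω).action j) ⊤ ⊔
      MeasurableSpace.comap (fun ω => (X i ω).cost j) inferInstance) ⊔
  (⨆ j ∈ Finset.range (h + 1), MeasurableSpace.comap (fun ω => (X k ω).state j) ⊤) ⊔
  (⨆ j ∈ Finset.range h,
      MeasurableSpace.comap (fun ω => (X k ω).action j) ⊤ ⊔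
      MeasurableSpace.comap (fun ω => (X k ω).cost j) inferInstance)

/-- The same together with the action of step `h` of episode `k`. -/
abbrev historyAction (H : ℕ) (X : ℕ → Ω → Episode S A) (k h : ℕ) : MeasurableSpace Ω :=
  history H X k h ⊔ MeasurableSpace.comap (fun ω => (X k ω).action h) ⊤

/-- `X 1, …, X K` are the episodes of the interaction of the algorithm with the MDP `M`, started
from `s₁` in each episode: given the past, actions are drawn from the current policy, costs from
the cost distribution, and next states from the transition probabilities. (Nothing is assumed on
the joint law of a cost and the next state.) -/
structure IsInteraction [Fintype S] [Fintype A] [DecidableEq S] [DecidableEq A] [Nonempty A]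
    [MeasurableSpace Ω] (M : MDP S A) (p : Params) (s₁ : S) (μ : Measure Ω)
    (X : ℕ → Ω → Episode S A) : Prop where
  measurable_state : ∀ k h s, MeasurableSet {ω | (X k ω).state h = s}
  measurable_action : ∀ k h a, MeasurableSet {ω | (X k ω).action h = a}
  measurable_cost : ∀ k h, Measurable fun ω => (X k ω).cost h
  initial : ∀ k ∈ Finset.Icc 1 p.K, ∀ᵐ ω ∂μ, (X k ω).state 0 = s₁
  action_law : ∀ k ∈ Finset.Icc 1 p.K, ∀ h < p.H, ∀ a,
    μ[Set.indicator {ω | (X k ω).action h = a} (fun _ => (1 : ℝ)) | history p.H X k h] =ᵐ[μ]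
      fun ω => policyAt p (fun i => X i ω) k h ((X k ω).state h) a
  cost_law : ∀ k ∈ Finset.Icc 1 p.K, ∀ h < p.H, ∀ B : Set ℝ, MeasurableSet B →
    μ[Set.indicator {ω | (X k ω).cost h ∈ B} (fun _ => (1 : ℝ)) | historyAction p.H X k h] =ᵐ[μ]
      fun ω => (M.costLaw h ((X k ω).state h) ((X k ω).action h)).real B
  state_law : ∀ k ∈ Finset.Icc 1 p.K, ∀ h < p.H, ∀ y,
    μ[Set.indicator {ω | (X k ω).state (h + 1) = y} (fun _ => (1 : ℝ)) |
        historyAction p.H X k h] =ᵐ[μ]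
      fun ω => M.P h ((X k ω).state h) ((X k ω).action h) y

end Interaction

/-- `√(S A H³ K) + √(A H⁴ K) + S^{5/2} A^{5/4} H^{3/2} K^{1/4}` -/
noncomputable def regretRate (S A H K : ℝ) : ℝ :=
  √(S * A * H ^ 3 * K) + √(A * H ^ 4 * K)
    + S ^ (5 / 2 : ℝ) * A ^ (5 / 4 : ℝ) * H ^ (3 / 2 : ℝ) * K ^ (1 / 4 : ℝ)

end RPOSAT

/-!
The regret is the sum of two differences over the episodes: `V^{π^k} - V^k`, the errors of the
estimated values as evaluations of the policies, and `V^k - V^*`, the estimated gaps.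

**Concentration.** With probability at least `1 - δ` the data obey Bernstein bounds at a level `x`
logarithmic in `S A H / δ` but only doubly logarithmic in `K` (`errorExponent`). These bounds are
the properties `Accurate` and `VisitsAccurate`; they follow from a Bernstein inequality uniform in
time (`IncrementBounds.measure_bernstein_le`: a stopped exponential supermartingale and a dyadic
grid of variance levels) and hold by `IsInteraction.measure_not_accurate_le`. For the large `K` of
the theorem, `100 x ≤ L`, so every bonus has a large constant to spare.

**Estimated gaps.** The estimates need not be optimistic, but they are up to a small factor: with
`X = V^k - V^*` at the next step, `Q^k - Q^* ≤ P (1 + λ ψ(X)) X` for a Lipschitz sign function `ψ`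
(`softSign`) and `λ = K^{-1/8}` (`Accurate.qAt_sub_optQ_le`). The deviations proportional to
`√P |X|` are split by the inequality of arithmetic and geometric means into a part of `λ ψ(X) X`
and a part paid by the bonus term with `K^{1/4} / n`. Unrolled along the tilted kernel
`P (1 + λ ψ(X))`, the gap becomes a weighted regret of mirror descent, whose weights depend on the
episode. They vary little, because each `V^k_h(s)` has polylogarithmic total variation
(`sum_abs_valAt_sub_le`): a mirror descent step only lowers the value, new data move the
estimates by `O(1 / n)`, the reference value is a delayed running average, and at pairs with few
visits the coarse bonus, independent of the values, is in force. Hence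
`Accurate.sum_valAt_sub_opt_le`: the gaps sum up to a constant times `√(A H⁴ K)`.

**Policy evaluation.** `V^{π^k} - V^k` is the sum of the Bellman errors along `π^k`. Each is at most
of the order of the bonus (`Accurate.bellmanError_le`): the standard deviation of `V^*` over `√n`,
a term `√(H L / n)`, the root of `P (|V^k - V^*| + |V^ref - V^*|)` times `√(S H L / n)`, and `1 / n`
terms. By Cauchy-Schwarz it is enough that the expected sum of `1 / n` over the visits is
logarithmic, that the variances of `V^*` along a policy sum up to at most `2 H²` per episode (law
of total variance, `sum_occ_variance_le`), and that the errors of `V^k` and `V^ref` sum up to order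
`√K` (`sum_occ_mul_totalGap_le`, from coarse bonuses and estimated gaps). The sum is of order `√(S A H³ K)`
up to logarithms (`VisitsAccurate.sum_bellmanError_le`), and `regret_le_of_large` adds the parts.
-/

namespace RPOSAT

/-! ### Value functions, occupancy measures and Bellman equations -/

theorem backward_induction {p : ℕ → Prop} {H : ℕ} (hH : p H)
    (step : ∀ h < H, p (h + 1) → p h) : ∀ h ≤ H, p h := by
  intro h hh
  induction hh using Nat.decreasingInduction with
  | self => exact hH
  | of_succ k hk ih => exact step k hk ih

section Values

variable {S A : Type*} [Fintype S] [Fintype A]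

/-- Expected total reward of the last `m` of `H` steps under the policy `π`, for an arbitrary
reward function `r`. -/
noncomputable def retToGo (P : ℕ → S → A → S → ℝ) (π r : ℕ → S → A → ℝ) (H : ℕ) :
    ℕ → S → ℝ
  | 0, _ => 0
  | m + 1, s => ∑ a, π (H - (m + 1)) s a *
      (r (H - (m + 1)) s a + ∑ y, P (H - (m + 1)) s a y * retToGo P π r H m y)

/-- Expected total reward of the steps `h, …, H - 1` when the state at step `h` is given. -/
noncomputable def ret (P : ℕ → S → A → S → ℝ) (π r : ℕ → S → A → ℝ) (H h : ℕ) (s : S) : ℝ :=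
  retToGo P π r H (H - h) s

theorem ret_end (P : ℕ → S → A → S → ℝ) (π r : ℕ → S → A → ℝ) (H : ℕ) (s : S) :
    ret P π r H H s = 0 := by simp [ret, retToGo]

theorem ret_step (P : ℕ → S → A → S → ℝ) (π r : ℕ → S → A → ℝ) {H h : ℕ} (hh : h < H) (s : S) :
    ret P π r H h s = ∑ a, π h s a * (r h s a + ∑ y, P h s a y * ret P π r H (h + 1) y) := by
  unfold ret
  obtain ⟨m, hm⟩ : ∃ m, H - h = m + 1 := ⟨H - h - 1, by omega⟩
  have h1 : H - (h + 1) = m := by omega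
  have h2 : H - (m + 1) = h := by omega
  rw [hm, h1, retToGo, h2]

theorem ret_nonneg {P : ℕ → S → A → S → ℝ} {π r : ℕ → S → A → ℝ} {H : ℕ}
    (hP : ∀ h s a y, 0 ≤ P h s a y) (hπ : ∀ h s a, 0 ≤ π h s a)
    (hr : ∀ h < H, ∀ s a, 0 ≤ r h s a) : ∀ h ≤ H, ∀ s, 0 ≤ ret P π r H h s := by
  refine backward_induction (fun s => by rw [ret_end]) fun h hh ih s => ?_
  rw [ret_step _ _ _ hh]
  exact sum_nonneg fun a _ => mul_nonneg (hπ _ _ _) (add_nonneg (hr h hh _ _)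
    (sum_nonneg fun y _ => mul_nonneg (hP _ _ _ _) (ih y)))

variable [DecidableEq S]

theorem sum_fin_cons {α : Type*} [Fintype α] (n : ℕ) (f : (Fin (n + 1) → α) → ℝ) :
    ∑ τ, f τ = ∑ x, ∑ τ : Fin n → α, f (Fin.cons x τ) := by
  rw [← (Fin.consEquiv fun _ => α).sum_comp, Fintype.sum_prod_type]
  rfl

omit [Fintype A] in
theorem trajProb_cons (M : MDP S A) (π : ℕ → S → A → ℝ) (n h : ℕ) (s : S) (x : S × A)
    (τ : Fin n → S × A) : M.trajProb π (n + 1) h s (Fin.cons x τ) =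
      (if x.1 = s then π h s x.2 else 0) *
        ∑ y, M.P h s x.2 y * M.trajProb π n (h + 1) y τ := rfl

theorem trajProb_sum (M : MDP S A) {π : ℕ → S → A → ℝ} (hπ : IsPolicy π) (n : ℕ) :
    ∀ (h : ℕ) (s : S), ∑ τ, M.trajProb π n h s τ = 1 := by
  induction n with
  | zero => intro h s; simp [MDP.trajProb]
  | succ n ih =>
    intro h s
    rw [sum_fin_cons]
    simp_rw [trajProb_cons, ← mul_sum]
    have : ∀ x : S × A, ∑ i : Fin n → S × A,
        ∑ y, M.P h s x.2 y * M.trajProb π n (h + 1) y i = 1 := fun x => by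
      rw [sum_comm]
      simp_rw [← mul_sum, ih, mul_one]
      exact (M.P_mem h s x.2).2
    simp_rw [this, mul_one, Fintype.sum_prod_type]
    rw [sum_comm]
    simp [(hπ h s).2]

theorem value_step (M : MDP S A) {π : ℕ → S → A → ℝ} (hπ : IsPolicy π) {H h : ℕ} (hh : h < H)
    (s : S) : M.value H π h s =
      ∑ a, π h s a * (M.c h s a + ∑ y, M.P h s a y * M.value H π (h + 1) y) := by
  obtain ⟨n, hn⟩ : ∃ n, H - h = n + 1 := ⟨H - h - 1, by omega⟩
  have h1 : H - (h + 1) = n := by omega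
  unfold MDP.value
  rw [hn, h1, sum_fin_cons]
  simp only [trajProb_cons, Fin.cons_zero, Fin.sum_univ_succ,
    Fin.cons_succ, Fin.val_zero, add_zero, Fin.val_succ]
  rw [Fintype.sum_prod_type, sum_comm]
  refine sum_congr rfl fun a _ => ?_
  rw [sum_eq_single s (fun b _ hb => by simp [hb]) (by simp)]
  simp only [if_true]
  have key : ∀ i : Fin n → S × A,
      (π h s a * ∑ y, M.P h s a y * M.trajProb π n (h + 1) y i) *
        (M.c h s a + ∑ j : Fin n, M.c (h + (j + 1)) (i j).1 (i j).2) =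
      π h s a * (M.c h s a * ∑ y, M.P h s a y * M.trajProb π n (h + 1) y i +
        ∑ y, M.P h s a y * (M.trajProb π n (h + 1) y i *
          ∑ j : Fin n, M.c (h + 1 + j) (i j).1 (i j).2)) := by
    intro i
    simp_rw [← mul_assoc, ← sum_mul, add_assoc, add_comm (1 : ℕ)]
    ring
  simp_rw [key, ← mul_sum, sum_add_distrib, ← mul_sum]
  congr 2
  · rw [sum_comm]
    simp_rw [← mul_sum, trajProb_sum M hπ, mul_one, (M.P_mem h s a).2, mul_one]
  · rw [sum_comm]
    simp_rw [← mul_sum]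

theorem value_end (M : MDP S A) (π : ℕ → S → A → ℝ) (H : ℕ) (s : S) : M.value H π H s = 0 := by
  unfold MDP.value
  refine sum_eq_zero fun τ _ => ?_
  have : IsEmpty (Fin (H - H)) := by rw [Nat.sub_self]; infer_instance
  simp

/-- State occupancy measure of `π` under the (not necessarily stochastic) kernel `P`. -/
noncomputable def occ (P : ℕ → S → A → S → ℝ) (π : ℕ → S → A → ℝ) (s₁ : S) : ℕ → S → ℝ
  | 0, s => if s = s₁ then 1 else 0
  | h + 1, y => ∑ s, ∑ a, occ P π s₁ h s * π h s a * P h s a y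

theorem occ_nonneg {P : ℕ → S → A → S → ℝ} {π : ℕ → S → A → ℝ} (s₁ : S)
    (hP : ∀ h s a y, 0 ≤ P h s a y) (hπ : ∀ h s a, 0 ≤ π h s a) :
    ∀ h s, 0 ≤ occ P π s₁ h s := by
  intro h
  induction h with
  | zero => intro s; simp only [occ]; split_ifs <;> norm_num
  | succ h ih =>
    intro y
    exact sum_nonneg fun s _ => sum_nonneg fun a _ =>
      mul_nonneg (mul_nonneg (ih s) (hπ _ _ _)) (hP _ _ _ _)

theorem sum_occ_succ_mul (P : ℕ → S → A → S → ℝ) (π : ℕ → S → A → ℝ) (s₁ : S) (h : ℕ)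
    (f : S → ℝ) : ∑ y, occ P π s₁ (h + 1) y * f y =
      ∑ s, ∑ a, occ P π s₁ h s * π h s a * ∑ y, P h s a y * f y := by
  simp only [occ, sum_mul, mul_sum]
  rw [sum_comm]
  refine sum_congr rfl fun s _ => ?_
  rw [sum_comm]
  exact sum_congr rfl fun a _ => sum_congr rfl fun y _ => by ring

theorem sum_occ {P : ℕ → S → A → S → ℝ} {π : ℕ → S → A → ℝ} (s₁ : S)
    (hP : ∀ h s a, P h s a ∈ stdSimplex ℝ S) (hπ : IsPolicy π) :
    ∀ h, ∑ s, occ P π s₁ h s = 1 := by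
  intro h
  induction h with
  | zero => simp [occ]
  | succ h ih =>
    have := sum_occ_succ_mul P π s₁ h (fun _ => (1 : ℝ))
    simp only [mul_one, (hP _ _ _).2] at this
    rw [this]
    simp_rw [← mul_sum, (hπ _ _).2, mul_one, ih]

/-- Telescoping along the occupancy measure: the performance difference lemma in its general
form. -/
theorem occ_telescope (P : ℕ → S → A → S → ℝ) (π : ℕ → S → A → ℝ) (s₁ : S)
    (f : ℕ → S → ℝ) (n : ℕ) : f 0 s₁ = ∑ s, occ P π s₁ n s * f n s +
      ∑ h ∈ range n, ∑ s, occ P π s₁ h s *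
        (f h s - ∑ a, π h s a * ∑ y, P h s a y * f (h + 1) y) := by
  induction n with
  | zero => simp [occ]
  | succ n ih =>
    rw [ih, sum_range_succ, sum_occ_succ_mul]
    simp_rw [mul_sub, sum_sub_distrib, mul_sum, mul_assoc]
    ring

theorem occ_telescope_end (P : ℕ → S → A → S → ℝ) (π : ℕ → S → A → ℝ) (s₁ : S)
    {f : ℕ → S → ℝ} {H : ℕ} (hf : ∀ s, f H s = 0) : f 0 s₁ =
      ∑ h ∈ range H, ∑ s, occ P π s₁ h s *
        (f h s - ∑ a, π h s a * ∑ y, P h s a y * f (h + 1) y) := by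
  rw [occ_telescope P π s₁ f H]; simp [hf]

/-- The state distribution of any step, integrated against the expected future reward, is at most
the total expected reward, for nonnegative rewards. -/
theorem sum_occ_mul_ret_le {P : ℕ → S → A → S → ℝ} {π r : ℕ → S → A → ℝ} {H : ℕ} (s₁ : S)
    (hP : ∀ h s a y, 0 ≤ P h s a y) (hπ : ∀ h s a, 0 ≤ π h s a)
    (hr : ∀ h < H, ∀ s a, 0 ≤ r h s a) {h : ℕ} (hh : h ≤ H) :
    ∑ s, occ P π s₁ h s * ret P π r H h s ≤ ret P π r H 0 s₁ := by
  rw [occ_telescope P π s₁ (ret P π r H) h]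
  refine le_add_of_nonneg_right (sum_nonneg fun i hi => sum_nonneg fun s _ =>
    mul_nonneg (occ_nonneg s₁ hP hπ _ _) ?_)
  have hi : i < h := mem_range.1 hi
  rw [ret_step _ _ _ (by omega : i < H)]
  simp_rw [mul_add, sum_add_distrib]
  have : 0 ≤ ∑ a, π i s a * r i s a :=
    sum_nonneg fun a _ => mul_nonneg (hπ _ _ _) (hr i (by omega) _ _)
  linarith

theorem ret_eq_sum_occ (P : ℕ → S → A → S → ℝ) (π r : ℕ → S → A → ℝ) (H : ℕ) (s₁ : S) :
    ret P π r H 0 s₁ = ∑ h ∈ range H, ∑ s, ∑ a, occ P π s₁ h s * π h s a * r h s a := by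
  rw [occ_telescope_end P π s₁ (ret_end P π r H)]
  refine sum_congr rfl fun h hh => sum_congr rfl fun s _ => ?_
  rw [ret_step _ _ _ (mem_range.1 hh)]
  simp_rw [mul_add, sum_add_distrib, add_sub_cancel_right, mul_sum, mul_assoc]

end Values

theorem variance_eq {S : Type*} [Fintype S] {w : S → ℝ} (hw : w ∈ stdSimplex ℝ S) (f : S → ℝ) :
    variance w f = ∑ y, w y * f y ^ 2 - (∑ y, w y * f y) ^ 2 := by
  unfold variance
  set m := ∑ z, w z * f z with hm
  have : ∀ y, w y * (f y - m) ^ 2 = w y * f y ^ 2 - 2 * m * (w y * f y) + w y * m ^ 2 :=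
    fun y => by ring
  simp_rw [this, sum_add_distrib, sum_sub_distrib, ← mul_sum, ← sum_mul, hw.2, ← hm]
  ring

theorem sum_simplex_mul_le {ι : Type*} [Fintype ι] {w f : ι → ℝ} (hw : w ∈ stdSimplex ℝ ι) {C : ℝ}
    (hf : ∀ i, f i ≤ C) : ∑ i, w i * f i ≤ C := by
  calc ∑ i, w i * f i ≤ ∑ i, w i * C :=
        sum_le_sum fun i _ => mul_le_mul_of_nonneg_left (hf i) (hw.1 i)
    _ = C := by rw [← sum_mul, hw.2, one_mul]

theorem le_sum_simplex_mul {ι : Type*} [Fintype ι] {w f : ι → ℝ} (hw : w ∈ stdSimplex ℝ ι) {C : ℝ}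
    (hf : ∀ i, C ≤ f i) : C ≤ ∑ i, w i * f i := by
  calc C = ∑ i, w i * C := by rw [← sum_mul, hw.2, one_mul]
    _ ≤ ∑ i, w i * f i := sum_le_sum fun i _ => mul_le_mul_of_nonneg_left (hf i) (hw.1 i)

section Optimal

theorem mean_costLaw_mem {S A : Type*} [Fintype S] (M : MDP S A) (h : ℕ) (s : S) (a : A) : M.c h s a ∈ Set.Icc (0 : ℝ) 1 := by
  have := M.costLaw_prob h s a
  have hI := M.costLaw_Icc h s a
  unfold MDP.c
  constructor
  · exact integral_nonneg_of_ae (hI.mono fun x hx => hx.1)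
  · have hint : Integrable (fun x : ℝ => x) (M.costLaw h s a) :=
      (integrable_const (1 : ℝ)).mono' measurable_id.aestronglyMeasurable
        (hI.mono fun x hx => by rw [Real.norm_eq_abs, abs_of_nonneg hx.1]; exact hx.2)
    have := integral_mono_ae hint (integrable_const (1 : ℝ)) (hI.mono fun x hx => hx.2)
    simpa using this

variable {S A : Type*} [Fintype S] [Fintype A] [Nonempty A]

/-- Optimal value with `m` steps to go, defined by the Bellman optimality equation. -/
noncomputable def MDP.optToGo (M : MDP S A) (H : ℕ) : ℕ → S → ℝ
  | 0, _ => 0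
  | m + 1, s => univ.inf' univ_nonempty fun a =>
      M.c (H - (m + 1)) s a + ∑ y, M.P (H - (m + 1)) s a y * MDP.optToGo M H m y

/-- The optimal value function, as the solution of the Bellman optimality equation. -/
noncomputable def MDP.opt (M : MDP S A) (H h : ℕ) (s : S) : ℝ := M.optToGo H (H - h) s

/-- The optimal action value. -/
noncomputable def MDP.optQ (M : MDP S A) (H h : ℕ) (s : S) (a : A) : ℝ :=
  M.c h s a + ∑ y, M.P h s a y * M.opt H (h + 1) y

theorem opt_end (M : MDP S A) (H : ℕ) (s : S) : M.opt H H s = 0 := by simp [MDP.opt, MDP.optToGo]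

theorem opt_step (M : MDP S A) {H h : ℕ} (hh : h < H) (s : S) :
    M.opt H h s = univ.inf' univ_nonempty fun a => M.optQ H h s a := by
  unfold MDP.optQ MDP.opt
  obtain ⟨m, hm⟩ : ∃ m, H - h = m + 1 := ⟨H - h - 1, by omega⟩
  have h1 : H - (h + 1) = m := by omega
  have h2 : H - (m + 1) = h := by omega
  rw [hm, h1, MDP.optToGo, h2]

theorem opt_le_optQ (M : MDP S A) {H h : ℕ} (hh : h < H) (s : S) (a : A) :
    M.opt H h s ≤ M.optQ H h s a := by
  rw [opt_step M hh]; exact inf'_le _ (mem_univ a)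

theorem exists_optQ_eq (M : MDP S A) {H h : ℕ} (hh : h < H) (s : S) :
    ∃ a, M.optQ H h s a = M.opt H h s := by
  rw [opt_step M hh]
  obtain ⟨a, -, ha⟩ := exists_mem_eq_inf' univ_nonempty fun a => M.optQ H h s a
  exact ⟨a, ha.symm⟩

theorem opt_mem (M : MDP S A) (H : ℕ) :
    ∀ h ≤ H, ∀ s, M.opt H h s ∈ Set.Icc (0 : ℝ) ((H : ℝ) - h) := by
  refine backward_induction (fun s => by simp [opt_end]) fun h hh ih s => ?_
  obtain ⟨a, ha⟩ := exists_optQ_eq M hh s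
  have hc := mean_costLaw_mem M h s a
  have h1 := sum_simplex_mul_le (M.P_mem h s a) (fun y => (ih y).2)
  have h2 := le_sum_simplex_mul (M.P_mem h s a) (fun y => (ih y).1)
  rw [← ha, MDP.optQ]
  push_cast at h1
  exact ⟨by linarith [hc.1], by linarith [hc.2]⟩

variable [DecidableEq S]

theorem opt_le_value (M : MDP S A) {π : ℕ → S → A → ℝ} (hπ : IsPolicy π) (H : ℕ) :
    ∀ h ≤ H, ∀ s, M.opt H h s ≤ M.value H π h s := by
  refine backward_induction (fun s => by rw [opt_end, value_end]) fun h hh ih s => ?_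
  rw [value_step M hπ hh]
  refine le_sum_simplex_mul (hπ h s) fun a => (opt_le_optQ M hh s a).trans ?_
  unfold MDP.optQ
  gcongr with y
  · exact (M.P_mem h s a).1 y
  · exact ih y

theorem opt_le_optValue (M : MDP S A) (H : ℕ) (s : S) : M.opt H 0 s ≤ M.optValue H 0 s := by
  classical
  have : Nonempty {π : ℕ → S → A → ℝ // IsPolicy π} :=
    ⟨fun _ _ => Pi.single (Classical.arbitrary A) 1, fun _ _ => single_mem_stdSimplex ℝ _⟩
  exact le_ciInf fun π => opt_le_value M π.2 H 0 (Nat.zero_le _) s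

/-- The value of a policy exceeds the optimal value by its expected total advantage. -/
theorem value_sub_opt (M : MDP S A) {π : ℕ → S → A → ℝ} (hπ : IsPolicy π) (H : ℕ) :
    ∀ h ≤ H, ∀ s, M.value H π h s - M.opt H h s =
      ret M.P π (fun h s a => M.optQ H h s a - M.opt H h s) H h s := by
  refine backward_induction (fun s => by rw [opt_end, value_end, ret_end, sub_zero])
    fun h hh ih s => ?_
  rw [value_step M hπ hh, ret_step _ _ _ hh]
  have : M.opt H h s = ∑ a, π h s a * M.opt H h s := by rw [← sum_mul, (hπ h s).2, one_mul]
  conv_lhs => rw [this]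
  rw [← sum_sub_distrib]
  refine sum_congr rfl fun a _ => ?_
  simp_rw [← ih, mul_sub, sum_sub_distrib, MDP.optQ]
  ring

/-- Law of total variance, as an inequality that holds for every policy because the optimal value
is a minimum: the variances of the optimal value at the next state sum up to at most `2 H²`. -/
theorem sum_occ_variance_le (M : MDP S A) {π : ℕ → S → A → ℝ} (hπ : IsPolicy π) (H : ℕ) (s₁ : S) :
    ∑ h ∈ range H, ∑ s, ∑ a, occ M.P π s₁ h s * π h s a * variance (M.P h s a) (M.opt H (h + 1))
      ≤ 2 * (H : ℝ) ^ 2 := by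
  have hocc := occ_nonneg (P := M.P) (π := π) s₁ (fun h s a y => (M.P_mem h s a).1 y)
    (fun h s a => (hπ h s).1 a)
  have key : ∀ h < H, ∀ s a, variance (M.P h s a) (M.opt H (h + 1)) ≤
      ∑ y, M.P h s a y * M.opt H (h + 1) y ^ 2 - M.opt H h s ^ 2 + 2 * H := by
    intro h hh s a
    rw [variance_eq (M.P_mem h s a)]
    have h1 := opt_le_optQ M hh s a
    have hc := mean_costLaw_mem M h s a
    have h2 := opt_mem M H h hh.le s
    have h3 := le_sum_simplex_mul (M.P_mem h s a) (fun y => (opt_mem M H (h + 1) hh y).1)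
    unfold MDP.optQ at h1
    set m := ∑ y, M.P h s a y * M.opt H (h + 1) y
    have hH : (1 : ℝ) ≤ H := by exact_mod_cast (by omega : 1 ≤ H)
    have h4 : M.opt H h s ≤ H := h2.2.trans (by linarith [Nat.cast_nonneg (α := ℝ) h])
    have h5 := h2.1
    have : M.opt H h s ^ 2 ≤ m ^ 2 + 2 * H := by
      rcases le_total (M.opt H h s) m with h6 | h6
      · nlinarith
      · have : M.opt H h s - m ≤ 1 := by linarith [hc.2]
        nlinarith
    linarith
  have htel := occ_telescope M.P π s₁ (fun h s => M.opt H h s ^ 2) H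
  have hone := sum_occ s₁ M.P_mem hπ
  simp only [opt_end] at htel
  calc ∑ h ∈ range H, ∑ s, ∑ a, occ M.P π s₁ h s * π h s a *
          variance (M.P h s a) (M.opt H (h + 1))
      ≤ ∑ h ∈ range H, ∑ s, ∑ a, occ M.P π s₁ h s * π h s a *
          (∑ y, M.P h s a y * M.opt H (h + 1) y ^ 2 - M.opt H h s ^ 2 + 2 * H) := by
        refine sum_le_sum fun h hh => sum_le_sum fun s _ => sum_le_sum fun a _ => ?_
        exact mul_le_mul_of_nonneg_left (key h (mem_range.1 hh) s a)
          (mul_nonneg (hocc h s) ((hπ h s).1 a))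
    _ = ∑ h ∈ range H, (∑ s, occ M.P π s₁ h s *
          (-(M.opt H h s ^ 2 - ∑ a, π h s a * ∑ y, M.P h s a y * M.opt H (h + 1) y ^ 2)) +
          2 * H) := by
        refine sum_congr rfl fun h _ => ?_
        have : (2 * H : ℝ) = ∑ s, occ M.P π s₁ h s * (2 * H) := by
          rw [← sum_mul, hone, one_mul]
        conv_rhs => rw [this]
        rw [← sum_add_distrib]
        refine sum_congr rfl fun s _ => ?_
        simp_rw [mul_assoc, ← mul_sum, mul_add, mul_sub, sum_add_distrib, sum_sub_distrib,
          ← sum_mul, (hπ h s).2]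
        ring
    _ ≤ 2 * (H : ℝ) ^ 2 := by
        rw [sum_add_distrib]
        simp only [mul_neg, sum_neg_distrib, sum_const, card_range, nsmul_eq_mul]
        have : 0 ≤ M.opt H 0 s₁ ^ 2 := sq_nonneg _
        simp only [ne_eq, OfNat.ofNat_ne_zero, not_false_eq_true, zero_pow, mul_zero,
          sum_const_zero, zero_add] at htel
        nlinarith

end Optimal

/-! ### Mirror descent on the simplex -/

section MirrorDescent

variable {A : Type*} [Fintype A] [Nonempty A]

theorem mdStep_mem (η : ℝ) (q p : A → ℝ) : mdStep η q p ∈ stdSimplex ℝ A :=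
  (Classical.choose_spec (exists_mdStep η q p)).1

theorem mdStep_isMinOn (η : ℝ) (q p : A → ℝ) :
    IsMinOn (mdObjective η q p) (stdSimplex ℝ A) (mdStep η q p) :=
  (Classical.choose_spec (exists_mdStep η q p)).2

/-- First order optimality condition of the mirror descent step. -/
theorem mdStep_variational (η : ℝ) (q p : A → ℝ) {x : A → ℝ} (hx : x ∈ stdSimplex ℝ A) :
    0 ≤ ∑ a, (η * q a + 2 * (mdStep η q p a - p a)) * (x a - mdStep η q p a) := by
  set z := mdStep η q p with hz
  set G := ∑ a, (η * q a + 2 * (z a - p a)) * (x a - z a) with hG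
  set E := ∑ a, (x a - z a) ^ 2 with hE
  have hmin : ∀ t ∈ Set.Icc (0 : ℝ) 1, 0 ≤ t * G + t ^ 2 * E := by
    intro t ht
    have hmem : (fun a => z a + t * (x a - z a)) ∈ stdSimplex ℝ A := by
      have := convex_stdSimplex ℝ A (mdStep_mem η q p) hx (sub_nonneg.2 ht.2) ht.1 (by ring)
      convert this using 1
      funext a
      simp only [Pi.add_apply, Pi.smul_apply, smul_eq_mul]
      ring
    have h := mdStep_isMinOn η q p hmem
    simp only [Set.mem_ofPred_eq, mdObjective, ← hz] at h
    have e : (η * ∑ a, q a * (z a + t * (x a - z a) - p a) +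
        ∑ a, (z a + t * (x a - z a) - p a) ^ 2) -
        (η * ∑ a, q a * (z a - p a) + ∑ a, (z a - p a) ^ 2) = t * G + t ^ 2 * E := by
      simp only [hG, hE, mul_sum, ← sum_add_distrib, ← sum_sub_distrib]
      exact sum_congr rfl fun a _ => by ring
    linarith
  have hE0 : 0 ≤ E := sum_nonneg fun a _ => sq_nonneg _
  by_contra hneg
  push Not at hneg
  -- a small step towards `x` would decrease the objective
  have hpos : 0 < -G / (E - G) := div_pos (by linarith) (by linarith)
  have h := hmin (-G / (E - G)) ⟨hpos.le, (div_le_one (by linarith)).2 (by linarith)⟩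
  have h2 : (-G / (E - G)) * (E - G) = -G := div_mul_cancel₀ _ (by linarith)
  have h3 : 0 ≤ -G / (E - G) * (G + (-G / (E - G)) * E) := by nlinarith
  have h4 : 0 ≤ G + (-G / (E - G)) * E := nonneg_of_mul_nonneg_right h3 hpos
  have h5 : (-G / (E - G)) * E = -G + (-G / (E - G)) * G := by linarith [h2]
  have h6 : 0 ≤ (-G / (E - G)) * G := by linarith
  nlinarith

theorem mdStep_lipschitz (η : ℝ) (q p q' p' : A → ℝ) :
    ∑ a, (mdStep η q p a - mdStep η q' p' a) ^ 2 ≤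
      ∑ a, (η * (q a - q' a) - 2 * (p a - p' a)) ^ 2 / 4 := by
  have h1 := mdStep_variational η q p (mdStep_mem η q' p')
  have h2 := mdStep_variational η q' p' (mdStep_mem η q p)
  have h3 := add_nonneg h1 h2
  rw [← sum_add_distrib] at h3
  have : ∑ a, (mdStep η q p a - mdStep η q' p' a) ^ 2 +
      ∑ a, ((η * q a + 2 * (mdStep η q p a - p a)) * (mdStep η q' p' a - mdStep η q p a) +
      (η * q' a + 2 * (mdStep η q' p' a - p' a)) * (mdStep η q p a - mdStep η q' p' a)) ≤
      ∑ a, (η * (q a - q' a) - 2 * (p a - p' a)) ^ 2 / 4 := by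
    rw [← sum_add_distrib]
    refine sum_le_sum fun a _ => ?_
    nlinarith [sq_nonneg ((η * (q a - q' a) - 2 * (p a - p' a)) / 2 +
      (mdStep η q p a - mdStep η q' p' a))]
  linarith

theorem continuous_mdStep (η : ℝ) (a : A) :
    Continuous fun x : (A → ℝ) × (A → ℝ) => mdStep η x.1 x.2 a := by
  rw [continuous_iff_continuousAt]
  intro x₀
  unfold ContinuousAt
  rw [tendsto_iff_dist_tendsto_zero]
  have hlim : Filter.Tendsto (fun x : (A → ℝ) × (A → ℝ) =>
      √(∑ a, (η * (x.1 a - x₀.1 a) - 2 * (x.2 a - x₀.2 a)) ^ 2 / 4)) (nhds x₀) (nhds 0) := by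
    have : Continuous fun x : (A → ℝ) × (A → ℝ) =>
      √(∑ a, (η * (x.1 a - x₀.1 a) - 2 * (x.2 a - x₀.2 a)) ^ 2 / 4) := by fun_prop
    have h := this.tendsto x₀
    simpa using h
  refine squeeze_zero (fun _ => dist_nonneg) (fun x => ?_) hlim
  rw [Real.dist_eq]
  refine Real.abs_le_sqrt (le_trans ?_ (mdStep_lipschitz η x.1 x.2 x₀.1 x₀.2))
  exact single_le_sum (f := fun a => (mdStep η x.1 x.2 a - mdStep η x₀.1 x₀.2 a) ^ 2)
    (fun _ _ => sq_nonneg _) (mem_univ a)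

/-- Three point inequality. -/
theorem mdStep_three_point (η : ℝ) (q p : A → ℝ) {x : A → ℝ} (hx : x ∈ stdSimplex ℝ A) :
    η * ∑ a, q a * (mdStep η q p a - x a) ≤ ∑ a, (x a - p a) ^ 2 -
      ∑ a, (x a - mdStep η q p a) ^ 2 - ∑ a, (mdStep η q p a - p a) ^ 2 := by
  have h := mdStep_variational η q p hx
  have : ∑ a, (x a - p a) ^ 2 - ∑ a, (x a - mdStep η q p a) ^ 2 -
      ∑ a, (mdStep η q p a - p a) ^ 2 - η * ∑ a, q a * (mdStep η q p a - x a) =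
      ∑ a, (η * q a + 2 * (mdStep η q p a - p a)) * (x a - mdStep η q p a) := by
    simp only [mul_sum, ← sum_sub_distrib]
    exact sum_congr rfl fun a _ => by ring
  linarith

/-- A mirror descent step does not increase the linear loss it is based on. -/
theorem mdStep_improves {η : ℝ} (hη : 0 < η) (q : A → ℝ) {p : A → ℝ} (hp : p ∈ stdSimplex ℝ A) :
    ∑ a, q a * mdStep η q p a ≤ ∑ a, q a * p a := by
  have h := mdStep_three_point η q p hp
  have h1 : 0 ≤ ∑ a, (p a - mdStep η q p a) ^ 2 := sum_nonneg fun _ _ => sq_nonneg _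
  have h2 : 0 ≤ ∑ a, (mdStep η q p a - p a) ^ 2 := sum_nonneg fun _ _ => sq_nonneg _
  simp only [sub_self, ne_eq, OfNat.ofNat_ne_zero, not_false_eq_true, zero_pow, sum_const_zero,
    mul_sub, sum_sub_distrib] at h
  nlinarith

theorem mdStep_one_step {η : ℝ} (hη : 0 < η) (q p : A → ℝ) {x : A → ℝ}
    (hx : x ∈ stdSimplex ℝ A) : ∑ a, q a * (p a - x a) ≤
      1 / η * (∑ a, (x a - p a) ^ 2 - ∑ a, (x a - mdStep η q p a) ^ 2) +
        η / 4 * ∑ a, q a ^ 2 := by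
  have h := mdStep_three_point η q p hx
  set z := mdStep η q p
  have h1 : ∑ a, q a * (p a - z a) ≤ η / 4 * ∑ a, q a ^ 2 + 1 / η * ∑ a, (z a - p a) ^ 2 := by
    simp only [mul_sum, ← sum_add_distrib]
    refine sum_le_sum fun a _ => ?_
    have e : η / 4 * q a ^ 2 + 1 / η * (z a - p a) ^ 2 - q a * (p a - z a) =
        1 / η * (η / 2 * q a + (z a - p a)) ^ 2 := by field_simp; ring
    have : 0 ≤ 1 / η * (η / 2 * q a + (z a - p a)) ^ 2 := by positivity
    linarith
  have h2 : ∑ a, q a * (z a - x a) ≤ 1 / η * (∑ a, (x a - p a) ^ 2 -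
      ∑ a, (x a - z a) ^ 2 - ∑ a, (z a - p a) ^ 2) := by
    rw [one_div, ← div_eq_inv_mul, le_div_iff₀ hη]; linarith
  have h3 : ∑ a, q a * (p a - x a) = ∑ a, q a * (p a - z a) + ∑ a, q a * (z a - x a) := by
    rw [← sum_add_distrib]; exact sum_congr rfl fun a _ => by ring
  rw [h3]
  linarith

omit [Nonempty A] in
theorem sum_sq_sub_simplex_le {x p : A → ℝ} (hx : x ∈ stdSimplex ℝ A) (hp : p ∈ stdSimplex ℝ A) :
    ∑ a, (x a - p a) ^ 2 ≤ 2 := by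
  have hle : ∀ {y : A → ℝ}, y ∈ stdSimplex ℝ A → ∀ a, y a ≤ 1 := fun {y} hy a =>
    (single_le_sum (fun b _ => hy.1 b) (mem_univ a)).trans hy.2.le
  calc ∑ a, (x a - p a) ^ 2 ≤ ∑ a, (x a + p a) := sum_le_sum fun a _ => by
        nlinarith [hx.1 a, hp.1 a, hle hx a, hle hp a, mul_nonneg (hx.1 a) (hp.1 a)]
    _ = 2 := by rw [sum_add_distrib, hx.2, hp.2]; norm_num

end MirrorDescent

/-- Abel summation for weighted telescoping sums with nondecreasing factors `θ`: slowly varying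
weights `w` cost only their total variation. -/
theorem weighted_telescope_le {w θ a : ℕ → ℝ} {K : ℕ} (hw : ∀ k, 0 ≤ w k) (hθ0 : θ 0 = 0)
    (hθ : ∀ k < K, θ k ≤ θ (k + 1)) (ha : ∀ k, a k ∈ Set.Icc (0 : ℝ) 2) :
    ∑ k ∈ range K, w (k + 1) * θ (k + 1) * (a (k + 1) - a (k + 2)) ≤
      2 * (∑ k ∈ range K, w (k + 1) * (θ (k + 1) - θ k) +
        θ K * ∑ k ∈ range K, |w (k + 1) - w k|) := by
  have key : ∀ n ≤ K, 0 ≤ θ n ∧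
      ∑ k ∈ range n, w (k + 1) * θ (k + 1) * (a (k + 1) - a (k + 2)) + w n * θ n * a (n + 1) ≤
      2 * (∑ k ∈ range n, w (k + 1) * (θ (k + 1) - θ k) +
        θ n * ∑ k ∈ range n, |w (k + 1) - w k|) := by
    intro n
    induction n with
    | zero => intro _; simp [hθ0]
    | succ n ih =>
      intro hn
      obtain ⟨h0, ih⟩ := ih (by omega)
      have hmono := hθ n (by omega)
      refine ⟨h0.trans hmono, ?_⟩
      simp only [sum_range_succ]
      set V := ∑ k ∈ range n, |w (k + 1) - w k|
      have hV : 0 ≤ V := sum_nonneg fun _ _ => abs_nonneg _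
      have h1 : θ n * V ≤ θ (n + 1) * V := mul_le_mul_of_nonneg_right hmono hV
      have h2 := ha (n + 1)
      have h3 : (w (n + 1) * θ (n + 1) - w n * θ n) * a (n + 1) ≤
          2 * (w (n + 1) * (θ (n + 1) - θ n) + θ (n + 1) * |w (n + 1) - w n|) := by
        have e : w (n + 1) * θ (n + 1) - w n * θ n ≤
            w (n + 1) * (θ (n + 1) - θ n) + θ (n + 1) * |w (n + 1) - w n| := by
          have := le_abs_self (w (n + 1) - w n)
          nlinarith [abs_nonneg (w (n + 1) - w n)]
        have hp : 0 ≤ w (n + 1) * (θ (n + 1) - θ n) + θ (n + 1) * |w (n + 1) - w n| :=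
          add_nonneg (mul_nonneg (hw _) (by linarith))
            (mul_nonneg (by linarith) (abs_nonneg _))
        nlinarith [mul_le_mul_of_nonneg_right e h2.1, mul_le_mul_of_nonneg_left h2.2 hp]
      nlinarith
  obtain ⟨h0, h⟩ := key K le_rfl
  have : 0 ≤ w K * θ K * a (K + 1) := mul_nonneg (mul_nonneg (hw _) h0) (ha _).1
  linarith

section Weighted

variable {A : Type*} [Fintype A] [Nonempty A]

/-- Regret of mirror descent when the losses carry weights that vary with the round. -/
theorem weighted_mirror_descent {K : ℕ} {η w θ : ℕ → ℝ} {q p : ℕ → A → ℝ} {x : A → ℝ}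
    (hx : x ∈ stdSimplex ℝ A) (hp1 : p 1 ∈ stdSimplex ℝ A)
    (hp : ∀ k, 1 ≤ k → p (k + 1) = mdStep (η k) (q k) (p k))
    (hη : ∀ k ∈ Icc 1 K, 0 < η k) (hw : ∀ k, 0 ≤ w k) (hθ0 : θ 0 = 0)
    (hθη : ∀ k ∈ Icc 1 K, θ k = 1 / η k) (hθ : ∀ k < K, θ k ≤ θ (k + 1)) :
    ∑ k ∈ range K, w (k + 1) * ∑ a, q (k + 1) a * (p (k + 1) a - x a) ≤
      2 * (∑ k ∈ range K, w (k + 1) * (θ (k + 1) - θ k) +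
        θ K * ∑ k ∈ range K, |w (k + 1) - w k|) +
      ∑ k ∈ range K, w (k + 1) * (η (k + 1) / 4 * ∑ a, q (k + 1) a ^ 2) := by
  have hmem : ∀ k, 1 ≤ k → p k ∈ stdSimplex ℝ A := by
    intro k hk
    obtain rfl | ⟨j, rfl⟩ : k = 1 ∨ ∃ j, k = j + 2 := by
      rcases k with _ | _ | j
      · omega
      · exact Or.inl rfl
      · exact Or.inr ⟨j, rfl⟩
    · exact hp1
    · rw [hp (j + 1) (by omega)]; exact mdStep_mem _ _ _
  have htel := weighted_telescope_le (w := w) (θ := θ) (K := K)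
    (a := fun k => if 1 ≤ k then ∑ a, (x a - p k a) ^ 2 else 0) hw hθ0 hθ (fun k => by
      split_ifs with hk
      · exact ⟨sum_nonneg fun _ _ => sq_nonneg _, sum_sq_sub_simplex_le hx (hmem k hk)⟩
      · simp)
  refine le_trans ?_ (add_le_add_left htel _)
  rw [← sum_add_distrib]
  refine sum_le_sum fun k hk => ?_
  have hk' : k + 1 ∈ Icc 1 K := by simp only [mem_Icc, mem_range] at *; omega
  rw [mul_assoc, ← mul_add]
  refine mul_le_mul_of_nonneg_left ?_ (hw _)
  have h := mdStep_one_step (hη _ hk') (q (k + 1)) (p (k + 1)) hx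
  rw [← hp (k + 1) (by omega), ← hθη _ hk'] at h
  simpa using h

end Weighted

/-! ### The run of the algorithm on fixed data -/

section Logs

variable (S A : Type*) [Fintype S] [Fintype A]

/-- The parameters of a meaningful run. -/
structure Params.Valid (p : Params) : Prop where
  H_pos : 0 < p.H
  K_pos : 0 < p.K
  δ_pos : 0 < p.δ
  δ_lt : p.δ < 1

/-- The logarithmic factor `L` of the reference-based bonus. -/
noncomputable abbrev logL (p : Params) : ℝ := logTerm S A p 2 p.K

/-- The logarithmic factor `L_c` of the cost bonus. -/
noncomputable abbrev logC (p : Params) : ℝ := logTerm S A p 2 (p.H * p.K)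

/-- The logarithmic factor `L_p` of the coarse transition bonus. -/
noncomputable abbrev logP (p : Params) : ℝ := logTerm S A p 3 (p.H * p.K)

variable [Nonempty S] [Nonempty A] {p : Params}

theorem one_le_card (α : Type*) [Fintype α] [Nonempty α] : (1 : ℝ) ≤ Fintype.card α := by
  exact_mod_cast Fintype.card_pos

theorem Params.Valid.one_le_H (hp : p.Valid) : (1 : ℝ) ≤ p.H := by exact_mod_cast hp.H_pos

theorem Params.Valid.one_le_K (hp : p.Valid) : (1 : ℝ) ≤ p.K := by exact_mod_cast hp.K_pos

theorem logL_le_logC (hp : p.Valid) : logL S A p ≤ logC S A p := by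
  have h1 := one_le_card S
  have h2 := one_le_card A
  have h3 := hp.one_le_H
  have h4 := hp.one_le_K
  have h5 := hp.δ_pos
  refine Real.log_le_log (by positivity) ?_
  gcongr
  nlinarith

theorem logC_le_logP (hp : p.Valid) : logC S A p ≤ logP S A p := by
  have h1 := one_le_card S
  have h2 := one_le_card A
  have h3 := hp.one_le_H
  have h4 := hp.one_le_K
  have h5 := hp.δ_pos
  refine Real.log_le_log (by positivity) ?_
  gcongr
  norm_num

theorem logP_le_two_mul (hp : p.Valid) : logP S A p ≤ 2 * logL S A p := by
  have h1 := one_le_card S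
  have h2 := one_le_card A
  have h3 := hp.one_le_H
  have h4 := hp.one_le_K
  have h5 := hp.δ_pos
  have h6 := hp.δ_lt
  unfold logP logL logTerm
  rw [← Real.log_rpow (by positivity)]
  refine Real.log_le_log (by positivity) ?_
  norm_num only [Real.rpow_ofNat, div_pow, Real.rpow_two]
  rw [div_le_div_iff₀ (by positivity) (by positivity)]
  have hm : (1 : ℝ) ≤ (Fintype.card S : ℝ) * Fintype.card A := one_le_mul_of_one_le_of_one_le h1 h2
  set m := (Fintype.card S : ℝ) * Fintype.card A with hmdef
  have e1 : 3 * (Fintype.card S : ℝ) * Fintype.card A * p.H * (p.H * p.K) * (p.δ ^ 2 / 25) =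
      (m * p.H ^ 2 * p.K * p.δ) * (3 / 25 * p.δ) := by rw [hmdef]; ring
  have e2 : (2 * (Fintype.card S : ℝ) * Fintype.card A * p.H * p.K) ^ 2 * (p.δ / 5) =
      (m * p.H ^ 2 * p.K * p.δ) * (4 / 5 * (m * p.K)) := by rw [hmdef]; ring
  rw [e1, e2]
  refine mul_le_mul_of_nonneg_left ?_ (by positivity)
  nlinarith

theorem log_K_le_logL (hp : p.Valid) : 2 + Real.log p.K ≤ logL S A p := by
  have h1 := one_le_card S
  have h2 := one_le_card A
  have h3 := hp.one_le_H
  have h4 := hp.one_le_K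
  have h5 := hp.δ_pos
  have h6 := hp.δ_lt
  unfold logL logTerm
  have h7 : (2 : ℝ) = Real.log (Real.exp 2) := by rw [Real.log_exp]
  rw [h7, ← Real.log_mul (by positivity) (by positivity), ← h7]
  refine Real.log_le_log (by positivity) ?_
  rw [le_div_iff₀ (by positivity)]
  have h8 : Real.exp 2 < 10 := by
    have := Real.exp_one_lt_d9
    have e : Real.exp 2 = Real.exp 1 * Real.exp 1 := by rw [← Real.exp_add]; norm_num
    rw [e]; nlinarith [Real.exp_pos 1]
  have hm : (1 : ℝ) ≤ (Fintype.card S : ℝ) * Fintype.card A * p.H :=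
    one_le_mul_of_one_le_of_one_le (one_le_mul_of_one_le_of_one_le h1 h2) h3
  set m := (Fintype.card S : ℝ) * Fintype.card A * p.H with hmdef
  have e : 2 * (Fintype.card S : ℝ) * Fintype.card A * p.H * p.K = 2 * m * p.K := by
    rw [hmdef]; ring
  rw [e]
  have : Real.exp 2 * (p.δ / 5) ≤ 2 := by nlinarith
  have h9 : (p.K : ℝ) ≤ m * p.K := by nlinarith
  nlinarith

theorem two_le_logL (hp : p.Valid) : 2 ≤ logL S A p := by
  have := log_K_le_logL S A hp
  have := Real.log_nonneg hp.one_le_K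
  linarith

end Logs

section Counts

variable {S A : Type*} [DecidableEq S] [DecidableEq A]

/-- The episode visits the pair `(s, a)` at step `h`. -/
def Episode.visits (e : Episode S A) (h : ℕ) (s : S) (a : A) : Prop :=
  e.state h = s ∧ e.action h = a

instance (e : Episode S A) (h : ℕ) (s : S) (a : A) : Decidable (e.visits h s a) :=
  inferInstanceAs (Decidable (_ ∧ _))

theorem card_filter_Icc_succ (k : ℕ) (P : ℕ → Prop) [DecidablePred P] :
    #{i ∈ Icc 1 (k + 1) | P i} = #{i ∈ Icc 1 k | P i} + if P (k + 1) then 1 else 0 := by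
  simp only [card_filter, sum_Icc_succ_top (Nat.le_add_left 1 k)]

variable (D : ℕ → Episode S A)

omit [DecidableEq A] in
theorem visitS_succ (k h : ℕ) (s : S) : visitS D (k + 1) h s =
    visitS D k h s + if (D (k + 1)).state h = s then 1 else 0 :=
  card_filter_Icc_succ k fun i => (D i).state h = s

theorem visitSA_succ (k h : ℕ) (s : S) (a : A) : visitSA D (k + 1) h s a =
    visitSA D k h s a + if (D (k + 1)).visits h s a then 1 else 0 :=
  card_filter_Icc_succ k fun i => (D i).visits h s a

theorem visitSAS_succ (k h : ℕ) (s : S) (a : A) (y : S) : visitSAS D (k + 1) h s a y =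
    visitSAS D k h s a y +
      if (D (k + 1)).visits h s a ∧ (D (k + 1)).state (h + 1) = y then 1 else 0 := by
  simp only [Episode.visits, and_assoc]
  exact card_filter_Icc_succ k fun i =>
    (D i).state h = s ∧ (D i).action h = a ∧ (D i).state (h + 1) = y

theorem visitSA_eq_sum (k h : ℕ) (s : S) (a : A) :
    (visitSA D k h s a : ℝ) = ∑ i ∈ Icc 1 k, if (D i).visits h s a then 1 else 0 := by
  rw [visitSA, card_filter]; push_cast; rfl

theorem visitSA_mono {j k : ℕ} (hjk : j ≤ k) (h : ℕ) (s : S) (a : A) :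
    visitSA D j h s a ≤ visitSA D k h s a :=
  card_le_card (filter_subset_filter _ (Icc_subset_Icc_right hjk))

theorem visitSA_le (k h : ℕ) (s : S) (a : A) : visitSA D k h s a ≤ k := by
  refine (card_filter_le _ _).trans ?_
  simp

variable [Fintype S] [Fintype A]

omit [Fintype A] in
theorem sum_visitSAS (k h : ℕ) (s : S) (a : A) :
    ∑ y, visitSAS D k h s a y = visitSA D k h s a := by
  simp only [visitSAS, visitSA, card_filter]
  rw [sum_comm]
  refine sum_congr rfl fun i _ => ?_
  by_cases h1 : (D i).state h = s <;> by_cases h2 : (D i).action h = a <;> simp [h1, h2]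

omit [Fintype S] in
theorem sum_visitSA (k h : ℕ) (s : S) :
    ∑ a, visitSA D k h s a = visitS D k h s := by
  simp only [visitS, visitSA, card_filter]
  rw [sum_comm]
  refine sum_congr rfl fun i _ => ?_
  by_cases h1 : (D i).state h = s <;> simp [h1]

omit [Fintype S] [Fintype A] in
theorem PBar_nonneg (k h : ℕ) (s : S) (a : A) (y : S) : 0 ≤ PBar D k h s a y := by
  unfold PBar; positivity

omit [Fintype A] in
theorem sum_PBar {k h : ℕ} {s : S} {a : A} (hn : visitSA D k h s a ≠ 0) :
    ∑ y, PBar D k h s a y = 1 := by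
  unfold PBar
  rw [← sum_div, ← Nat.cast_sum, sum_visitSAS, div_self (by exact_mod_cast hn)]

omit [Fintype A] in
theorem PBar_mem {k h : ℕ} {s : S} {a : A} (hn : visitSA D k h s a ≠ 0) :
    PBar D k h s a ∈ stdSimplex ℝ S :=
  ⟨fun y => PBar_nonneg D k h s a y, sum_PBar D hn⟩

omit [Fintype S] [Fintype A] in
theorem PBar_eq_zero {k h : ℕ} {s : S} {a : A} (hn : visitSA D k h s a = 0) (y : S) :
    PBar D k h s a y = 0 := by simp [PBar, hn]

omit [Fintype S] [Fintype A] in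
theorem cBar_eq_zero {k h : ℕ} {s : S} {a : A} (hn : visitSA D k h s a = 0) :
    cBar D k h s a = 0 := by simp [cBar, hn]

omit [Fintype S] [Fintype A] in
theorem cBar_mem {K H : ℕ} (hcost : ∀ k ∈ Icc 1 K, ∀ h < H, (D k).cost h ∈ Set.Icc (0 : ℝ) 1)
    {k h : ℕ} (hk : k ≤ K) (hh : h < H) (s : S) (a : A) :
    cBar D k h s a ∈ Set.Icc (0 : ℝ) 1 := by
  have h1 : ∀ i ∈ Icc 1 k, (D i).cost h ∈ Set.Icc (0 : ℝ) 1 := fun i hi =>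
    hcost i (Icc_subset_Icc_right hk hi) h hh
  unfold cBar
  refine ⟨div_nonneg (sum_nonneg fun i hi => (h1 i (mem_filter.1 hi).1).1) (by positivity), ?_⟩
  refine div_le_one_of_le₀ ?_ (by positivity)
  rw [visitSA]
  refine (sum_le_card_nsmul _ _ 1 fun i hi => (h1 i (mem_filter.1 hi).1).2).trans ?_
  simp

end Counts

section Run

variable {S A : Type*} [Fintype S] [Fintype A] [DecidableEq S] [DecidableEq A] [Nonempty A]
variable (p : Params) (D : ℕ → Episode S A)

/-- The reference value used in the policy evaluation of episode `k`. -/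
noncomputable def refAt (k : ℕ) : ℕ → S → ℝ := (run p D (k - 1)).vref

/-- The estimated value `V_h^k` computed by the algorithm. -/
noncomputable def valAt (k : ℕ) : ℕ → S → ℝ := evalV p D k (policyAt p D k) (refAt p D k)

/-- The estimated action value `Q_h^k` computed by the algorithm. -/
noncomputable def qAt (k : ℕ) : ℕ → S → A → ℝ := evalQ p D k (policyAt p D k) (refAt p D k)

/-- The bonus `b_h^k` used by the algorithm. -/
noncomputable def bonusAt (k h : ℕ) (s : S) (a : A) : ℝ :=
  bonus p D k h (valAt p D k (h + 1)) (refAt p D k (h + 1)) s a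

theorem qAt_eq (k h : ℕ) (s : S) (a : A) : qAt p D k h s a =
    max (cBar D k h s a + ∑ y, PBar D k h s a y * valAt p D k (h + 1) y - bonusAt p D k h s a) 0 :=
  rfl

theorem policyAt_succ {k : ℕ} (hk : 1 ≤ k) (h : ℕ) (s : S) : policyAt p D (k + 1) h s =
    mdStep (p.η k) (qAt p D k h s) (policyAt p D k h s) := by
  obtain ⟨j, rfl⟩ : ∃ j, k = j + 1 := ⟨k - 1, by omega⟩
  rfl

theorem policyAt_mem (k : ℕ) : IsPolicy (policyAt p D k) := by
  intro h s
  rcases Nat.lt_or_ge k 2 with hk | hk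
  · have : policyAt p D k h s = fun _ => 1 / (Fintype.card A : ℝ) := by
      unfold policyAt
      rw [show k - 1 = 0 by omega]
      rfl
    rw [this]
    refine ⟨fun _ => by positivity, ?_⟩
    simp
  · obtain ⟨j, rfl⟩ : ∃ j, k = j + 1 := ⟨k - 1, by omega⟩
    rw [policyAt_succ p D (by omega)]
    exact mdStep_mem _ _ _

theorem valAt_end (k : ℕ) (s : S) : valAt p D k p.H s = 0 := by
  simp [valAt, evalV, evalToGo]

theorem valAt_step (k : ℕ) {h : ℕ} (hh : h < p.H) (s : S) :
    valAt p D k h s = ∑ a, qAt p D k h s a * policyAt p D k h s a := by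
  obtain ⟨m, hm⟩ : ∃ m, p.H - h = m + 1 := ⟨p.H - h - 1, by omega⟩
  have h1 : p.H - (h + 1) = m := by omega
  have h2 : p.H - (m + 1) = h := by omega
  unfold valAt qAt evalQ evalV
  rw [hm, h1, evalToGo, h2]

theorem vsum_run (k h : ℕ) (s : S) : (run p D k).vsum h s =
    ∑ i ∈ Icc 1 k, if (D i).state h = s then valAt p D i h s else 0 := by
  induction k with
  | zero => simp [run, AlgState.init]
  | succ k ih =>
    rw [sum_Icc_succ_top (Nat.le_add_left 1 k), ← ih]
    rfl

/-- The average of the estimated values over the visits of `s` at step `h` in the episodes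
`1, …, k`. -/
noncomputable def visitAvg (k h : ℕ) (s : S) : ℝ :=
  (∑ i ∈ Icc 1 k, if (D i).state h = s then valAt p D i h s else 0) / visitS D k h s

theorem refAt_succ {k : ℕ} (hk : 1 ≤ k) (h : ℕ) (s : S) : refAt p D (k + 1) h s =
    if C0 S A p * √(k : ℝ) ≤ visitS D k h s then visitAvg p D k h s else refAt p D k h s := by
  obtain ⟨j, rfl⟩ : ∃ j, k = j + 1 := ⟨k - 1, by omega⟩
  unfold visitAvg
  rw [← vsum_run]
  rfl

theorem refAt_one (h : ℕ) (s : S) : refAt p D 1 h s = 0 := rfl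

variable {p D}

omit [DecidableEq S] [DecidableEq A] [Nonempty A] in
theorem coarseBonus_nonneg (n : ℝ) : 0 ≤ coarseBonus S A p n := by
  unfold coarseBonus costWidth; positivity

omit [DecidableEq S] [DecidableEq A] in
theorem refBonus_nonneg [Nonempty S] (hp : p.Valid) {n : ℝ} (hn : 0 ≤ n) (w V R : S → ℝ) :
    0 ≤ refBonus p A n w V R := by
  have hL : 0 ≤ logTerm S A p 2 p.K := by linarith [two_le_logL S A hp]
  unfold refBonus costWidth
  positivity

theorem bonus_nonneg [Nonempty S] (hp : p.Valid) (k h : ℕ) (V R : S → ℝ) (s : S) (a : A) :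
    0 ≤ bonus p D k h V R s a :=
  le_min (refBonus_nonneg hp (Nat.cast_nonneg _) _ _ _) (coarseBonus_nonneg _)

theorem bonus_eq_zero [Nonempty S] (hp : p.Valid) {k h : ℕ} {s : S} {a : A}
    (hn : visitSA D k h s a = 0) (V R : S → ℝ) : bonus p D k h V R s a = 0 := by
  refine le_antisymm ((min_le_right _ _).trans ?_) (bonus_nonneg hp k h V R s a)
  rw [hn]
  simp [coarseBonus, costWidth]

theorem qAt_eq_zero [Nonempty S] (hp : p.Valid) {k h : ℕ} {s : S} {a : A}
    (hn : visitSA D k h s a = 0) : qAt p D k h s a = 0 := by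
  rw [qAt_eq, bonusAt, bonus_eq_zero hp hn, cBar_eq_zero D hn]
  simp [PBar_eq_zero D hn]

theorem qAt_nonneg (k h : ℕ) (s : S) (a : A) : 0 ≤ qAt p D k h s a := le_max_right _ _

omit [Fintype A] [Nonempty A] in
theorem sum_PBar_mul_le {k h : ℕ} {s : S} {a : A} {f : S → ℝ} {C : ℝ} (hC : 0 ≤ C)
    (hf : ∀ y, f y ≤ C) : ∑ y, PBar D k h s a y * f y ≤ C := by
  by_cases hn : visitSA D k h s a = 0
  · simpa [PBar_eq_zero D hn] using hC
  · exact sum_simplex_mul_le (PBar_mem D hn) hf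

section Bounds

variable [Nonempty S] (hp : p.Valid)
  (hcost : ∀ k ∈ Icc 1 p.K, ∀ h < p.H, (D k).cost h ∈ Set.Icc (0 : ℝ) 1)
include hp hcost

theorem qAt_le_of_valAt_le {k h : ℕ} (hk : k ≤ p.K) (hh : h < p.H) {C : ℝ} (hC : 0 ≤ C)
    (hV : ∀ y, valAt p D k (h + 1) y ≤ C) (s : S) (a : A) : qAt p D k h s a ≤ 1 + C := by
  rw [qAt_eq]
  have h1 := (cBar_mem D hcost hk hh s a).2
  have h2 := sum_PBar_mul_le (D := D) (k := k) (h := h) (s := s) (a := a) hC hV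
  have h3 := bonus_nonneg (D := D) hp k h (valAt p D k (h + 1)) (refAt p D k (h + 1)) s a
  exact max_le (by unfold bonusAt; linarith) (by linarith)

theorem valAt_mem' {k : ℕ} (hk : k ≤ p.K) :
    ∀ h ≤ p.H, ∀ s, valAt p D k h s ∈ Set.Icc (0 : ℝ) ((p.H : ℝ) - h) := by
  refine backward_induction (fun s => by simp [valAt_end]) fun h hh ih s => ?_
  rw [valAt_step p D k hh]
  have hC : (0 : ℝ) ≤ (p.H : ℝ) - (h + 1 : ℕ) := by
    rw [sub_nonneg]; exact_mod_cast hh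
  have h1 := qAt_le_of_valAt_le hp hcost hk hh hC (fun y => (ih y).2) s
  simp_rw [mul_comm (qAt p D k h s _)]
  refine ⟨le_sum_simplex_mul (policyAt_mem p D k h s) fun a => qAt_nonneg k h s a,
    sum_simplex_mul_le (policyAt_mem p D k h s) fun a => (h1 a).trans ?_⟩
  push_cast; linarith

theorem valAt_mem {k h : ℕ} (hk : k ≤ p.K) (hh : h ≤ p.H) (s : S) :
    valAt p D k h s ∈ Set.Icc (0 : ℝ) p.H := by
  have := valAt_mem' hp hcost hk h hh s
  exact ⟨this.1, this.2.trans (by linarith [Nat.cast_nonneg (α := ℝ) h])⟩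

theorem qAt_le {k h : ℕ} (hk : k ≤ p.K) (hh : h < p.H) (s : S) (a : A) :
    qAt p D k h s a ≤ p.H := by
  have hC : (0 : ℝ) ≤ (p.H : ℝ) - (h + 1 : ℕ) := by
    rw [sub_nonneg]; exact_mod_cast hh
  refine (qAt_le_of_valAt_le hp hcost hk hh hC
    (fun y => (valAt_mem' hp hcost hk (h + 1) hh y).2) s a).trans ?_
  push_cast; linarith [Nat.cast_nonneg (α := ℝ) h]

theorem visitAvg_mem {k h : ℕ} (hk : k ≤ p.K) (hh : h ≤ p.H) (s : S) :
    visitAvg p D k h s ∈ Set.Icc (0 : ℝ) p.H := by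
  have h1 : ∀ i ∈ Icc 1 k, valAt p D i h s ∈ Set.Icc (0 : ℝ) p.H := fun i hi =>
    valAt_mem hp hcost ((mem_Icc.1 hi).2.trans hk) hh s
  unfold visitAvg
  constructor
  · refine div_nonneg (sum_nonneg fun i hi => ?_) (by positivity)
    split_ifs
    · exact (h1 i hi).1
    · exact le_rfl
  · refine div_le_of_le_mul₀ (by positivity) (by positivity) ?_
    rw [visitS, card_filter]
    push_cast
    rw [mul_sum]
    refine sum_le_sum fun i hi => ?_
    split_ifs
    · simpa using (h1 i hi).2
    · simp

theorem refAt_mem {k h : ℕ} (hk : 1 ≤ k) (hkK : k ≤ p.K) (hh : h ≤ p.H) (s : S) :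
    refAt p D k h s ∈ Set.Icc (0 : ℝ) p.H := by
  induction k, hk using Nat.le_induction with
  | base => rw [refAt_one]; exact ⟨le_rfl, by positivity⟩
  | succ k hk ih =>
    rw [refAt_succ p D hk]
    split_ifs
    · exact visitAvg_mem hp hcost (by omega) hh s
    · exact ih (by omega)

end Bounds

theorem visitAvg_end (k : ℕ) (s : S) : visitAvg p D k p.H s = 0 := by
  simp [visitAvg, valAt_end]

theorem refAt_end {k : ℕ} (hk : 1 ≤ k) (s : S) : refAt p D k p.H s = 0 := by
  induction k, hk using Nat.le_induction with
  | base => rfl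
  | succ k hk ih => rw [refAt_succ p D hk, ih, visitAvg_end, ite_self]

end Run

/-! ### Standard deviations and the dependence of the bonus on its arguments -/

section Deviation

variable {S : Type*} [Fintype S]

/-- The centered vector `√(w y) (f y - ∑ w f)`, whose Euclidean norm is the standard deviation. -/
noncomputable def centered (w : S → ℝ) : (S → ℝ) →ₗ[ℝ] EuclideanSpace ℝ S where
  toFun f := WithLp.toLp 2 fun y => √(w y) * (f y - ∑ z, w z * f z)
  map_add' f g := by
    ext y
    simp only [PiLp.add_apply, Pi.add_apply, mul_add, sum_add_distrib]
    ring
  map_smul' c f := by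
    ext y
    simp only [PiLp.smul_apply, Pi.smul_apply, smul_eq_mul, RingHom.id_apply]
    have : ∑ z, w z * (c * f z) = c * ∑ z, w z * f z := by
      rw [mul_sum]; exact sum_congr rfl fun z _ => by ring
    rw [this]
    ring

theorem norm_centered {w : S → ℝ} (hw : ∀ y, 0 ≤ w y) (f : S → ℝ) :
    ‖centered w f‖ = √(variance w f) := by
  rw [EuclideanSpace.norm_eq]
  congr 1
  refine sum_congr rfl fun y _ => ?_
  simp [centered, mul_pow, Real.sq_sqrt (hw y)]

theorem variance_nonneg {w : S → ℝ} (hw : ∀ y, 0 ≤ w y) (f : S → ℝ) : 0 ≤ variance w f :=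
  sum_nonneg fun y _ => mul_nonneg (hw y) (sq_nonneg _)

theorem sqrt_variance_add_le {w : S → ℝ} (hw : ∀ y, 0 ≤ w y) (f g : S → ℝ) :
    √(variance w (f + g)) ≤ √(variance w f) + √(variance w g) := by
  rw [← norm_centered hw, ← norm_centered hw, ← norm_centered hw, map_add]
  exact norm_add_le _ _

theorem simplex_le_one {w : S → ℝ} (hw : w ∈ stdSimplex ℝ S) (y : S) : w y ≤ 1 :=
  (single_le_sum (fun b _ => hw.1 b) (mem_univ y)).trans hw.2.le

theorem variance_single [DecidableEq S] {w : S → ℝ} (hw : w ∈ stdSimplex ℝ S) (y : S) :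
    variance w (Pi.single y 1) = w y * (1 - w y) := by
  rw [variance_eq hw]
  have h1 : ∀ z, w z * (Pi.single y 1 : S → ℝ) z ^ 2 = if z = y then w y else 0 := by
    intro z; by_cases h : z = y
    · subst h; simp
    · simp [h]
  have h2 : ∀ z, w z * (Pi.single y 1 : S → ℝ) z = if z = y then w y else 0 := by
    intro z; by_cases h : z = y
    · subst h; simp
    · simp [h]
  simp only [h1, h2, sum_ite_eq', mem_univ, if_true]
  ring

/-- The standard deviation is at most the sum of the standard deviations of the coordinates. -/
theorem sqrt_variance_le_sum {w : S → ℝ} (hw : w ∈ stdSimplex ℝ S) (f : S → ℝ) :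
    √(variance w f) ≤ ∑ y, √(w y * (1 - w y)) * |f y| := by
  classical
  have hf : f = ∑ y, f y • (Pi.single y 1 : S → ℝ) := by
    funext z
    simp [Finset.sum_apply, Pi.single_apply]
  rw [← norm_centered hw.1]
  conv_lhs => rw [hf, map_sum]
  refine (norm_sum_le _ _).trans (sum_le_sum fun y _ => ?_)
  rw [map_smul, norm_smul, norm_centered hw.1, variance_single hw, Real.norm_eq_abs, mul_comm]

theorem abs_sqrt_variance_sub_le {w : S → ℝ} (hw : w ∈ stdSimplex ℝ S) (f g : S → ℝ) :
    |√(variance w f) - √(variance w g)| ≤ ∑ y, √(w y * (1 - w y)) * |f y - g y| := by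
  have h1 := sqrt_variance_add_le hw.1 (f - g) g
  have h2 := sqrt_variance_add_le hw.1 (g - f) f
  rw [sub_add_cancel] at h1 h2
  have h3 := sqrt_variance_le_sum hw (f - g)
  have h4 := sqrt_variance_le_sum hw (g - f)
  have h5 : ∑ y, √(w y * (1 - w y)) * |(g - f) y| = ∑ y, √(w y * (1 - w y)) * |f y - g y| :=
    sum_congr rfl fun y _ => by rw [Pi.sub_apply, abs_sub_comm]
  simp only [Pi.sub_apply] at h3
  rw [abs_le]
  constructor <;> linarith

theorem abs_sqrt_sub_sqrt_le (a b : ℝ) : |√a - √b| ≤ √|a - b| := by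
  wlog h : b ≤ a generalizing a b
  · rw [abs_sub_comm, abs_sub_comm a b]; exact this b a (le_of_not_ge h)
  rw [abs_of_nonneg (sub_nonneg.2 (Real.sqrt_le_sqrt h)), abs_of_nonneg (sub_nonneg.2 h),
    sub_le_iff_le_add]
  rcases le_total 0 b with hb | hb
  · rw [Real.sqrt_le_left (by positivity)]
    nlinarith [Real.sq_sqrt (sub_nonneg.2 h), Real.sq_sqrt hb, Real.sqrt_nonneg (a - b),
      Real.sqrt_nonneg b, mul_nonneg (Real.sqrt_nonneg (a - b)) (Real.sqrt_nonneg b)]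
  · rw [Real.sqrt_eq_zero_of_nonpos hb, add_zero]
    exact Real.sqrt_le_sqrt (by linarith)

end Deviation

section Bonus

variable {S A : Type*} [Fintype S] [Fintype A]

/-- The weight of `|V y - R y|` in the reference-based bonus. -/
noncomputable def gapWeight (S A : Type*) [Fintype S] [Fintype A] (p : Params) (n u : ℝ) : ℝ :=
  √(2 * u * (1 - u) * logL S A p / (n - 1)) + 7 * logL S A p / (3 * n)

/-- The bonus as a function of the number of visits, the empirical transition probabilities, the
estimated value and the reference value. -/
noncomputable def bonusFn (p : Params) (A : Type*) [Fintype A] (n : ℝ) (w V R : S → ℝ) : ℝ :=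
  min (refBonus p A n w V R) (coarseBonus S A p n)

theorem abs_min_sub_min_le {a b a' b' C : ℝ} (h1 : |a - a'| ≤ C) (h2 : |b - b'| ≤ C) :
    |min a b - min a' b'| ≤ C :=
  (abs_min_sub_min_le_max a b a' b').trans (max_le h1 h2)

variable [Nonempty S] [Nonempty A] {p : Params}

theorem fourth_root_sq (p : Params) : ((p.K : ℝ) ^ (1 / 4 : ℝ)) ^ 2 = √(p.K : ℝ) := by
  rw [← Real.rpow_natCast, ← Real.rpow_mul (by positivity), Real.sqrt_eq_rpow]
  norm_num

/-- The dimensional factor of the last term of the reference-based bonus dominates `S H`. -/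
theorem dim_factor_ge (hp : p.Valid) : (Fintype.card S : ℝ) * p.H ≤
    (Fintype.card S : ℝ) ^ (3 / 2 : ℝ) * (Fintype.card A : ℝ) ^ (1 / 4 : ℝ) *
      (p.H : ℝ) ^ (7 / 4 : ℝ) := by
  have h1 := one_le_card S
  have h2 := one_le_card A
  have h3 := hp.one_le_H
  have e1 : (Fintype.card S : ℝ) ≤ (Fintype.card S : ℝ) ^ (3 / 2 : ℝ) :=
    Real.self_le_rpow_of_one_le h1 (by norm_num)
  have e2 : 1 ≤ (Fintype.card A : ℝ) ^ (1 / 4 : ℝ) := Real.one_le_rpow h2 (by norm_num)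
  have e3 : (p.H : ℝ) ≤ (p.H : ℝ) ^ (7 / 4 : ℝ) := Real.self_le_rpow_of_one_le h3 (by norm_num)
  calc (Fintype.card S : ℝ) * p.H = Fintype.card S * 1 * p.H := by ring
    _ ≤ _ := by gcongr

theorem dim_factor_le (hp : p.Valid) : (Fintype.card S : ℝ) ^ (3 / 2 : ℝ) *
    (Fintype.card A : ℝ) ^ (1 / 4 : ℝ) * (p.H : ℝ) ^ (7 / 4 : ℝ) ≤
    (Fintype.card S : ℝ) ^ 2 * Fintype.card A * (p.H : ℝ) ^ 2 := by
  have h1 := one_le_card S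
  have h2 := one_le_card A
  have h3 := hp.one_le_H
  have e1 : (Fintype.card S : ℝ) ^ (3 / 2 : ℝ) ≤ (Fintype.card S : ℝ) ^ 2 := by
    rw [← Real.rpow_two]; exact Real.rpow_le_rpow_of_exponent_le h1 (by norm_num)
  have e2 : (Fintype.card A : ℝ) ^ (1 / 4 : ℝ) ≤ Fintype.card A := by
    conv_rhs => rw [← Real.rpow_one (Fintype.card A : ℝ)]
    exact Real.rpow_le_rpow_of_exponent_le h2 (by norm_num)
  have e3 : (p.H : ℝ) ^ (7 / 4 : ℝ) ≤ (p.H : ℝ) ^ 2 := by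
    rw [← Real.rpow_two]; exact Real.rpow_le_rpow_of_exponent_le h3 (by norm_num)
  gcongr

/-- As long as a pair has at most `√K / 2` visits, the coarse bonus is the smaller one; in
particular the bonus does not depend on the value estimates. -/
theorem coarseBonus_le_refBonus (hp : p.Valid) {n : ℝ} (hn0 : 0 ≤ n) (hn : n ≤ √(p.K : ℝ) / 2)
    (w V R : S → ℝ) : coarseBonus S A p n ≤ refBonus p A n w V R := by
  have h1 := one_le_card S
  have hL := two_le_logL S A hp
  have hLp := logP_le_two_mul S A hp
  have h3 := hp.one_le_H
  set kq := (p.K : ℝ) ^ (1 / 4 : ℝ) with hkq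
  have hkq0 : 0 ≤ kq := by positivity
  have hkq2 : kq ^ 2 = √(p.K : ℝ) := fourth_root_sq p
  set L := logTerm S A p 2 p.K with hLdef
  have hL' : 2 ≤ L := hL
  have key : p.H * √(4 * Fintype.card S * logTerm S A p 3 (p.H * p.K) / n) ≤
      2 * (Fintype.card S : ℝ) ^ (3 / 2 : ℝ) * (Fintype.card A : ℝ) ^ (1 / 4 : ℝ) *
        (p.H : ℝ) ^ (7 / 4 : ℝ) * kq * √L / n := by
    rcases hn0.eq_or_lt with rfl | hnpos
    · simp
    have hd := dim_factor_ge (S := S) (A := A) hp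
    have s1 : √(4 * Fintype.card S * logTerm S A p 3 (p.H * p.K) / n) ≤
        2 * Fintype.card S * kq * √L / n := by
      refine Real.sqrt_le_iff.2 ⟨by positivity, ?_⟩
      rw [div_pow, mul_pow, mul_pow, mul_pow, Real.sq_sqrt (by linarith), hkq2,
        div_le_div_iff₀ hnpos (by positivity)]
      have hn2 : 2 * n ≤ √(p.K : ℝ) := by linarith
      calc 4 * (Fintype.card S : ℝ) * logTerm S A p 3 (p.H * p.K) * n ^ 2
          ≤ 4 * (Fintype.card S : ℝ) * (2 * L) * n ^ 2 := by gcongr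
        _ = 4 * Fintype.card S * (2 * n) * L * n := by ring
        _ ≤ 4 * (Fintype.card S) ^ 2 * √(p.K : ℝ) * L * n := by gcongr; exact le_self_pow₀ h1 two_ne_zero
        _ = _ := by ring
    calc p.H * √(4 * Fintype.card S * logTerm S A p 3 (p.H * p.K) / n)
        ≤ p.H * (2 * Fintype.card S * kq * √L / n) := by gcongr
      _ = 2 * (Fintype.card S * p.H) * kq * √L / n := by ring
      _ ≤ 2 * ((Fintype.card S : ℝ) ^ (3 / 2 : ℝ) * (Fintype.card A : ℝ) ^ (1 / 4 : ℝ) *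
        (p.H : ℝ) ^ (7 / 4 : ℝ)) * kq * √L / n := by gcongr
      _ = _ := by ring
  have hL0 : 0 ≤ L := by linarith
  have t1 : 0 ≤ √(6 * variance w R * L / n) + √(4 * p.H * L / (Fintype.card S * n)) +
      8 * √(Fintype.card S * (p.H : ℝ) ^ 2) * L / (3 * n) := by positivity
  have t2 : 0 ≤ ∑ y, (√(2 * w y * (1 - w y) * L / (n - 1)) + 7 * L / (3 * n)) * |V y - R y| := by
    positivity
  have t3 : 0 ≤ √(4 * p.H * logTerm S A p 3 (p.H * p.K) / n) +
      7 * Fintype.card S * p.H * L / (3 * n) := by positivity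
  unfold coarseBonus refBonus
  simp only [← hLdef, ← hkq]
  linarith

theorem bonusFn_eq_coarse (hp : p.Valid) {n : ℝ} (hn0 : 0 ≤ n) (hn : n ≤ √(p.K : ℝ) / 2)
    (w V R : S → ℝ) : bonusFn p A n w V R = coarseBonus S A p n :=
  min_eq_right (coarseBonus_le_refBonus hp hn0 hn w V R)

omit [Nonempty S] [Nonempty A] in
theorem abs_refBonus_sub_value (n : ℝ) (w V V' R : S → ℝ) (hg : ∀ y, 0 ≤ gapWeight S A p n (w y)) :
    |refBonus p A n w V R - refBonus p A n w V' R| ≤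
      ∑ y, gapWeight S A p n (w y) * |V y - V' y| := by
  have e : refBonus p A n w V R - refBonus p A n w V' R =
      ∑ y, gapWeight S A p n (w y) * (|V y - R y| - |V' y - R y|) := by
    simp only [mul_sub, sum_sub_distrib]
    unfold refBonus gapWeight
    ring
  rw [e]
  refine (abs_sum_le_sum_abs _ _).trans (sum_le_sum fun y _ => ?_)
  rw [abs_mul, abs_of_nonneg (hg y)]
  refine mul_le_mul_of_nonneg_left ?_ (hg y)
  have := abs_abs_sub_abs_le (V y - R y) (V' y - R y)
  simpa using this

theorem gapWeight_nonneg (hp : p.Valid) {n : ℝ} (hn : 0 ≤ n) (u : ℝ) : 0 ≤ gapWeight S A p n u := by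
  have := two_le_logL S A hp
  unfold gapWeight
  positivity

/-- Above `√K / 2` visits the weights of the gaps are dominated by the transition probabilities,
up to a term of order `1 / √K`. -/
theorem gapWeight_le (hp : p.Valid) (hK : 16 ≤ (p.K : ℝ)) {n u : ℝ} (hn : √(p.K : ℝ) / 2 < n)
    (hu : u ∈ Set.Icc (0 : ℝ) 1) :
    gapWeight S A p n u ≤ u / p.H + 8 * p.H * logL S A p / √(p.K : ℝ) := by
  have hL := two_le_logL S A hp
  have hH := hp.one_le_H
  set L := logL S A p
  have hK4 : 4 ≤ √(p.K : ℝ) := Real.le_sqrt_of_sq_le (by linarith)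
  have hn2 : 2 < n := by linarith
  have h1 : √(2 * u * (1 - u) * L / (n - 1)) ≤ u / p.H + p.H * L / n := by
    refine Real.sqrt_le_iff.2 ⟨by have := hu.1; positivity, ?_⟩
    have e1 : 2 * u * (1 - u) * L / (n - 1) ≤ 4 * u * L / n := by
      rw [div_le_div_iff₀ (by linarith) (by linarith)]
      have h3 : 0 ≤ u * L := mul_nonneg hu.1 (by linarith)
      have : 2 * (1 - u) * n ≤ 4 * (n - 1) := by nlinarith [hu.1]
      nlinarith [mul_le_mul_of_nonneg_left this h3]
    have e2 : 4 * u * L / n = 4 * (u / p.H) * (p.H * L / n) := by field_simp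
    rw [e2] at e1
    nlinarith [sq_nonneg (u / p.H - p.H * L / n)]
  have h2 : 7 * L / (3 * n) ≤ 3 * p.H * L / n := by
    rw [div_le_div_iff₀ (by linarith) (by linarith)]
    have : 0 ≤ L * n := by positivity
    nlinarith
  have h3 : 4 * p.H * L / n ≤ 8 * p.H * L / √(p.K : ℝ) := by
    rw [div_le_div_iff₀ (by linarith) (by linarith)]
    have : 0 ≤ p.H * L := by positivity
    nlinarith
  unfold gapWeight
  have e : p.H * L / n + 3 * p.H * L / n = 4 * p.H * L / n := by ring
  linarith

theorem abs_bonusFn_sub_value (hp : p.Valid) (hK : 16 ≤ (p.K : ℝ)) {n : ℝ} (hn : 0 ≤ n)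
    {w : S → ℝ} (hw : w ∈ stdSimplex ℝ S) (V V' R : S → ℝ) :
    |bonusFn p A n w V R - bonusFn p A n w V' R| ≤
      ∑ y, (w y / p.H + 8 * p.H * logL S A p / √(p.K : ℝ)) * |V y - V' y| := by
  have hL := two_le_logL S A hp
  rcases le_or_gt n (√(p.K : ℝ) / 2) with h | h
  · rw [bonusFn_eq_coarse hp hn h, bonusFn_eq_coarse hp hn h, sub_self, abs_zero]
    have := hw.1
    exact sum_nonneg fun y _ => mul_nonneg (add_nonneg (div_nonneg (this y) (by positivity))
      (by positivity)) (abs_nonneg _)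
  · have hsum : ∑ y, gapWeight S A p n (w y) * |V y - V' y| ≤
        ∑ y, (w y / p.H + 8 * p.H * logL S A p / √(p.K : ℝ)) * |V y - V' y| :=
      sum_le_sum fun y _ => mul_le_mul_of_nonneg_right
        (gapWeight_le hp hK h ⟨hw.1 y, simplex_le_one hw y⟩) (abs_nonneg _)
    refine le_trans (abs_min_sub_min_le ((abs_refBonus_sub_value n w V V' R
      fun y => gapWeight_nonneg hp hn _).trans le_rfl) ?_) hsum
    rw [sub_self, abs_zero]
    exact sum_nonneg fun y _ => mul_nonneg (gapWeight_nonneg hp hn _) (abs_nonneg _)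

theorem abs_bonusFn_sub_ref (hp : p.Valid) {n : ℝ} (hn : 1 ≤ n) (hn' : n = 1 ∨ 2 ≤ n)
    {w : S → ℝ} (hw : w ∈ stdSimplex ℝ S) (V R R' : S → ℝ) :
    |bonusFn p A n w V R - bonusFn p A n w V R'| ≤
      7 * logL S A p * ∑ y, |R y - R' y| := by
  have hL := two_le_logL S A hp
  set L := logL S A p with hLdef
  have hsum : 0 ≤ ∑ y, |R y - R' y| := sum_nonneg fun _ _ => abs_nonneg _
  refine abs_min_sub_min_le ?_ (by rw [sub_self, abs_zero]; positivity)
  have hvv : ∀ f : S → ℝ, √(6 * variance w f * L / n) = √(6 * L / n) * √(variance w f) := by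
    intro f
    rw [← Real.sqrt_mul (by positivity)]; congr 1; ring
  have e : refBonus p A n w V R - refBonus p A n w V R' =
      √(6 * L / n) * (√(variance w R) - √(variance w R')) +
      ∑ y, gapWeight S A p n (w y) * (|V y - R y| - |V y - R' y|) := by
    simp only [mul_sub, sum_sub_distrib, ← hvv]
    unfold refBonus gapWeight
    ring
  have hw1 : ∀ y, √(w y * (1 - w y)) ≤ 1 := fun y => by
    refine Real.sqrt_le_one.2 ?_
    nlinarith [hw.1 y, simplex_le_one hw y]
  have b1 : √(6 * L / n) ≤ 3 * L := by
    refine Real.sqrt_le_iff.2 ⟨by positivity, ?_⟩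
    rw [div_le_iff₀ (by linarith)]
    nlinarith [sq_nonneg L]
  have b2 : ∀ y, gapWeight S A p n (w y) ≤ 4 * L := fun y => by
    have c1 : √(2 * w y * (1 - w y) * L / (n - 1)) ≤ L := by
      rcases hn' with rfl | h2
      · simp; linarith
      refine Real.sqrt_le_iff.2 ⟨by positivity, ?_⟩
      rw [div_le_iff₀ (by linarith)]
      have : w y * (1 - w y) ≤ 1 / 4 := by nlinarith [sq_nonneg (w y - 1 / 2)]
      nlinarith
    have c2 : 7 * L / (3 * n) ≤ 3 * L := by
      rw [div_le_iff₀ (by linarith)]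
      nlinarith
    unfold gapWeight
    linarith
  rw [e]
  refine (abs_add_le _ _).trans ?_
  have d1 : |√(6 * L / n) * (√(variance w R) - √(variance w R'))| ≤
      3 * L * ∑ y, |R y - R' y| := by
    rw [abs_mul, abs_of_nonneg (Real.sqrt_nonneg _)]
    refine mul_le_mul b1 ((abs_sqrt_variance_sub_le hw R R').trans
      (sum_le_sum fun y _ => ?_)) (abs_nonneg _) (by positivity)
    exact mul_le_of_le_one_left (abs_nonneg _) (hw1 y)
  have d2 : |∑ y, gapWeight S A p n (w y) * (|V y - R y| - |V y - R' y|)| ≤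
      4 * L * ∑ y, |R y - R' y| := by
    rw [mul_sum]
    refine (abs_sum_le_sum_abs _ _).trans (sum_le_sum fun y _ => ?_)
    rw [abs_mul, abs_of_nonneg (gapWeight_nonneg hp (by linarith) _)]
    refine mul_le_mul (b2 y) ?_ (abs_nonneg _) (by positivity)
    have := abs_abs_sub_abs_le (V y - R y) (V y - R' y)
    rwa [sub_sub_sub_cancel_left, abs_sub_comm (R' y)] at this
  linarith

end Bonus

section DataChange

variable {S A : Type*} [Fintype S] [Fintype A] [Nonempty S] [Nonempty A] {p : Params}

theorem abs_sqrt_div_sub_le {a b n C : ℝ} (hn : 0 < n) (h : |a - b| ≤ C ^ 2 / n ^ 2)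
    (hC : 0 ≤ C) : |√a - √b| ≤ C / n := by
  refine (abs_sqrt_sub_sqrt_le a b).trans (Real.sqrt_le_iff.2 ⟨by positivity, ?_⟩)
  rwa [div_pow]

theorem abs_sqrt_const_div_sub_le {a n : ℝ} (ha : 0 ≤ a) (hn : 0 < n) :
    |√(a / n) - √(a / (n + 1))| ≤ √a / n := by
  refine abs_sqrt_div_sub_le hn ?_ (Real.sqrt_nonneg _)
  have e : a / n - a / (n + 1) = a / (n * (n + 1)) := by field_simp; ring
  rw [Real.sq_sqrt ha, e, abs_of_nonneg (by positivity)]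
  gcongr
  nlinarith

theorem abs_const_div_sub_le {a n : ℝ} (ha : 0 ≤ a) (hn : 0 < n) :
    |a / n - a / (n + 1)| ≤ a / n := by
  have h1 : a / (n + 1) ≤ a / n := by gcongr; linarith
  have h2 : 0 ≤ a / (n + 1) := by positivity
  rw [abs_of_nonneg (by linarith)]
  linarith

omit [Nonempty S] in
theorem abs_sum_mul_sub_le {w w' f : S → ℝ} {ε C : ℝ} (hd : ∀ y, |w y - w' y| ≤ ε)
    (hf : ∀ y, f y ∈ Set.Icc (0 : ℝ) C) :
    |∑ y, w y * f y - ∑ y, w' y * f y| ≤ Fintype.card S * (ε * C) := by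
  rw [← sum_sub_distrib]
  refine (abs_sum_le_sum_abs _ _).trans ?_
  have : ∀ y ∈ (univ : Finset S), |w y * f y - w' y * f y| ≤ ε * C := fun y _ => by
    rw [← sub_mul, abs_mul, abs_of_nonneg (hf y).1]
    exact mul_le_mul (hd y) (hf y).2 (hf y).1 ((abs_nonneg _).trans (hd y))
  refine (sum_le_card_nsmul _ _ _ this).trans ?_
  simp

omit [Nonempty S] in
theorem abs_variance_sub_le {w w' f : S → ℝ} {ε C : ℝ} (hw : w ∈ stdSimplex ℝ S)
    (hw' : w' ∈ stdSimplex ℝ S) (hd : ∀ y, |w y - w' y| ≤ ε)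
    (hf : ∀ y, f y ∈ Set.Icc (0 : ℝ) C) :
    |variance w f - variance w' f| ≤ 3 * Fintype.card S * ε * C ^ 2 := by
  rw [variance_eq hw, variance_eq hw']
  have h1 := abs_sum_mul_sub_le (f := fun y => f y ^ 2) (C := C ^ 2) hd (fun y =>
    ⟨sq_nonneg _, pow_le_pow_left₀ (hf y).1 (hf y).2 2⟩)
  have h2 := abs_sum_mul_sub_le hd hf
  have a1 := sum_simplex_mul_le hw fun y => (hf y).2
  have a2 := sum_simplex_mul_le hw' fun y => (hf y).2
  have a3 := le_sum_simplex_mul hw fun y => (hf y).1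
  have a4 := le_sum_simplex_mul hw' fun y => (hf y).1
  set m := ∑ y, w y * f y
  set m' := ∑ y, w' y * f y
  have h3 : |m ^ 2 - m' ^ 2| ≤ Fintype.card S * (ε * C) * (2 * C) := by
    rw [sq_sub_sq, abs_mul, mul_comm, abs_of_nonneg (add_nonneg a3 a4)]
    exact mul_le_mul h2 (by linarith) (by linarith) ((abs_nonneg _).trans h2)
  have h4 : ∀ a b c d : ℝ, |a - b - (c - d)| ≤ |a - c| + |b - d| := fun a b c d => by
    rw [show a - b - (c - d) = (a - c) - (b - d) by ring]; exact abs_sub _ _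
  refine (h4 _ _ _ _).trans ?_
  nlinarith

omit [Nonempty S] in
theorem variance_le_sq {w f : S → ℝ} {C : ℝ} (hw : w ∈ stdSimplex ℝ S)
    (hf : ∀ y, f y ∈ Set.Icc (0 : ℝ) C) : variance w f ≤ C ^ 2 := by
  rw [variance_eq hw]
  have := sum_simplex_mul_le hw (f := fun y => f y ^ 2) (C := C ^ 2) fun y =>
    pow_le_pow_left₀ (hf y).1 (hf y).2 2
  nlinarith [sq_nonneg (∑ y, w y * f y)]

theorem abs_gapWeight_data_le (hp : p.Valid) {n u u' : ℝ} (hn : n = 1 ∨ 2 ≤ n)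
    (hu : u ∈ Set.Icc (0 : ℝ) 1) (hu' : u' ∈ Set.Icc (0 : ℝ) 1) (hd : |u - u'| ≤ 1 / n) :
    |gapWeight S A p n u - gapWeight S A p (n + 1) u'| ≤ 5 * logL S A p / n := by
  have hL := two_le_logL S A hp
  set L := logL S A p
  have hn1 : 1 ≤ n := by rcases hn with h | h <;> linarith
  have h1 : |√(2 * u * (1 - u) * L / (n - 1)) - √(2 * u' * (1 - u') * L / (n + 1 - 1))| ≤
      2 * L / n := by
    rw [add_sub_cancel_right]
    have q : ∀ v : ℝ, v ∈ Set.Icc (0 : ℝ) 1 → v * (1 - v) ∈ Set.Icc (0 : ℝ) (1 / 4) := fun v hv =>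
      ⟨mul_nonneg hv.1 (by linarith [hv.2]), by nlinarith [sq_nonneg (v - 1 / 2)]⟩
    have qu := q u hu
    have qu' := q u' hu'
    have hq : |u * (1 - u) - u' * (1 - u')| ≤ 1 / n := by
      rw [show u * (1 - u) - u' * (1 - u') = (u - u') * (1 - u - u') by ring, abs_mul]
      refine (mul_le_of_le_one_right (abs_nonneg _) ?_).trans hd
      rw [abs_le]
      constructor <;> linarith [hu.1, hu.2, hu'.1, hu'.2]
    refine abs_sqrt_div_sub_le (by linarith) ?_ (by positivity)
    rcases hn with rfl | h2
    · have e : 2 * u * (1 - u) * L / (1 - 1) - 2 * u' * (1 - u') * L / 1 =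
        -(2 * (u' * (1 - u')) * L) := by rw [sub_self, div_zero, div_one]; ring
      rw [e, abs_neg, abs_of_nonneg (by have := qu'.1; positivity)]
      nlinarith [qu'.1, qu'.2]
    · have e : 2 * u * (1 - u) * L / (n - 1) - 2 * u' * (1 - u') * L / n =
          2 * L * ((u * (1 - u) - u' * (1 - u')) / n + u * (1 - u) / ((n - 1) * n)) := by
        have : n - 1 ≠ 0 := by linarith
        field_simp
        ring
      rw [e, abs_mul, abs_of_nonneg (by positivity : 0 ≤ 2 * L)]
      have i1 : |(u * (1 - u) - u' * (1 - u')) / n| ≤ 1 / n ^ 2 := by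
        rw [abs_div, abs_of_nonneg (by linarith : 0 ≤ n), div_le_iff₀ (by linarith)]
        refine hq.trans (le_of_eq ?_)
        field_simp
      have i2 : |u * (1 - u) / ((n - 1) * n)| ≤ 1 / n ^ 2 := by
        have : 0 < n - 1 := by linarith
        rw [abs_of_nonneg (by have := qu.1; positivity), div_le_div_iff₀ (by positivity)
          (by positivity)]
        nlinarith [qu.2, qu.1, sq_nonneg n]
      have i3 := abs_add_le ((u * (1 - u) - u' * (1 - u')) / n) (u * (1 - u) / ((n - 1) * n))
      have i4 : |(u * (1 - u) - u' * (1 - u')) / n + u * (1 - u) / ((n - 1) * n)| ≤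
          2 / n ^ 2 := by
        have : 2 / n ^ 2 = 1 / n ^ 2 + 1 / n ^ 2 := by ring
        linarith
      calc 2 * L * |(u * (1 - u) - u' * (1 - u')) / n + u * (1 - u) / ((n - 1) * n)|
          ≤ 2 * L * (2 / n ^ 2) := by gcongr
        _ = 4 * L / n ^ 2 := by ring
        _ ≤ (2 * L) ^ 2 / n ^ 2 := by gcongr; nlinarith
  have h2 : |7 * L / (3 * n) - 7 * L / (3 * (n + 1))| ≤ 3 * L / n := by
    have := abs_const_div_sub_le (a := 7 * L / 3) (n := n) (by positivity) (by linarith)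
    rw [div_div, div_div] at this
    refine this.trans ?_
    rw [div_le_div_iff₀ (by linarith) (by linarith)]
    nlinarith
  unfold gapWeight
  have e : ∀ a b c d : ℝ, a + b - (c + d) = (a - c) + (b - d) := fun a b c d => by ring
  rw [e]
  refine (abs_add_le _ _).trans ?_
  have : 5 * L / n = 2 * L / n + 3 * L / n := by ring
  rw [this]
  exact add_le_add h1 h2

/-- The coarse bonus changes by `O(1 / n)` when a visit is added. -/
theorem abs_coarseBonus_data_le (hp : p.Valid) {n : ℝ} (hn : 1 ≤ n) :
    |coarseBonus S A p n - coarseBonus S A p (n + 1)| ≤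
      6 * Fintype.card S * p.H * logL S A p / n := by
  have hL := two_le_logL S A hp
  have hLc := logC_le_logP S A hp
  have hLc' := logL_le_logC S A hp
  have hLp := logP_le_two_mul S A hp
  have hS := one_le_card S
  have hH := hp.one_le_H
  set L := logL S A p
  set Lc := logC S A p with hLcd
  set Lp := logP S A p with hLpd
  have h1 := abs_sqrt_const_div_sub_le (a := 2 * Lc) (n := n) (by linarith) (by linarith)
  have h2 := abs_sqrt_const_div_sub_le (a := 4 * Fintype.card S * Lp) (n := n)
    (by have : 0 ≤ Lp := by linarith
        positivity) (by linarith)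
  have h3 : √(2 * Lc) ≤ 2 * L := Real.sqrt_le_iff.2 ⟨by positivity, by nlinarith⟩
  have h4 : √(4 * Fintype.card S * Lp) ≤ 4 * Fintype.card S * L := by
    refine Real.sqrt_le_iff.2 ⟨by positivity, ?_⟩
    have a1 : (4 * Fintype.card S : ℝ) * Lp ≤ 4 * Fintype.card S * (2 * L) := by gcongr
    have a2 : 4 * (Fintype.card S : ℝ) * (2 * L) = 8 * (Fintype.card S * L) := by ring
    have a3 : (1 : ℝ) ≤ Fintype.card S * L := by nlinarith
    nlinarith
  have e : coarseBonus S A p n - coarseBonus S A p (n + 1) =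
      (√(2 * Lc / n) - √(2 * Lc / (n + 1))) + p.H * (√(4 * Fintype.card S * Lp / n) -
        √(4 * Fintype.card S * Lp / (n + 1))) := by
    unfold coarseBonus costWidth
    ring
  rw [e]
  refine (abs_add_le _ _).trans ?_
  rw [abs_mul, abs_of_nonneg (by positivity : (0 : ℝ) ≤ p.H)]
  calc |√(2 * Lc / n) - √(2 * Lc / (n + 1))| + p.H * |√(4 * Fintype.card S * Lp / n) -
        √(4 * Fintype.card S * Lp / (n + 1))|
      ≤ 2 * L / n + p.H * (4 * Fintype.card S * L / n) := by
        refine add_le_add (h1.trans (by gcongr)) (mul_le_mul_of_nonneg_left (h2.trans ?_)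
          (by positivity))
        gcongr
    _ = (2 * L + 4 * Fintype.card S * p.H * L) / n := by ring
    _ ≤ 6 * Fintype.card S * p.H * L / n := by
        gcongr
        have : (1 : ℝ) ≤ Fintype.card S * p.H := one_le_mul_of_one_le_of_one_le hS hH
        nlinarith

set_option maxHeartbeats 800000 in
/-- The reference-based bonus changes by `O(1 / n)` when a visit is added to more than about
`√K / 2` visits. -/
theorem abs_refBonus_data_le (hp : p.Valid) {n : ℝ} (hn : n = 1 ∨ 2 ≤ n)
    (hnK : √(p.K : ℝ) / 2 ≤ n + 1) {w w' V R : S → ℝ} (hw : w ∈ stdSimplex ℝ S)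
    (hw' : w' ∈ stdSimplex ℝ S) (hd : ∀ y, |w y - w' y| ≤ 1 / n)
    (hV : ∀ y, V y ∈ Set.Icc (0 : ℝ) p.H) (hR : ∀ y, R y ∈ Set.Icc (0 : ℝ) p.H) :
    |refBonus p A n w V R - refBonus p A (n + 1) w' V R| ≤
      27 * ((Fintype.card S : ℝ) ^ 2 * Fintype.card A * (p.H : ℝ) ^ 2 * logL S A p) / n := by
  have hn1 : 1 ≤ n := by rcases hn with h | h <;> linarith
  have hn0 : 0 < n := by linarith
  have hL := two_le_logL S A hp
  have hLc := logC_le_logP S A hp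
  have hLc' := logL_le_logC S A hp
  have hLp := logP_le_two_mul S A hp
  have hS := one_le_card S
  have hA := one_le_card A
  have hH := hp.one_le_H
  have hK := hp.one_le_K
  set L := logL S A p with hLd
  set Lc := logC S A p with hLcd
  set Lp := logP S A p with hLpd
  have hLp0 : 0 ≤ Lp := by linarith
  set cS : ℝ := (Fintype.card S : ℝ) with hcS
  set cA : ℝ := (Fintype.card A : ℝ)
  set H : ℝ := (p.H : ℝ) with hHd
  set dim := cS ^ (3 / 2 : ℝ) * cA ^ (1 / 4 : ℝ) * H ^ (7 / 4 : ℝ) with hdim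
  have hdim0 : 0 ≤ dim := by positivity
  have hdim1 : dim ≤ cS ^ 2 * cA * H ^ 2 := dim_factor_le hp
  set kq := (p.K : ℝ) ^ (1 / 4 : ℝ) with hkq
  have hkq1 : 1 ≤ kq := Real.one_le_rpow hK (by norm_num)
  have hkq2 : kq ^ 2 = √(p.K : ℝ) := fourth_root_sq p
  set B := cS ^ 2 * cA * H ^ 2 * L with hB
  -- every constant below is dominated by `B`
  have hSH : cS * H ≤ cS ^ 2 * cA * H ^ 2 := by
    have : (1 : ℝ) ≤ cS * H * cA :=
      one_le_mul_of_one_le_of_one_le (one_le_mul_of_one_le_of_one_le hS hH) hA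
    have h0 := le_mul_of_one_le_right (by positivity : 0 ≤ cS * H) this
    linarith [show cS * H * (cS * H * cA) = cS ^ 2 * cA * H ^ 2 by ring]
  have hSHL : cS * H * L ≤ B := by rw [hB]; gcongr
  have hHL : H * L ≤ B := by
    have : H * L ≤ cS * (H * L) := le_mul_of_one_le_left (by positivity) hS
    linarith
  have hLB : L ≤ B := (le_mul_of_one_le_left (by linarith) hH).trans hHL
  have hB1 : 1 ≤ B := by linarith
  have hB2 : B ≤ B ^ 2 := le_self_pow₀ hB1 two_ne_zero
  have t1 : |√(2 * Lc / n) - √(2 * Lc / (n + 1))| ≤ 2 * B / n := by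
    refine (abs_sqrt_const_div_sub_le (by linarith) hn0).trans ?_
    gcongr
    refine Real.sqrt_le_iff.2 ⟨by positivity, ?_⟩
    rw [mul_pow]
    linarith
  have t2 : |√(6 * variance w R * L / n) - √(6 * variance w' R * L / (n + 1))| ≤ 5 * B / n := by
    have hv := abs_variance_sub_le hw hw' hd hR
    have hv0 := variance_nonneg hw.1 R
    have hv1 := variance_le_sq hw hR
    have e : 6 * variance w R * L / n - 6 * variance w' R * L / (n + 1) =
        6 * L * ((variance w R - variance w' R) / (n + 1) + variance w R / (n * (n + 1))) := by
      field_simp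
      ring
    refine (abs_sqrt_div_sub_le hn0 (C := 5 * (cS * H * L)) ?_ (by positivity)).trans (by gcongr)
    rw [e, abs_mul, abs_of_nonneg (by positivity : 0 ≤ 6 * L)]
    have i1 : |(variance w R - variance w' R) / (n + 1)| ≤ 3 * cS * H ^ 2 / n ^ 2 := by
      rw [abs_div, abs_of_nonneg (by linarith : 0 ≤ n + 1), div_le_iff₀ (by linarith)]
      refine hv.trans ?_
      rw [div_mul_eq_mul_div, le_div_iff₀ (by positivity)]
      have : 3 * cS * (1 / n) * H ^ 2 * n ^ 2 = 3 * cS * H ^ 2 * n := by field_simp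
      rw [this]
      gcongr
      linarith
    have i2 : |variance w R / (n * (n + 1))| ≤ H ^ 2 / n ^ 2 := by
      rw [abs_of_nonneg (by positivity)]
      gcongr
      linarith [show n * (n + 1) = n ^ 2 + n by ring]
    have i3 := abs_add_le ((variance w R - variance w' R) / (n + 1))
      (variance w R / (n * (n + 1)))
    calc 6 * L * |(variance w R - variance w' R) / (n + 1) + variance w R / (n * (n + 1))|
        ≤ 6 * L * (3 * cS * H ^ 2 / n ^ 2 + H ^ 2 / n ^ 2) := by gcongr; linarith
      _ = 6 * L * H ^ 2 * (3 * cS + 1) / n ^ 2 := by ring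
      _ ≤ (5 * (cS * H * L)) ^ 2 / n ^ 2 := by
        gcongr
        have e2 : (5 * (cS * H * L)) ^ 2 = L * H ^ 2 * (25 * L * cS ^ 2) := by ring
        rw [e2, show 6 * L * H ^ 2 * (3 * cS + 1) = L * H ^ 2 * (6 * (3 * cS + 1)) by ring]
        refine mul_le_mul_of_nonneg_left ?_ (by positivity)
        have e3 : cS ≤ cS ^ 2 := le_self_pow₀ hS two_ne_zero
        have e4 : 2 * cS ^ 2 ≤ L * cS ^ 2 := by gcongr
        linarith
  have t3 : |√(4 * H * L / (cS * n)) - √(4 * H * L / (cS * (n + 1)))| ≤ 2 * B / n := by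
    rw [← div_div, ← div_div]
    refine (abs_sqrt_const_div_sub_le (by positivity) hn0).trans ?_
    gcongr
    refine Real.sqrt_le_iff.2 ⟨by positivity, ?_⟩
    refine (div_le_self (by positivity) hS).trans ?_
    rw [mul_pow]
    linarith
  have t4 : |8 * √(cS * H ^ 2) * L / (3 * n) - 8 * √(cS * H ^ 2) * L / (3 * (n + 1))| ≤
      3 * B / n := by
    rw [← div_div, ← div_div]
    refine (abs_const_div_sub_le (by positivity) hn0).trans ?_
    gcongr
    have : √(cS * H ^ 2) ≤ cS * H := by
      refine Real.sqrt_le_iff.2 ⟨by positivity, ?_⟩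
      rw [mul_pow]
      gcongr
      exact le_self_pow₀ hS two_ne_zero
    have : √(cS * H ^ 2) * L ≤ B := (mul_le_mul_of_nonneg_right this (by linarith)).trans hSHL
    linarith
  have t5 : |∑ y, gapWeight S A p n (w y) * |V y - R y| -
      ∑ y, gapWeight S A p (n + 1) (w' y) * (|V y - R y|)| ≤ 5 * B / n := by
    rw [← sum_sub_distrib]
    refine (abs_sum_le_sum_abs _ _).trans ?_
    have : ∀ y ∈ (univ : Finset S), |gapWeight S A p n (w y) * |V y - R y| -
        gapWeight S A p (n + 1) (w' y) * (|V y - R y|)| ≤ 5 * L / n * H := fun y _ => by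
      rw [← sub_mul, abs_mul, abs_abs]
      refine mul_le_mul (abs_gapWeight_data_le hp hn ⟨hw.1 y, simplex_le_one hw y⟩
        ⟨hw'.1 y, simplex_le_one hw' y⟩ (hd y)) ?_ (abs_nonneg _) (by positivity)
      rw [abs_le]
      constructor <;> linarith [(hV y).1, (hV y).2, (hR y).1, (hR y).2]
    refine (sum_le_card_nsmul _ _ _ this).trans ?_
    rw [card_univ, nsmul_eq_mul, ← hcS, show cS * (5 * L / n * H) = 5 * (cS * H * L) / n by ring]
    gcongr
  have t6 : |√(4 * H * Lp / n) - √(4 * H * Lp / (n + 1))| ≤ 3 * B / n := by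
    refine (abs_sqrt_const_div_sub_le (by positivity) hn0).trans ?_
    gcongr
    refine Real.sqrt_le_iff.2 ⟨by positivity, ?_⟩
    have h2 : 4 * H * Lp ≤ 4 * H * (2 * L) := by gcongr
    rw [mul_pow]
    linarith
  have t7 : |7 * cS * H * L / (3 * n) - 7 * cS * H * L / (3 * (n + 1))| ≤ 3 * B / n := by
    rw [← div_div, ← div_div]
    refine (abs_const_div_sub_le (by positivity) hn0).trans ?_
    gcongr
    linarith
  have t8 : |2 * cS ^ (3 / 2 : ℝ) * cA ^ (1 / 4 : ℝ) * H ^ (7 / 4 : ℝ) * kq * √L / n -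
      2 * cS ^ (3 / 2 : ℝ) * cA ^ (1 / 4 : ℝ) * H ^ (7 / 4 : ℝ) * kq * √L / (n + 1)| ≤
      4 * B / n := by
    have e : 2 * cS ^ (3 / 2 : ℝ) * cA ^ (1 / 4 : ℝ) * H ^ (7 / 4 : ℝ) * kq * √L / n -
      2 * cS ^ (3 / 2 : ℝ) * cA ^ (1 / 4 : ℝ) * H ^ (7 / 4 : ℝ) * kq * √L / (n + 1) =
        2 * dim * √L * (kq / (n + 1)) / n := by
      rw [hdim]
      field_simp
      ring
    rw [e, abs_of_nonneg (by positivity)]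
    refine div_le_div_of_nonneg_right ?_ hn0.le
    have h1 : kq / (n + 1) ≤ 2 := by
      rw [div_le_iff₀ (by linarith)]
      linarith [le_self_pow₀ hkq1 two_ne_zero]
    have h2 : √L ≤ L :=
      Real.sqrt_le_iff.2 ⟨by positivity, le_self_pow₀ (by linarith) two_ne_zero⟩
    calc 2 * dim * √L * (kq / (n + 1)) ≤ 2 * (cS ^ 2 * cA * H ^ 2) * L * 2 := by gcongr
      _ = 4 * B := by rw [hB]; ring
  have hunf : ∀ n w, refBonus p A n w V R = √(2 * Lc / n) + (√(6 * variance w R * L / n) +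
      √(4 * H * L / (cS * n)) + 8 * √(cS * H ^ 2) * L / (3 * n)) +
      ∑ y, gapWeight S A p n (w y) * |V y - R y| + (√(4 * H * Lp / n) +
      7 * cS * H * L / (3 * n) +
      2 * cS ^ (3 / 2 : ℝ) * cA ^ (1 / 4 : ℝ) * H ^ (7 / 4 : ℝ) * kq * √L / n) :=
    fun n w => rfl
  rw [hunf, hunf]
  have hsum : 27 * B / n = 2 * B / n + 5 * B / n + 2 * B / n + 3 * B / n + 5 * B / n +
    3 * B / n + 3 * B / n + 4 * B / n := by ring
  rw [hsum]
  rw [abs_le] at t1 t2 t3 t4 t5 t6 t7 t8 ⊢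
  constructor <;> linarith [t1.1, t1.2, t2.1, t2.2, t3.1, t3.2, t4.1, t4.2, t5.1, t5.2, t6.1,
    t6.2, t7.1, t7.2, t8.1, t8.2]

theorem abs_bonusFn_data_le (hp : p.Valid) {n : ℝ} (hn : n = 1 ∨ 2 ≤ n)
    {w w' V R : S → ℝ} (hw : w ∈ stdSimplex ℝ S)
    (hw' : w' ∈ stdSimplex ℝ S) (hd : ∀ y, |w y - w' y| ≤ 1 / n)
    (hV : ∀ y, V y ∈ Set.Icc (0 : ℝ) p.H) (hR : ∀ y, R y ∈ Set.Icc (0 : ℝ) p.H) :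
    |bonusFn p A n w V R - bonusFn p A (n + 1) w' V R| ≤
      27 * ((Fintype.card S : ℝ) ^ 2 * Fintype.card A * (p.H : ℝ) ^ 2 * logL S A p) / n := by
  have hn1 : 1 ≤ n := by rcases hn with h | h <;> linarith
  have hL := two_le_logL S A hp
  have hS := one_le_card S
  have hA := one_le_card A
  have hH := hp.one_le_H
  have hc : |coarseBonus S A p n - coarseBonus S A p (n + 1)| ≤
      27 * ((Fintype.card S : ℝ) ^ 2 * Fintype.card A * (p.H : ℝ) ^ 2 * logL S A p) / n := by
    refine (abs_coarseBonus_data_le hp hn1).trans ?_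
    refine div_le_div_of_nonneg_right ?_ (by linarith)
    have : (1 : ℝ) ≤ Fintype.card S * Fintype.card A * p.H :=
      one_le_mul_of_one_le_of_one_le (one_le_mul_of_one_le_of_one_le hS hA) hH
    have h0 : 0 ≤ (Fintype.card S : ℝ) * p.H * logL S A p := by positivity
    nlinarith
  rcases le_total (n + 1) (√(p.K : ℝ) / 2) with h | h
  · rw [bonusFn_eq_coarse hp (by linarith) (by linarith), bonusFn_eq_coarse hp (by linarith) h]
    exact hc
  · exact abs_min_sub_min_le (abs_refBonus_data_le hp hn h hw hw' hd hV hR) hc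

end DataChange

/-! ### Total variation of the value estimates over the episodes -/

section Variation

theorem sum_one_div_le (a b : ℝ) (ha : 0 ≤ a) (hb : 0 ≤ b) {n N : ℕ} (hn : n ≤ N) :
    ∑ j ∈ range n, (if j = 0 then a else b / j) ≤ a + b * (1 + Real.log N) := by
  have hlog : 0 ≤ Real.log N := Real.log_natCast_nonneg N
  rcases n with _ | n
  · simp; positivity
  rw [sum_range_succ']
  simp only [if_true]
  have h1 : ∑ j ∈ range n, (if j + 1 = 0 then a else b / ((j + 1 : ℕ) : ℝ)) =
      b * (harmonic n : ℝ) := by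
    rw [harmonic]
    push_cast
    rw [mul_sum]
    refine sum_congr rfl fun j _ => ?_
    simp [div_eq_mul_inv]
  rw [h1]
  have h2 : (harmonic n : ℝ) ≤ 1 + Real.log N := by
    rcases Nat.eq_zero_or_pos n with rfl | hpos
    · simp; positivity
    refine (harmonic_le_one_add_log n).trans ?_
    have : Real.log n ≤ Real.log N :=
      Real.log_le_log (by exact_mod_cast hpos) (by exact_mod_cast (by omega : n ≤ N))
    linarith
  nlinarith [mul_le_mul_of_nonneg_left h2 hb]

/-- Summing a function of a counter over the times at which the counter increases. -/
theorem sum_at_visits {n : ℕ → ℕ} {v : ℕ → Prop} [DecidablePred v] (f : ℕ → ℝ) (hn0 : n 0 = 0)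
    (hn : ∀ k, n (k + 1) = n k + if v (k + 1) then 1 else 0) (K : ℕ) :
    ∑ k ∈ range K, (if v (k + 1) then f (n k) else 0) = ∑ j ∈ range (n K), f j := by
  induction K with
  | zero => simp [hn0]
  | succ K ih =>
    rw [sum_range_succ, ih, hn K]
    split_ifs
    · rw [sum_range_succ]
    · simp

/-- Total variation is controlled by the upward variation for a sequence with values in `[0, C]`. -/
theorem sum_abs_sub_le {x u : ℕ → ℝ} {C : ℝ} {K : ℕ} (hx : ∀ k ∈ Icc 1 K, x k ∈ Set.Icc 0 C)
    (hC : 0 ≤ C) (hu : ∀ k ∈ Ico 1 K, x (k + 1) - x k ≤ u k) (hu0 : ∀ k, 0 ≤ u k) :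
    ∑ k ∈ Ico 1 K, |x (k + 1) - x k| ≤ 2 * ∑ k ∈ Ico 1 K, u k + C := by
  rcases Nat.eq_zero_or_pos K with rfl | hK
  · simpa using hC
  have h1 : ∑ k ∈ Ico 1 K, |x (k + 1) - x k| ≤
      ∑ k ∈ Ico 1 K, (2 * u k - (x (k + 1) - x k)) := by
    refine sum_le_sum fun k hk => ?_
    have := hu k hk
    have := hu0 k
    rw [abs_le]
    constructor <;> linarith
  rw [sum_sub_distrib, ← mul_sum, sum_Ico_sub x (by omega : 1 ≤ K)] at h1
  have h2 := hx 1 (mem_Icc.2 ⟨le_rfl, hK⟩)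
  have h3 := hx K (mem_Icc.2 ⟨hK, le_rfl⟩)
  linarith [h2.2, h3.1]

variable {S A : Type*} [Fintype S] [Fintype A] [DecidableEq S] [DecidableEq A] [Nonempty A]
  {p : Params} {D : ℕ → Episode S A}

/-- Change of the running average of the values at the visited episodes. -/
theorem abs_visitAvg_sub_le [Nonempty S] (hp : p.Valid)
    (hcost : ∀ k ∈ Icc 1 p.K, ∀ h < p.H, (D k).cost h ∈ Set.Icc (0 : ℝ) 1)
    {k h : ℕ} (hk : k + 1 ≤ p.K) (hh : h ≤ p.H) (s : S) :
    |visitAvg p D (k + 1) h s - visitAvg p D k h s| ≤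
      if (D (k + 1)).state h = s then
        (if visitS D k h s = 0 then (p.H : ℝ) else p.H / visitS D k h s) else 0 := by
  have h0 := visitAvg_mem hp hcost (by omega : k ≤ p.K) hh s
  have h1 := visitAvg_mem hp hcost hk hh s
  have h2 := valAt_mem hp hcost hk hh s
  split_ifs with hv hn
  · rw [abs_le]
    constructor <;> linarith [h0.1, h0.2, h1.1, h1.2]
  · have hn' : (0 : ℝ) < visitS D k h s := by exact_mod_cast Nat.pos_of_ne_zero hn
    have e : visitAvg p D (k + 1) h s - visitAvg p D k h s =
        (valAt p D (k + 1) h s - visitAvg p D k h s) / (visitS D k h s + 1) := by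
      unfold visitAvg
      rw [sum_Icc_succ_top (Nat.le_add_left 1 k), if_pos hv, visitS_succ, if_pos hv]
      push_cast
      field_simp
      ring
    rw [e, abs_div, abs_of_pos (by linarith : (0 : ℝ) < visitS D k h s + 1)]
    gcongr
    · rw [abs_le]
      constructor <;> linarith [h0.1, h0.2, h2.1, h2.2]
    · linarith
  · unfold visitAvg
    rw [sum_Icc_succ_top (Nat.le_add_left 1 k), if_neg hv, visitS_succ, if_neg hv]
    simp

omit [Fintype S] [Fintype A] [DecidableEq A] [Nonempty A] in
theorem visitS_le (k h : ℕ) (s : S) : visitS D k h s ≤ k := by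
  refine (card_filter_le _ _).trans ?_
  simp

/-- The reference value follows a running average with delay, so its total variation is at most
that of the running average, which is logarithmic. -/
theorem sum_abs_refAt_sub_le [Nonempty S] (hp : p.Valid)
    (hcost : ∀ k ∈ Icc 1 p.K, ∀ h < p.H, (D k).cost h ∈ Set.Icc (0 : ℝ) 1)
    {h : ℕ} (hh : h ≤ p.H) (s : S) :
    ∑ k ∈ Ico 1 p.K, |refAt p D (k + 1) h s - refAt p D k h s| ≤
      p.H * (2 + Real.log p.K) := by
  have key : ∀ j < p.K, ∑ k ∈ range j, |refAt p D (k + 2) h s - refAt p D (k + 1) h s| +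
      |refAt p D (j + 1) h s - visitAvg p D j h s| ≤
      ∑ k ∈ range j, |visitAvg p D (k + 1) h s - visitAvg p D k h s| := by
    intro j
    induction j with
    | zero => simp [refAt_one, visitAvg]
    | succ j ih =>
      intro hj
      have ih := ih (by omega)
      rw [sum_range_succ, sum_range_succ, refAt_succ p D (by omega : 1 ≤ j + 1)]
      split_ifs
      · rw [sub_self, abs_zero]
        have := abs_sub_le (visitAvg p D (j + 1) h s) (visitAvg p D j h s)
          (refAt p D (j + 1) h s)
        rw [abs_sub_comm (visitAvg p D j h s)] at this
        linarith
      · rw [sub_self, abs_zero]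
        have := abs_sub_le (refAt p D (j + 1) h s) (visitAvg p D j h s)
          (visitAvg p D (j + 1) h s)
        rw [abs_sub_comm (visitAvg p D j h s)] at this
        linarith
  have hK := hp.K_pos
  have h1 := key (p.K - 1) (by omega)
  have h2 : ∑ k ∈ range (p.K - 1), |visitAvg p D (k + 1) h s - visitAvg p D k h s| ≤
      p.H + p.H * (1 + Real.log p.K) := by
    calc _ ≤ ∑ k ∈ range (p.K - 1), (if (D (k + 1)).state h = s then
          (if visitS D k h s = 0 then (p.H : ℝ) else p.H / visitS D k h s) else 0) :=
          sum_le_sum fun k hk => abs_visitAvg_sub_le hp hcost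
            (by have := mem_range.1 hk; omega) hh s
      _ = _ := sum_at_visits (n := fun k => visitS D k h s)
          (v := fun k => (D k).state h = s) (fun j => if j = 0 then (p.H : ℝ) else p.H / j)
          (by simp [visitS]) (fun k => visitS_succ D k h s) _
      _ ≤ _ := sum_one_div_le _ _ (by positivity) (by positivity)
          ((visitS_le _ h s).trans (by omega))
  rw [sum_Ico_eq_sum_range]
  simp_rw [add_comm 1, add_assoc]
  have h3 := abs_nonneg (refAt p D (p.K - 1 + 1) h s - visitAvg p D (p.K - 1) h s)
  linarith

/-- Drift of the estimates at step `h` between the episodes `k` and `k + 1` that is caused by the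
new data. -/
noncomputable def dataDrift (p : Params) (D : ℕ → Episode S A) (k h : ℕ) : ℝ :=
  (∑ s, ∑ a, if (D (k + 1)).visits h s a then
    (if visitSA D k h s a = 0 then (p.H : ℝ) else
      29 * ((Fintype.card S : ℝ) ^ 2 * Fintype.card A * (p.H : ℝ) ^ 2 * logL S A p) /
        visitSA D k h s a) else 0) +
  7 * logL S A p * ∑ y, |refAt p D (k + 1) (h + 1) y - refAt p D k (h + 1) y|

theorem max_zero_sub_le {x y C : ℝ} (hC : 0 ≤ C) (h : x - y ≤ C) : max x 0 - max y 0 ≤ C := by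
  rw [sub_le_iff_le_add]
  exact max_le (by linarith [le_max_left y 0]) (by linarith [le_max_right y 0])

omit [Fintype S] [Fintype A] [Nonempty A] in
theorem abs_cBar_succ_sub_le
    (hcost : ∀ k ∈ Icc 1 p.K, ∀ h < p.H, (D k).cost h ∈ Set.Icc (0 : ℝ) 1)
    {k h : ℕ} (hk : k + 1 ≤ p.K) (hh : h < p.H) {s : S} {a : A} (hv : (D (k + 1)).visits h s a)
    (hn : visitSA D k h s a ≠ 0) :
    |cBar D (k + 1) h s a - cBar D k h s a| ≤ 1 / visitSA D k h s a := by
  have h0 := cBar_mem D hcost (by omega : k ≤ p.K) hh s a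
  have h1 := hcost (k + 1) (mem_Icc.2 ⟨by omega, hk⟩) h hh
  have hn' : (0 : ℝ) < visitSA D k h s a := by exact_mod_cast Nat.pos_of_ne_zero hn
  have e : cBar D (k + 1) h s a - cBar D k h s a =
      ((D (k + 1)).cost h - cBar D k h s a) / (visitSA D k h s a + 1) := by
    unfold cBar
    have hv' : (D (k + 1)).state h = s ∧ (D (k + 1)).action h = a := hv
    rw [sum_filter, sum_filter, sum_Icc_succ_top (Nat.le_add_left 1 k), if_pos hv', visitSA_succ,
      if_pos hv]
    push_cast
    field_simp
    ring
  rw [e, abs_div, abs_of_pos (by linarith : (0 : ℝ) < visitSA D k h s a + 1)]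
  gcongr
  · rw [abs_le]
    constructor <;> linarith [h0.1, h0.2, h1.1, h1.2]
  · linarith

omit [Fintype A] [Nonempty A] in
theorem abs_PBar_succ_sub_le {k h : ℕ} {s : S} {a : A} (hv : (D (k + 1)).visits h s a)
    (hn : visitSA D k h s a ≠ 0) (y : S) :
    |PBar D k h s a y - PBar D (k + 1) h s a y| ≤ 1 / visitSA D k h s a := by
  have h0 : PBar D k h s a y ∈ Set.Icc (0 : ℝ) 1 :=
    ⟨PBar_nonneg D k h s a y, simplex_le_one (PBar_mem D hn) y⟩
  have hn' : (0 : ℝ) < visitSA D k h s a := by exact_mod_cast Nat.pos_of_ne_zero hn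
  have e : PBar D k h s a y - PBar D (k + 1) h s a y =
      (PBar D k h s a y - if (D (k + 1)).state (h + 1) = y then 1 else 0) /
        (visitSA D k h s a + 1) := by
    unfold PBar
    rw [visitSAS_succ, visitSA_succ, if_pos hv]
    push_cast
    by_cases hy : (D (k + 1)).state (h + 1) = y
    · simp only [hv, hy, and_self, if_true]
      field_simp
      ring
    · simp only [hv, hy, and_false, if_false]
      field_simp
      ring
  rw [e, abs_div, abs_of_pos (by linarith : (0 : ℝ) < visitSA D k h s a + 1)]
  gcongr
  · rw [abs_le]
    split_ifs <;> constructor <;> linarith [h0.1, h0.2]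
  · linarith

end Variation

section Variation

variable {S A : Type*} [Fintype S] [Fintype A] [DecidableEq S] [DecidableEq A] [Nonempty A]
  {p : Params} {D : ℕ → Episode S A}

theorem bonusAt_eq (k h : ℕ) (s : S) (a : A) : bonusAt p D k h s a =
    bonusFn p A (visitSA D k h s a) (PBar D k h s a) (valAt p D k (h + 1))
      (refAt p D k (h + 1)) := rfl

/-- The coefficient with which absolute changes of the next value enter the change of an estimated
action value. -/
noncomputable def varCoef (S A : Type*) [Fintype S] [Fintype A] (p : Params) : ℝ :=
  8 * p.H * logL S A p / √(p.K : ℝ)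

omit [DecidableEq S] [DecidableEq A] in
theorem varCoef_nonneg [Nonempty S] (hp : p.Valid) : 0 ≤ varCoef S A p := by
  have := two_le_logL S A hp
  unfold varCoef
  positivity

theorem cast_eq_one_or_two_le {n : ℕ} (hn : n ≠ 0) : (n : ℝ) = 1 ∨ 2 ≤ (n : ℝ) := by
  rcases Nat.lt_or_ge n 2 with h | h
  · left; have : n = 1 := by omega
    simp [this]
  · right; exact_mod_cast h

section Steps

variable [Nonempty S] (hp : p.Valid) (hK : 16 ≤ (p.K : ℝ))
  (hcost : ∀ k ∈ Icc 1 p.K, ∀ h < p.H, (D k).cost h ∈ Set.Icc (0 : ℝ) 1)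
include hp hK

omit [DecidableEq S] [DecidableEq A] in
/-- Effect of a change of the next value on `w V - b(V)`: increases of `V` are amplified by
`1 + 1 / H`, and decreases are harmless up to a term of order `1 / √K`. -/
theorem value_change_le {n : ℝ} (hn : 0 ≤ n) {w : S → ℝ} (hw : w ∈ stdSimplex ℝ S)
    {V V' : S → ℝ} (R : S → ℝ) {U : ℝ} (hU0 : 0 ≤ U) (hU : ∀ y, V' y - V y ≤ U) :
    (∑ y, w y * V' y - bonusFn p A n w V' R) - (∑ y, w y * V y - bonusFn p A n w V R) ≤
      (1 + 1 / p.H) * U + varCoef S A p * ∑ y, |V' y - V y| := by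
  have hH := hp.one_le_H
  have hvc := varCoef_nonneg (S := S) (A := A) hp
  have h1 := (le_abs_self _).trans (abs_bonusFn_sub_value (A := A) hp hK hn hw V V' R)
  have hα : (1 : ℝ) / p.H ≤ 1 := (div_le_one (by linarith)).2 hH
  have h2 : ∑ y, w y * V' y - ∑ y, w y * V y + ∑ y, (w y / p.H + varCoef S A p) * |V y - V' y| ≤
      ∑ y, (w y * ((1 + 1 / p.H) * U) + varCoef S A p * |V' y - V y|) := by
    rw [← sum_sub_distrib, ← sum_add_distrib]
    refine sum_le_sum fun y _ => ?_
    rw [abs_sub_comm (V y)]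
    have e : w y * V' y - w y * V y + (w y / p.H + varCoef S A p) * |V' y - V y| =
        w y * ((V' y - V y) + 1 / p.H * |V' y - V y|) + varCoef S A p * |V' y - V y| := by ring
    rw [e]
    refine add_le_add_left (mul_le_mul_of_nonneg_left ?_ (hw.1 y)) _
    rcases abs_cases (V' y - V y) with ⟨h, h0⟩ | ⟨h, h0⟩ <;> rw [h]
    · have := hU y
      have : (1 + 1 / (p.H : ℝ)) * (V' y - V y) ≤ (1 + 1 / p.H) * U := by gcongr
      linarith
    · have : 0 ≤ (1 + 1 / (p.H : ℝ)) * U := by positivity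
      nlinarith
  rw [sum_add_distrib, ← sum_mul, hw.2, one_mul, ← mul_sum] at h2
  unfold varCoef at *
  linarith

include hcost

/-- Increase of an estimated action value by new data and by changes of the next value. -/
theorem qAt_succ_sub_le {k h : ℕ} (hk1 : 1 ≤ k) (hk : k + 1 ≤ p.K) (hh : h < p.H) {U : ℝ}
    (hU0 : 0 ≤ U) (hU : ∀ y, valAt p D (k + 1) (h + 1) y - valAt p D k (h + 1) y ≤ U)
    (s : S) (a : A) : qAt p D (k + 1) h s a - qAt p D k h s a ≤
      dataDrift p D k h + (1 + 1 / p.H) * U +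
        varCoef S A p * ∑ y, |valAt p D (k + 1) (h + 1) y - valAt p D k (h + 1) y| := by
  have hL := two_le_logL S A hp
  have hH := hp.one_le_H
  have hS := one_le_card S
  have hA := one_le_card A
  have hvc := varCoef_nonneg (S := S) (A := A) hp
  have hsum : 0 ≤ ∑ y, |valAt p D (k + 1) (h + 1) y - valAt p D k (h + 1) y| :=
    sum_nonneg fun _ _ => abs_nonneg _
  set g := (Fintype.card S : ℝ) ^ 2 * Fintype.card A * (p.H : ℝ) ^ 2 * logL S A p with hg
  set r := ∑ y, |refAt p D (k + 1) (h + 1) y - refAt p D k (h + 1) y| with hr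
  have hr0 : 0 ≤ r := sum_nonneg fun _ _ => abs_nonneg _
  have hterm : ∀ s a, 0 ≤ if (D (k + 1)).visits h s a then
      (if visitSA D k h s a = 0 then (p.H : ℝ) else 29 * g / visitSA D k h s a) else 0 := by
    intro s a
    split_ifs <;> positivity
  have hdrift : (if (D (k + 1)).visits h s a then
      (if visitSA D k h s a = 0 then (p.H : ℝ) else 29 * g / visitSA D k h s a) else 0) +
      7 * logL S A p * r ≤ dataDrift p D k h := by
    refine add_le_add_left ?_ _
    refine le_trans ?_ (single_le_sum (fun s _ => sum_nonneg fun a _ => hterm s a) (mem_univ s))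
    exact single_le_sum (fun a _ => hterm s a) (mem_univ a)
  have hrest : 0 ≤ (1 + 1 / (p.H : ℝ)) * U + varCoef S A p *
      ∑ y, |valAt p D (k + 1) (h + 1) y - valAt p D k (h + 1) y| := by positivity
  by_cases hn : visitSA D k h s a = 0
  · -- the pair was not visited before
    rw [qAt_eq_zero hp hn]
    by_cases hv : (D (k + 1)).visits h s a
    · rw [if_pos hv, if_pos hn] at hdrift
      have := qAt_le hp hcost hk hh s a
      have : 0 ≤ 7 * logL S A p * r := by positivity
      linarith
    · rw [if_neg hv] at hdrift
      rw [qAt_eq_zero hp (by rw [visitSA_succ, hn, if_neg hv])]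
      have : 0 ≤ 7 * logL S A p * r := by positivity
      linarith
  have hn' := cast_eq_one_or_two_le hn
  have hn0 : (1 : ℝ) ≤ visitSA D k h s a := by rcases hn' with h | h <;> linarith
  have hw := PBar_mem D hn
  have hVm : ∀ y, valAt p D (k + 1) (h + 1) y ∈ Set.Icc (0 : ℝ) p.H := fun y =>
    valAt_mem hp hcost hk hh y
  have hRm : ∀ y, refAt p D k (h + 1) y ∈ Set.Icc (0 : ℝ) p.H := fun y =>
    refAt_mem hp hcost hk1 (by omega) hh y
  have hvalue := value_change_le (A := A) hp hK
    (n := (visitSA D k h s a : ℝ)) (by linarith) hw (V := valAt p D k (h + 1))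
    (V' := valAt p D (k + 1) (h + 1)) (refAt p D k (h + 1)) hU0 hU
  have hC : 0 ≤ dataDrift p D k h + (1 + 1 / (p.H : ℝ)) * U + varCoef S A p *
      ∑ y, |valAt p D (k + 1) (h + 1) y - valAt p D k (h + 1) y| := by
    have : 0 ≤ 7 * logL S A p * r := by positivity
    linarith [hterm s a]
  rw [qAt_eq, qAt_eq]
  refine max_zero_sub_le hC ?_
  rw [bonusAt_eq, bonusAt_eq]
  have hn'' : visitSA D (k + 1) h s a ≠ 0 := by rw [visitSA_succ]; omega
  have hw' := PBar_mem D hn''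
  have href := abs_bonusFn_sub_ref (A := A) hp
    (by exact_mod_cast Nat.pos_of_ne_zero hn'') (cast_eq_one_or_two_le hn'') hw'
    (valAt p D (k + 1) (h + 1)) (refAt p D (k + 1) (h + 1)) (refAt p D k (h + 1))
  have href' := (abs_le.1 href).1
  by_cases hv : (D (k + 1)).visits h s a
  · rw [if_pos hv, if_neg hn] at hdrift
    have hd := abs_PBar_succ_sub_le hv hn
    have hdata := abs_bonusFn_data_le (A := A) hp hn' hw hw' hd hVm hRm
    have hcast : ((visitSA D (k + 1) h s a : ℕ) : ℝ) = visitSA D k h s a + 1 := by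
      rw [visitSA_succ, if_pos hv]; push_cast; ring
    rw [hcast] at href' ⊢
    have hc := (abs_le.1 (abs_cBar_succ_sub_le hcost hk hh hv hn)).2
    have hPV := (abs_le.1 (abs_sum_mul_sub_le hd hVm)).1
    have hdata' := (abs_le.1 hdata).2
    set n : ℝ := (visitSA D k h s a : ℝ) with hnd
    have hsmall : 1 / n + Fintype.card S * (1 / n * p.H) ≤ 2 * g / n := by
      have : 1 / n + Fintype.card S * (1 / n * p.H) = (1 + Fintype.card S * p.H) / n := by ring
      rw [this]
      refine div_le_div_of_nonneg_right ?_ (by linarith)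
      have h1 : (1 : ℝ) ≤ Fintype.card S * p.H := one_le_mul_of_one_le_of_one_le hS hH
      have h2 : (1 : ℝ) ≤ (Fintype.card S * p.H) * Fintype.card A * logL S A p :=
        one_le_mul_of_one_le_of_one_le (one_le_mul_of_one_le_of_one_le h1 hA) (by linarith)
      have h3 := le_mul_of_one_le_right (by linarith : (0 : ℝ) ≤ Fintype.card S * p.H) h2
      have h4 : (Fintype.card S * p.H : ℝ) * ((Fintype.card S * p.H) * Fintype.card A *
        logL S A p) = g := by rw [hg]; ring
      linarith
    have hsplit : 29 * g / n = 27 * g / n + 2 * g / n := by ring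
    linarith
  · rw [if_neg hv] at hdrift
    have hcast : visitSA D (k + 1) h s a = visitSA D k h s a := by
      rw [visitSA_succ, if_neg hv, add_zero]
    have hPe : PBar D (k + 1) h s a = PBar D k h s a := by
      funext y
      unfold PBar
      rw [hcast, visitSAS_succ]
      simp [hv]
    have hce : cBar D (k + 1) h s a = cBar D k h s a := by
      unfold cBar
      have hv' : ¬ ((D (k + 1)).state h = s ∧ (D (k + 1)).action h = a) := hv
      rw [hcast, sum_filter, sum_filter, sum_Icc_succ_top (Nat.le_add_left 1 k), if_neg hv',
        add_zero]
    rw [hcast, hPe] at href' ⊢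
    rw [hce]
    linarith

variable (hη : ∀ k ∈ Icc 1 p.K, 0 < p.η k)
include hη

/-- Estimated values increase from one episode to the next only as far as the estimated action
values do, because the mirror descent step improves the policy. -/
theorem valAt_succ_sub_le {k h : ℕ} (hk1 : 1 ≤ k) (hk : k + 1 ≤ p.K) (hh : h < p.H) {U : ℝ}
    (hU0 : 0 ≤ U) (hU : ∀ y, valAt p D (k + 1) (h + 1) y - valAt p D k (h + 1) y ≤ U) (s : S) :
    valAt p D (k + 1) h s - valAt p D k h s ≤
      dataDrift p D k h + (1 + 1 / p.H) * U +
        varCoef S A p * ∑ y, |valAt p D (k + 1) (h + 1) y - valAt p D k (h + 1) y| := by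
  rw [valAt_step p D _ hh, valAt_step p D _ hh]
  have h1 := mdStep_improves (hη k (mem_Icc.2 ⟨hk1, by omega⟩)) (qAt p D k h s)
    (policyAt_mem p D k h s)
  rw [← policyAt_succ p D hk1] at h1
  have h2 := sum_simplex_mul_le (policyAt_mem p D (k + 1) h s) fun a =>
    qAt_succ_sub_le hp hK hcost hk1 hk hh hU0 hU s a
  simp_rw [mul_sub, sum_sub_distrib] at h2
  simp_rw [mul_comm (policyAt p D (k + 1) h s _)] at h2
  linarith

end Steps

theorem sum_dataDrift_le [Nonempty S] (hp : p.Valid)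
    (hcost : ∀ k ∈ Icc 1 p.K, ∀ h < p.H, (D k).cost h ∈ Set.Icc (0 : ℝ) 1)
    {h : ℕ} (hh : h < p.H) : ∑ k ∈ Ico 1 p.K, dataDrift p D k h ≤
      37 * ((Fintype.card S : ℝ) ^ 3 * (Fintype.card A) ^ 2 * (p.H : ℝ) ^ 2 *
        logL S A p ^ 2) := by
  have hL := two_le_logL S A hp
  have hLK := log_K_le_logL S A hp
  have hH := hp.one_le_H
  have hS := one_le_card S
  have hA := one_le_card A
  set L := logL S A p
  set g := (Fintype.card S : ℝ) ^ 2 * Fintype.card A * (p.H : ℝ) ^ 2 * L with hg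
  have hlog : 0 ≤ Real.log p.K := Real.log_natCast_nonneg _
  have h1 : ∀ s a, ∑ k ∈ Ico 1 p.K, (if (D (k + 1)).visits h s a then
      (if visitSA D k h s a = 0 then (p.H : ℝ) else 29 * g / visitSA D k h s a) else 0) ≤
      p.H + 29 * g * L := by
    intro s a
    calc _ ≤ ∑ k ∈ range p.K, (if (D (k + 1)).visits h s a then
          (if visitSA D k h s a = 0 then (p.H : ℝ) else 29 * g / visitSA D k h s a) else 0) := by
          refine sum_le_sum_of_subset_of_nonneg (fun k hk => mem_range.2 (mem_Ico.1 hk).2) ?_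
          intro k _ _
          split_ifs <;> positivity
      _ = _ := sum_at_visits (n := fun k => visitSA D k h s a)
          (v := fun k => (D k).visits h s a) (fun j => if j = 0 then (p.H : ℝ) else 29 * g / j)
          (by simp [visitSA]) (fun k => visitSA_succ D k h s a) _
      _ ≤ p.H + 29 * g * (1 + Real.log p.K) :=
          sum_one_div_le _ _ (by positivity) (by positivity) (visitSA_le _ _ h s a)
      _ ≤ _ := by gcongr; linarith
  have h2 : ∑ k ∈ Ico 1 p.K, ∑ y, |refAt p D (k + 1) (h + 1) y - refAt p D k (h + 1) y| ≤
      Fintype.card S * (p.H * L) := by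
    rw [sum_comm]
    refine (sum_le_card_nsmul _ _ _ fun y _ => sum_abs_refAt_sub_le hp hcost hh y).trans ?_
    rw [card_univ, nsmul_eq_mul]
    gcongr
  have h3 : ∑ k ∈ Ico 1 p.K, ∑ s, ∑ a, (if (D (k + 1)).visits h s a then
      (if visitSA D k h s a = 0 then (p.H : ℝ) else 29 * g / visitSA D k h s a) else 0) ≤
      Fintype.card S * (Fintype.card A * (p.H + 29 * g * L)) := by
    rw [sum_comm]
    refine (sum_le_card_nsmul _ _ _ fun s _ => ?_).trans (le_of_eq (by
      rw [card_univ, nsmul_eq_mul]))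
    rw [sum_comm]
    refine (sum_le_card_nsmul _ _ _ fun a _ => h1 s a).trans (le_of_eq (by
      rw [card_univ, nsmul_eq_mul]))
  unfold dataDrift
  rw [sum_add_distrib, ← mul_sum]
  set X := (Fintype.card S : ℝ) ^ 3 * (Fintype.card A) ^ 2 * (p.H : ℝ) ^ 2 * L ^ 2 with hX
  have e1 : (Fintype.card S : ℝ) * (Fintype.card A * (p.H + 29 * g * L)) =
      Fintype.card S * Fintype.card A * p.H + 29 * X := by rw [hg, hX]; ring
  have e2 : (Fintype.card S : ℝ) * Fintype.card A * p.H ≤ X := by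
    have a1 : (1 : ℝ) ≤ (Fintype.card S) ^ 2 * Fintype.card A * p.H * L ^ 2 :=
      one_le_mul_of_one_le_of_one_le (one_le_mul_of_one_le_of_one_le
        (one_le_mul_of_one_le_of_one_le (one_le_pow₀ hS) hA) hH) (one_le_pow₀ (by linarith))
    have := le_mul_of_one_le_right (by positivity : (0 : ℝ) ≤ Fintype.card S *
      Fintype.card A * p.H) a1
    linarith [show (Fintype.card S : ℝ) * Fintype.card A * p.H *
      ((Fintype.card S) ^ 2 * Fintype.card A * p.H * L ^ 2) = X by rw [hX]; ring]
  have e3 : L * (Fintype.card S * (p.H * L)) ≤ X := by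
    have a1 : (1 : ℝ) ≤ (Fintype.card S) ^ 2 * (Fintype.card A) ^ 2 * p.H :=
      one_le_mul_of_one_le_of_one_le (one_le_mul_of_one_le_of_one_le
        (one_le_pow₀ hS) (one_le_pow₀ hA)) hH
    have := le_mul_of_one_le_right (by positivity : (0 : ℝ) ≤ L * (Fintype.card S * (p.H * L))) a1
    linarith [show L * (Fintype.card S * (p.H * L)) *
      ((Fintype.card S) ^ 2 * (Fintype.card A) ^ 2 * p.H) = X by rw [hX]; ring]
  have e4 : 7 * L * ∑ k ∈ Ico 1 p.K, ∑ y, |refAt p D (k + 1) (h + 1) y -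
      refAt p D k (h + 1) y| ≤ 7 * L * (Fintype.card S * (p.H * L)) := by gcongr
  linarith

theorem one_add_two_div_pow_le (n : ℕ) (hn : 0 < n) : (1 + 2 / (n : ℝ)) ^ n ≤ 8 := by
  have hn' : (0 : ℝ) < n := by exact_mod_cast hn
  have h1 : 1 + 2 / (n : ℝ) ≤ Real.exp (2 / n) := by
    have := Real.add_one_le_exp (2 / (n : ℝ)); linarith
  calc (1 + 2 / (n : ℝ)) ^ n ≤ Real.exp (2 / n) ^ n := by gcongr
    _ = Real.exp 2 := by rw [← Real.exp_nat_mul]; congr 1; field_simp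
    _ = Real.exp 1 * Real.exp 1 := by rw [← Real.exp_add]; norm_num
    _ ≤ 8 := by nlinarith [Real.exp_one_lt_d9, Real.exp_pos 1]

/-- The estimated value of any fixed state changes in total, over all episodes, only by a
polylogarithmic amount. -/
theorem sum_abs_valAt_sub_le [Nonempty S] (hp : p.Valid)
    (hK : 16 * Fintype.card S * (p.H : ℝ) ^ 2 * logL S A p ≤ √(p.K : ℝ))
    (hcost : ∀ k ∈ Icc 1 p.K, ∀ h < p.H, (D k).cost h ∈ Set.Icc (0 : ℝ) 1)
    (hη : ∀ k ∈ Icc 1 p.K, 0 < p.η k) {h : ℕ} (hh : h ≤ p.H) (s : S) :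
    ∑ k ∈ Ico 1 p.K, |valAt p D (k + 1) h s - valAt p D k h s| ≤
      700 * ((Fintype.card S : ℝ) ^ 3 * (Fintype.card A) ^ 2 * (p.H : ℝ) ^ 3 *
        logL S A p ^ 2) := by
  have hL := two_le_logL S A hp
  have hH := hp.one_le_H
  have hS := one_le_card S
  have hA := one_le_card A
  have hvc := varCoef_nonneg (S := S) (A := A) hp
  set L := logL S A p with hLd
  set X := (Fintype.card S : ℝ) ^ 3 * (Fintype.card A) ^ 2 * (p.H : ℝ) ^ 2 * L ^ 2 with hX
  have hX1 : 1 ≤ X := by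
    refine one_le_mul_of_one_le_of_one_le (one_le_mul_of_one_le_of_one_le
      (one_le_mul_of_one_le_of_one_le ?_ ?_) ?_) ?_ <;> refine one_le_pow₀ ?_ <;> linarith
  have hK32 : 32 ≤ √(p.K : ℝ) := by
    have a1 : (1 : ℝ) ≤ Fintype.card S * (p.H : ℝ) ^ 2 :=
      one_le_mul_of_one_le_of_one_le hS (one_le_pow₀ hH)
    nlinarith
  have hK16 : 16 ≤ (p.K : ℝ) := by
    have := Real.sq_sqrt (Nat.cast_nonneg (α := ℝ) p.K)
    nlinarith
  have hcoef : 2 * (varCoef S A p * Fintype.card S * p.H) ≤ 1 := by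
    unfold varCoef
    have e : 2 * (8 * p.H * logL S A p / √(p.K : ℝ) * Fintype.card S * p.H) =
        16 * Fintype.card S * (p.H : ℝ) ^ 2 * L / √(p.K : ℝ) := by ring
    rw [e, div_le_one (by linarith)]
    exact hK
  -- Backward induction with a common bound `u` for the increases at each step. The absolute
  -- changes of the next value are at most twice its increases up to `H`, and by `hcoef` their
  -- coefficient is so small that `u` grows only by the factor `1 + 2 / H` per step.
  have key : ∀ h ≤ p.H, ∃ u : ℕ → ℝ, (∀ k, 0 ≤ u k) ∧
      (∀ k ∈ Ico 1 p.K, ∀ s, valAt p D (k + 1) h s - valAt p D k h s ≤ u k) ∧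
      ∑ k ∈ Ico 1 p.K, u k ≤
        38 * X * ((p.H - h : ℕ) : ℝ) * (1 + 2 / (p.H : ℝ)) ^ (p.H - h) := by
    refine backward_induction ⟨fun _ => 0, fun _ => le_rfl, fun k _ s => by simp [valAt_end],
      by simp⟩ fun h hh ⟨u, hu0, hu, hus⟩ => ?_
    have hdrift0 : ∀ k, 0 ≤ dataDrift p D k h := fun k => by
      unfold dataDrift
      refine add_nonneg (sum_nonneg fun s _ => sum_nonneg fun a _ => ?_) (by positivity)
      split_ifs <;> positivity
    refine ⟨fun k => dataDrift p D k h + (1 + 1 / p.H) * u k + varCoef S A p *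
      ∑ y, |valAt p D (k + 1) (h + 1) y - valAt p D k (h + 1) y|, fun k => ?_, fun k hk s => ?_, ?_⟩
    · have := hdrift0 k
      have := hu0 k
      positivity
    · have := mem_Ico.1 hk
      exact valAt_succ_sub_le hp hK16 hcost hη this.1 (by omega) hh (hu0 k) (hu k hk) s
    · rw [sum_add_distrib, sum_add_distrib, ← mul_sum, ← mul_sum, sum_comm]
      have hd := sum_dataDrift_le (D := D) hp hcost hh
      have htv : ∀ y, ∑ k ∈ Ico 1 p.K,
          |valAt p D (k + 1) (h + 1) y - valAt p D k (h + 1) y| ≤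
          2 * ∑ k ∈ Ico 1 p.K, u k + p.H := fun y =>
        sum_abs_sub_le (x := fun k => valAt p D k (h + 1) y) (fun k hk => valAt_mem hp hcost
          (mem_Icc.1 hk).2 hh y) (by linarith) (fun k hk => hu k hk y) hu0
      have htv' : ∑ y, ∑ k ∈ Ico 1 p.K,
          |valAt p D (k + 1) (h + 1) y - valAt p D k (h + 1) y| ≤
          Fintype.card S * (2 * ∑ k ∈ Ico 1 p.K, u k + p.H) := by
        refine (sum_le_card_nsmul _ _ _ fun y _ => htv y).trans ?_
        rw [card_univ, nsmul_eq_mul]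
      have hus0 : 0 ≤ ∑ k ∈ Ico 1 p.K, u k := sum_nonneg fun k _ => hu0 k
      set Us := ∑ k ∈ Ico 1 p.K, u k
      have hlast : varCoef S A p * (Fintype.card S * (2 * Us + p.H)) ≤ 1 / p.H * Us + 1 := by
        have e : varCoef S A p * (Fintype.card S * (2 * Us + p.H)) =
            2 * (varCoef S A p * Fintype.card S * p.H) * (1 / p.H * Us) +
            2 * (varCoef S A p * Fintype.card S * p.H) / 2 := by field_simp
        rw [e]
        have : 0 ≤ 1 / (p.H : ℝ) * Us := by positivity
        nlinarith
      have hlast' := mul_le_mul_of_nonneg_left htv' hvc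
      obtain ⟨m, hm⟩ : ∃ m, p.H - h = m + 1 := ⟨p.H - h - 1, by omega⟩
      have hm' : p.H - (h + 1) = m := by omega
      rw [hm'] at hus
      rw [hm]
      have hpow : 1 ≤ (1 + 2 / (p.H : ℝ)) ^ m := by
        refine one_le_pow₀ ?_
        have : 0 ≤ 2 / (p.H : ℝ) := by positivity
        linarith
      have hstep : (1 + 2 / (p.H : ℝ)) * Us ≤
          (1 + 2 / (p.H : ℝ)) * (38 * X * m * (1 + 2 / (p.H : ℝ)) ^ m) := by gcongr
      have hpow' : 38 * X ≤ 38 * X * (1 + 2 / (p.H : ℝ)) ^ (m + 1) := by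
        refine le_mul_of_one_le_right (by positivity) ?_
        refine one_le_pow₀ ?_
        have : 0 ≤ 2 / (p.H : ℝ) := by positivity
        linarith
      have e : 38 * X * ((m + 1 : ℕ) : ℝ) * (1 + 2 / (p.H : ℝ)) ^ (m + 1) =
          (1 + 2 / (p.H : ℝ)) * (38 * X * m * (1 + 2 / (p.H : ℝ)) ^ m) +
          38 * X * (1 + 2 / (p.H : ℝ)) ^ (m + 1) := by
        push_cast; ring
      rw [e]
      have e2 : (1 + 2 / (p.H : ℝ)) * Us = (1 + 1 / (p.H : ℝ)) * Us + 1 / p.H * Us := by ring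
      linarith
  obtain ⟨u, hu0, hu, hus⟩ := key h hh
  have htv := sum_abs_sub_le (x := fun k => valAt p D k h s) (K := p.K) (fun k hk =>
    valAt_mem hp hcost (mem_Icc.1 hk).2 hh s) (by linarith) (fun k hk => hu k hk s) hu0
  have hb : 38 * X * ((p.H - h : ℕ) : ℝ) * (1 + 2 / (p.H : ℝ)) ^ (p.H - h) ≤ 38 * X * p.H * 8 := by
    have h1 : (1 + 2 / (p.H : ℝ)) ^ (p.H - h) ≤ 8 := by
      refine (pow_le_pow_right₀ ?_ (Nat.sub_le _ _)).trans (one_add_two_div_pow_le _ hp.H_pos)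
      have : 0 ≤ 2 / (p.H : ℝ) := by positivity
      linarith
    have h2 : ((p.H - h : ℕ) : ℝ) ≤ p.H := by exact_mod_cast Nat.sub_le _ _
    gcongr
  have e : 700 * ((Fintype.card S : ℝ) ^ 3 * (Fintype.card A) ^ 2 * (p.H : ℝ) ^ 3 * L ^ 2) =
      700 * (X * p.H) := by rw [hX]; ring
  rw [e]
  have : (p.H : ℝ) ≤ X * p.H := le_mul_of_one_le_left (by linarith) hX1
  linarith

end Variation

/-! ### Accuracy of the empirical model and weighted optimism -/

section Clip

/-- The sign function, made Lipschitz: linear with slope `S` near `0` and clipped at `±1`. -/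
noncomputable def softSign (S : Type*) [Fintype S] (t : ℝ) : ℝ :=
  max (-1) (min 1 (Fintype.card S * t))

variable {S : Type*} [Fintype S]

theorem abs_softSign_le (t : ℝ) : |softSign S t| ≤ 1 := by
  unfold softSign
  rw [abs_le]
  exact ⟨le_max_left _ _, max_le (by norm_num) (min_le_left _ _)⟩

theorem abs_softSign_sub_le (a b : ℝ) :
    |softSign S a - softSign S b| ≤ Fintype.card S * |a - b| := by
  unfold softSign
  have h1 := abs_max_sub_max_le_max (-1 : ℝ) (min 1 (Fintype.card S * a)) (-1)
    (min 1 (Fintype.card S * b))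
  have h2 := abs_min_sub_min_le_max (1 : ℝ) (Fintype.card S * a) 1 (Fintype.card S * b)
  replace h1 := h1.trans (max_le (by simp) le_rfl)
  replace h2 := h2.trans (max_le (by simp) le_rfl)
  refine (h1.trans h2).trans (le_of_eq ?_)
  rw [← mul_sub, abs_mul, Nat.abs_cast]

theorem softSign_mul_nonneg (t : ℝ) : 0 ≤ softSign S t * t := by
  unfold softSign
  have hS : (0 : ℝ) ≤ Fintype.card S := Nat.cast_nonneg _
  rcases le_total 0 t with h | h
  · exact mul_nonneg (le_max_of_le_right (le_min zero_le_one (mul_nonneg hS h))) h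
  · refine mul_nonneg_of_nonpos_of_nonpos ?_ h
    exact max_le (by norm_num) (min_le_of_right_le (mul_nonpos_of_nonneg_of_nonpos hS h))

theorem softSign_mul_le (t : ℝ) : softSign S t * t ≤ |t| := by
  refine (le_abs_self _).trans ?_
  rw [abs_mul]
  exact mul_le_of_le_one_left (abs_nonneg _) (abs_softSign_le t)

theorem abs_le_softSign_mul [Nonempty S] (t : ℝ) :
    |t| ≤ softSign S t * t + 1 / Fintype.card S := by
  have hS : (0 : ℝ) < Fintype.card S := by exact_mod_cast Fintype.card_pos
  by_cases ht : |t| ≤ 1 / Fintype.card S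
  · linarith [softSign_mul_nonneg (S := S) t]
  · push Not at ht
    have hpos : (0 : ℝ) < 1 / Fintype.card S := by positivity
    rw [div_lt_iff₀ hS] at ht
    unfold softSign
    rcases abs_cases t with ⟨h, h0⟩ | ⟨h, h0⟩ <;> rw [h] at ht ⊢
    · rw [min_eq_left (by linarith), max_eq_right (by norm_num)]
      linarith
    · rw [min_eq_right (by linarith), max_eq_left (by linarith)]
      linarith

end Clip

section Empirical

variable {S : Type*} [Fintype S]

theorem variance_le_sum_sq {w : S → ℝ} (hw : w ∈ stdSimplex ℝ S) (f : S → ℝ) (m : ℝ) :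
    variance w f ≤ ∑ y, w y * (f y - m) ^ 2 := by
  have e : ∑ y, w y * (f y - m) ^ 2 = variance w f + (∑ y, w y * f y - m) ^ 2 := by
    rw [variance_eq hw]
    have : ∀ y, w y * (f y - m) ^ 2 = w y * f y ^ 2 - 2 * m * (w y * f y) + w y * m ^ 2 :=
      fun y => by ring
    simp_rw [this, sum_add_distrib, sum_sub_distrib, ← mul_sum, ← sum_mul, hw.2]
    ring
  rw [e]
  linarith [sq_nonneg (∑ y, w y * f y - m)]

theorem sqrt_variance_le_of_le {w v : S → ℝ} (hw : w ∈ stdSimplex ℝ S) (hv : v ∈ stdSimplex ℝ S)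
    {f : S → ℝ} {H t : ℝ} (ht : 0 ≤ t) (hH : 0 ≤ H) (hf : ∀ y, f y ∈ Set.Icc 0 H)
    (hwv : ∀ y, w y ≤ 2 * v y + 13 * t ^ 2) :
    √(variance w f) ≤ 3 / 2 * √(variance v f) + 4 * (Fintype.card S * H * t) := by
  have hv0 := variance_nonneg hv.1 f
  set m := ∑ y, v y * f y with hm
  have hm1 : m ≤ H := sum_simplex_mul_le hv fun y => (hf y).2
  have hm0 : 0 ≤ m := le_sum_simplex_mul hv fun y => (hf y).1
  have h1 : variance w f ≤ 2 * variance v f + 13 * (Fintype.card S * (H ^ 2 * t ^ 2)) := by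
    refine (variance_le_sum_sq hw f m).trans ?_
    calc ∑ y, w y * (f y - m) ^ 2 ≤ ∑ y, (2 * (v y * (f y - m) ^ 2) + 13 * (H ^ 2 * t ^ 2)) := by
          refine sum_le_sum fun y _ => ?_
          have hsq : (f y - m) ^ 2 ≤ H ^ 2 := by
            rw [sq_le_sq, abs_of_nonneg hH, abs_le]
            constructor <;> linarith [(hf y).1, (hf y).2]
          have a1 := mul_le_mul_of_nonneg_right (hwv y) (sq_nonneg (f y - m))
          have a2 := mul_le_mul_of_nonneg_left hsq (by positivity : 0 ≤ 13 * t ^ 2)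
          linarith
      _ = _ := by
          rw [sum_add_distrib, ← mul_sum, sum_const, card_univ, nsmul_eq_mul]
          unfold variance
          ring
  refine Real.sqrt_le_iff.2 ⟨by positivity, ?_⟩
  have hS : (Fintype.card S : ℝ) ≤ (Fintype.card S : ℝ) ^ 2 := by
    exact_mod_cast Nat.le_self_pow two_ne_zero _
  have h2 : (Fintype.card S : ℝ) * (H ^ 2 * t ^ 2) ≤ (Fintype.card S) ^ 2 * (H ^ 2 * t ^ 2) := by
    gcongr
  have h3 : 0 ≤ √(variance v f) * (Fintype.card S * H * t) := by positivity
  nlinarith [Real.sq_sqrt hv0]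

/-- Transfers the deviation bounds between the empirical distribution `q` and the true one `P`,
where `t²` stands for `x / n`. The deviation of `q V` splits into that of `q V*`, which is of the
order of the standard deviation of the reference value, and coordinatewise contributions of
`V - R` and of `V - V*`. -/
theorem transition_deviation_le {P q : S → ℝ} (hP : P ∈ stdSimplex ℝ S) (hq : q ∈ stdSimplex ℝ S)
    {V Vs R : S → ℝ} {H t : ℝ} (ht : 0 ≤ t) (hH : 0 ≤ H)
    (hV : ∀ y, V y ∈ Set.Icc 0 H) (hVs : ∀ y, Vs y ∈ Set.Icc 0 H)
    (hd : ∀ y, |q y - P y| ≤ 3 * (√(P y) * t) + 2 * t ^ 2)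
    (hdV : |∑ y, (q y - P y) * Vs y| ≤ 3 * (√(variance P Vs) * t) + 2 * (H * t ^ 2)) :
    |∑ y, (q y - P y) * V y| ≤ 9 / 2 * t * √(variance q R) +
      ∑ y, 9 / 2 * t * √(q y * (1 - q y)) * |V y - R y| +
      10 * t * ∑ y, √(P y) * |V y - Vs y| + 30 * (Fintype.card S * H * t ^ 2) := by
  have hPq : ∀ y, P y ≤ 2 * q y + 13 * t ^ 2 := fun y => by
    have h1 := (abs_le.1 (hd y)).1
    nlinarith [sq_nonneg (√(P y) - 3 * t), Real.sq_sqrt (hP.1 y)]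
  have hqP : ∀ y, q y ≤ 2 * P y + 5 * t ^ 2 := fun y => by
    have h1 := (abs_le.1 (hd y)).2
    nlinarith [sq_nonneg (√(P y) - 3 / 2 * t), Real.sq_sqrt (hP.1 y)]
  have hsq : ∀ y, √(q y * (1 - q y)) ≤ 3 / 2 * √(P y) + 5 / 2 * t := fun y => by
    refine Real.sqrt_le_iff.2 ⟨by positivity, ?_⟩
    have h1 : q y * (1 - q y) ≤ q y := by nlinarith [hq.1 y]
    have h2 : 0 ≤ √(P y) * t := by positivity
    nlinarith [hqP y, Real.sq_sqrt (hP.1 y), hP.1 y]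
  have h1 := sqrt_variance_le_of_le hP hq ht hH hVs hPq
  have h2 : √(variance q Vs) ≤ √(variance q R) + ∑ y, √(q y * (1 - q y)) * |V y - R y| +
      ∑ y, (3 / 2 * √(P y) + 5 / 2 * t) * |V y - Vs y| := by
    have h := (abs_le.1 (abs_sqrt_variance_sub_le hq Vs R)).2
    have h' : ∑ y, √(q y * (1 - q y)) * |Vs y - R y| ≤
        ∑ y, (√(q y * (1 - q y)) * |V y - R y| +
          (3 / 2 * √(P y) + 5 / 2 * t) * |V y - Vs y|) := by
      refine sum_le_sum fun y _ => ?_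
      have a1 : |Vs y - R y| ≤ |V y - R y| + |V y - Vs y| := by
        have := abs_sub_le (Vs y) (V y) (R y)
        rw [abs_sub_comm (Vs y) (V y)] at this
        linarith
      have a2 := mul_le_mul_of_nonneg_left a1 (Real.sqrt_nonneg (q y * (1 - q y)))
      have a3 := mul_le_mul_of_nonneg_right (hsq y) (abs_nonneg (V y - Vs y))
      linarith
    rw [sum_add_distrib] at h'
    linarith
  have h3 : |∑ y, (q y - P y) * (V y - Vs y)| ≤
      ∑ y, (3 * (√(P y) * t) + 2 * t ^ 2) * |V y - Vs y| := by
    refine (abs_sum_le_sum_abs _ _).trans (sum_le_sum fun y _ => ?_)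
    rw [abs_mul]
    exact mul_le_mul_of_nonneg_right (hd y) (abs_nonneg _)
  have h4 : ∑ y, |V y - Vs y| ≤ Fintype.card S * H := by
    refine (sum_le_card_nsmul _ _ H fun y _ => ?_).trans (le_of_eq (by
      rw [card_univ, nsmul_eq_mul]))
    rw [abs_le]
    constructor <;> linarith [(hV y).1, (hV y).2, (hVs y).1, (hVs y).2]
  have e1 : ∑ y, (q y - P y) * V y =
      ∑ y, (q y - P y) * Vs y + ∑ y, (q y - P y) * (V y - Vs y) := by
    rw [← sum_add_distrib]; exact sum_congr rfl fun y _ => by ring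
  have e2 : ∑ y, (3 / 2 * √(P y) + 5 / 2 * t) * |V y - Vs y| =
      3 / 2 * ∑ y, √(P y) * |V y - Vs y| + 5 / 2 * t * ∑ y, |V y - Vs y| := by
    rw [mul_sum, mul_sum, ← sum_add_distrib]; exact sum_congr rfl fun y _ => by ring
  have e3 : ∑ y, (3 * (√(P y) * t) + 2 * t ^ 2) * |V y - Vs y| =
      3 * t * ∑ y, √(P y) * |V y - Vs y| + 2 * t ^ 2 * ∑ y, |V y - Vs y| := by
    rw [mul_sum, mul_sum, ← sum_add_distrib]; exact sum_congr rfl fun y _ => by ring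
  have e4 : ∑ y, 9 / 2 * t * √(q y * (1 - q y)) * |V y - R y| =
      9 / 2 * t * ∑ y, √(q y * (1 - q y)) * |V y - R y| := by
    rw [mul_sum]; exact sum_congr rfl fun y _ => by ring
  rw [e1, e4]
  rw [e3] at h3
  rw [e2] at h2
  refine (abs_add_le _ _).trans ?_
  set Z := ∑ y, √(P y) * |V y - Vs y| with hZ
  have hZ0 : 0 ≤ Z := sum_nonneg fun y _ => by positivity
  set Y := ∑ y, |V y - Vs y| with hY
  have b1 := mul_le_mul_of_nonneg_right h1 ht
  have b2 := mul_le_mul_of_nonneg_right h2 ht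
  have b3 := mul_le_mul_of_nonneg_right h4 (sq_nonneg t)
  have b4 : H * t ^ 2 * 1 ≤ Fintype.card S * H * t ^ 2 := by
    rcases isEmpty_or_nonempty S with hS | hS
    · exact absurd hP.2 (by simp)
    have := one_le_card S
    have : 0 ≤ H * t ^ 2 := by positivity
    nlinarith
  have b5 : 0 ≤ t * Z := by positivity
  nlinarith

theorem sum_sqrt_simplex_le {w : S → ℝ} (hw : w ∈ stdSimplex ℝ S) :
    ∑ y, √(w y) ≤ √(Fintype.card S : ℝ) := by
  refine Real.le_sqrt_of_sq_le ?_
  have := sq_sum_le_card_mul_sum_sq (s := univ) (f := fun y => √(w y))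
  simp_rw [Real.sq_sqrt (hw.1 _), hw.2, mul_one, card_univ] at this
  exact this

end Empirical

section Optimism

variable {S A : Type*} [Fintype S] [Fintype A] [DecidableEq S] [DecidableEq A] [Nonempty A]

/-- The observed data are accurate at level `x`: empirical costs, empirical transition
probabilities and the empirical mean of the optimal value obey Bernstein bounds. -/
structure Accurate (M : MDP S A) (p : Params) (D : ℕ → Episode S A) (x : ℝ) : Prop where
  cost_mem : ∀ k ∈ Icc 1 p.K, ∀ h < p.H, (D k).cost h ∈ Set.Icc (0 : ℝ) 1
  cost_dev : ∀ k ≤ p.K, ∀ h < p.H, ∀ s a, visitSA D k h s a ≠ 0 →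
    |cBar D k h s a - M.c h s a| ≤
      3 * √(x / visitSA D k h s a) + 2 * (x / visitSA D k h s a)
  trans_dev : ∀ k ≤ p.K, ∀ h < p.H, ∀ s a y, visitSA D k h s a ≠ 0 →
    |PBar D k h s a y - M.P h s a y| ≤
      3 * √(M.P h s a y * (x / visitSA D k h s a)) + 2 * (x / visitSA D k h s a)
  val_dev : ∀ k ≤ p.K, ∀ h < p.H, ∀ s a, visitSA D k h s a ≠ 0 →
    |∑ y, (PBar D k h s a y - M.P h s a y) * M.opt p.H (h + 1) y| ≤
      3 * √(variance (M.P h s a) (M.opt p.H (h + 1)) * (x / visitSA D k h s a)) +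
        2 * p.H * (x / visitSA D k h s a)

variable {M : MDP S A} {p : Params} {D : ℕ → Episode S A} {x : ℝ}

section Consequences

variable [Nonempty S] (hp : p.Valid) (hx : 1 ≤ x) (hxL : 100 * x ≤ logL S A p)
  (hD : Accurate M p D x)
include hp hx hxL hD

theorem Accurate.cost_le {k h : ℕ} (hk : k ≤ p.K) (hh : h < p.H) {s : S} {a : A}
    (hn : visitSA D k h s a ≠ 0) :
    |cBar D k h s a - M.c h s a| ≤ costWidth S A p (visitSA D k h s a) := by
  have hdev := hD.cost_dev k hk h hh s a hn
  have hn' : (0 : ℝ) < visitSA D k h s a := by exact_mod_cast Nat.pos_of_ne_zero hn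
  have hLc := logL_le_logC S A hp
  set n : ℝ := (visitSA D k h s a : ℝ)
  have ht0 : 0 ≤ x / n := by positivity
  have key : 5 * √(x / n) ≤ costWidth S A p n := by
    have : 5 * √(x / n) = √(25 * (x / n)) := by
      rw [Real.sqrt_mul (by norm_num), show (25 : ℝ) = 5 ^ 2 by norm_num,
        Real.sqrt_sq (by norm_num)]
    rw [this]
    refine Real.sqrt_le_sqrt ?_
    rw [← mul_div_assoc]
    refine div_le_div_of_nonneg_right ?_ hn'.le
    change 25 * x ≤ 2 * logC S A p
    linarith
  refine le_trans ?_ key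
  rcases le_total (x / n) 1 with h1 | h1
  · have : x / n ≤ √(x / n) := Real.le_sqrt_of_sq_le (by nlinarith)
    linarith
  · have h2 : 1 ≤ √(x / n) := Real.one_le_sqrt.2 h1
    have h3 := cBar_mem D hD.cost_mem hk hh s a
    have h4 := mean_costLaw_mem M h s a
    rw [abs_le]
    constructor <;> linarith [h3.1, h3.2, h4.1, h4.2]

/-- The coarse transition bonus is valid for every function with values in `[0, H]`. -/
theorem Accurate.coarse_le {k h : ℕ} (hk : k ≤ p.K) (hh : h < p.H) {s : S} {a : A}
    (hn : visitSA D k h s a ≠ 0) {f : S → ℝ} (hf : ∀ y, f y ∈ Set.Icc (0 : ℝ) p.H) :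
    |∑ y, (PBar D k h s a y - M.P h s a y) * f y| ≤
      p.H * √(4 * Fintype.card S * logP S A p / visitSA D k h s a) := by
  have hdev := fun y => hD.trans_dev k hk h hh s a y hn
  have hn' : (0 : ℝ) < visitSA D k h s a := by exact_mod_cast Nat.pos_of_ne_zero hn
  have hLp := (logL_le_logC S A hp).trans (logC_le_logP S A hp)
  have hS := one_le_card S
  have hP := M.P_mem h s a
  have hq := PBar_mem D hn
  have hH := hp.one_le_H
  set n : ℝ := (visitSA D k h s a : ℝ)
  have ht0 : 0 ≤ Fintype.card S * (x / n) := by positivity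
  have key : 5 * √(Fintype.card S * (x / n)) ≤
      √(4 * Fintype.card S * logP S A p / n) := by
    have : 5 * √(Fintype.card S * (x / n)) = √(25 * (Fintype.card S * (x / n))) := by
      rw [Real.sqrt_mul (by norm_num : (0 : ℝ) ≤ 25), show (25 : ℝ) = 5 ^ 2 by norm_num,
        Real.sqrt_sq (by norm_num)]
    rw [this]
    refine Real.sqrt_le_sqrt ?_
    rw [show 25 * (Fintype.card S * (x / n)) = Fintype.card S * (25 * x) / n by ring,
      show 4 * Fintype.card S * logP S A p / n = Fintype.card S * (4 * logP S A p) / n by ring]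
    refine div_le_div_of_nonneg_right (mul_le_mul_of_nonneg_left ?_ (by linarith)) hn'.le
    linarith
  have h0 : |∑ y, (PBar D k h s a y - M.P h s a y) * f y| ≤
      5 * √(Fintype.card S * (x / n)) * p.H := by
    rcases le_total (Fintype.card S * (x / n)) 1 with h1 | h1
    · have h2 : Fintype.card S * (x / n) ≤ √(Fintype.card S * (x / n)) :=
        Real.le_sqrt_of_sq_le (by nlinarith)
      refine (abs_sum_le_sum_abs _ _).trans ?_
      calc ∑ y, |(PBar D k h s a y - M.P h s a y) * f y|
          ≤ ∑ y, (3 * (√(M.P h s a y) * √(x / n)) + 2 * (x / n)) * p.H := by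
            refine sum_le_sum fun y _ => ?_
            rw [abs_mul, abs_of_nonneg (hf y).1]
            refine mul_le_mul ?_ (hf y).2 (hf y).1 (by positivity)
            rw [← Real.sqrt_mul (hP.1 y)]
            exact hdev y
        _ = (3 * (∑ y, √(M.P h s a y)) * √(x / n) + 2 * (Fintype.card S * (x / n))) * p.H := by
            rw [← sum_mul, sum_add_distrib, ← mul_sum, ← sum_mul, sum_const, card_univ,
              nsmul_eq_mul]
            ring
        _ ≤ (3 * √(Fintype.card S : ℝ) * √(x / n) + 2 * (Fintype.card S * (x / n))) * p.H := by
            gcongr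
            exact sum_sqrt_simplex_le hP
        _ ≤ _ := by
            rw [mul_assoc 3, ← Real.sqrt_mul (by positivity)]
            gcongr
            linarith
    · have h2 : 1 ≤ √(Fintype.card S * (x / n)) := Real.one_le_sqrt.2 h1
      have e : ∑ y, (PBar D k h s a y - M.P h s a y) * f y =
          ∑ y, PBar D k h s a y * f y - ∑ y, M.P h s a y * f y := by
        rw [← sum_sub_distrib]; exact sum_congr rfl fun y _ => by ring
      have a1 := sum_simplex_mul_le hq fun y => (hf y).2
      have a2 := sum_simplex_mul_le hP fun y => (hf y).2
      have a3 := le_sum_simplex_mul hq fun y => (hf y).1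
      have a4 := le_sum_simplex_mul hP fun y => (hf y).1
      have h3 : (p.H : ℝ) ≤ 5 * √(Fintype.card S * (x / n)) * p.H := by nlinarith
      rw [e, abs_le]
      constructor <;> linarith
  refine h0.trans ?_
  rw [mul_comm]
  gcongr

theorem Accurate.model_coarse_le {k h : ℕ} (hk : k ≤ p.K) (hh : h < p.H) {s : S} {a : A}
    (hn : visitSA D k h s a ≠ 0) {f : S → ℝ} (hf : ∀ y, f y ∈ Set.Icc (0 : ℝ) p.H) :
    |(cBar D k h s a + ∑ y, PBar D k h s a y * f y) - (M.c h s a + ∑ y, M.P h s a y * f y)| ≤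
      coarseBonus S A p (visitSA D k h s a) := by
  have h1 := hD.cost_le hp hx hxL hk hh hn
  have h2 := hD.coarse_le hp hx hxL hk hh hn hf
  have e : (cBar D k h s a + ∑ y, PBar D k h s a y * f y) -
      (M.c h s a + ∑ y, M.P h s a y * f y) = (cBar D k h s a - M.c h s a) +
      ∑ y, (PBar D k h s a y - M.P h s a y) * f y := by
    simp_rw [sub_mul, sum_sub_distrib]
    ring
  rw [e]
  exact (abs_add_le _ _).trans (add_le_add h1 h2)

omit hxL in
/-- Bernstein-type control of the empirical transition operator on the estimated value. -/
theorem Accurate.fine_le {k h : ℕ} (hk : k ≤ p.K) (hh : h < p.H) {s : S} {a : A}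
    (hn : visitSA D k h s a ≠ 0) (R : S → ℝ) :
    |∑ y, (PBar D k h s a y - M.P h s a y) * valAt p D k (h + 1) y| ≤
      9 / 2 * √(x / visitSA D k h s a) * √(variance (PBar D k h s a) R) +
      ∑ y, 9 / 2 * √(x / visitSA D k h s a) * √(PBar D k h s a y * (1 - PBar D k h s a y)) *
        |valAt p D k (h + 1) y - R y| +
      10 * √(x / visitSA D k h s a) *
        ∑ y, √(M.P h s a y) * |valAt p D k (h + 1) y - M.opt p.H (h + 1) y| +
      30 * (Fintype.card S * p.H * (x / visitSA D k h s a)) := by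
  have hn' : (0 : ℝ) < visitSA D k h s a := by exact_mod_cast Nat.pos_of_ne_zero hn
  have hP := M.P_mem h s a
  have hopt : ∀ y, M.opt p.H (h + 1) y ∈ Set.Icc (0 : ℝ) p.H := fun y => by
    have := opt_mem M p.H (h + 1) hh y
    exact ⟨this.1, this.2.trans (by linarith [Nat.cast_nonneg (α := ℝ) (h + 1)])⟩
  have hxn : 0 ≤ x / (visitSA D k h s a : ℝ) := by positivity
  have := transition_deviation_le hP (PBar_mem D hn) (V := valAt p D k (h + 1))
    (Vs := M.opt p.H (h + 1)) (R := R) (H := p.H) (t := √(x / visitSA D k h s a))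
    (Real.sqrt_nonneg _) (Nat.cast_nonneg _) (fun y => valAt_mem hp hD.cost_mem hk hh y) hopt
    (fun y => by
      rw [Real.sq_sqrt hxn, ← Real.sqrt_mul (hP.1 y)]
      exact hD.trans_dev k hk h hh s a y hn)
    (by
      rw [Real.sq_sqrt hxn, ← Real.sqrt_mul (variance_nonneg hP.1 _), ← mul_assoc 2]
      exact hD.val_dev k hk h hh s a hn)
  rwa [Real.sq_sqrt hxn] at this

end Consequences

end Optimism

/-! ### Weighted optimism of the estimated action values -/

section Absorption

variable {S : Type*} [Fintype S]

theorem ten_mul_sqrt_le {lam t u : ℝ} (hlam : 0 < lam) (hu : 0 ≤ u) :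
    10 * t * √u ≤ lam * u + 25 * t ^ 2 / lam := by
  have c1 : lam * u + 25 * t ^ 2 / lam - 10 * t * √u = (lam * √u - 5 * t) ^ 2 / lam := by
    have : (lam * √u - 5 * t) ^ 2 = lam ^ 2 * u - 10 * lam * t * √u + 25 * t ^ 2 := by
      rw [sub_sq, mul_pow, Real.sq_sqrt hu]; ring
    rw [this]
    field_simp
    ring
  have c2 : 0 ≤ (lam * √u - 5 * t) ^ 2 / lam := by positivity
  linarith

theorem ten_mul_sum_sqrt_le [Nonempty S] {P X : S → ℝ} {lam t H : ℝ} (hP : P ∈ stdSimplex ℝ S)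
    (ht : 0 ≤ t) (hlam : 0 < lam) (hX : ∀ y, softSign S (X y) * X y ≤ H) :
    10 * t * ∑ y, √(P y) * |X y| ≤ 10 * t + (lam * ∑ y, P y * (softSign S (X y) * X y) +
      25 * t ^ 2 / lam * (Fintype.card S * H)) := by
  have hS := one_le_card S
  have a1 : ∀ y, 10 * t * (√(P y) * |X y|) ≤
      10 * t * (√(P y) * (1 / Fintype.card S)) + (lam * (P y * (softSign S (X y) * X y)) +
        25 * t ^ 2 / lam * H) := fun y => by
    have b1 := mul_le_mul_of_nonneg_left (abs_le_softSign_mul (S := S) (X y))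
      (by positivity : 0 ≤ 10 * t * √(P y))
    have b3 := mul_le_mul_of_nonneg_right (ten_mul_sqrt_le (t := t) hlam (hP.1 y))
      (softSign_mul_nonneg (S := S) (X y))
    have b4 := mul_le_mul_of_nonneg_left (hX y) (by positivity : 0 ≤ 25 * t ^ 2 / lam)
    linarith
  have a2 := sum_le_sum fun y (_ : y ∈ univ) => a1 y
  rw [← mul_sum, sum_add_distrib, sum_add_distrib, ← mul_sum, ← mul_sum, ← sum_mul,
    sum_const, card_univ, nsmul_eq_mul] at a2
  have a3 : (∑ y, √(P y)) * (1 / Fintype.card S) ≤ 1 := by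
    rw [mul_one_div, div_le_one (by linarith)]
    exact (sum_sqrt_simplex_le hP).trans (Real.sqrt_le_iff.2 ⟨by linarith, by nlinarith⟩)
  have a4 := mul_le_mul_of_nonneg_left a3 (by positivity : 0 ≤ 10 * t)
  linarith

end Absorption

section Optimism

variable {S A : Type*} [Fintype S] [Fintype A] [DecidableEq S] [DecidableEq A] [Nonempty A]
variable {M : MDP S A} {p : Params} {D : ℕ → Episode S A} {x lam : ℝ}
variable [Nonempty S] (hp : p.Valid) (hx : 1 ≤ x) (hxL : 100 * x ≤ logL S A p)
  (hD : Accurate M p D x)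

include hp hx hxL hD

/-- The reference-based bonus exceeds the error of the empirical model up to a small multiple
`lam` of the absolute error `X = V^k - V*` of the estimated value. The term
`lam * P ψ(X) X` absorbs the part of the deviation that is proportional to `√P |X|`, by the
inequality of arithmetic and geometric means and the `K^{1/4} / n` term of the bonus. -/
theorem Accurate.refBonus_ge (hlam : 0 < lam) (hlamx : 25 * x ≤ lam * (p.K : ℝ) ^ (1 / 4 : ℝ))
    {k h : ℕ} (hk : k ≤ p.K) (hh : h < p.H) {s : S} {a : A} (hn : visitSA D k h s a ≠ 0)
    (R : S → ℝ) :
    (cBar D k h s a - M.c h s a) +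
        ∑ y, (PBar D k h s a y - M.P h s a y) * valAt p D k (h + 1) y ≤
      refBonus p A (visitSA D k h s a) (PBar D k h s a) (valAt p D k (h + 1)) R +
        lam * ∑ y, M.P h s a y * (softSign S (valAt p D k (h + 1) y - M.opt p.H (h + 1) y) *
          (valAt p D k (h + 1) y - M.opt p.H (h + 1) y)) := by
  have hcost := (abs_le.1 (hD.cost_le hp hx hxL hk hh hn)).2
  have hP := M.P_mem h s a
  have hq := PBar_mem D hn
  have hV : ∀ y, valAt p D k (h + 1) y ∈ Set.Icc (0 : ℝ) p.H := fun y =>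
    valAt_mem hp hD.cost_mem hk hh y
  have hopt : ∀ y, M.opt p.H (h + 1) y ∈ Set.Icc (0 : ℝ) p.H := fun y => by
    have := opt_mem M p.H (h + 1) hh y
    exact ⟨this.1, this.2.trans (by linarith [Nat.cast_nonneg (α := ℝ) (h + 1)])⟩
  have hfine := hD.fine_le hp hx hk hh hn R
  have hS := one_le_card S
  have hH := hp.one_le_H
  have hL : 100 ≤ logL S A p := by linarith
  have hLp := (logL_le_logC S A hp).trans (logC_le_logP S A hp)
  have hn1 : 1 ≤ visitSA D k h s a := Nat.pos_of_ne_zero hn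
  have hkq : 0 ≤ (p.K : ℝ) ^ (1 / 4 : ℝ) := by positivity
  set V := valAt p D k (h + 1) with hVdef
  set X : S → ℝ := fun y => V y - M.opt p.H (h + 1) y with hX
  set w := PBar D k h s a with hw
  set L := logL S A p with hLdef
  set cS : ℝ := (Fintype.card S : ℝ) with hcS
  have hψ0 : ∀ y, 0 ≤ softSign S (X y) * X y := fun y => softSign_mul_nonneg _
  have hψH : ∀ y, softSign S (X y) * X y ≤ p.H := fun y => by
    refine (softSign_mul_le _).trans ?_
    rw [abs_le]
    constructor <;> linarith [(hV y).1, (hV y).2, (hopt y).1, (hopt y).2]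
  change _ ≤ refBonus p A _ w V R + lam * ∑ y, M.P h s a y * (softSign S (X y) * X y)
  have hlast : 0 ≤ lam * ∑ y, M.P h s a y * (softSign S (X y) * X y) :=
    mul_nonneg hlam.le (sum_nonneg fun y _ => mul_nonneg (hP.1 y) (hψ0 y))
  have hrb : refBonus p A (visitSA D k h s a) w V R = costWidth S A p (visitSA D k h s a) +
      (√(6 * variance w R * L / visitSA D k h s a) +
        √(4 * p.H * L / (cS * visitSA D k h s a)) +
          8 * √(cS * p.H ^ 2) * L / (3 * visitSA D k h s a)) +
      ∑ y, gapWeight S A p (visitSA D k h s a) (w y) * |V y - R y| +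
      (√(4 * p.H * logP S A p / visitSA D k h s a) + 7 * cS * p.H * L / (3 * visitSA D k h s a)
        + 2 * cS ^ (3 / 2 : ℝ) * (Fintype.card A : ℝ) ^ (1 / 4 : ℝ) * (p.H : ℝ) ^ (7 / 4 : ℝ) *
          (p.K : ℝ) ^ (1 / 4 : ℝ) * √L / visitSA D k h s a) := rfl
  rw [hrb]
  have hnR : (1 : ℝ) ≤ visitSA D k h s a := by exact_mod_cast hn1
  set n : ℝ := (visitSA D k h s a : ℝ) with hndef
  have hn0 : 0 < n := by linarith
  have t1 := Real.sqrt_nonneg (4 * p.H * L / (cS * n))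
  have t2 : 0 ≤ 8 * √(cS * p.H ^ 2) * L / (3 * n) := by positivity
  have hgap0 : 0 ≤ ∑ y, gapWeight S A p n (w y) * |V y - R y| :=
    sum_nonneg fun y _ => mul_nonneg
      (add_nonneg (Real.sqrt_nonneg _) (by positivity)) (abs_nonneg _)
  have t3 : 0 ≤ 2 * cS ^ (3 / 2 : ℝ) * (Fintype.card A : ℝ) ^ (1 / 4 : ℝ) *
      (p.H : ℝ) ^ (7 / 4 : ℝ) * (p.K : ℝ) ^ (1 / 4 : ℝ) * √L / n := by positivity
  rcases hn1.eq_or_lt with hone | htwo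
  -- after a single visit the roots with `n - 1` vanish, but the term with `S H L / n` exceeds `H`
  · have e1 : n = 1 := by rw [hndef, ← hone]; simp
    have h1 : ∑ y, (w y - M.P h s a y) * V y ≤ p.H := by
      simp_rw [sub_mul, sum_sub_distrib]
      have a1 := sum_simplex_mul_le hq fun y => (hV y).2
      have a2 := le_sum_simplex_mul hP fun y => (hV y).1
      linarith
    have h2 : p.H ≤ 7 * cS * p.H * L / (3 * n) := by
      rw [e1, mul_one, le_div_iff₀ (by norm_num)]
      have : (p.H : ℝ) * 1 ≤ p.H * (cS * L) :=
        mul_le_mul_of_nonneg_left (one_le_mul_of_one_le_of_one_le hS (by linarith)) (by linarith)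
      nlinarith
    have t4 := Real.sqrt_nonneg (6 * variance w R * L / n)
    have t5 := Real.sqrt_nonneg (4 * p.H * logP S A p / n)
    linarith
  · have hn2 : (2 : ℝ) ≤ n := by rw [hndef]; exact_mod_cast htwo
    have hxn : 0 ≤ x / n := by positivity
    set t := √(x / n) with ht
    have ht0 : 0 ≤ t := Real.sqrt_nonneg _
    have ht2 : t ^ 2 = x / n := Real.sq_sqrt hxn
    have hvar := variance_nonneg hq.1 R
    -- each part of the deviation bound `hfine` is paid by its own term of the bonus
    have h1 : 9 / 2 * t * √(variance w R) ≤ √(6 * variance w R * L / n) := by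
      refine Real.le_sqrt_of_sq_le ?_
      rw [mul_pow, mul_pow, ht2, Real.sq_sqrt hvar,
        show (9 / 2) ^ 2 * (x / n) * variance w R = (variance w R * ((81 / 4) * x)) / n by ring,
        show 6 * variance w R * L / n = variance w R * (6 * L) / n by ring]
      exact div_le_div_of_nonneg_right (mul_le_mul_of_nonneg_left (by linarith) hvar) hn0.le
    have h2 : ∑ y, 9 / 2 * t * √(w y * (1 - w y)) * |V y - R y| ≤
        ∑ y, gapWeight S A p n (w y) * |V y - R y| := by
      refine sum_le_sum fun y _ => mul_le_mul_of_nonneg_right ?_ (abs_nonneg _)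
      have hwy : 0 ≤ w y * (1 - w y) := mul_nonneg (hq.1 y) (by linarith [simplex_le_one hq y])
      have : 9 / 2 * t * √(w y * (1 - w y)) ≤ √(2 * w y * (1 - w y) * L / (n - 1)) := by
        refine Real.le_sqrt_of_sq_le ?_
        rw [mul_pow, mul_pow, ht2, Real.sq_sqrt hwy,
          show (9 / 2) ^ 2 * (x / n) * (w y * (1 - w y)) =
            ((w y * (1 - w y)) * ((81 / 4) * x)) / n by ring,
          show 2 * w y * (1 - w y) * L / (n - 1) = (w y * (1 - w y)) * (2 * L) / (n - 1) by ring]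
        refine div_le_div₀ (by positivity)
          (mul_le_mul_of_nonneg_left (by linarith) hwy) (by linarith) (by linarith)
      unfold gapWeight
      have : 0 ≤ 7 * logL S A p / (3 * n) := by positivity
      linarith
    have h3 : 30 * (cS * p.H * (x / n)) ≤ 7 * cS * p.H * L / (3 * n) := by
      rw [show 30 * (cS * p.H * (x / n)) = (cS * p.H) * (90 * x) / (3 * n) by field_simp; ring,
        show 7 * cS * p.H * L / (3 * n) = (cS * p.H) * (7 * L) / (3 * n) by ring]
      exact div_le_div_of_nonneg_right (mul_le_mul_of_nonneg_left (by linarith) (by positivity))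
        (by positivity)
    have h4 : 10 * t ≤ √(4 * p.H * logP S A p / n) := by
      refine Real.le_sqrt_of_sq_le ?_
      rw [mul_pow, ht2, show 10 ^ 2 * (x / n) = (100 * x) / n by ring]
      refine div_le_div_of_nonneg_right ?_ hn0.le
      nlinarith
    have h5 := ten_mul_sum_sqrt_le hP ht0 hlam hψH
    rw [ht2, ← hcS] at h5
    -- the remainder of the arithmetic-geometric inequality: here `lam` must exceed `K^{-1/4}`
    have h6 : 25 * (x / n) / lam * (cS * p.H) ≤ 2 * cS ^ (3 / 2 : ℝ) *
        (Fintype.card A : ℝ) ^ (1 / 4 : ℝ) * (p.H : ℝ) ^ (7 / 4 : ℝ) * (p.K : ℝ) ^ (1 / 4 : ℝ) *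
          √L / n := by
      have a1 : 25 * x / lam ≤ (p.K : ℝ) ^ (1 / 4 : ℝ) := by
        rw [div_le_iff₀ hlam]; linarith
      have a2 := dim_factor_ge (S := S) (A := A) hp
      have a3 : 1 ≤ √L := Real.one_le_sqrt.2 (by linarith)
      rw [show 25 * (x / n) / lam * (cS * p.H) = (25 * x / lam) * (cS * p.H) / n by ring]
      refine div_le_div_of_nonneg_right ?_ hn0.le
      have a4 := mul_le_mul a1 a2 (by positivity) hkq
      set dd := cS ^ (3 / 2 : ℝ) * (Fintype.card A : ℝ) ^ (1 / 4 : ℝ) * (p.H : ℝ) ^ (7 / 4 : ℝ)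
      have a5 : 0 ≤ (p.K : ℝ) ^ (1 / 4 : ℝ) * dd := by positivity
      have a6 := mul_le_mul_of_nonneg_left a3 a5
      have a7 : 2 * cS ^ (3 / 2 : ℝ) * (Fintype.card A : ℝ) ^ (1 / 4 : ℝ) *
          (p.H : ℝ) ^ (7 / 4 : ℝ) * (p.K : ℝ) ^ (1 / 4 : ℝ) * √L =
          2 * ((p.K : ℝ) ^ (1 / 4 : ℝ) * dd * √L) := by ring
      rw [a7]
      linarith
    have h7 := (abs_le.1 hfine).2
    linarith

/-- Optimism up to the factor `1 + lam ψ(X)` on the error of the value at the next step. -/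
theorem Accurate.qAt_sub_optQ_le (hlam : 0 < lam)
    (hlamx : 25 * x ≤ lam * (p.K : ℝ) ^ (1 / 4 : ℝ))
    {k h : ℕ} (hk : k ≤ p.K) (hh : h < p.H) (s : S) (a : A) :
    qAt p D k h s a - M.optQ p.H h s a ≤ ∑ y, M.P h s a y *
      (1 + lam * softSign S (valAt p D k (h + 1) y - M.opt p.H (h + 1) y)) *
        (valAt p D k (h + 1) y - M.opt p.H (h + 1) y) := by
  have hV : ∀ y, valAt p D k (h + 1) y ∈ Set.Icc (0 : ℝ) p.H := fun y =>
    valAt_mem hp hD.cost_mem hk hh y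
  have hP := M.P_mem h s a
  set Z := lam * ∑ y, M.P h s a y * (softSign S (valAt p D k (h + 1) y - M.opt p.H (h + 1) y) *
          (valAt p D k (h + 1) y - M.opt p.H (h + 1) y)) with hZ
  have hZ0 : 0 ≤ Z :=
    mul_nonneg hlam.le (sum_nonneg fun y _ => mul_nonneg (hP.1 y) (softSign_mul_nonneg _))
  have e : ∑ y, M.P h s a y *
      (1 + lam * softSign S (valAt p D k (h + 1) y - M.opt p.H (h + 1) y)) *
        (valAt p D k (h + 1) y - M.opt p.H (h + 1) y) =
      ∑ y, M.P h s a y * valAt p D k (h + 1) y - ∑ y, M.P h s a y * M.opt p.H (h + 1) y + Z := by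
    rw [hZ, mul_sum, ← sum_sub_distrib, ← sum_add_distrib]
    exact sum_congr rfl fun y _ => by ring
  rw [e]
  unfold MDP.optQ
  have hPV := le_sum_simplex_mul hP fun y => (hV y).1
  have hc := mean_costLaw_mem M h s a
  suffices qAt p D k h s a ≤ M.c h s a + ∑ y, M.P h s a y * valAt p D k (h + 1) y + Z by linarith
  by_cases hn : visitSA D k h s a = 0
  · rw [qAt_eq_zero hp hn]
    have := hc.1
    change 0 ≤ M.c h s a at this
    linarith
  · rw [qAt_eq, bonusAt_eq]
    refine max_le ?_ (by have := hc.1; change 0 ≤ M.c h s a at this; linarith)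
    unfold bonusFn
    have e2 : ∑ y, (PBar D k h s a y - M.P h s a y) * valAt p D k (h + 1) y =
        ∑ y, PBar D k h s a y * valAt p D k (h + 1) y -
          ∑ y, M.P h s a y * valAt p D k (h + 1) y := by
      simp_rw [sub_mul, sum_sub_distrib]
    rcases min_choice (refBonus p A (visitSA D k h s a) (PBar D k h s a) (valAt p D k (h + 1))
      (refAt p D k (h + 1))) (coarseBonus S A p (visitSA D k h s a)) with h1 | h1 <;> rw [h1]
    · have := hD.refBonus_ge hp hx hxL hlam hlamx hk hh hn (refAt p D k (h + 1))
      rw [e2] at this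
      linarith
    · have := (abs_le.1 (hD.model_coarse_le hp hx hxL hk hh hn hV)).2
      linarith

end Optimism

/-! ### Regret of mirror descent with slowly varying weights -/

section Occupancy

variable {S A : Type*} [Fintype S] [Fintype A] [DecidableEq S]
variable {P P' : ℕ → S → A → S → ℝ} {π : ℕ → S → A → ℝ} {c : ℝ} {e : ℕ → ℝ}

theorem sum_occ_le_pow (s₁ : S) (hP0 : ∀ h s a y, 0 ≤ P h s a y)
    (hPc : ∀ h s a, ∑ y, P h s a y ≤ c) (hc : 0 ≤ c) (hπ : IsPolicy π) (h : ℕ) :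
    ∑ s, occ P π s₁ h s ≤ c ^ h := by
  induction h with
  | zero => simp [occ]
  | succ h ih =>
    have e1 := sum_occ_succ_mul P π s₁ h (fun _ => 1)
    simp only [mul_one] at e1
    rw [e1]
    calc ∑ s, ∑ a, occ P π s₁ h s * π h s a * ∑ y, P h s a y
        ≤ ∑ s, ∑ a, occ P π s₁ h s * π h s a * c := by
          refine sum_le_sum fun s _ => sum_le_sum fun a _ => ?_
          exact mul_le_mul_of_nonneg_left (hPc h s a)
            (mul_nonneg (occ_nonneg s₁ hP0 (fun h s a => (hπ h s).1 a) h s) ((hπ h s).1 a))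
      _ = (∑ s, occ P π s₁ h s) * c := by
          rw [sum_mul]
          refine sum_congr rfl fun s _ => ?_
          rw [← sum_mul, ← mul_sum, (hπ h s).2, mul_one]
      _ ≤ c ^ h * c := mul_le_mul_of_nonneg_right ih hc
      _ = c ^ (h + 1) := (pow_succ c h).symm

theorem sum_abs_occ_sub_le (s₁ : S) (hP0 : ∀ h s a y, 0 ≤ P h s a y)
    (hP0' : ∀ h s a y, 0 ≤ P' h s a y)
    (hPc : ∀ h s a, ∑ y, P h s a y ≤ c) (hPc' : ∀ h s a, ∑ y, P' h s a y ≤ c) (hc : 1 ≤ c)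
    (hπ : IsPolicy π) (he : ∀ h s a, ∑ y, |P' h s a y - P h s a y| ≤ e h) (he0 : ∀ h, 0 ≤ e h)
    (h : ℕ) :
    ∑ s, |occ P' π s₁ h s - occ P π s₁ h s| ≤ c ^ h * ∑ j ∈ range h, e j := by
  have hc0 : 0 ≤ c := by linarith
  induction h with
  | zero => simp [occ]
  | succ h ih =>
    have hocc := occ_nonneg (P := P) (π := π) s₁ hP0 (fun h s a => (hπ h s).1 a)
    have e1 : ∀ y, |occ P' π s₁ (h + 1) y - occ P π s₁ (h + 1) y| ≤
        ∑ s, ∑ a, (|occ P' π s₁ h s - occ P π s₁ h s| * π h s a * P' h s a y +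
          occ P π s₁ h s * π h s a * |P' h s a y - P h s a y|) := fun y => by
      change |∑ s, ∑ a, _ - ∑ s, ∑ a, _| ≤ _
      rw [← sum_sub_distrib]
      simp_rw [← sum_sub_distrib]
      refine (abs_sum_le_sum_abs _ _).trans (sum_le_sum fun s _ => ?_)
      refine (abs_sum_le_sum_abs _ _).trans (sum_le_sum fun a _ => ?_)
      have e2 : occ P' π s₁ h s * π h s a * P' h s a y - occ P π s₁ h s * π h s a * P h s a y =
          (occ P' π s₁ h s - occ P π s₁ h s) * π h s a * P' h s a y +
            occ P π s₁ h s * π h s a * (P' h s a y - P h s a y) := by ring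
      rw [e2]
      refine (abs_add_le _ _).trans (le_of_eq ?_)
      rw [abs_mul, abs_mul, abs_mul, abs_mul, abs_of_nonneg ((hπ h s).1 a),
        abs_of_nonneg (hP0' h s a y), abs_of_nonneg (hocc h s)]
    calc ∑ y, |occ P' π s₁ (h + 1) y - occ P π s₁ (h + 1) y|
        ≤ ∑ y, ∑ s, ∑ a, (|occ P' π s₁ h s - occ P π s₁ h s| * π h s a * P' h s a y +
          occ P π s₁ h s * π h s a * |P' h s a y - P h s a y|) := sum_le_sum fun y _ => e1 y
      _ = ∑ s, ∑ a, (|occ P' π s₁ h s - occ P π s₁ h s| * π h s a * ∑ y, P' h s a y +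
          occ P π s₁ h s * π h s a * ∑ y, |P' h s a y - P h s a y|) := by
          rw [sum_comm]
          refine sum_congr rfl fun s _ => ?_
          rw [sum_comm]
          refine sum_congr rfl fun a _ => ?_
          rw [sum_add_distrib, mul_sum, mul_sum]
      _ ≤ ∑ s, ∑ a, (|occ P' π s₁ h s - occ P π s₁ h s| * π h s a * c +
          occ P π s₁ h s * π h s a * e h) := by
          refine sum_le_sum fun s _ => sum_le_sum fun a _ => add_le_add ?_ ?_
          · exact mul_le_mul_of_nonneg_left (hPc' h s a)
              (mul_nonneg (abs_nonneg _) ((hπ h s).1 a))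
          · exact mul_le_mul_of_nonneg_left (he h s a)
              (mul_nonneg (hocc h s) ((hπ h s).1 a))
      _ = (∑ s, |occ P' π s₁ h s - occ P π s₁ h s|) * c + (∑ s, occ P π s₁ h s) * e h := by
          rw [sum_mul, sum_mul, ← sum_add_distrib]
          refine sum_congr rfl fun s _ => ?_
          rw [sum_add_distrib, ← sum_mul, ← mul_sum, ← sum_mul, ← mul_sum, (hπ h s).2]
          ring
      _ ≤ (c ^ h * ∑ j ∈ range h, e j) * c + c ^ h * e h := by
          refine add_le_add (mul_le_mul_of_nonneg_right ih hc0) ?_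
          exact mul_le_mul_of_nonneg_right (sum_occ_le_pow s₁ hP0 hPc hc0 hπ h) (he0 h)
      _ ≤ c ^ (h + 1) * ∑ j ∈ range (h + 1), e j := by
          rw [sum_range_succ, pow_succ]
          have : c ^ h * e h * 1 ≤ c ^ h * e h * c :=
            mul_le_mul_of_nonneg_left hc (mul_nonneg (pow_nonneg hc0 _) (he0 h))
          linarith

end Occupancy

section MirrorRegret

variable {S A : Type*} [Fintype S] [Fintype A] [DecidableEq S] [DecidableEq A] [Nonempty A]
variable {M : MDP S A} {p : Params} {D : ℕ → Episode S A} {x lam : ℝ}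

/-- An optimal deterministic policy. -/
noncomputable def greedyPolicy (M : MDP S A) (H h : ℕ) (s : S) : A → ℝ :=
  if hh : h < H then Pi.single (exists_optQ_eq M hh s).choose 1
  else Pi.single (Classical.arbitrary A) 1

omit [DecidableEq S] in
theorem greedyPolicy_mem (M : MDP S A) (H : ℕ) : IsPolicy (greedyPolicy M H) := fun h s => by
  unfold greedyPolicy
  split_ifs <;> exact single_mem_stdSimplex ℝ _

omit [DecidableEq S] in
theorem sum_greedyPolicy_mul_optQ (M : MDP S A) {H h : ℕ} (hh : h < H) (s : S) :
    ∑ a, greedyPolicy M H h s a * M.optQ H h s a = M.opt H h s := by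
  unfold greedyPolicy
  rw [dif_pos hh]
  simp [Pi.single_apply, (exists_optQ_eq M hh s).choose_spec]

/-- The transition kernel reweighted by `1 + lam ψ(V^k - V*)`. -/
noncomputable def tiltedKernel (M : MDP S A) (p : Params) (D : ℕ → Episode S A) (lam : ℝ)
    (k h : ℕ) (s : S) (a : A) (y : S) : ℝ :=
  M.P h s a y * (1 + lam * softSign S (valAt p D k (h + 1) y - M.opt p.H (h + 1) y))

theorem tiltedKernel_nonneg (h0 : 0 ≤ lam) (h1 : lam ≤ 1) (k h : ℕ) (s : S) (a : A) (y : S) :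
    0 ≤ tiltedKernel M p D lam k h s a y := by
  refine mul_nonneg ((M.P_mem h s a).1 y) ?_
  have := (abs_le.1 (abs_softSign_le (S := S) (valAt p D k (h + 1) y - M.opt p.H (h + 1) y))).1
  nlinarith

theorem sum_tiltedKernel_le (h0 : 0 ≤ lam) (k h : ℕ) (s : S) (a : A) :
    ∑ y, tiltedKernel M p D lam k h s a y ≤ 1 + lam := by
  refine sum_simplex_mul_le (M.P_mem h s a) fun y => ?_
  have := (abs_le.1 (abs_softSign_le (S := S) (valAt p D k (h + 1) y - M.opt p.H (h + 1) y))).2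
  nlinarith

theorem sum_abs_tiltedKernel_sub_le (h0 : 0 ≤ lam) (k j h : ℕ) (s : S) (a : A) :
    ∑ y, |tiltedKernel M p D lam k h s a y - tiltedKernel M p D lam j h s a y| ≤
      lam * Fintype.card S * ∑ y, |valAt p D k (h + 1) y - valAt p D j (h + 1) y| := by
  rw [mul_sum]
  refine sum_le_sum fun y _ => ?_
  unfold tiltedKernel
  have hP := M.P_mem h s a
  rw [← mul_sub, abs_mul, abs_of_nonneg (hP.1 y), add_sub_add_left_eq_sub, ← mul_sub, abs_mul,
    abs_of_nonneg h0]
  have h1 := abs_softSign_sub_le (S := S) (valAt p D k (h + 1) y - M.opt p.H (h + 1) y)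
    (valAt p D j (h + 1) y - M.opt p.H (h + 1) y)
  rw [sub_sub_sub_cancel_right] at h1
  have h2 := mul_le_mul_of_nonneg_left h1 h0
  have h3 := mul_le_of_le_one_left (a := M.P h s a y)
    (mul_nonneg h0 (abs_nonneg (softSign S (valAt p D k (h + 1) y - M.opt p.H (h + 1) y) -
      softSign S (valAt p D j (h + 1) y - M.opt p.H (h + 1) y)))) (simplex_le_one hP y)
  linarith

/-- The occupancy weights of the greedy policy under the tilted kernel. -/
noncomputable def tiltedOcc (M : MDP S A) (p : Params) (D : ℕ → Episode S A) (lam : ℝ) (s₁ : S)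
    (k h : ℕ) (s : S) : ℝ :=
  occ (tiltedKernel M p D lam k) (greedyPolicy M p.H) s₁ h s

theorem one_add_pow_le_two {lam : ℝ} {H h : ℕ} (h0 : 0 ≤ lam) (hlamH : lam * H ≤ 1 / 2)
    (hh : h ≤ H) : (1 + lam) ^ h ≤ 2 := by
  have h1 : (1 + lam) ^ h ≤ Real.exp (1 / 2) := by
    calc (1 + lam) ^ h ≤ (1 + lam) ^ H := pow_le_pow_right₀ (by linarith) hh
      _ ≤ (Real.exp lam) ^ H := by
          refine pow_le_pow_left₀ (by linarith) ?_ H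
          linarith [Real.add_one_le_exp lam]
      _ = Real.exp (H * lam) := (Real.exp_nat_mul _ _).symm
      _ ≤ _ := Real.exp_le_exp.2 (by linarith)
  have h2 : Real.exp (1 / 2) * Real.exp (1 / 2) = Real.exp 1 := by
    rw [← Real.exp_add]; norm_num
  have h3 := Real.exp_one_lt_d9
  have h4 := Real.exp_pos (1 / 2)
  nlinarith

variable (s₁ : S)

theorem tiltedOcc_nonneg (h0 : 0 ≤ lam) (h1 : lam ≤ 1) (k h : ℕ) (s : S) :
    0 ≤ tiltedOcc M p D lam s₁ k h s :=
  occ_nonneg s₁ (tiltedKernel_nonneg h0 h1 k) (fun h s a => (greedyPolicy_mem M p.H h s).1 a) h s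

theorem sum_tiltedOcc_le (h0 : 0 ≤ lam) (h1 : lam ≤ 1) (hlamH : lam * p.H ≤ 1 / 2) (k : ℕ)
    {h : ℕ} (hh : h ≤ p.H) : ∑ s, tiltedOcc M p D lam s₁ k h s ≤ 2 :=
  (sum_occ_le_pow s₁ (tiltedKernel_nonneg h0 h1 k) (sum_tiltedKernel_le h0 k) (by linarith)
    (greedyPolicy_mem M p.H) h).trans (one_add_pow_le_two h0 hlamH hh)

theorem sum_abs_tiltedOcc_sub_le (h0 : 0 ≤ lam) (h1 : lam ≤ 1) (hlamH : lam * p.H ≤ 1 / 2)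
    (k j : ℕ) {h : ℕ} (hh : h ≤ p.H) :
    ∑ s, |tiltedOcc M p D lam s₁ k h s - tiltedOcc M p D lam s₁ j h s| ≤
      2 * ∑ i ∈ range p.H, lam * Fintype.card S *
        ∑ y, |valAt p D k (i + 1) y - valAt p D j (i + 1) y| := by
  have he0 : ∀ i, 0 ≤ lam * Fintype.card S *
        ∑ y, |valAt p D k (i + 1) y - valAt p D j (i + 1) y| := fun i =>
    mul_nonneg (mul_nonneg h0 (Nat.cast_nonneg _)) (sum_nonneg fun y _ => abs_nonneg _)
  have := sum_abs_occ_sub_le s₁ (tiltedKernel_nonneg (M := M) (p := p) (D := D) h0 h1 j)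
    (tiltedKernel_nonneg h0 h1 k) (sum_tiltedKernel_le h0 j) (sum_tiltedKernel_le h0 k)
    (by linarith) (greedyPolicy_mem M p.H) (sum_abs_tiltedKernel_sub_le h0 k j) he0 h
  refine this.trans ?_
  refine mul_le_mul (one_add_pow_le_two h0 hlamH hh) ?_ (sum_nonneg fun i _ => he0 i) zero_le_two
  exact sum_le_sum_of_subset_of_nonneg (range_mono hh) fun i _ _ => he0 i

variable [Nonempty S] (hp : p.Valid) (hx : 1 ≤ x) (hxL : 100 * x ≤ logL S A p)
  (hD : Accurate M p D x) (hlam : 0 < lam) (hlam1 : lam ≤ 1) (hlamH : lam * p.H ≤ 1 / 2)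
include hp hD hlam hlam1

include hx hxL in
/-- By weighted optimism, the error of the estimated value at the first step is a weighted sum of
the gains of the mirror descent steps. -/
theorem Accurate.valAt_sub_opt_le (hlamx : 25 * x ≤ lam * (p.K : ℝ) ^ (1 / 4 : ℝ)) {k : ℕ}
    (hk : k ≤ p.K) :
    valAt p D k 0 s₁ - M.opt p.H 0 s₁ ≤ ∑ h ∈ range p.H, ∑ s, tiltedOcc M p D lam s₁ k h s *
      ∑ a, qAt p D k h s a * (policyAt p D k h s a - greedyPolicy M p.H h s a) := by
  have e := occ_telescope_end (tiltedKernel M p D lam k) (greedyPolicy M p.H) s₁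
    (f := fun h s => valAt p D k h s - M.opt p.H h s) (H := p.H)
    (fun s => by rw [valAt_end, opt_end, sub_zero])
  rw [e]
  refine sum_le_sum fun h hh => sum_le_sum fun s _ => ?_
  rw [mem_range] at hh
  refine mul_le_mul_of_nonneg_left ?_ (tiltedOcc_nonneg s₁ hlam.le hlam1 k h s)
  have h1 : ∑ a, greedyPolicy M p.H h s a * (qAt p D k h s a - M.optQ p.H h s a) ≤
      ∑ a, greedyPolicy M p.H h s a * ∑ y, tiltedKernel M p D lam k h s a y *
        (valAt p D k (h + 1) y - M.opt p.H (h + 1) y) :=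
    sum_le_sum fun a _ => mul_le_mul_of_nonneg_left
      (hD.qAt_sub_optQ_le hp hx hxL hlam hlamx hk hh s a) ((greedyPolicy_mem M p.H h s).1 a)
  generalize ∑ a, greedyPolicy M p.H h s a * ∑ y, tiltedKernel M p D lam k h s a y *
        (valAt p D k (h + 1) y - M.opt p.H (h + 1) y) = Y at h1 ⊢
  simp_rw [mul_sub, sum_sub_distrib] at h1 ⊢
  rw [sum_greedyPolicy_mul_optQ M hh] at h1
  simp_rw [mul_comm (greedyPolicy M p.H h s _) (qAt p D k h s _)] at h1
  rw [valAt_step p D k hh]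
  linarith

include hlamH in
theorem Accurate.sum_sum_abs_tiltedOcc_sub_le
    (hK : 16 * (Fintype.card S : ℝ) * (p.H : ℝ) ^ 2 * logL S A p ≤ √(p.K : ℝ))
    (hη : ∀ k ∈ Icc 1 p.K, 0 < p.η k) {h : ℕ} (hh : h ≤ p.H) :
    ∑ k ∈ Ico 1 p.K, ∑ s, |tiltedOcc M p D lam s₁ (k + 1) h s - tiltedOcc M p D lam s₁ k h s| ≤
      1400 * lam * ((Fintype.card S : ℝ) ^ 5 * (Fintype.card A : ℝ) ^ 2 * (p.H : ℝ) ^ 4 *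
        logL S A p ^ 2) := by
  calc _ ≤ ∑ k ∈ Ico 1 p.K, 2 * ∑ i ∈ range p.H, lam * Fintype.card S *
        ∑ y, |valAt p D (k + 1) (i + 1) y - valAt p D k (i + 1) y| :=
        sum_le_sum fun k _ => sum_abs_tiltedOcc_sub_le s₁ hlam.le hlam1 hlamH (k + 1) k hh
    _ = 2 * ∑ i ∈ range p.H, lam * Fintype.card S *
        ∑ y, ∑ k ∈ Ico 1 p.K, |valAt p D (k + 1) (i + 1) y - valAt p D k (i + 1) y| := by
        rw [← mul_sum, sum_comm]
        congr 1
        refine sum_congr rfl fun i _ => ?_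
        rw [← mul_sum, sum_comm]
    _ ≤ 2 * ∑ i ∈ range p.H, lam * Fintype.card S * ∑ _y : S,
        700 * ((Fintype.card S : ℝ) ^ 3 * (Fintype.card A : ℝ) ^ 2 * (p.H : ℝ) ^ 3 *
          logL S A p ^ 2) := by
        refine mul_le_mul_of_nonneg_left (sum_le_sum fun i hi => ?_) zero_le_two
        refine mul_le_mul_of_nonneg_left (sum_le_sum fun y _ => ?_) (by positivity)
        exact sum_abs_valAt_sub_le hp hK hD.cost_mem hη (mem_range.1 hi) y
    _ = _ := by
        simp only [sum_const, card_univ, card_range, nsmul_eq_mul]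
        ring

end MirrorRegret

/-! ### The sum of the estimated value gaps -/

theorem sum_one_div_sqrt_le (K : ℕ) : ∑ k ∈ range K, 1 / √((k : ℝ) + 1) ≤ 2 * √(K : ℝ) := by
  induction K with
  | zero => simp
  | succ K ih =>
    rw [sum_range_succ]
    push_cast
    have h0 : 0 ≤ √(K : ℝ) := Real.sqrt_nonneg _
    have h1 : 0 < √((K : ℝ) + 1) := Real.sqrt_pos.2 (by positivity)
    have e0 : √(K : ℝ) ^ 2 = K := Real.sq_sqrt (by positivity)
    have e1 : √((K : ℝ) + 1) ^ 2 = K + 1 := Real.sq_sqrt (by positivity)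
    have h2 : 1 / √((K : ℝ) + 1) ≤ 2 * √((K : ℝ) + 1) - 2 * √(K : ℝ) := by
      rw [div_le_iff₀ h1]
      nlinarith [sq_nonneg (√((K : ℝ) + 1) - √(K : ℝ))]
    linarith

section MirrorRegret

variable {S A : Type*} [Fintype S] [Fintype A] [DecidableEq S] [DecidableEq A] [Nonempty A]
variable {M : MDP S A} {p : Params} {D : ℕ → Episode S A} {x lam : ℝ}

variable (s₁ : S)
variable [Nonempty S] (hp : p.Valid) (hx : 1 ≤ x) (hxL : 100 * x ≤ logL S A p)
  (hD : Accurate M p D x) (hlam : 0 < lam) (hlam1 : lam ≤ 1) (hlamH : lam * p.H ≤ 1 / 2)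
include hp hx hxL hD hlam hlam1 hlamH

/-- The regret bound of mirror descent, summed over the steps and states with the tilted occupancy
weights, whose total variation over the episodes is at most `1`. -/
theorem Accurate.sum_valAt_sub_opt_le {c₁ c₂ : ℝ} (hc₁ : 0 < c₁)
    (hlamx : 25 * x ≤ lam * (p.K : ℝ) ^ (1 / 4 : ℝ))
    (hK : 16 * (Fintype.card S : ℝ) * (p.H : ℝ) ^ 2 * logL S A p ≤ √(p.K : ℝ))
    (hvar : 1400 * lam * ((Fintype.card S : ℝ) ^ 5 * (Fintype.card A : ℝ) ^ 2 * (p.H : ℝ) ^ 4 *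
        logL S A p ^ 2) ≤ 1)
    (hη : ∀ t ∈ Icc 1 p.K, c₁ * √(1 / ((p.H : ℝ) ^ 2 * Fintype.card A * t)) ≤ p.η t ∧
      p.η t ≤ c₂ * √(1 / ((p.H : ℝ) ^ 2 * Fintype.card A * t)))
    (hanti : AntitoneOn p.η (Set.Icc 1 p.K)) :
    ∑ k ∈ Icc 1 p.K, (valAt p D k 0 s₁ - M.opt p.H 0 s₁) ≤
      (6 / c₁ + c₂) * √(Fintype.card A * (p.H : ℝ) ^ 4 * p.K) := by
  have hH := hp.one_le_H
  have hA := one_le_card A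
  have hK1 := hp.K_pos
  have hηpos : ∀ k ∈ Icc 1 p.K, 0 < p.η k := fun k hk => by
    refine lt_of_lt_of_le (mul_pos hc₁ (Real.sqrt_pos.2 ?_)) (hη k hk).1
    have : (0 : ℝ) < k := by exact_mod_cast (mem_Icc.1 hk).1
    positivity
  -- `θ` is `1 / η`, extended by `0` so that Abel summation starts at the index `0`
  set θ : ℕ → ℝ := fun k => if k = 0 then 0 else 1 / p.η k with hθ
  have hθ0 : θ 0 = 0 := if_pos rfl
  have hθk : ∀ k ∈ Icc 1 p.K, θ k = 1 / p.η k := fun k hk =>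
    if_neg (by have := (mem_Icc.1 hk).1; omega)
  have hθmono : ∀ k < p.K, θ k ≤ θ (k + 1) := fun k hk => by
    have hk1 : k + 1 ∈ Icc 1 p.K := mem_Icc.2 ⟨by omega, hk⟩
    rw [hθk _ hk1]
    rcases Nat.eq_zero_or_pos k with rfl | h0
    · rw [hθ0]; exact (one_div_pos.2 (hηpos _ hk1)).le
    · rw [hθk k (mem_Icc.2 ⟨h0, hk.le⟩)]
      exact one_div_le_one_div_of_le (hηpos _ hk1)
        (hanti ⟨h0, hk.le⟩ ⟨by omega, hk⟩ (by omega))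
  have hW0 := fun k h s => tiltedOcc_nonneg (M := M) (p := p) (D := D) s₁ hlam.le hlam1 k h s
  have hWs := fun k {h} (hh : h ≤ p.H) =>
    sum_tiltedOcc_le (M := M) (p := p) (D := D) s₁ hlam.le hlam1 hlamH k hh
  -- the weights repeat their first value at the index `0`, which adds no variation
  set W : ℕ → ℕ → S → ℝ := fun k h s => tiltedOcc M p D lam s₁ (max k 1) h s with hW
  have hWabs : ∀ h < p.H, ∑ s, ∑ k ∈ range p.K, |W (k + 1) h s - W k h s| ≤ 1 := fun h hh => by
    rw [sum_comm]
    refine le_trans (le_of_eq ?_) ((hD.sum_sum_abs_tiltedOcc_sub_le s₁ hp hlam hlam1 hlamH hK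
      hηpos hh.le).trans hvar)
    rw [range_eq_Ico, sum_eq_sum_Ico_succ_bot hp.K_pos]
    have e0 : ∑ s, |W (0 + 1) h s - W 0 h s| = 0 := sum_eq_zero fun s _ => by simp [hW]
    rw [e0, zero_add]
    refine sum_congr rfl fun k hk => ?_
    have hk1 : 1 ≤ k := (mem_Ico.1 hk).1
    simp only [hW]
    rw [max_eq_left hk1, max_eq_left (by omega : 1 ≤ k + 1)]
  have hmd : ∀ h < p.H, ∀ s, ∑ k ∈ range p.K, W (k + 1) h s * ∑ a, qAt p D (k + 1) h s a *
      (policyAt p D (k + 1) h s a - greedyPolicy M p.H h s a) ≤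
      2 * (∑ k ∈ range p.K, W (k + 1) h s * (θ (k + 1) - θ k) +
        θ p.K * ∑ k ∈ range p.K, |W (k + 1) h s - W k h s|) +
      ∑ k ∈ range p.K, W (k + 1) h s * (p.η (k + 1) / 4 * (Fintype.card A * (p.H : ℝ) ^ 2)) :=
      fun h hh s => by
    refine (weighted_mirror_descent (η := p.η) (w := fun k => W k h s) (θ := θ)
      (q := fun k => qAt p D k h s) (p := fun k => policyAt p D k h s)
      (greedyPolicy_mem M p.H h s) (policyAt_mem p D 1 h s)
      (fun k hk => policyAt_succ p D hk h s) hηpos (fun k => hW0 _ _ _) hθ0 hθk hθmono).trans ?_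
    refine add_le_add le_rfl (sum_le_sum fun k hk => ?_)
    have hk1 : k + 1 ∈ Icc 1 p.K := mem_Icc.2 ⟨by omega, mem_range.1 hk⟩
    refine mul_le_mul_of_nonneg_left (mul_le_mul_of_nonneg_left ?_
      (by linarith [hηpos _ hk1])) (hW0 _ _ _)
    refine (sum_le_card_nsmul _ _ ((p.H : ℝ) ^ 2) fun a _ => ?_).trans (le_of_eq (by
      rw [card_univ, nsmul_eq_mul]))
    exact pow_le_pow_left₀ (qAt_nonneg _ _ _ _)
      (qAt_le hp hD.cost_mem (mem_Icc.1 hk1).2 hh s a) 2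
  have hθK : 0 ≤ θ p.K := by
    rw [hθk _ (mem_Icc.2 ⟨hK1, le_rfl⟩)]
    exact (one_div_pos.2 (hηpos _ (mem_Icc.2 ⟨hK1, le_rfl⟩))).le
  have hmdh : ∀ h < p.H, ∑ k ∈ range p.K, ∑ s, W (k + 1) h s * ∑ a, qAt p D (k + 1) h s a *
      (policyAt p D (k + 1) h s a - greedyPolicy M p.H h s a) ≤
      6 * θ p.K + (Fintype.card A * (p.H : ℝ) ^ 2) / 2 * ∑ k ∈ range p.K, p.η (k + 1) :=
      fun h hh => by
    rw [sum_comm]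
    refine (sum_le_sum fun s _ => hmd h hh s).trans ?_
    rw [sum_add_distrib, ← mul_sum, sum_add_distrib, ← mul_sum]
    have b1 : ∑ s, ∑ k ∈ range p.K, W (k + 1) h s * (θ (k + 1) - θ k) ≤ 2 * θ p.K := by
      rw [sum_comm]
      calc _ = ∑ k ∈ range p.K, (∑ s, W (k + 1) h s) * (θ (k + 1) - θ k) :=
            sum_congr rfl fun k _ => (sum_mul _ _ _).symm
        _ ≤ ∑ k ∈ range p.K, 2 * (θ (k + 1) - θ k) := sum_le_sum fun k hk =>
            mul_le_mul_of_nonneg_right (hWs _ hh.le)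
              (sub_nonneg.2 (hθmono k (mem_range.1 hk)))
        _ = 2 * θ p.K := by rw [← mul_sum, sum_range_sub, hθ0, sub_zero]
    have b2 := mul_le_mul_of_nonneg_left (hWabs h hh) hθK
    have b3 : ∑ s, ∑ k ∈ range p.K,
        W (k + 1) h s * (p.η (k + 1) / 4 * (Fintype.card A * (p.H : ℝ) ^ 2)) ≤
        (Fintype.card A * (p.H : ℝ) ^ 2) / 2 * ∑ k ∈ range p.K, p.η (k + 1) := by
      rw [sum_comm, mul_sum]
      refine sum_le_sum fun k hk => ?_
      have hk1 : k + 1 ∈ Icc 1 p.K := mem_Icc.2 ⟨by omega, mem_range.1 hk⟩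
      rw [← sum_mul]
      have := mul_le_mul_of_nonneg_right (hWs (max (k + 1) 1) hh.le)
        (mul_nonneg (by linarith [hηpos _ hk1] : 0 ≤ p.η (k + 1) / 4)
          (by positivity : 0 ≤ Fintype.card A * (p.H : ℝ) ^ 2))
      linarith
    linarith
  have hsum : ∑ k ∈ Icc 1 p.K, (valAt p D k 0 s₁ - M.opt p.H 0 s₁) ≤
      p.H * (6 * θ p.K +
        (Fintype.card A * (p.H : ℝ) ^ 2) / 2 * ∑ k ∈ range p.K, p.η (k + 1)) := by
    rw [← Ico_add_one_right_eq_Icc, sum_Ico_eq_sum_range]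
    calc _ ≤ ∑ k ∈ range p.K, ∑ h ∈ range p.H, ∑ s, W (k + 1) h s *
          ∑ a, qAt p D (k + 1) h s a *
            (policyAt p D (k + 1) h s a - greedyPolicy M p.H h s a) := by
          refine sum_le_sum fun k hk => ?_
          rw [add_comm 1 k]
          have := hD.valAt_sub_opt_le s₁ hp hx hxL hlam hlam1 hlamx (k := k + 1)
            (mem_range.1 hk)
          simpa [hW] using this
      _ = ∑ h ∈ range p.H, ∑ k ∈ range p.K, ∑ s, W (k + 1) h s *
          ∑ a, qAt p D (k + 1) h s a *
            (policyAt p D (k + 1) h s a - greedyPolicy M p.H h s a) := sum_comm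
      _ ≤ _ := by
          refine (sum_le_card_nsmul _ _ _ fun h hh => hmdh h (mem_range.1 hh)).trans (le_of_eq ?_)
          rw [card_range, nsmul_eq_mul]
  -- bounds on the step sizes
  set cA : ℝ := (Fintype.card A : ℝ) with hcA
  set r := √cA with hr
  have hr0 : 0 < r := Real.sqrt_pos.2 (by linarith)
  have hr2 : r ^ 2 = cA := Real.sq_sqrt (by linarith)
  have hsq : ∀ t : ℝ, 0 ≤ t → √(1 / ((p.H : ℝ) ^ 2 * cA * t)) = 1 / (p.H * r * √t) := fun t ht => by
    rw [Real.sqrt_div zero_le_one, Real.sqrt_one, Real.sqrt_mul (by positivity),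
      Real.sqrt_mul (by positivity), Real.sqrt_sq (by linarith)]
  have hgoal : √(cA * (p.H : ℝ) ^ 4 * p.K) = p.H ^ 2 * r * √p.K := by
    rw [Real.sqrt_mul (by positivity), Real.sqrt_mul (by positivity),
      show (p.H : ℝ) ^ 4 = (p.H ^ 2) ^ 2 by ring, Real.sqrt_sq (by positivity)]
    ring
  have hKpos : (0 : ℝ) < p.K := by exact_mod_cast hK1
  have hsK : 0 < √(p.K : ℝ) := Real.sqrt_pos.2 hKpos
  have hH0 : (0 : ℝ) < p.H := by linarith
  have hθle : θ p.K ≤ p.H * r * √p.K / c₁ := by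
    have hmem : p.K ∈ Icc 1 p.K := mem_Icc.2 ⟨hK1, le_rfl⟩
    rw [hθk _ hmem]
    have h1 := (hη _ hmem).1
    rw [hsq _ hKpos.le] at h1
    rw [show p.H * r * √p.K / c₁ = 1 / (c₁ * (1 / (p.H * r * √p.K))) by field_simp]
    exact one_div_le_one_div_of_le (by positivity) h1
  have hc₂ : 0 ≤ c₂ := by
    have hmem : p.K ∈ Icc 1 p.K := mem_Icc.2 ⟨hK1, le_rfl⟩
    by_contra hneg
    have h1 := (hη _ hmem).2
    have h2 := hηpos _ hmem
    have h3 := Real.sqrt_nonneg (1 / ((p.H : ℝ) ^ 2 * cA * p.K))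
    nlinarith
  have hηsum : ∑ k ∈ range p.K, p.η (k + 1) ≤ c₂ * (2 * √p.K) / (p.H * r) := by
    calc _ ≤ ∑ k ∈ range p.K, c₂ / (p.H * r) * (1 / √((k : ℝ) + 1)) := by
          refine sum_le_sum fun k hk => ?_
          have h1 := (hη _ (mem_Icc.2 ⟨by omega, mem_range.1 hk⟩ : k + 1 ∈ Icc 1 p.K)).2
          rw [hsq _ (by positivity)] at h1
          refine h1.trans (le_of_eq ?_)
          push_cast
          field_simp
      _ ≤ c₂ / (p.H * r) * (2 * √p.K) := by
          rw [← mul_sum]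
          exact mul_le_mul_of_nonneg_left (sum_one_div_sqrt_le p.K) (by positivity)
      _ = _ := by ring
  rw [hgoal]
  refine hsum.trans ?_
  have e1 : (6 / c₁ + c₂) * (p.H ^ 2 * r * √p.K) =
      p.H * (6 * (p.H * r * √p.K / c₁) + cA * p.H ^ 2 / 2 * (c₂ * (2 * √p.K) / (p.H * r))) := by
    rw [← hr2]
    field_simp
  rw [e1]
  have := mul_le_mul_of_nonneg_left hηsum (by positivity : 0 ≤ cA * (p.H : ℝ) ^ 2 / 2)
  exact mul_le_mul_of_nonneg_left (by linarith) hH0.le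

end MirrorRegret

/-! ### Sums over the visits and the crude error bound -/

theorem div_le_two_mul_log_sub {P a : ℝ} (hP : 0 ≤ P) (ha : a ∈ Set.Icc (0 : ℝ) 1) :
    a / (1 + P) ≤ 2 * (Real.log (1 + (P + a)) - Real.log (1 + P)) := by
  have h1 : 0 < 1 + P := by linarith
  have h2 : 0 < 1 + (P + a) := by linarith [ha.1]
  have h3 := Real.one_sub_inv_le_log_of_pos (div_pos h2 h1)
  rw [Real.log_div h2.ne' h1.ne', inv_div] at h3
  have h4 : 1 - (1 + P) / (1 + (P + a)) = a / (1 + (P + a)) := by field_simp; ring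
  rw [h4] at h3
  have h5 : a / (1 + P) ≤ 2 * (a / (1 + (P + a))) := by
    rw [← mul_div_assoc, div_le_div_iff₀ h1 h2]
    nlinarith [ha.1, ha.2, mul_nonneg ha.1 hP, mul_nonneg ha.1 (sub_nonneg.2 ha.2)]
  linarith

/-- If the denominators grow at least like half the partial sums, up to `2 x`, the sum of the
quotients is logarithmic. -/
theorem sum_div_le_log {a m : ℕ → ℝ} {x : ℝ} {K : ℕ} (hx : 1 ≤ x)
    (ha : ∀ k ∈ Icc 1 K, a k ∈ Set.Icc (0 : ℝ) 1) (hm1 : ∀ k ∈ Icc 1 K, 1 ≤ m k)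
    (hm : ∀ k ∈ Icc 1 K, (∑ i ∈ Icc 1 (k - 1), a i) / 2 - 2 * x ≤ m k) :
    ∑ k ∈ Icc 1 K, a k / m k ≤ 18 * x * Real.log (1 + K) := by
  have key : ∀ n ≤ K, 0 ≤ ∑ k ∈ Icc 1 n, a k ∧ ∑ k ∈ Icc 1 n, a k ≤ n ∧
      ∑ k ∈ Icc 1 n, a k / m k ≤ 18 * x * Real.log (1 + ∑ k ∈ Icc 1 n, a k) := by
    intro n
    induction n with
    | zero => simp
    | succ n ih =>
      intro hn
      obtain ⟨h0, hle, h1⟩ := ih (by omega)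
      have hmem : n + 1 ∈ Icc 1 K := mem_Icc.2 ⟨by omega, hn⟩
      have hak := ha _ hmem
      have hmk1 := hm1 _ hmem
      have hmk := hm _ hmem
      rw [Nat.add_sub_cancel] at hmk
      rw [sum_Icc_succ_top (by omega), sum_Icc_succ_top (by omega)]
      set P := ∑ k ∈ Icc 1 n, a k
      refine ⟨by linarith [hak.1], by push_cast; linarith [hak.2], ?_⟩
      have h2 : 1 + P ≤ 9 * x * m (n + 1) := by
        rcases le_total P (8 * x) with h | h
        · nlinarith
        · nlinarith
      have h3 : a (n + 1) / m (n + 1) ≤ 9 * x * (a (n + 1) / (1 + P)) := by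
        rw [← mul_div_assoc, div_le_div_iff₀ (by linarith) (by linarith)]
        have := mul_le_mul_of_nonneg_left h2 hak.1
        linarith
      have h4 := mul_le_mul_of_nonneg_left (div_le_two_mul_log_sub h0 hak)
        (by linarith : 0 ≤ 9 * x)
      linarith
  obtain ⟨h0, hle, h1⟩ := key K le_rfl
  refine h1.trans (mul_le_mul_of_nonneg_left ?_ (by linarith))
  exact Real.log_le_log (by linarith) (by linarith)

section Counts

variable {S A : Type*} [Fintype S] [Fintype A] [DecidableEq S] [DecidableEq A] [Nonempty A]

/-- The probability to visit `(s, a)` at step `h` of episode `k`, given the past episodes. -/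
noncomputable def visitProb (M : MDP S A) (p : Params) (D : ℕ → Episode S A) (s₁ : S)
    (k h : ℕ) (s : S) (a : A) : ℝ :=
  occ M.P (policyAt p D k) s₁ h s * policyAt p D k h s a

/-- The number of visits before episode `k`, at least `1`. -/
noncomputable def pastVisits (D : ℕ → Episode S A) (k h : ℕ) (s : S) (a : A) : ℝ :=
  max 1 (visitSA D (k - 1) h s a)

/-- A bound on `|V^k - V*|` that depends only on the episodes before `k`: the expected return of
twice the crude bonus plus the suboptimality gap. -/
noncomputable def gapBound (M : MDP S A) (p : Params) (D : ℕ → Episode S A) (k : ℕ) :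
    ℕ → S → ℝ :=
  ret M.P (policyAt p D k) (fun h s a => 2 * coarseBonus S A p (pastVisits D k h s a) +
    (M.optQ p.H h s a - M.opt p.H h s)) p.H

/-- The visits follow their conditional probabilities at level `x`: the visit counts are at least
half the sums of the conditional probabilities, up to `2 x`, and the visits weighted by the clipped
gap bounds are at most twice their conditional expectations, up to `x`. -/
structure VisitsAccurate (M : MDP S A) (p : Params) (D : ℕ → Episode S A) (x : ℝ) (s₁ : S) :
    Prop where
  lower : ∀ k ≤ p.K, ∀ h < p.H, ∀ s a,
    (∑ i ∈ Icc 1 k, visitProb M p D s₁ i h s a) / 2 - 2 * x ≤ visitSA D k h s a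
  upper : ∀ h < p.H, ∀ s,
    ∑ i ∈ Icc 1 p.K, (if (D i).state h = s then min (gapBound M p D i h s / p.H) 1 else 0) ≤
      2 * ∑ i ∈ Icc 1 p.K,
        occ M.P (policyAt p D i) s₁ h s * min (gapBound M p D i h s / p.H) 1 + x

variable {M : MDP S A} {p : Params} {D : ℕ → Episode S A} {x : ℝ} {s₁ : S}

omit [Fintype S] [Fintype A] [Nonempty A] in
theorem one_le_pastVisits (k h : ℕ) (s : S) (a : A) : 1 ≤ pastVisits D k h s a := le_max_left _ _

omit [Fintype S] [Fintype A] [Nonempty A] in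
theorem pastVisits_le {k h : ℕ} {s : S} {a : A} (hn : visitSA D k h s a ≠ 0) :
    pastVisits D k h s a ≤ visitSA D k h s a := by
  refine max_le (by exact_mod_cast Nat.pos_of_ne_zero hn) ?_
  exact_mod_cast visitSA_mono D (Nat.sub_le k 1) h s a

theorem occ_policyAt_nonneg (k h : ℕ) (s : S) : 0 ≤ occ M.P (policyAt p D k) s₁ h s :=
  occ_nonneg s₁ (fun h s a => (M.P_mem h s a).1) (fun h s => (policyAt_mem p D k h s).1) h s

theorem visitProb_nonneg (k h : ℕ) (s : S) (a : A) : 0 ≤ visitProb M p D s₁ k h s a :=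
  mul_nonneg (occ_policyAt_nonneg k h s) ((policyAt_mem p D k h s).1 a)

theorem sum_visitProb (k h : ℕ) (s : S) :
    ∑ a, visitProb M p D s₁ k h s a = occ M.P (policyAt p D k) s₁ h s := by
  unfold visitProb
  rw [← mul_sum, (policyAt_mem p D k h s).2, mul_one]

theorem sum_sum_visitProb (k h : ℕ) : ∑ s, ∑ a, visitProb M p D s₁ k h s a = 1 := by
  simp_rw [sum_visitProb]
  exact sum_occ s₁ M.P_mem (policyAt_mem p D k) h

theorem visitProb_le_one (k h : ℕ) (s : S) (a : A) : visitProb M p D s₁ k h s a ≤ 1 := by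
  rw [← sum_sum_visitProb (M := M) (p := p) (D := D) (s₁ := s₁) k h]
  refine (single_le_sum (f := fun a => visitProb M p D s₁ k h s a)
    (fun a _ => visitProb_nonneg k h s a) (mem_univ a)).trans ?_
  exact single_le_sum (f := fun s => ∑ a, visitProb M p D s₁ k h s a)
    (fun s _ => sum_nonneg fun a _ => visitProb_nonneg k h s a) (mem_univ s)

variable [Nonempty S] (hp : p.Valid) (hx : 1 ≤ x) (hxL : 100 * x ≤ logL S A p)
  (hD : Accurate M p D x) (hv : VisitsAccurate M p D x s₁)

include hp hx hxL hv in
theorem VisitsAccurate.sum_visitProb_div_le {h : ℕ} (hh : h < p.H) (s : S) (a : A) :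
    ∑ k ∈ Icc 1 p.K, visitProb M p D s₁ k h s a / pastVisits D k h s a ≤ logL S A p ^ 2 := by
  refine (sum_div_le_log hx (fun k _ => ⟨visitProb_nonneg k h s a, visitProb_le_one k h s a⟩)
    (fun k _ => one_le_pastVisits k h s a) fun k hk => ?_).trans ?_
  · exact (hv.lower (k - 1) (by have := (mem_Icc.1 hk).2; omega) h hh s a).trans
      (le_max_right _ _)
  · have hK := hp.one_le_K
    have hlog := log_K_le_logL S A hp
    have h1 : Real.log (1 + p.K) ≤ logL S A p := by
      have : Real.log (1 + p.K) ≤ Real.log (2 * p.K) :=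
        Real.log_le_log (by linarith) (by linarith)
      rw [Real.log_mul (by norm_num) (by linarith)] at this
      linarith [Real.log_two_lt_d9]
    have h2 : 0 ≤ Real.log (1 + p.K) := Real.log_nonneg (by linarith)
    rw [sq]
    exact mul_le_mul (by linarith) h1 h2 (by linarith)

include hp hx hxL hv in
theorem VisitsAccurate.sum_all_visitProb_div_le :
    ∑ k ∈ Icc 1 p.K, ∑ h ∈ range p.H, ∑ s, ∑ a,
      visitProb M p D s₁ k h s a / pastVisits D k h s a ≤
      Fintype.card S * Fintype.card A * p.H * logL S A p ^ 2 := by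
  rw [sum_comm]
  calc _ = ∑ h ∈ range p.H, ∑ s, ∑ a, ∑ k ∈ Icc 1 p.K,
        visitProb M p D s₁ k h s a / pastVisits D k h s a := by
        refine sum_congr rfl fun h _ => ?_
        rw [sum_comm]
        exact sum_congr rfl fun s _ => sum_comm
    _ ≤ ∑ h ∈ range p.H, ∑ _s : S, ∑ _a : A, logL S A p ^ 2 :=
        sum_le_sum fun h hh => sum_le_sum fun s _ => sum_le_sum fun a _ =>
          hv.sum_visitProb_div_le hp hx hxL (mem_range.1 hh) s a
    _ = _ := by
        simp only [sum_const, card_univ, card_range, nsmul_eq_mul]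
        ring

omit [DecidableEq S] [DecidableEq A] [Nonempty A] [Nonempty S] in
/-- The Cauchy–Schwarz inequality for the sums over episodes, steps, states and actions. -/
theorem sum_all_mul_le_sqrt (q f g : ℕ → ℕ → S → A → ℝ) (hq : ∀ k h s a, 0 ≤ q k h s a) (K H : ℕ)
    (hf : ∀ k h s a, 0 ≤ f k h s a) (hg : ∀ k h s a, 0 ≤ g k h s a) :
    ∑ k ∈ Icc 1 K, ∑ h ∈ range H, ∑ s, ∑ a, q k h s a * (√(f k h s a) * √(g k h s a)) ≤
      √(∑ k ∈ Icc 1 K, ∑ h ∈ range H, ∑ s, ∑ a, q k h s a * f k h s a) *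
      √(∑ k ∈ Icc 1 K, ∑ h ∈ range H, ∑ s, ∑ a, q k h s a * g k h s a) := by
  have e : ∀ F : ℕ → ℕ → S → A → ℝ, ∑ k ∈ Icc 1 K, ∑ h ∈ range H, ∑ s, ∑ a, F k h s a =
      ∑ z ∈ (Icc 1 K ×ˢ range H) ×ˢ (univ : Finset (S × A)), F z.1.1 z.1.2 z.2.1 z.2.2 :=
    fun F => by
    rw [sum_product, sum_product]
    exact sum_congr rfl fun k _ => sum_congr rfl fun h _ => 
      (Fintype.sum_prod_type fun z : S × A => F k h z.1 z.2).symm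
  rw [e, e, e]
  refine Eq.trans_le ?_ (Real.sum_sqrt_mul_sqrt_le _ (fun z => mul_nonneg (hq _ _ _ _) (hf _ _ _ _))
    fun z => mul_nonneg (hq _ _ _ _) (hg _ _ _ _))
  refine sum_congr rfl fun z _ => ?_
  rw [Real.sqrt_mul (hq _ _ _ _), Real.sqrt_mul (hq _ _ _ _)]
  have := Real.mul_self_sqrt (hq z.1.1 z.1.2 z.2.1 z.2.2)
  linear_combination (-(√(f z.1.1 z.1.2 z.2.1 z.2.2) * √(g z.1.1 z.1.2 z.2.1 z.2.2))) * this

end Counts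

/-! ### The estimation error is controlled by past data -/

section Crude

variable {S A : Type*} [Fintype S] [Fintype A] [DecidableEq S] [DecidableEq A] [Nonempty A]
variable {M : MDP S A} {p : Params} {D : ℕ → Episode S A} {x : ℝ} {s₁ : S}

/-- The Bellman error `c + P V^k - Q^k` of the estimated values. -/
noncomputable def bellmanError (M : MDP S A) (p : Params) (D : ℕ → Episode S A) (k h : ℕ) (s : S)
    (a : A) : ℝ :=
  M.c h s a + ∑ y, M.P h s a y * valAt p D k (h + 1) y - qAt p D k h s a

variable [Nonempty S] (hp : p.Valid) (hx : 1 ≤ x) (hxL : 100 * x ≤ logL S A p)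
  (hD : Accurate M p D x) (hv : VisitsAccurate M p D x s₁)

omit [DecidableEq S] [DecidableEq A] in
include hp in
theorem coarseBonus_anti {m n : ℝ} (hm : 0 < m) (hmn : m ≤ n) :
    coarseBonus S A p n ≤ coarseBonus S A p m := by
  have hL := two_le_logL S A hp
  have hC := logL_le_logC S A hp
  have hP := logC_le_logP S A hp
  have h1 : 0 ≤ 2 * logC S A p := by linarith
  have h2 : 0 ≤ 4 * (Fintype.card S : ℝ) * logP S A p :=
    mul_nonneg (by positivity) (by linarith)
  unfold coarseBonus costWidth
  refine add_le_add (Real.sqrt_le_sqrt (div_le_div_of_nonneg_left h1 hm hmn))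
    (mul_le_mul_of_nonneg_left (Real.sqrt_le_sqrt (div_le_div_of_nonneg_left h2 hm hmn))
      (Nat.cast_nonneg _))

include hp hD in
theorem model_value_mem {k h : ℕ} (hk : k ≤ p.K) (hh : h < p.H) (s : S) (a : A) :
    M.c h s a + ∑ y, M.P h s a y * valAt p D k (h + 1) y ∈ Set.Icc (0 : ℝ) p.H := by
  have hV := fun y => valAt_mem' hp hD.cost_mem hk (h + 1) hh y
  have h1 := sum_simplex_mul_le (M.P_mem h s a) fun y => (hV y).2
  have h2 := le_sum_simplex_mul (M.P_mem h s a) fun y => (hV y).1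
  have h3 := mean_costLaw_mem M h s a
  push_cast at h1
  have h4 : (0 : ℝ) ≤ h := Nat.cast_nonneg h
  exact ⟨by linarith [h3.1], by linarith [h3.2]⟩

include hp hx hxL hD in
/-- The coarse bound for the Bellman errors, in terms of the visits before the episode: unlike the
bonus itself, it is determined before the episode is played. -/
theorem Accurate.abs_bellmanError_le {k h : ℕ} (hk : k ≤ p.K) (hh : h < p.H) (s : S) (a : A) :
    |bellmanError M p D k h s a| ≤ 2 * coarseBonus S A p (pastVisits D k h s a) := by
  have hm := model_value_mem hp hD hk hh s a
  unfold bellmanError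
  by_cases hn : visitSA D k h s a = 0
  -- an unvisited pair has the estimate `0`, and the coarse bonus of one visit exceeds `H`
  · have hn' : visitSA D (k - 1) h s a = 0 := by
      have := visitSA_mono D (Nat.sub_le k 1) h s a
      omega
    have h1 : pastVisits D k h s a = 1 := by simp [pastVisits, hn']
    rw [qAt_eq_zero hp hn, sub_zero, abs_of_nonneg hm.1, h1]
    have hL := two_le_logL S A hp
    have hC := logL_le_logC S A hp
    have hP := logC_le_logP S A hp
    have hS := one_le_card S
    have h2 : 1 ≤ √(4 * Fintype.card S * logP S A p / 1) := by
      refine Real.one_le_sqrt.2 ?_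
      nlinarith
    have h3 := mul_le_mul_of_nonneg_left h2 (Nat.cast_nonneg (α := ℝ) p.H)
    have h4 : 0 ≤ costWidth S A p 1 := Real.sqrt_nonneg _
    have h5 : coarseBonus S A p 1 =
      costWidth S A p 1 + p.H * √(4 * Fintype.card S * logP S A p / 1) := rfl
    have h6 : (0 : ℝ) ≤ p.H := Nat.cast_nonneg _
    linarith [hm.2]
  · have hV : ∀ y, valAt p D k (h + 1) y ∈ Set.Icc (0 : ℝ) p.H := fun y =>
      valAt_mem hp hD.cost_mem hk hh y
    have h1 := abs_le.1 (hD.model_coarse_le hp hx hxL hk hh hn hV)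
    have h2 := coarseBonus_anti (S := S) (A := A) hp
      (by linarith [one_le_pastVisits (D := D) k h s a]) (pastVisits_le (k := k) hn)
    have h3 : bonusAt p D k h s a ≤ coarseBonus S A p (visitSA D k h s a) := min_le_right _ _
    have h4 : 0 ≤ bonusAt p D k h s a := bonus_nonneg hp _ _ _ _ _ _
    rw [qAt_eq, abs_le]
    constructor
    · rcases max_choice (cBar D k h s a + ∑ y, PBar D k h s a y * valAt p D k (h + 1) y -
        bonusAt p D k h s a) 0 with e | e <;> rw [e] <;> linarith [hm.1]
    · linarith [le_max_left (cBar D k h s a + ∑ y, PBar D k h s a y * valAt p D k (h + 1) y -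
        bonusAt p D k h s a) 0]

omit [Nonempty S] in
theorem gapBound_step (k : ℕ) {h : ℕ} (hh : h < p.H) (s : S) : gapBound M p D k h s =
    ∑ a, policyAt p D k h s a * (2 * coarseBonus S A p (pastVisits D k h s a) +
      (M.optQ p.H h s a - M.opt p.H h s) + ∑ y, M.P h s a y * gapBound M p D k (h + 1) y) :=
  ret_step _ _ _ hh s

include hp hx hxL hD in
theorem Accurate.abs_valAt_sub_opt_le {k : ℕ} (hk : k ≤ p.K) :
    ∀ h ≤ p.H, ∀ s, |valAt p D k h s - M.opt p.H h s| ≤ gapBound M p D k h s := by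
  refine backward_induction (fun s => ?_) fun h hh ih s => ?_
  · rw [valAt_end, opt_end, sub_zero, abs_zero]
    exact (ret_end _ _ _ _ _).ge
  · rw [valAt_step p D k hh, gapBound_step k hh]
    have hπ := policyAt_mem p D k h s
    have e : ∑ a, qAt p D k h s a * policyAt p D k h s a - M.opt p.H h s =
        ∑ a, policyAt p D k h s a * (qAt p D k h s a - M.opt p.H h s) := by
      simp_rw [mul_sub, sum_sub_distrib, ← sum_mul, hπ.2, one_mul, mul_comm]
    rw [e]
    refine (abs_sum_le_sum_abs _ _).trans (sum_le_sum fun a _ => ?_)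
    rw [abs_mul, abs_of_nonneg (hπ.1 a)]
    refine mul_le_mul_of_nonneg_left ?_ (hπ.1 a)
    have h1 := abs_le.1 (hD.abs_bellmanError_le hp hx hxL hk hh s a)
    have h2 := opt_le_optQ M hh s a
    have h3 : |∑ y, M.P h s a y * valAt p D k (h + 1) y -
        ∑ y, M.P h s a y * M.opt p.H (h + 1) y| ≤
        ∑ y, M.P h s a y * gapBound M p D k (h + 1) y := by
      rw [← sum_sub_distrib]
      refine (abs_sum_le_sum_abs _ _).trans (sum_le_sum fun y _ => ?_)
      rw [← mul_sub, abs_mul, abs_of_nonneg ((M.P_mem h s a).1 y)]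
      exact mul_le_mul_of_nonneg_left (ih y) ((M.P_mem h s a).1 y)
    have h4 := abs_le.1 h3
    unfold bellmanError at h1
    have h5 : M.optQ p.H h s a = M.c h s a + ∑ y, M.P h s a y * M.opt p.H (h + 1) y := rfl
    rw [abs_le]
    constructor <;> linarith [h1.1, h1.2, h4.1, h4.2]

omit [Nonempty S] in
/-- The value of the policy exceeds its estimate by the expected sum of the Bellman errors. -/
theorem value_sub_valAt (M : MDP S A) (p : Params) (D : ℕ → Episode S A) (k : ℕ) (s₁ : S) :
    M.value p.H (policyAt p D k) 0 s₁ - valAt p D k 0 s₁ =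
      ∑ h ∈ range p.H, ∑ s, ∑ a, visitProb M p D s₁ k h s a * bellmanError M p D k h s a := by
  have e := occ_telescope_end M.P (policyAt p D k) s₁
    (f := fun h s => M.value p.H (policyAt p D k) h s - valAt p D k h s) (H := p.H)
    (fun s => by rw [valAt_end, value_end, sub_zero])
  rw [e]
  refine sum_congr rfl fun h hh => sum_congr rfl fun s _ => ?_
  rw [mem_range] at hh
  rw [value_step M (policyAt_mem p D k) hh, valAt_step p D k hh]
  unfold visitProb bellmanError
  simp_rw [mul_assoc, ← mul_sum]
  congr 1
  simp_rw [mul_comm (qAt p D k h s _), ← sum_sub_distrib]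
  refine sum_congr rfl fun a _ => ?_
  simp_rw [mul_sub, sum_sub_distrib]
  ring

end Crude

section Totals

variable {S A : Type*} [Fintype S] [Fintype A] [DecidableEq S] [DecidableEq A] [Nonempty A]
variable {M : MDP S A} {p : Params} {D : ℕ → Episode S A} {x : ℝ} {s₁ : S}
variable [Nonempty S] (hp : p.Valid) (hx : 1 ≤ x) (hxL : 100 * x ≤ logL S A p)
  (hD : Accurate M p D x) (hv : VisitsAccurate M p D x s₁)

omit [DecidableEq S] [DecidableEq A] in
include hp in
theorem two_mul_coarseBonus_le {m : ℝ} (hm : 1 ≤ m) : 2 * coarseBonus S A p m ≤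
    10 * (p.H * √(Fintype.card S * logL S A p)) * (√1 * √(1 / m)) := by
  have hL := two_le_logL S A hp
  have hP := logP_le_two_mul S A hp
  have hC := logC_le_logP S A hp
  have hS := one_le_card S
  have hH := hp.one_le_H
  have h1 : costWidth S A p m ≤ 2 * (√(Fintype.card S * logL S A p) * √(1 / m)) := by
    rw [← Real.sqrt_mul (by positivity), show (2 : ℝ) = √(2 ^ 2) by
      rw [Real.sqrt_sq (by norm_num)], ← Real.sqrt_mul (by norm_num)]
    refine Real.sqrt_le_sqrt ?_
    change 2 * logC S A p / m ≤ _
    rw [show (2 : ℝ) ^ 2 * (Fintype.card S * logL S A p * (1 / m)) =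
      (4 * (Fintype.card S * logL S A p)) / m by ring]
    refine div_le_div_of_nonneg_right ?_ (by linarith)
    nlinarith
  have h2 : √(4 * Fintype.card S * logP S A p / m) ≤
      3 * (√(Fintype.card S * logL S A p) * √(1 / m)) := by
    rw [← Real.sqrt_mul (by positivity), show (3 : ℝ) = √(3 ^ 2) by
      rw [Real.sqrt_sq (by norm_num)], ← Real.sqrt_mul (by norm_num)]
    refine Real.sqrt_le_sqrt ?_
    rw [show (3 : ℝ) ^ 2 * (Fintype.card S * logL S A p * (1 / m)) =
      (9 * (Fintype.card S * logL S A p)) / m by ring]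
    refine div_le_div_of_nonneg_right ?_ (by linarith)
    nlinarith
  have h3 : coarseBonus S A p m =
      costWidth S A p m + p.H * √(4 * Fintype.card S * logP S A p / m) := rfl
  have h4 := mul_le_mul_of_nonneg_left h2 (by linarith : (0 : ℝ) ≤ p.H)
  set z := √(Fintype.card S * logL S A p) * √(1 / m) with hz
  have hz0 : 0 ≤ z := by positivity
  rw [h3, Real.sqrt_one, one_mul, mul_assoc 10, mul_assoc (p.H : ℝ), ← hz]
  nlinarith

include hp hx hxL hv in
theorem VisitsAccurate.sum_visitProb_mul_coarse_le :
    ∑ k ∈ Icc 1 p.K, ∑ h ∈ range p.H, ∑ s, ∑ a,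
      visitProb M p D s₁ k h s a * (2 * coarseBonus S A p (pastVisits D k h s a)) ≤
      10 * (Fintype.card S * Fintype.card A * (p.H : ℝ) ^ 2 * logL S A p ^ 2) * √(p.K : ℝ) := by
  have hS := one_le_card S
  have hA := one_le_card A
  have hH := hp.one_le_H
  have hL := two_le_logL S A hp
  have hcs := sum_all_mul_le_sqrt (visitProb M p D s₁) (fun _ _ _ _ => 1)
    (fun k h s a => 1 / pastVisits D k h s a) visitProb_nonneg p.K p.H (fun _ _ _ _ => zero_le_one)
    (fun k h s a => by have := one_le_pastVisits (D := D) k h s a; positivity)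
  simp_rw [mul_one, mul_one_div, sum_sum_visitProb, sum_const, card_range, Nat.card_Icc,
    nsmul_eq_mul, mul_one, Nat.add_sub_cancel] at hcs
  have h1 := Real.sqrt_le_sqrt (hv.sum_all_visitProb_div_le hp hx hxL)
  calc _ ≤ ∑ k ∈ Icc 1 p.K, ∑ h ∈ range p.H, ∑ s, ∑ a,
        10 * (p.H * √(Fintype.card S * logL S A p)) *
          (visitProb M p D s₁ k h s a * (√1 * √(1 / pastVisits D k h s a))) := by
        refine sum_le_sum fun k _ => sum_le_sum fun h _ => sum_le_sum fun s _ =>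
          sum_le_sum fun a _ => ?_
        have := mul_le_mul_of_nonneg_left (two_mul_coarseBonus_le (S := S) (A := A) hp
          (one_le_pastVisits (D := D) k h s a)) (visitProb_nonneg (M := M) (p := p) (s₁ := s₁)
            (D := D) k h s a)
        linarith
    _ ≤ 10 * (p.H * √(Fintype.card S * logL S A p)) * (√(p.K * p.H) *
        √(Fintype.card S * Fintype.card A * p.H * logL S A p ^ 2)) := by
        simp_rw [← mul_sum]
        refine mul_le_mul_of_nonneg_left ?_ (by positivity)
        refine le_trans hcs ?_
        exact mul_le_mul_of_nonneg_left h1 (Real.sqrt_nonneg _)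
    _ ≤ _ := by
        rw [Real.sqrt_mul (Nat.cast_nonneg p.K) (p.H : ℝ)]
        have e : √(Fintype.card S * logL S A p) * √(p.H : ℝ) *
            √(Fintype.card S * Fintype.card A * p.H * logL S A p ^ 2) ≤
            Fintype.card S * Fintype.card A * p.H * logL S A p ^ 2 := by
          rw [← Real.sqrt_mul (by positivity), ← Real.sqrt_mul (by positivity)]
          refine Real.sqrt_le_iff.2 ⟨by positivity, ?_⟩
          set cS : ℝ := (Fintype.card S : ℝ)
          set cA : ℝ := (Fintype.card A : ℝ)
          set L := logL S A p
          have : cA * L ^ 3 ≤ cA ^ 2 * L ^ 4 := by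
            refine mul_le_mul (le_self_pow₀ hA two_ne_zero)
              (pow_le_pow_right₀ (by linarith) (by norm_num)) (by positivity) (by positivity)
          have h2 := mul_le_mul_of_nonneg_left this (by positivity : 0 ≤ cS ^ 2 * (p.H : ℝ) ^ 2)
          linarith
        have := mul_le_mul_of_nonneg_left e (by positivity : 0 ≤ 10 * p.H * √(p.K : ℝ))
        linarith

/-- A bound, of order `√K`, for the sum over the episodes of the gap bounds at the first step. -/
noncomputable def gapTotal (S A : Type*) [Fintype S] [Fintype A] (p : Params) (cA : ℝ) : ℝ :=
  (20 + cA) * (Fintype.card S * Fintype.card A * (p.H : ℝ) ^ 2 * logL S A p ^ 2) * √(p.K : ℝ)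

include hp hx hxL hD hv in
/-- The gap bound is an expected sum of coarse bonuses and advantages. The advantages add up to
`V^{π^k} - V^*`, that is, to Bellman errors, which are below the coarse bonuses again, and to the
estimated gap `V^k - V^*`. -/
theorem VisitsAccurate.sum_gapBound_zero_le {cA : ℝ} (hcA : 0 ≤ cA)
    (hX : ∑ k ∈ Icc 1 p.K, (valAt p D k 0 s₁ - M.opt p.H 0 s₁) ≤
      cA * √(Fintype.card A * (p.H : ℝ) ^ 4 * p.K)) :
    ∑ k ∈ Icc 1 p.K, gapBound M p D k 0 s₁ ≤ gapTotal S A p cA := by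
  have hS := one_le_card S
  have hA := one_le_card A
  have hH := hp.one_le_H
  have hL := two_le_logL S A hp
  have h1 := hv.sum_visitProb_mul_coarse_le hp hx hxL
  set B := ∑ k ∈ Icc 1 p.K, ∑ h ∈ range p.H, ∑ s, ∑ a,
      visitProb M p D s₁ k h s a * (2 * coarseBonus S A p (pastVisits D k h s a)) with hB
  have h2 : ∀ k ∈ Icc 1 p.K, gapBound M p D k 0 s₁ ≤ 2 * ∑ h ∈ range p.H, ∑ s, ∑ a,
      visitProb M p D s₁ k h s a * (2 * coarseBonus S A p (pastVisits D k h s a)) +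
      (valAt p D k 0 s₁ - M.opt p.H 0 s₁) := fun k hk => by
    have e1 : gapBound M p D k 0 s₁ = ∑ h ∈ range p.H, ∑ s, ∑ a,
        visitProb M p D s₁ k h s a * (2 * coarseBonus S A p (pastVisits D k h s a)) +
        (M.value p.H (policyAt p D k) 0 s₁ - M.opt p.H 0 s₁) := by
      rw [value_sub_opt M (policyAt_mem p D k) p.H 0 (Nat.zero_le _)]
      unfold gapBound
      rw [ret_eq_sum_occ, ret_eq_sum_occ, ← sum_add_distrib]
      simp_rw [mul_add, sum_add_distrib]
      rfl
    have e2 := value_sub_valAt M p D k s₁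
    have e3 : ∑ h ∈ range p.H, ∑ s, ∑ a,
        visitProb M p D s₁ k h s a * bellmanError M p D k h s a ≤
        ∑ h ∈ range p.H, ∑ s, ∑ a,
        visitProb M p D s₁ k h s a * (2 * coarseBonus S A p (pastVisits D k h s a)) :=
      sum_le_sum fun h hh => sum_le_sum fun s _ => sum_le_sum fun a _ =>
        mul_le_mul_of_nonneg_left ((le_abs_self _).trans
          (hD.abs_bellmanError_le hp hx hxL (mem_Icc.1 hk).2 (mem_range.1 hh) s a))
          (visitProb_nonneg k h s a)
    linarith
  have h3 := sum_le_sum h2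
  rw [sum_add_distrib, ← mul_sum, ← hB] at h3
  have h4 : √(Fintype.card A * (p.H : ℝ) ^ 4 * p.K) ≤
      (Fintype.card S * Fintype.card A * (p.H : ℝ) ^ 2 * logL S A p ^ 2) * √(p.K : ℝ) := by
    rw [Real.sqrt_mul (by positivity)]
    refine mul_le_mul_of_nonneg_right ?_ (Real.sqrt_nonneg _)
    refine Real.sqrt_le_iff.2 ⟨by positivity, ?_⟩
    set cS : ℝ := (Fintype.card S : ℝ)
    set nA : ℝ := (Fintype.card A : ℝ)
    set L := logL S A p
    have a1 : nA ≤ nA ^ 2 := le_self_pow₀ hA two_ne_zero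
    have a2 : 1 ≤ cS ^ 2 * L ^ 4 :=
      one_le_mul_of_one_le_of_one_le (one_le_pow₀ hS) (one_le_pow₀ (by linarith))
    have a3 : nA * (p.H : ℝ) ^ 4 * 1 ≤ nA ^ 2 * (p.H : ℝ) ^ 4 * (cS ^ 2 * L ^ 4) :=
      mul_le_mul (mul_le_mul_of_nonneg_right a1 (by positivity)) a2 zero_le_one (by positivity)
    linarith
  have h5 := mul_le_mul_of_nonneg_left h4 hcA
  unfold gapTotal
  linarith

omit [Nonempty S] in
theorem sum_occ_mul_gapBound_le {h : ℕ} (hh : h ≤ p.H) : ∑ k ∈ Icc 1 p.K, ∑ s,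
    occ M.P (policyAt p D k) s₁ h s * gapBound M p D k h s ≤
      ∑ k ∈ Icc 1 p.K, gapBound M p D k 0 s₁ := by
  refine sum_le_sum fun k _ => ?_
  refine sum_occ_mul_ret_le s₁ (fun h s a => (M.P_mem h s a).1)
    (fun h s => (policyAt_mem p D k h s).1) (fun h hh s a => ?_) hh
  have h1 := coarseBonus_nonneg (S := S) (A := A) (p := p) (pastVisits D k h s a)
  have h2 := opt_le_optQ M hh s a
  linarith

end Totals

/-! ### Quality of the reference values -/

section Reference

variable {S A : Type*} [Fintype S] [Fintype A] [DecidableEq S] [DecidableEq A] [Nonempty A]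
variable {M : MDP S A} {p : Params} {D : ℕ → Episode S A} {x : ℝ} {s₁ : S}
variable [Nonempty S] (hp : p.Valid) (hx : 1 ≤ x) (hxL : 100 * x ≤ logL S A p)
  (hD : Accurate M p D x) (hv : VisitsAccurate M p D x s₁)

omit [DecidableEq S] [DecidableEq A] in
include hp in
theorem one_le_C0 : 1 ≤ C0 S A p := by
  have hS := one_le_card S
  have hA := one_le_card A
  have hH := hp.one_le_H
  exact Real.one_le_sqrt.2 (one_le_mul_of_one_le_of_one_le
    (one_le_mul_of_one_le_of_one_le (one_le_pow₀ hS) hA) (one_le_pow₀ hH))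

omit [DecidableEq S] [DecidableEq A] in
include hp in
theorem C0_le : C0 S A p ≤ (Fintype.card S : ℝ) ^ 2 * Fintype.card A * (p.H : ℝ) ^ 2 := by
  have hS := one_le_card S
  have hA := one_le_card A
  have hH := hp.one_le_H
  refine Real.sqrt_le_iff.2 ⟨by positivity, ?_⟩
  rw [mul_pow, mul_pow, ← pow_mul, ← pow_mul]
  exact mul_le_mul (mul_le_mul (pow_le_pow_right₀ hS (by norm_num)) (le_self_pow₀ hA two_ne_zero)
    (by positivity) (by positivity)) (pow_le_pow_right₀ hH (by norm_num)) (by positivity)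
    (by positivity)

omit [Fintype S] [Nonempty A] [Nonempty S] in
theorem visitSA_le_visitS (D : ℕ → Episode S A) (k h : ℕ) (s : S) (a : A) :
    visitSA D k h s a ≤ visitS D k h s := by
  rw [← sum_visitSA D k h s]
  exact single_le_sum (f := fun a => visitSA D k h s a) (fun _ _ => Nat.zero_le _) (mem_univ a)

omit [DecidableEq S] [DecidableEq A] [Nonempty S] in
theorem opt_mem_Icc (M : MDP S A) {H h : ℕ} (hh : h ≤ H) (s : S) :
    M.opt H h s ∈ Set.Icc (0 : ℝ) H := by
  have := opt_mem M H h hh s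
  exact ⟨this.1, this.2.trans (by linarith [Nat.cast_nonneg (α := ℝ) h])⟩

/-- The sum of the errors of the estimated value of `s` over the visits to `s`. -/
noncomputable def visitError (M : MDP S A) (p : Params) (D : ℕ → Episode S A) (h : ℕ) (s : S) : ℝ :=
  ∑ i ∈ Icc 1 p.K, if (D i).state h = s then |valAt p D i h s - M.opt p.H h s| else 0

omit [Nonempty S] in
theorem visitError_nonneg (h : ℕ) (s : S) : 0 ≤ visitError M p D h s :=
  sum_nonneg fun i _ => by split_ifs <;> positivity

omit [Nonempty S] in
theorem abs_visitAvg_sub_opt_le {k h : ℕ} (hk : k ≤ p.K) {s : S} (hn : visitS D k h s ≠ 0) :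
    |visitAvg p D k h s - M.opt p.H h s| ≤ visitError M p D h s / visitS D k h s := by
  have hn' : (0 : ℝ) < visitS D k h s := by exact_mod_cast Nat.pos_of_ne_zero hn
  have e0 : (visitS D k h s : ℝ) = ∑ i ∈ Icc 1 k, if (D i).state h = s then (1 : ℝ) else 0 := by
    rw [sum_boole]; rfl
  have e : visitAvg p D k h s - M.opt p.H h s = (∑ i ∈ Icc 1 k,
      if (D i).state h = s then valAt p D i h s - M.opt p.H h s else 0) / visitS D k h s := by
    rw [eq_div_iff hn'.ne', sub_mul]
    unfold visitAvg
    rw [div_mul_cancel₀ _ hn'.ne', e0, mul_sum, ← sum_sub_distrib]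
    refine sum_congr rfl fun i _ => ?_
    split_ifs <;> ring
  rw [e, abs_div, abs_of_pos hn']
  refine div_le_div_of_nonneg_right ?_ hn'.le
  refine (abs_sum_le_sum_abs _ _).trans ?_
  unfold visitError
  refine le_trans (sum_le_sum fun i _ => ?_) (sum_le_sum_of_subset_of_nonneg
    (Icc_subset_Icc_right hk) fun i _ _ => by split_ifs <;> positivity)
  split_ifs <;> simp

include hp hD in
/-- Either the reference value was updated at the last episode, and is an average of as many
estimates as there were visits, or there were few visits. -/
theorem abs_refAt_sub_opt_le {k h : ℕ} (hk : k ∈ Icc 1 p.K) (hh : h ≤ p.H) (s : S) (a : A) :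
    |refAt p D k h s - M.opt p.H h s| ≤
      (visitError M p D h s + p.H * (C0 S A p * √(p.K : ℝ) + 1)) / pastVisits D k h s a := by
  obtain ⟨hk1, hkK⟩ := mem_Icc.1 hk
  have hC := one_le_C0 (S := S) (A := A) hp
  have hm := one_le_pastVisits (D := D) k h s a
  have hE := visitError_nonneg (M := M) (p := p) (D := D) h s
  have hR := refAt_mem hp hD.cost_mem hk1 hkK hh s
  have ho := opt_mem_Icc M hh s
  have hcrude : |refAt p D k h s - M.opt p.H h s| ≤ p.H := by
    rw [abs_le]; constructor <;> linarith [hR.1, hR.2, ho.1, ho.2]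
  have hfew : pastVisits D k h s a ≤ C0 S A p * √(p.K : ℝ) + 1 →
      |refAt p D k h s - M.opt p.H h s| ≤
      (visitError M p D h s + p.H * (C0 S A p * √(p.K : ℝ) + 1)) / pastVisits D k h s a := by
    intro hle
    rw [le_div_iff₀ (by linarith)]
    have := mul_le_mul hcrude hle (by linarith) (Nat.cast_nonneg _)
    linarith
  rcases hk1.eq_or_lt with h1 | h1
  -- in the first episode the reference value is zero and there are no earlier visits
  · refine hfew ?_
    have : pastVisits D k h s a = 1 := by simp [pastVisits, ← h1, visitSA]
    rw [this]
    have : 0 ≤ C0 S A p * √(p.K : ℝ) := by positivity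
    linarith
  · obtain ⟨j, rfl⟩ : ∃ j, k = j + 1 := ⟨k - 1, by omega⟩
    have hsa : (visitSA D j h s a : ℝ) ≤ visitS D j h s := by
      exact_mod_cast visitSA_le_visitS D j h s a
    by_cases hcond : C0 S A p * √(j : ℝ) ≤ visitS D j h s
    · rw [refAt_succ p D (by omega), if_pos hcond]
      have hj : (1 : ℝ) ≤ j := by exact_mod_cast (by omega : 1 ≤ j)
      have h2 : (1 : ℝ) ≤ visitS D j h s :=
        (one_le_mul_of_one_le_of_one_le hC (Real.one_le_sqrt.2 hj)).trans hcond
      have h3 : visitS D j h s ≠ 0 := fun h0 => by rw [h0] at h2; norm_num at h2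
      refine (abs_visitAvg_sub_opt_le (M := M) (by omega) h3).trans ?_
      have h4 : pastVisits D (j + 1) h s a ≤ visitS D j h s := max_le h2 hsa
      refine div_le_div₀ (by positivity) ?_ (by linarith) h4
      have : 0 ≤ p.H * (C0 S A p * √(p.K : ℝ) + 1) := by positivity
      linarith
    · refine hfew (max_le ?_ ?_)
      · have : 0 ≤ C0 S A p * √(p.K : ℝ) := by positivity
        linarith
      · have h2 : √(j : ℝ) ≤ √(p.K : ℝ) :=
          Real.sqrt_le_sqrt (by exact_mod_cast (by omega : j ≤ p.K))
        have h3 := mul_le_mul_of_nonneg_left h2 (by linarith : 0 ≤ C0 S A p)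
        rw [Nat.add_sub_cancel]
        linarith

include hp hx hxL hD hv in
theorem sum_occ_mul_refAt_le {h : ℕ} (hh : h < p.H) (s : S) :
    ∑ k ∈ Icc 1 p.K, occ M.P (policyAt p D k) s₁ h s * |refAt p D k h s - M.opt p.H h s| ≤
      Fintype.card A * logL S A p ^ 2 *
        (visitError M p D h s + p.H * (C0 S A p * √(p.K : ℝ) + 1)) := by
  set Z := visitError M p D h s + p.H * (C0 S A p * √(p.K : ℝ) + 1) with hZ
  have hZ0 : 0 ≤ Z := by
    have := one_le_C0 (S := S) (A := A) hp
    have := visitError_nonneg (M := M) (p := p) (D := D) h s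
    positivity
  calc _ ≤ ∑ k ∈ Icc 1 p.K, ∑ a, visitProb M p D s₁ k h s a / pastVisits D k h s a * Z := by
        refine sum_le_sum fun k hk => ?_
        rw [← sum_visitProb, sum_mul]
        refine sum_le_sum fun a _ => ?_
        have := mul_le_mul_of_nonneg_left (abs_refAt_sub_opt_le hp hD hk hh.le s a)
          (visitProb_nonneg (M := M) (p := p) (s₁ := s₁) (D := D) k h s a)
        refine this.trans (le_of_eq ?_)
        rw [← hZ]; ring
    _ = ∑ a, (∑ k ∈ Icc 1 p.K, visitProb M p D s₁ k h s a / pastVisits D k h s a) * Z := by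
        rw [sum_comm]
        exact sum_congr rfl fun a _ => (sum_mul _ _ _).symm
    _ ≤ ∑ _a : A, logL S A p ^ 2 * Z := sum_le_sum fun a _ =>
        mul_le_mul_of_nonneg_right (hv.sum_visitProb_div_le hp hx hxL hh s a) hZ0
    _ = _ := by rw [sum_const, card_univ, nsmul_eq_mul]; ring

include hp hx hxL hD hv in
/-- The sum of the errors at the visits is at most twice its conditional expectation. The gap bound
is clipped at `H`, which keeps the weights of the visits in `[0, 1]` and loses nothing, as the
errors are at most `H`. -/
theorem visitError_le {h : ℕ} (hh : h < p.H) (s : S) : visitError M p D h s ≤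
    2 * ∑ k ∈ Icc 1 p.K, occ M.P (policyAt p D k) s₁ h s * gapBound M p D k h s + p.H * x := by
  have hH := hp.one_le_H
  have h1 : visitError M p D h s ≤ p.H * ∑ i ∈ Icc 1 p.K,
      (if (D i).state h = s then min (gapBound M p D i h s / p.H) 1 else 0) := by
    rw [mul_sum]
    refine sum_le_sum fun i hi => ?_
    have hi2 := (mem_Icc.1 hi).2
    split_ifs
    · rw [mul_min_of_nonneg _ _ (by linarith), mul_div_cancel₀ _ (by linarith), mul_one]
      refine le_min (hD.abs_valAt_sub_opt_le hp hx hxL hi2 h hh.le s) ?_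
      have a1 := valAt_mem hp hD.cost_mem hi2 hh.le s
      have a2 := opt_mem_Icc M hh.le s
      rw [abs_le]; constructor <;> linarith [a1.1, a1.2, a2.1, a2.2]
    · simp
  refine h1.trans ((mul_le_mul_of_nonneg_left (hv.upper h hh s) (by linarith)).trans ?_)
  rw [mul_add]
  refine add_le_add ?_ le_rfl
  rw [mul_left_comm, mul_sum]
  refine mul_le_mul_of_nonneg_left (sum_le_sum fun k _ => ?_) zero_le_two
  rw [mul_left_comm]
  refine mul_le_mul_of_nonneg_left ?_ (occ_policyAt_nonneg k h s)
  have := mul_le_mul_of_nonneg_left (min_le_left (gapBound M p D k h s / p.H) 1)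
    (by linarith : (0 : ℝ) ≤ p.H)
  rwa [mul_div_cancel₀ _ (by linarith)] at this

/-- The error of the estimated value plus that of the reference value. -/
noncomputable def totalGap (M : MDP S A) (p : Params) (D : ℕ → Episode S A) (k h : ℕ) (s : S) : ℝ :=
  |valAt p D k h s - M.opt p.H h s| + |refAt p D k h s - M.opt p.H h s|

/-- A bound on the expected sum of the total gaps at a step. -/
noncomputable def gapTotalBound (S A : Type*) [Fintype S] [Fintype A] (p : Params) (cA : ℝ) : ℝ :=
  3 * (21 + cA) * ((Fintype.card S : ℝ) ^ 3 * (Fintype.card A : ℝ) ^ 2 * (p.H : ℝ) ^ 3 *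
    logL S A p ^ 4) * √(p.K : ℝ)

include hp hx hxL hD hv in
theorem sum_occ_mul_totalGap_le {cA : ℝ} (hcA : 0 ≤ cA)
    (hX : ∑ k ∈ Icc 1 p.K, (valAt p D k 0 s₁ - M.opt p.H 0 s₁) ≤
      cA * √(Fintype.card A * (p.H : ℝ) ^ 4 * p.K)) {h : ℕ} (hh : h ≤ p.H) :
    ∑ k ∈ Icc 1 p.K, ∑ s, occ M.P (policyAt p D k) s₁ h s * totalGap M p D k h s ≤
      gapTotalBound S A p cA := by
  have hS := one_le_card S
  have hA := one_le_card A
  have hH := hp.one_le_H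
  have hL := two_le_logL S A hp
  have hK : 1 ≤ √(p.K : ℝ) := Real.one_le_sqrt.2 hp.one_le_K
  rcases hh.eq_or_lt with rfl | hh
  · refine le_trans (le_of_eq (sum_eq_zero fun k hk => sum_eq_zero fun s _ => ?_))
      (by unfold gapTotalBound; positivity)
    unfold totalGap
    rw [valAt_end, opt_end, refAt_end (mem_Icc.1 hk).1]
    simp
  set G := ∑ k ∈ Icc 1 p.K, ∑ s, occ M.P (policyAt p D k) s₁ h s * gapBound M p D k h s with hG
  have hGle : G ≤ gapTotal S A p cA := (sum_occ_mul_gapBound_le hh.le).trans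
    (hv.sum_gapBound_zero_le hp hx hxL hD hcA hX)
  have h1 : ∑ k ∈ Icc 1 p.K, ∑ s, occ M.P (policyAt p D k) s₁ h s *
      |valAt p D k h s - M.opt p.H h s| ≤ G :=
    sum_le_sum fun k hk => sum_le_sum fun s _ => mul_le_mul_of_nonneg_left
      (hD.abs_valAt_sub_opt_le hp hx hxL (mem_Icc.1 hk).2 h hh.le s) (occ_policyAt_nonneg k h s)
  have h2 : ∑ k ∈ Icc 1 p.K, ∑ s, occ M.P (policyAt p D k) s₁ h s *
      |refAt p D k h s - M.opt p.H h s| ≤ Fintype.card A * logL S A p ^ 2 *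
        (2 * G + Fintype.card S * (p.H * x) +
          Fintype.card S * (p.H * (C0 S A p * √(p.K : ℝ) + 1))) := by
    rw [sum_comm]
    refine (sum_le_sum fun s _ => sum_occ_mul_refAt_le hp hx hxL hD hv hh s).trans ?_
    rw [← mul_sum, sum_add_distrib, sum_const, card_univ, nsmul_eq_mul]
    refine mul_le_mul_of_nonneg_left (add_le_add ?_ le_rfl) (by positivity)
    refine (sum_le_sum fun s _ => visitError_le hp hx hxL hD hv hh s).trans ?_
    rw [sum_add_distrib, ← mul_sum, sum_const, card_univ, nsmul_eq_mul, hG, sum_comm]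
  have e : ∑ k ∈ Icc 1 p.K, ∑ s, occ M.P (policyAt p D k) s₁ h s * totalGap M p D k h s =
      ∑ k ∈ Icc 1 p.K, ∑ s, occ M.P (policyAt p D k) s₁ h s *
        |valAt p D k h s - M.opt p.H h s| + ∑ k ∈ Icc 1 p.K, ∑ s,
        occ M.P (policyAt p D k) s₁ h s * |refAt p D k h s - M.opt p.H h s| := by
    unfold totalGap
    simp_rw [mul_add, sum_add_distrib]
  rw [e]
  refine (add_le_add h1 h2).trans ?_
  have hC := C0_le (S := S) (A := A) hp
  unfold gapTotalBound
  unfold gapTotal at hGle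
  set cS : ℝ := (Fintype.card S : ℝ) with hcS
  set nA : ℝ := (Fintype.card A : ℝ) with hnA
  set L := logL S A p with hLd
  set H : ℝ := (p.H : ℝ) with hHd
  set k := √(p.K : ℝ) with hkd
  have hk0 : 0 ≤ k := by linarith
  have b1 : G + nA * L ^ 2 * (2 * G) ≤ 3 * (20 + cA) * (cS ^ 3 * nA ^ 2 * H ^ 3 * L ^ 4) * k := by
    have c1 : G + nA * L ^ 2 * (2 * G) ≤ 3 * (nA * L ^ 2) *
        ((20 + cA) * (cS * nA * H ^ 2 * L ^ 2) * k) := by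
      have d1 : 1 ≤ nA * L ^ 2 :=
        one_le_mul_of_one_le_of_one_le hA (one_le_pow₀ (by linarith))
      set T := (20 + cA) * (cS * nA * H ^ 2 * L ^ 2) * k with hT
      have hT0 : 0 ≤ T := by positivity
      have d2 := mul_le_mul_of_nonneg_left hGle (by linarith : 0 ≤ nA * L ^ 2)
      nlinarith
    refine c1.trans ?_
    have c2 : cS * H ^ 2 ≤ cS ^ 3 * H ^ 3 := mul_le_mul (le_self_pow₀ hS (by norm_num))
      (pow_le_pow_right₀ hH (by norm_num)) (by positivity) (by positivity)
    have c3 := mul_le_mul_of_nonneg_left c2 (by positivity : 0 ≤ 3 * (20 + cA) * nA ^ 2 * L ^ 4 * k)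
    linarith
  have b2 : nA * L ^ 2 * (cS * (H * x) + cS * (H * (C0 S A p * k + 1))) ≤
      3 * (cS ^ 3 * nA ^ 2 * H ^ 3 * L ^ 4) * k := by
    have hx' : x ≤ L := by linarith
    have hSA : 1 ≤ cS ^ 2 * nA * H ^ 2 := one_le_mul_of_one_le_of_one_le
      (one_le_mul_of_one_le_of_one_le (one_le_pow₀ hS) hA) (one_le_pow₀ hH)
    set T := cS ^ 2 * nA * H ^ 2 with hT
    have hT0 : 0 ≤ T := by linarith
    have hLk : 1 ≤ L * k := one_le_mul_of_one_le_of_one_le (by linarith) hK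
    have hTk : 1 ≤ T * k := one_le_mul_of_one_le_of_one_le hSA hK
    have c1 : x ≤ T * (L * k) := by
      have : L * 1 ≤ L * (T * k) := mul_le_mul_of_nonneg_left hTk (by linarith)
      linarith
    have c2 : C0 S A p * k ≤ T * (L * k) := by
      have : C0 S A p * k ≤ T * k := mul_le_mul_of_nonneg_right hC hk0
      have : T * k * 1 ≤ T * k * L := mul_le_mul_of_nonneg_left (by linarith) (by positivity)
      linarith
    have c3 : 1 ≤ T * (L * k) := one_le_mul_of_one_le_of_one_le hSA hLk
    have c4 : nA * L ^ 2 * (cS * (H * x) + cS * (H * (C0 S A p * k + 1))) ≤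
        nA * L ^ 2 * (cS * (H * (3 * (T * (L * k))))) := by
      refine mul_le_mul_of_nonneg_left ?_ (by positivity)
      rw [← mul_add, ← mul_add]
      exact mul_le_mul_of_nonneg_left (mul_le_mul_of_nonneg_left (by linarith) (by linarith))
        (by linarith)
    refine c4.trans ?_
    have c5 : L ^ 3 ≤ L ^ 4 := pow_le_pow_right₀ (by linarith) (by norm_num)
    have c6 := mul_le_mul_of_nonneg_left c5 (by positivity : 0 ≤ 3 * (cS ^ 3 * nA ^ 2 * H ^ 3) * k)
    rw [hT]
    linarith
  linarith

end Reference

/-! ### The Bernstein-type bound for the Bellman errors and the regret -/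

section Fine

variable {S A : Type*} [Fintype S] [Fintype A] [DecidableEq S] [DecidableEq A] [Nonempty A]
variable {M : MDP S A} {p : Params} {D : ℕ → Episode S A} {x : ℝ} {s₁ : S}
variable [Nonempty S]

omit [DecidableEq S] [DecidableEq A] in
theorem costWidth_le (hp : p.Valid) {n : ℝ} (hn : 0 < n) :
    costWidth S A p n ≤ 2 * √(logL S A p / n) := by
  have hC := logC_le_logP S A hp
  have hP := logP_le_two_mul S A hp
  rw [show (2 : ℝ) = √(2 ^ 2) by rw [Real.sqrt_sq (by norm_num)], ← Real.sqrt_mul (by norm_num)]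
  refine Real.sqrt_le_sqrt ?_
  change 2 * logC S A p / n ≤ _
  rw [← mul_div_assoc]
  exact div_le_div_of_nonneg_right (by linarith) hn.le

omit [DecidableEq S] [DecidableEq A] in
theorem refBonus_le (hp : p.Valid) {n : ℕ} (hn : n ≠ 0) {w V R : S → ℝ}
    (hw : w ∈ stdSimplex ℝ S) :
    refBonus p A n w V R ≤ 7 * √(p.H : ℝ) * √(logL S A p / n) +
      5 / 2 * √(logL S A p / n) * √(variance w R) +
      ∑ y, (2 * √(logL S A p / n) * √(w y) + 7 * logL S A p / (3 * n)) * |V y - R y| +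
      (6 * (Fintype.card S * p.H * logL S A p) + 2 * (((Fintype.card S : ℝ) ^ 2 * Fintype.card A *
        (p.H : ℝ) ^ 2) * ((p.K : ℝ) ^ (1 / 4 : ℝ) * logL S A p))) / n := by
  have hS := one_le_card S
  have hA := one_le_card A
  have hH := hp.one_le_H
  have hL := two_le_logL S A hp
  have hC := logC_le_logP S A hp
  have hP := logP_le_two_mul S A hp
  have hn1 : (1 : ℝ) ≤ n := by exact_mod_cast Nat.pos_of_ne_zero hn
  have hn0 : (0 : ℝ) < n := by linarith
  have hdim := dim_factor_le (S := S) (A := A) hp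
  have hrb : refBonus p A n w V R = costWidth S A p n + (√(6 * variance w R * logL S A p / n) +
        √(4 * p.H * logL S A p / (Fintype.card S * n)) +
          8 * √(Fintype.card S * (p.H : ℝ) ^ 2) * logL S A p / (3 * n)) +
      ∑ y, gapWeight S A p n (w y) * |V y - R y| +
      (√(4 * p.H * logP S A p / n) + 7 * Fintype.card S * p.H * logL S A p / (3 * n)
        + 2 * (Fintype.card S : ℝ) ^ (3 / 2 : ℝ) * (Fintype.card A : ℝ) ^ (1 / 4 : ℝ) *
          (p.H : ℝ) ^ (7 / 4 : ℝ) * (p.K : ℝ) ^ (1 / 4 : ℝ) * √(logL S A p) / n) := rfl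
  rw [hrb]
  have t0 := costWidth_le (S := S) (A := A) hp hn0
  set L := logL S A p with hLd
  set cS : ℝ := (Fintype.card S : ℝ) with hcS
  set ℓ := √(L / n) with hℓ
  have hℓ0 : 0 ≤ ℓ := Real.sqrt_nonneg _
  have hvar := variance_nonneg hw.1 R
  have hsH : 1 ≤ √(p.H : ℝ) := Real.one_le_sqrt.2 hH
  have t1 : √(6 * variance w R * L / n) ≤ 5 / 2 * ℓ * √(variance w R) := by
    rw [show (5 / 2 : ℝ) = √((5 / 2) ^ 2) by rw [Real.sqrt_sq (by norm_num)], hℓ,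
      ← Real.sqrt_mul (by norm_num), ← Real.sqrt_mul (by positivity)]
    refine Real.sqrt_le_sqrt ?_
    have : 0 ≤ variance w R * L / n := by positivity
    calc 6 * variance w R * L / n = 6 * (variance w R * L / n) := by ring
      _ ≤ (25 / 4) * (variance w R * L / n) := by linarith
      _ = _ := by ring
  have t2 : √(4 * p.H * L / (cS * n)) ≤ 2 * (√(p.H : ℝ) * ℓ) := by
    rw [show (2 : ℝ) = √(2 ^ 2) by rw [Real.sqrt_sq (by norm_num)], hℓ,
      ← Real.sqrt_mul (by positivity), ← Real.sqrt_mul (by norm_num)]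
    refine Real.sqrt_le_sqrt ?_
    rw [show (2 : ℝ) ^ 2 * (p.H * (L / n)) = 4 * p.H * L / (1 * n) by ring]
    exact div_le_div_of_nonneg_left (by positivity) (by linarith)
      (mul_le_mul_of_nonneg_right hS hn0.le)
  have t3 : 8 * √(cS * (p.H : ℝ) ^ 2) * L / (3 * n) ≤ 8 / 3 * (cS * p.H * L) / n := by
    have : √(cS * (p.H : ℝ) ^ 2) ≤ cS * p.H := by
      refine Real.sqrt_le_iff.2 ⟨by positivity, ?_⟩
      rw [mul_pow]
      exact mul_le_mul_of_nonneg_right (le_self_pow₀ hS two_ne_zero) (by positivity)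
    rw [show 8 * √(cS * (p.H : ℝ) ^ 2) * L / (3 * n) = 8 / 3 * (√(cS * (p.H : ℝ) ^ 2) * L) / n by
      field_simp]
    refine div_le_div_of_nonneg_right ?_ hn0.le
    have := mul_le_mul_of_nonneg_right this (by linarith : 0 ≤ L)
    linarith
  have t4 : √(4 * p.H * logP S A p / n) ≤ 3 * (√(p.H : ℝ) * ℓ) := by
    rw [show (3 : ℝ) = √(3 ^ 2) by rw [Real.sqrt_sq (by norm_num)], hℓ,
      ← Real.sqrt_mul (by positivity), ← Real.sqrt_mul (by norm_num)]
    refine Real.sqrt_le_sqrt ?_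
    rw [show (3 : ℝ) ^ 2 * (p.H * (L / n)) = p.H * (9 * L) / n by ring,
      show 4 * p.H * logP S A p / n = p.H * (4 * logP S A p) / n by ring]
    exact div_le_div_of_nonneg_right (mul_le_mul_of_nonneg_left (by linarith) (by linarith)) hn0.le
  have t5 : 2 * cS ^ (3 / 2 : ℝ) * (Fintype.card A : ℝ) ^ (1 / 4 : ℝ) *
          (p.H : ℝ) ^ (7 / 4 : ℝ) * (p.K : ℝ) ^ (1 / 4 : ℝ) * √L / n ≤
      2 * ((cS ^ 2 * Fintype.card A * (p.H : ℝ) ^ 2) * ((p.K : ℝ) ^ (1 / 4 : ℝ) * L)) / n := by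
    refine div_le_div_of_nonneg_right ?_ hn0.le
    have hs : √L ≤ L := Real.sqrt_le_iff.2 ⟨by linarith, by nlinarith⟩
    have a1 := mul_le_mul_of_nonneg_left hs (by positivity : 0 ≤ (p.K : ℝ) ^ (1 / 4 : ℝ))
    have a2 := mul_le_mul hdim a1 (by positivity) (by positivity)
    linarith
  have t6 : ∑ y, gapWeight S A p n (w y) * |V y - R y| ≤
      ∑ y, (2 * ℓ * √(w y) + 7 * L / (3 * n)) * |V y - R y| := by
    refine sum_le_sum fun y _ => mul_le_mul_of_nonneg_right ?_ (abs_nonneg _)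
    unfold gapWeight
    refine add_le_add ?_ le_rfl
    rw [show (2 : ℝ) = √(2 ^ 2) by rw [Real.sqrt_sq (by norm_num)], hℓ,
      ← Real.sqrt_mul (by norm_num), ← Real.sqrt_mul (by positivity)]
    rw [Real.sqrt_sq (by norm_num)]
    rcases Nat.eq_or_lt_of_le (Nat.one_le_iff_ne_zero.2 hn) with h1 | h1
    · rw [← h1]; simp
    · refine Real.sqrt_le_sqrt ?_
      have hn2 : (2 : ℝ) ≤ n := by exact_mod_cast h1
      rw [show (2 : ℝ) ^ 2 * (L / n) * w y = (2 * (w y * L)) / (n / 2) by field_simp]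
      refine div_le_div₀ (mul_nonneg zero_le_two (mul_nonneg (hw.1 y) (by linarith))) ?_
        (by linarith) (by linarith)
      have a1 := mul_nonneg (hw.1 y) (by linarith : 0 ≤ L)
      have a2 := mul_nonneg (hw.1 y) a1
      change 2 * w y * (1 - w y) * L ≤ _
      linarith
  have t7 : 7 * cS * p.H * L / (3 * n) = 7 / 3 * (cS * p.H * L) / n := by field_simp
  have t8 : ℓ ≤ √(p.H : ℝ) * ℓ := le_mul_of_one_le_left hℓ0 hsH
  have t9 : 0 ≤ cS * p.H * L / n := by positivity
  rw [add_div]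
  have t10 : 8 / 3 * (cS * p.H * L) / n + 7 / 3 * (cS * p.H * L) / n ≤
      6 * (cS * p.H * L) / n := by
    rw [← add_div]
    have : 0 ≤ cS * p.H * L := by positivity
    exact div_le_div_of_nonneg_right (by linarith) hn0.le
  linarith

omit [DecidableEq S] [Nonempty S] in
theorem sum_sqrt_mul_le {P E : S → ℝ} {B : ℝ} (hP : ∀ y, 0 ≤ P y) (hE : ∀ y, 0 ≤ E y)
    (hEB : ∀ y, E y ≤ B) :
    ∑ y, √(P y) * E y ≤ √(Fintype.card S * B) * √(∑ y, P y * E y) := by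
  have h1 : ∑ y, √(P y) * E y ≤ ∑ y, √B * √(P y * E y) := by
    refine sum_le_sum fun y _ => ?_
    rw [Real.sqrt_mul (hP y)]
    have : E y ≤ √B * √(E y) := by
      rw [← Real.sqrt_mul ((hE y).trans (hEB y))]
      exact Real.le_sqrt_of_sq_le (by nlinarith [hE y, hEB y])
    nlinarith [Real.sqrt_nonneg (P y)]
  have h2 := Real.sum_sqrt_mul_sqrt_le (univ : Finset S) (f := fun _ => B)
    (g := fun y => P y * E y) 
  refine h1.trans ?_
  by_cases hB : 0 ≤ B
  · have := h2 (fun _ => hB) (fun y => mul_nonneg (hP y) (hE y))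
    simpa [sum_const, card_univ, nsmul_eq_mul] using this
  · have : √B = 0 := Real.sqrt_eq_zero_of_nonpos (by linarith)
    simp only [this, zero_mul, sum_const_zero]
    positivity

omit [DecidableEq S] [Nonempty S] in
/-- Collects the deviation terms of the Bellman error. Here `t²` stands for `x / n`, `ℓ²` for
`L / n`, and `E` bounds the errors of the estimated value `V` and of the reference `R`. -/
theorem deviation_sum_le {P w V Vs R E : S → ℝ} {H t ℓ : ℝ} (hP : P ∈ stdSimplex ℝ S)
    (hq : w ∈ stdSimplex ℝ S) (ht0 : 0 ≤ t) (htℓ : t ≤ ℓ / 10) (hH : 0 ≤ H)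
    (hopt : ∀ y, Vs y ∈ Set.Icc 0 H) (hE : ∀ y, E y ∈ Set.Icc 0 (2 * H))
    (hEV : ∀ y, |V y - Vs y| ≤ E y) (hEVR : ∀ y, |V y - Vs y| + |R y - Vs y| ≤ E y)
    (hd : ∀ y, |w y - P y| ≤ 3 * (√(P y) * t) + 2 * t ^ 2) :
    9 / 2 * t * √(variance w R) + ∑ y, 9 / 2 * t * √(w y * (1 - w y)) * |V y - R y| +
        10 * t * ∑ y, √(P y) * |V y - Vs y| + 30 * (Fintype.card S * H * t ^ 2) +
        5 / 2 * ℓ * √(variance w R) +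
        ∑ y, (2 * ℓ * √(w y) + 7 / 3 * ℓ ^ 2) * |V y - R y| ≤
      ℓ * (9 / 2 * √(variance P Vs) +
        15 * √(Fintype.card S * H) * √(∑ y, P y * E y)) + 9 * (Fintype.card S * H * ℓ ^ 2) := by
  have hℓ0 : 0 ≤ ℓ := by linarith
  set cS : ℝ := (Fintype.card S : ℝ) with hcS
  have hE0 : ∀ y, 0 ≤ E y := fun y => (hE y).1
  have hRE : ∀ y, |R y - Vs y| ≤ E y := fun y =>
    (le_add_of_nonneg_left (abs_nonneg _)).trans (hEVR y)
  have hVR : ∀ y, |V y - R y| ≤ E y := fun y => by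
    have := abs_sub_le (V y) (Vs y) (R y)
    rw [abs_sub_comm (Vs y) (R y)] at this
    exact this.trans (hEVR y)
  have hqP : ∀ y, w y ≤ 2 * P y + 5 * t ^ 2 := fun y => by
    have h1 := (abs_le.1 (hd y)).2
    nlinarith [sq_nonneg (√(P y) - 3 / 2 * t), Real.sq_sqrt (hP.1 y)]
  have hsq : ∀ y, √(w y) ≤ 3 / 2 * √(P y) + 5 / 2 * t := fun y => by
    refine Real.sqrt_le_iff.2 ⟨by positivity, ?_⟩
    have h2 : 0 ≤ √(P y) * t := by positivity
    nlinarith [hqP y, Real.sq_sqrt (hP.1 y), hP.1 y]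
  have hsq' : ∀ y, √(w y * (1 - w y)) ≤ √(w y) := fun y =>
    Real.sqrt_le_sqrt (mul_le_of_le_one_right (hq.1 y) (by linarith [hq.1 y]))
  set F := ∑ y, √(w y) * E y with hF
  set G := ∑ y, √(P y) * E y with hG
  have hF0 : 0 ≤ F := sum_nonneg fun y _ => mul_nonneg (Real.sqrt_nonneg _) (hE0 y)
  have hG0 : 0 ≤ G := sum_nonneg fun y _ => mul_nonneg (Real.sqrt_nonneg _) (hE0 y)
  have hEs : ∑ y, E y ≤ cS * (2 * H) := by
    refine (sum_le_card_nsmul _ _ _ fun y _ => (hE y).2).trans (le_of_eq ?_)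
    rw [card_univ, nsmul_eq_mul]
  have hFG : F ≤ 3 / 2 * G + 5 / 2 * t * (cS * (2 * H)) := by
    calc F ≤ ∑ y, (3 / 2 * (√(P y) * E y) + 5 / 2 * t * E y) := sum_le_sum fun y _ => by
          have := mul_le_mul_of_nonneg_right (hsq y) (hE0 y)
          linarith
      _ = 3 / 2 * G + 5 / 2 * t * ∑ y, E y := by rw [sum_add_distrib, ← mul_sum, ← mul_sum]
      _ ≤ _ := by
          have := mul_le_mul_of_nonneg_left hEs (by positivity : 0 ≤ 5 / 2 * t)
          linarith
  have hsdV := sqrt_variance_le_of_le hq hP (f := Vs) (H := H) (t := t) ht0 hH hopt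
    fun y => by linarith [hqP y, sq_nonneg t]
  have hsdR := (abs_le.1 (abs_sqrt_variance_sub_le hq R Vs)).2
  have hsd : √(variance w R) ≤ 3 / 2 * √(variance P Vs) + 4 * (cS * H * t) + F := by
    have : ∑ y, √(w y * (1 - w y)) * |R y - Vs y| ≤ F := sum_le_sum fun y _ =>
      mul_le_mul (hsq' y) (hRE y) (abs_nonneg _) (Real.sqrt_nonneg _)
    linarith
  have s1 : ∑ y, 9 / 2 * t * √(w y * (1 - w y)) * |V y - R y| ≤ ℓ / 2 * F := by
    rw [hF, mul_sum]
    refine sum_le_sum fun y _ => ?_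
    rw [mul_assoc]
    exact mul_le_mul (by linarith) (mul_le_mul (hsq' y) (hVR y) (abs_nonneg _)
      (Real.sqrt_nonneg _)) (by positivity) (by positivity)
  have s2 : 10 * t * ∑ y, √(P y) * |V y - Vs y| ≤ ℓ * G := by
    refine mul_le_mul (by linarith) (sum_le_sum fun y _ => ?_) (sum_nonneg fun y _ => by positivity)
      hℓ0
    exact mul_le_mul_of_nonneg_left (hEV y) (Real.sqrt_nonneg _)
  have s3 : ∑ y, (2 * ℓ * √(w y) + 7 / 3 * ℓ ^ 2) * |V y - R y| ≤
      2 * ℓ * F + 14 / 3 * (cS * H * ℓ ^ 2) := by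
    calc _ ≤ ∑ y, (2 * ℓ * (√(w y) * E y) + 7 / 3 * ℓ ^ 2 * E y) := sum_le_sum fun y _ => by
          have := mul_le_mul_of_nonneg_left (hVR y)
            (by positivity : 0 ≤ 2 * ℓ * √(w y) + 7 / 3 * ℓ ^ 2)
          linarith
      _ = 2 * ℓ * F + 7 / 3 * ℓ ^ 2 * ∑ y, E y := by
          rw [sum_add_distrib, ← mul_sum, ← mul_sum]
      _ ≤ 2 * ℓ * F + 7 / 3 * ℓ ^ 2 * (cS * (2 * H)) := by
          have := mul_le_mul_of_nonneg_left hEs (by positivity : 0 ≤ 7 / 3 * ℓ ^ 2)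
          linarith
      _ = _ := by ring
  have s4 : cS * H * t ^ 2 ≤ (cS * H * ℓ ^ 2) / 100 := by
    have h1 : t ^ 2 ≤ (ℓ / 10) ^ 2 := pow_le_pow_left₀ ht0 htℓ 2
    have h2 := mul_le_mul_of_nonneg_left h1 (by positivity : 0 ≤ cS * H)
    linarith
  have s5 : 9 / 2 * t * √(variance w R) ≤ ℓ / 2 * √(variance w R) :=
    mul_le_mul_of_nonneg_right (by linarith) (Real.sqrt_nonneg _)
  have s6 := mul_le_mul_of_nonneg_left hsd hℓ0
  have s7 : ℓ * (cS * H * t) ≤ (cS * H * ℓ ^ 2) / 10 := by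
    have := mul_le_mul_of_nonneg_left htℓ (by positivity : 0 ≤ ℓ * (cS * H))
    linarith
  have s8 := mul_le_mul_of_nonneg_left hFG hℓ0
  have s9 : ℓ * G ≤ ℓ * (3 / 2 * √(cS * H) * √(∑ y, P y * E y)) := by
    refine mul_le_mul_of_nonneg_left ?_ hℓ0
    have h1 := sum_sqrt_mul_le hP.1 hE0 fun y => (hE y).2
    refine h1.trans (mul_le_mul_of_nonneg_right ?_ (Real.sqrt_nonneg _))
    rw [show (3 / 2 : ℝ) = √((3 / 2) ^ 2) by rw [Real.sqrt_sq (by norm_num)],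
      ← Real.sqrt_mul (by positivity)]
    refine Real.sqrt_le_sqrt ?_
    have : 0 ≤ cS * H := by positivity
    change cS * (2 * H) ≤ _
    linarith
  have hG' : 0 ≤ ℓ * (√(cS * H) * √(∑ y, P y * E y)) := by positivity
  have hS' : 0 ≤ cS * H * ℓ ^ 2 := by positivity
  linarith

variable (hp : p.Valid) (hx : 1 ≤ x) (hxL : 100 * x ≤ logL S A p)
  (hD : Accurate M p D x) (hv : VisitsAccurate M p D x s₁)

include hp hD in
theorem totalGap_mem {k h : ℕ} (hk : k ∈ Icc 1 p.K) (hh : h ≤ p.H) (s : S) :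
    totalGap M p D k h s ∈ Set.Icc (0 : ℝ) (2 * p.H) := by
  obtain ⟨hk1, hk2⟩ := mem_Icc.1 hk
  have a1 := valAt_mem hp hD.cost_mem hk2 hh s
  have a2 := opt_mem_Icc M hh s
  have a3 := refAt_mem hp hD.cost_mem hk1 hk2 hh s
  refine ⟨by unfold totalGap; positivity, ?_⟩
  have b1 : |valAt p D k h s - M.opt p.H h s| ≤ p.H := by
    rw [abs_le]; constructor <;> linarith [a1.1, a1.2, a2.1, a2.2]
  have b2 : |refAt p D k h s - M.opt p.H h s| ≤ p.H := by
    rw [abs_le]; constructor <;> linarith [a3.1, a3.2, a2.1, a2.2]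
  unfold totalGap
  linarith

/-- The dimension factor of the terms of order `1 / n` in the bound for the Bellman errors. -/
noncomputable def fineDim (S A : Type*) [Fintype S] [Fintype A] (p : Params) : ℝ :=
  (Fintype.card S : ℝ) ^ 2 * Fintype.card A * (p.H : ℝ) ^ 2 *
    ((p.K : ℝ) ^ (1 / 4 : ℝ) * logL S A p)

omit [DecidableEq S] [DecidableEq A] in
include hp in
theorem card_mul_le_fineDim : Fintype.card S * p.H * logL S A p ≤ fineDim S A p := by
  have hS := one_le_card S
  have hA := one_le_card A
  have hH := hp.one_le_H
  have hL := two_le_logL S A hp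
  have hK : 1 ≤ (p.K : ℝ) ^ (1 / 4 : ℝ) := Real.one_le_rpow hp.one_le_K (by norm_num)
  unfold fineDim
  have a1 : (Fintype.card S : ℝ) * p.H ≤
      (Fintype.card S : ℝ) ^ 2 * Fintype.card A * (p.H : ℝ) ^ 2 := by
    have b1 : (Fintype.card S : ℝ) ≤ (Fintype.card S : ℝ) ^ 2 * Fintype.card A :=
      (le_self_pow₀ hS two_ne_zero).trans (le_mul_of_one_le_right (by positivity) hA)
    exact mul_le_mul b1 (le_self_pow₀ hH two_ne_zero) (by positivity) (by positivity)
  exact mul_le_mul a1 (le_mul_of_one_le_left (by linarith) hK) (by linarith) (by positivity)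

include hp hx hxL hD in
theorem Accurate.bellmanError_le_of_visited {k h : ℕ} (hk : k ∈ Icc 1 p.K) (hh : h < p.H) {s : S}
    {a : A} (hn : visitSA D k h s a ≠ 0) :
    bellmanError M p D k h s a ≤ √(logL S A p / visitSA D k h s a) *
        (9 * √(p.H : ℝ) + 5 * √(variance (M.P h s a) (M.opt p.H (h + 1))) +
          15 * √(Fintype.card S * p.H) *
            √(∑ y, M.P h s a y * totalGap M p D k (h + 1) y)) +
      20 * fineDim S A p / visitSA D k h s a := by
  obtain ⟨hk1, hk2⟩ := mem_Icc.1 hk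
  have hS := one_le_card S
  have hH := hp.one_le_H
  have hL : 100 ≤ logL S A p := by linarith
  have hP := M.P_mem h s a
  have hq := PBar_mem D hn
  have hn0 : (0 : ℝ) < visitSA D k h s a := by exact_mod_cast Nat.pos_of_ne_zero hn
  have hdim := card_mul_le_fineDim (S := S) (A := A) hp
  have hE := fun y => totalGap_mem hp hD hk hh y
  have hopt := fun y => opt_mem_Icc M hh y
  have hcw := costWidth_le (S := S) (A := A) hp hn0
  have hcost := (abs_le.1 (hD.cost_le hp hx hxL hk2 hh hn)).1
  have hfine := (abs_le.1 (hD.fine_le hp hx hk2 hh hn (refAt p D k (h + 1)))).1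
  have hbonus : bonusAt p D k h s a ≤ refBonus p A (visitSA D k h s a) (PBar D k h s a)
    (valAt p D k (h + 1)) (refAt p D k (h + 1)) := min_le_left _ _
  have hrb := refBonus_le (A := A) hp hn (V := valAt p D k (h + 1))
    (R := refAt p D k (h + 1)) hq
  have hQ : cBar D k h s a + ∑ y, PBar D k h s a y * valAt p D k (h + 1) y -
    bonusAt p D k h s a ≤ qAt p D k h s a := le_max_left _ _
  have hd : ∀ y, |PBar D k h s a y - M.P h s a y| ≤
      3 * (√(M.P h s a y) * √(x / visitSA D k h s a)) + 2 * √(x / visitSA D k h s a) ^ 2 :=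
    fun y => by
      rw [Real.sq_sqrt (by positivity), ← Real.sqrt_mul (hP.1 y)]
      exact hD.trans_dev k hk2 h hh s a y hn
  have hℓ2 : √(logL S A p / visitSA D k h s a) ^ 2 = logL S A p / visitSA D k h s a :=
    Real.sq_sqrt (by positivity)
  have htℓ : √(x / visitSA D k h s a) ≤ √(logL S A p / visitSA D k h s a) / 10 := by
    refine Real.sqrt_le_iff.2 ⟨by positivity, ?_⟩
    rw [div_pow, hℓ2, div_div, div_le_div_iff₀ hn0 (by positivity)]
    nlinarith
  have hcomb := deviation_sum_le hP hq (V := valAt p D k (h + 1)) (Vs := M.opt p.H (h + 1))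
    (R := refAt p D k (h + 1)) (E := totalGap M p D k (h + 1)) (H := p.H)
    (t := √(x / visitSA D k h s a)) (ℓ := √(logL S A p / visitSA D k h s a))
    (Real.sqrt_nonneg _) htℓ (by linarith) hopt hE
    (fun y => le_add_of_nonneg_right (abs_nonneg _))
    (fun y => le_rfl) hd
  rw [Real.sq_sqrt (by positivity : 0 ≤ x / (visitSA D k h s a : ℝ)), hℓ2] at hcomb
  have e7 : 7 * logL S A p / (3 * visitSA D k h s a) =
      7 / 3 * (logL S A p / visitSA D k h s a) := by field_simp
  rw [e7] at hrb
  have hX : bellmanError M p D k h s a ≤ costWidth S A p (visitSA D k h s a) -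
      ∑ y, (PBar D k h s a y - M.P h s a y) * valAt p D k (h + 1) y + bonusAt p D k h s a := by
    unfold bellmanError
    simp_rw [sub_mul, sum_sub_distrib]
    linarith
  set n : ℝ := (visitSA D k h s a : ℝ) with hnd
  have s10 : Fintype.card S * p.H * (logL S A p / n) ≤ fineDim S A p / n := by
    rw [← mul_div_assoc]
    exact div_le_div_of_nonneg_right hdim hn0.le
  have s11 : (6 * (Fintype.card S * p.H * logL S A p) + 2 * (((Fintype.card S : ℝ) ^ 2 *
      (Fintype.card A : ℝ) * (p.H : ℝ) ^ 2) * ((p.K : ℝ) ^ (1 / 4 : ℝ) * logL S A p))) / n =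
      6 * (Fintype.card S * p.H * (logL S A p / n)) + 2 * (fineDim S A p / n) := by
    unfold fineDim; field_simp
  rw [s11] at hrb
  have hℓ0 : 0 ≤ √(logL S A p / n) := Real.sqrt_nonneg _
  have hsH : √(logL S A p / n) ≤ √(p.H : ℝ) * √(logL S A p / n) :=
    le_mul_of_one_le_left hℓ0 (Real.one_le_sqrt.2 hH)
  have hdn : 0 ≤ fineDim S A p / n := le_trans (by positivity) s10
  rw [mul_div_assoc]
  have hvs : 0 ≤ √(logL S A p / n) * √(variance (M.P h s a) (M.opt p.H (h + 1))) := by positivity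
  linarith

end Fine

/-! ### The regret on the event that the data are accurate -/

section Regret

variable {S A : Type*} [Fintype S] [Fintype A] [DecidableEq S] [DecidableEq A] [Nonempty A]
variable {M : MDP S A} {p : Params} {D : ℕ → Episode S A} {x : ℝ} {s₁ : S}
variable [Nonempty S] (hp : p.Valid) (hx : 1 ≤ x) (hxL : 100 * x ≤ logL S A p)
  (hD : Accurate M p D x) (hv : VisitsAccurate M p D x s₁)

include hp hx hxL hD in
/-- The bound for the Bellman errors in terms of the number of visits before the episode. -/
theorem Accurate.bellmanError_le {k h : ℕ} (hk : k ∈ Icc 1 p.K) (hh : h < p.H) (s : S) (a : A) :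
    bellmanError M p D k h s a ≤
      9 * (√(p.H : ℝ) * √(logL S A p)) * (√1 * √(1 / pastVisits D k h s a)) +
      5 * √(logL S A p) * (√(variance (M.P h s a) (M.opt p.H (h + 1))) *
        √(1 / pastVisits D k h s a)) +
      15 * (√(Fintype.card S * p.H) * √(logL S A p)) *
        (√(∑ y, M.P h s a y * totalGap M p D k (h + 1) y) * √(1 / pastVisits D k h s a)) +
      20 * fineDim S A p * (1 / pastVisits D k h s a) := by
  have hm := one_le_pastVisits (D := D) k h s a
  have hL := two_le_logL S A hp
  have hS := one_le_card S
  have hH := hp.one_le_H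
  have hdim := card_mul_le_fineDim (S := S) (A := A) hp
  have hdim0 : 0 ≤ fineDim S A p := le_trans (by positivity) hdim
  by_cases hn : visitSA D k h s a = 0
  -- at an unvisited pair `pastVisits` is `1`, and the last term alone exceeds `H`
  · have h1 : bellmanError M p D k h s a ≤ p.H := by
      unfold bellmanError
      rw [qAt_eq_zero hp hn, sub_zero]
      exact (model_value_mem hp hD (mem_Icc.1 hk).2 hh s a).2
    have hn' : visitSA D (k - 1) h s a = 0 := by
      have := visitSA_mono D (Nat.sub_le k 1) h s a
      omega
    have h2 : pastVisits D k h s a = 1 := by simp [pastVisits, hn']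
    have h3 : (p.H : ℝ) ≤ Fintype.card S * p.H * logL S A p := by
      have := one_le_mul_of_one_le_of_one_le hS (by linarith : 1 ≤ logL S A p)
      nlinarith
    have h4 : (p.H : ℝ) ≤ 20 * fineDim S A p * (1 / pastVisits D k h s a) := by
      rw [h2]; linarith
    refine h1.trans (h4.trans (le_add_of_nonneg_left ?_))
    positivity
  · have h1 := hD.bellmanError_le_of_visited hp hx hxL hk hh hn
    have hnm := pastVisits_le (k := k) hn
    have hn0 : (0 : ℝ) < visitSA D k h s a := by linarith
    have h2 : √(logL S A p / visitSA D k h s a) ≤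
        √(logL S A p) * √(1 / pastVisits D k h s a) := by
      rw [← Real.sqrt_mul (by linarith), mul_one_div]
      exact Real.sqrt_le_sqrt (div_le_div_of_nonneg_left (by linarith) (by linarith) hnm)
    have h3 : 20 * fineDim S A p / visitSA D k h s a ≤
        20 * fineDim S A p * (1 / pastVisits D k h s a) := by
      rw [mul_one_div]
      exact div_le_div_of_nonneg_left (by positivity) (by linarith) hnm
    refine h1.trans (add_le_add ?_ h3)
    refine (mul_le_mul_of_nonneg_right h2 (by positivity)).trans (le_of_eq ?_)
    rw [Real.sqrt_one]
    ring

omit [Nonempty S] in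
theorem sum_visitProb_mul_next (k : ℕ) (f : ℕ → S → ℝ) (h : ℕ) :
    ∑ s, ∑ a, visitProb M p D s₁ k h s a * ∑ y, M.P h s a y * f (h + 1) y =
      ∑ y, occ M.P (policyAt p D k) s₁ (h + 1) y * f (h + 1) y :=
  (sum_occ_succ_mul M.P (policyAt p D k) s₁ h (f (h + 1))).symm

include hp hx hxL hD hv in
theorem VisitsAccurate.sum_bellmanError_le {cA : ℝ} (hcA : 0 ≤ cA)
    (hX : ∑ k ∈ Icc 1 p.K, (valAt p D k 0 s₁ - M.opt p.H 0 s₁) ≤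
      cA * √(Fintype.card A * (p.H : ℝ) ^ 4 * p.K)) :
    ∑ k ∈ Icc 1 p.K, ∑ h ∈ range p.H, ∑ s, ∑ a,
      visitProb M p D s₁ k h s a * bellmanError M p D k h s a ≤
      17 * logL S A p ^ 2 * √(Fintype.card S * Fintype.card A * (p.H : ℝ) ^ 3 * p.K) +
      (20 + 15 * √(63 + 3 * cA)) * ((Fintype.card S : ℝ) ^ 3 * (Fintype.card A : ℝ) ^ 2 *
        (p.H : ℝ) ^ 3 * logL S A p ^ 4) * (p.K : ℝ) ^ (1 / 4 : ℝ) := by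
  have hL := two_le_logL S A hp
  have hS := one_le_card S
  have hA := one_le_card A
  have hH := hp.one_le_H
  have hq0 := visitProb_nonneg (M := M) (p := p) (D := D) (s₁ := s₁)
  have hm := fun k h s a => one_le_pastVisits (D := D) k h s a
  have hinv : ∀ k h s a, 0 ≤ 1 / pastVisits D k h s a := fun k h s a =>
    one_div_nonneg.2 (by linarith [hm k h s a])
  have hΓ := hv.sum_all_visitProb_div_le hp hx hxL
  simp_rw [div_eq_mul_one_div (visitProb _ _ _ _ _ _ _ _)] at hΓ
  set Γ := Fintype.card S * Fintype.card A * p.H * logL S A p ^ 2 with hΓd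
  have hsΓ := Real.sqrt_le_sqrt hΓ
  -- the three Cauchy–Schwarz estimates
  have c1 := sum_all_mul_le_sqrt (visitProb M p D s₁) (fun _ _ _ _ => 1)
    (fun k h s a => 1 / pastVisits D k h s a) hq0 p.K p.H (fun _ _ _ _ => zero_le_one) hinv
  have c2 := sum_all_mul_le_sqrt (visitProb M p D s₁)
    (fun _ h s a => variance (M.P h s a) (M.opt p.H (h + 1)))
    (fun k h s a => 1 / pastVisits D k h s a) hq0 p.K p.H
    (fun _ h s a => variance_nonneg (M.P_mem h s a).1 _) hinv
  have c3 := sum_all_mul_le_sqrt (visitProb M p D s₁)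
    (fun k h s a => ∑ y, M.P h s a y * totalGap M p D k (h + 1) y)
    (fun k h s a => 1 / pastVisits D k h s a) hq0 p.K p.H
    (fun k h s a => sum_nonneg fun y _ => mul_nonneg ((M.P_mem h s a).1 y)
      (by unfold totalGap; positivity)) hinv
  simp_rw [mul_one, sum_sum_visitProb, sum_const, card_range, Nat.card_Icc,
    nsmul_eq_mul, mul_one, Nat.add_sub_cancel] at c1
  have v2 : ∑ k ∈ Icc 1 p.K, ∑ h ∈ range p.H, ∑ s, ∑ a, visitProb M p D s₁ k h s a *
      variance (M.P h s a) (M.opt p.H (h + 1)) ≤ p.K * (2 * (p.H : ℝ) ^ 2) := by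
    refine (sum_le_card_nsmul _ _ _ fun k _ =>
      sum_occ_variance_le M (policyAt_mem p D k) p.H s₁).trans (le_of_eq ?_)
    rw [Nat.card_Icc, nsmul_eq_mul, Nat.add_sub_cancel]
  have v3 : ∑ k ∈ Icc 1 p.K, ∑ h ∈ range p.H, ∑ s, ∑ a, visitProb M p D s₁ k h s a *
      ∑ y, M.P h s a y * totalGap M p D k (h + 1) y ≤ p.H * gapTotalBound S A p cA := by
    simp_rw [sum_visitProb_mul_next]
    rw [sum_comm]
    refine (sum_le_card_nsmul _ _ _ fun h hh => sum_occ_mul_totalGap_le hp hx hxL hD hv hcA hX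
      (mem_range.1 hh)).trans (le_of_eq ?_)
    rw [card_range, nsmul_eq_mul]
  replace c1 := c1.trans (mul_le_mul_of_nonneg_left hsΓ (Real.sqrt_nonneg _))
  replace c2 := c2.trans (mul_le_mul (Real.sqrt_le_sqrt v2) hsΓ (Real.sqrt_nonneg _)
    (Real.sqrt_nonneg _))
  replace c3 := c3.trans (mul_le_mul (Real.sqrt_le_sqrt v3) hsΓ (Real.sqrt_nonneg _)
    (Real.sqrt_nonneg _))
  have hmain : ∑ k ∈ Icc 1 p.K, ∑ h ∈ range p.H, ∑ s, ∑ a,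
      visitProb M p D s₁ k h s a * bellmanError M p D k h s a ≤
      9 * (√(p.H : ℝ) * √(logL S A p)) * (√(p.K * p.H) * √Γ) +
      5 * √(logL S A p) * (√(p.K * (2 * (p.H : ℝ) ^ 2)) * √Γ) +
      15 * (√(Fintype.card S * p.H) * √(logL S A p)) *
        (√(p.H * gapTotalBound S A p cA) * √Γ) + 20 * fineDim S A p * Γ := by
    have d1 := mul_le_mul_of_nonneg_left c1
      (by positivity : 0 ≤ 9 * (√(p.H : ℝ) * √(logL S A p)))
    have d2 := mul_le_mul_of_nonneg_left c2 (by positivity : 0 ≤ 5 * √(logL S A p))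
    have d3 := mul_le_mul_of_nonneg_left c3
      (by positivity : 0 ≤ 15 * (√(Fintype.card S * p.H) * √(logL S A p)))
    have hdim := card_mul_le_fineDim (S := S) (A := A) hp
    have hdim0 : 0 ≤ fineDim S A p := le_trans (by positivity) hdim
    have d4 := mul_le_mul_of_nonneg_left hΓ (by positivity : 0 ≤ 20 * fineDim S A p)
    refine le_trans ?_ (add_le_add (add_le_add (add_le_add d1 d2) d3) d4)
    simp_rw [mul_sum, ← sum_add_distrib]
    refine sum_le_sum fun k hk => sum_le_sum fun h hh => sum_le_sum fun s _ =>
      sum_le_sum fun a _ => ?_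
    have := mul_le_mul_of_nonneg_left
      (hD.bellmanError_le hp hx hxL hk (mem_range.1 hh) s a) (hq0 k h s a)
    refine this.trans (le_of_eq ?_)
    ring
  refine hmain.trans ?_
  have hG : gapTotalBound S A p cA = 3 * (21 + cA) * ((Fintype.card S : ℝ) ^ 3 *
    (Fintype.card A : ℝ) ^ 2 * (p.H : ℝ) ^ 3 * logL S A p ^ 4) * √(p.K : ℝ) := rfl
  rw [hG, hΓd]
  unfold fineDim
  have hkq0 : 0 ≤ (p.K : ℝ) ^ (1 / 4 : ℝ) := by positivity
  rw [← fourth_root_sq p]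
  set kq := (p.K : ℝ) ^ (1 / 4 : ℝ) with hkq
  set cS : ℝ := (Fintype.card S : ℝ) with hcS
  set nA : ℝ := (Fintype.card A : ℝ) with hnA
  set L := logL S A p with hLd
  set H : ℝ := (p.H : ℝ) with hHd
  have hK0 : (0 : ℝ) ≤ p.K := Nat.cast_nonneg _
  have hL32 : L * √L ≤ L ^ 2 := by
    have hs : √L ≤ L := Real.sqrt_le_iff.2 ⟨by linarith, by nlinarith⟩
    rw [sq]; exact mul_le_mul_of_nonneg_left hs (by linarith)
  have eΓ : √(cS * nA * H * L ^ 2) = √(cS * nA * H) * L := by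
    rw [Real.sqrt_mul (by positivity), Real.sqrt_sq (by linarith)]
  have e1 : √H * √L * (√(p.K * H) * √(cS * nA * H * L ^ 2)) =
      L * √L * √(cS * nA * H ^ 3 * p.K) := by
    have : √H * √(p.K * H) * √(cS * nA * H) = √(cS * nA * H ^ 3 * p.K) := by
      rw [← Real.sqrt_mul (by positivity), ← Real.sqrt_mul (by positivity)]
      congr 1
      ring
    rw [eΓ, ← this]
    ring
  have e2 : √L * (√(p.K * (2 * H ^ 2)) * √(cS * nA * H * L ^ 2)) ≤
      3 / 2 * (L * √L * √(cS * nA * H ^ 3 * p.K)) := by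
    have h1 : √(p.K * (2 * H ^ 2)) * √(cS * nA * H) ≤ 3 / 2 * √(cS * nA * H ^ 3 * p.K) := by
      rw [← Real.sqrt_mul (by positivity)]
      refine Real.sqrt_le_iff.2 ⟨by positivity, ?_⟩
      rw [mul_pow, Real.sq_sqrt (by positivity)]
      have : 0 ≤ cS * nA * H ^ 3 * p.K := by positivity
      linarith
    have := mul_le_mul_of_nonneg_left h1 (by positivity : 0 ≤ L * √L)
    rw [eΓ]
    linarith
  have e3 : √(cS * H) * √L * (√(H * (3 * (21 + cA) * (cS ^ 3 * nA ^ 2 * H ^ 3 * L ^ 4) * kq ^ 2)) *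
      √(cS * nA * H * L ^ 2)) ≤ √(63 + 3 * cA) * (cS ^ 3 * nA ^ 2 * H ^ 3 * L ^ 4) * kq := by
    rw [← Real.sqrt_mul (by positivity), ← Real.sqrt_mul (by positivity),
      ← Real.sqrt_mul (by positivity)]
    refine Real.sqrt_le_iff.2 ⟨by positivity, ?_⟩
    rw [mul_pow, mul_pow, Real.sq_sqrt (by positivity)]
    have h3 : cS ^ 5 * nA ^ 3 * H ^ 6 * L ^ 7 ≤ cS ^ 6 * nA ^ 4 * H ^ 6 * L ^ 8 := by
      have a1 : cS ^ 5 ≤ cS ^ 6 := pow_le_pow_right₀ hS (by norm_num)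
      have a2 : nA ^ 3 ≤ nA ^ 4 := pow_le_pow_right₀ hA (by norm_num)
      have a3 : L ^ 7 ≤ L ^ 8 := pow_le_pow_right₀ (by linarith) (by norm_num)
      exact mul_le_mul (mul_le_mul_of_nonneg_right (mul_le_mul a1 a2 (by positivity)
        (by positivity)) (by positivity)) a3 (by positivity) (by positivity)
    have := mul_le_mul_of_nonneg_left h3 (by positivity : 0 ≤ (63 + 3 * cA) * kq ^ 2)
    linarith
  have e4 : cS ^ 2 * nA * H ^ 2 * (kq * L) * (cS * nA * H * L ^ 2) ≤
      cS ^ 3 * nA ^ 2 * H ^ 3 * L ^ 4 * kq := by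
    have a3 : L ^ 3 ≤ L ^ 4 := pow_le_pow_right₀ (by linarith) (by norm_num)
    have := mul_le_mul_of_nonneg_left a3 (by positivity : 0 ≤ cS ^ 3 * nA ^ 2 * H ^ 3 * kq)
    linarith
  have e5 := mul_le_mul_of_nonneg_right hL32 (Real.sqrt_nonneg (cS * nA * H ^ 3 * p.K))
  have e6 : 0 ≤ L * √L * √(cS * nA * H ^ 3 * p.K) := by positivity
  linarith

include hp hx hxL hD hv in
/-- The regret bound on the event that the data are accurate. -/
theorem VisitsAccurate.regret_le {lam : ℝ} (hlam : 0 < lam) (hlam1 : lam ≤ 1)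
    (hlamH : lam * p.H ≤ 1 / 2) {c₁ c₂ : ℝ} (hc₁ : 0 < c₁) (hc₂ : 0 ≤ c₂)
    (hlamx : 25 * x ≤ lam * (p.K : ℝ) ^ (1 / 4 : ℝ))
    (hK : 16 * (Fintype.card S : ℝ) * (p.H : ℝ) ^ 2 * logL S A p ≤ √(p.K : ℝ))
    (hvar : 1400 * lam * ((Fintype.card S : ℝ) ^ 5 * (Fintype.card A : ℝ) ^ 2 * (p.H : ℝ) ^ 4 *
        logL S A p ^ 2) ≤ 1)
    (hη : ∀ t ∈ Icc 1 p.K, c₁ * √(1 / ((p.H : ℝ) ^ 2 * Fintype.card A * t)) ≤ p.η t ∧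
      p.η t ≤ c₂ * √(1 / ((p.H : ℝ) ^ 2 * Fintype.card A * t)))
    (hanti : AntitoneOn p.η (Set.Icc 1 p.K)) :
    regret M p s₁ D ≤
      17 * logL S A p ^ 2 * √(Fintype.card S * Fintype.card A * (p.H : ℝ) ^ 3 * p.K) +
      (20 + 15 * √(63 + 3 * (6 / c₁ + c₂))) * ((Fintype.card S : ℝ) ^ 3 *
        (Fintype.card A : ℝ) ^ 2 * (p.H : ℝ) ^ 3 * logL S A p ^ 4) * (p.K : ℝ) ^ (1 / 4 : ℝ) +
      (6 / c₁ + c₂) * √(Fintype.card A * (p.H : ℝ) ^ 4 * p.K) := by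
  have hX := hD.sum_valAt_sub_opt_le s₁ hp hx hxL hlam hlam1 hlamH hc₁ hlamx hK hvar hη hanti
  have h1 := hv.sum_bellmanError_le hp hx hxL hD (by positivity) hX
  unfold regret
  calc _ ≤ ∑ k ∈ Icc 1 p.K, (∑ h ∈ range p.H, ∑ s, ∑ a,
        visitProb M p D s₁ k h s a * bellmanError M p D k h s a +
        (valAt p D k 0 s₁ - M.opt p.H 0 s₁)) := by
        refine sum_le_sum fun k _ => ?_
        have := value_sub_valAt M p D k s₁
        have := opt_le_optValue M p.H s₁
        linarith
    _ ≤ _ := by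
        rw [sum_add_distrib]
        exact add_le_add h1 hX

end Regret

/-! ### A maximal Bernstein inequality for adapted sums -/

theorem exp_le_one_add_add_sq {y : ℝ} (hy : |y| ≤ 1) : Real.exp y ≤ 1 + y + y ^ 2 := by
  have := Real.abs_exp_sub_one_sub_id_le hy
  linarith [(abs_le.1 this).2]

section Adapted

variable {Ω : Type*} [m0 : MeasurableSpace Ω] {μ : Measure Ω}

/-- The increments `ξ 1, …, ξ K` are centered and have conditional variance at most `v k`, given
the information `𝒢 k` available before `ξ k` is revealed. Conditional expectations are expressed
by testing against bounded nonnegative `𝒢 k`-measurable functions. -/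
structure IncrementBounds (μ : Measure Ω) (𝒢 : ℕ → MeasurableSpace Ω) (ξ v : ℕ → Ω → ℝ) (K : ℕ) :
    Prop where
  le : ∀ k, 𝒢 k ≤ m0
  meas : ∀ k ∈ Icc 1 K, Measurable (ξ k)
  past : ∀ k ∈ Icc 1 K, ∀ i ∈ Ico 1 k, Measurable[𝒢 k] (ξ i)
  meas_v : ∀ k ∈ Icc 1 K, ∀ i ∈ Icc 1 k, Measurable[𝒢 k] (v i)
  abs_le : ∀ k ∈ Icc 1 K, ∀ ω, |ξ k ω| ≤ 1
  v_nonneg : ∀ k ∈ Icc 1 K, ∀ ω, 0 ≤ v k ω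
  mean : ∀ k ∈ Icc 1 K, ∀ G : Ω → ℝ, Measurable[𝒢 k] G → (∀ ω, 0 ≤ G ω) → (∃ C, ∀ ω, G ω ≤ C) →
    ∫ ω, G ω * ξ k ω ∂μ = 0
  var : ∀ k ∈ Icc 1 K, ∀ G : Ω → ℝ, Measurable[𝒢 k] G → (∀ ω, 0 ≤ G ω) → (∃ C, ∀ ω, G ω ≤ C) →
    ∫ ω, G ω * ξ k ω ^ 2 ∂μ ≤ ∫ ω, G ω * v k ω ∂μ
  v_le : ∀ k ∈ Icc 1 K, ∀ ω, v k ω ≤ 1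

variable {𝒢 : ℕ → MeasurableSpace Ω} {ξ v : ℕ → Ω → ℝ} {K : ℕ}

theorem IncrementBounds.neg (h : IncrementBounds μ 𝒢 ξ v K) :
    IncrementBounds μ 𝒢 (fun k ω => -ξ k ω) v K where
  le := h.le
  meas k hk := (h.meas k hk).neg
  past k hk i hi := (h.past k hk i hi).neg
  meas_v := h.meas_v
  abs_le k hk ω := by rw [abs_neg]; exact h.abs_le k hk ω
  v_nonneg := h.v_nonneg
  mean k hk G hG h0 hC := by
    simp_rw [mul_neg, integral_neg, h.mean k hk G hG h0 hC, neg_zero]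
  var k hk G hG h0 hC := by simp_rw [neg_sq]; exact h.var k hk G hG h0 hC
  v_le := h.v_le

theorem integrable_of_bounded [IsFiniteMeasure μ] {f : Ω → ℝ} (hf : Measurable f) {C : ℝ}
    (hC : ∀ ω, |f ω| ≤ C) : Integrable f μ :=
  Integrable.of_bound hf.aestronglyMeasurable C
    (Filter.Eventually.of_forall fun ω => by rw [Real.norm_eq_abs]; exact hC ω)

variable [IsProbabilityMeasure μ]

/-- The exponential moment of a stopped compensated sum is at most `1`. -/
theorem IncrementBounds.integral_exp_le (h : IncrementBounds μ 𝒢 ξ v K) {lam : ℝ} (h0 : 0 ≤ lam)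
    (h1 : lam ≤ 1) {b : ℕ → Ω → Prop} [∀ i ω, Decidable (b i ω)]
    (hb : ∀ k ∈ Icc 1 K, ∀ i ∈ Icc 1 k, MeasurableSet[𝒢 k] {ω | b i ω}) :
    ∀ n ≤ K, ∫ ω, Real.exp (∑ i ∈ Icc 1 n,
      if b i ω then lam * ξ i ω - lam ^ 2 * v i ω else 0) ∂μ ≤ 1 := by
  intro n
  induction n with
  | zero => simp
  | succ n ih =>
    intro hn
    refine le_trans ?_ (ih (by omega))
    have hmem : n + 1 ∈ Icc 1 K := mem_Icc.2 ⟨by omega, hn⟩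
    set k := n + 1 with hk
    set Y : ℕ → Ω → ℝ := fun i ω => if b i ω then lam * ξ i ω - lam ^ 2 * v i ω else 0 with hY
    have hYm : ∀ i ∈ Icc 1 n, Measurable[𝒢 k] (Y i) := fun i hi => by
      obtain ⟨hi1, hi2⟩ := mem_Icc.1 hi
      refine Measurable.ite (hb k hmem i (mem_Icc.2 ⟨hi1, by omega⟩)) ?_ measurable_const
      exact ((h.past k hmem i (mem_Ico.2 ⟨hi1, by omega⟩)).const_mul _).sub
        ((h.meas_v k hmem i (mem_Icc.2 ⟨hi1, by omega⟩)).const_mul _)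
    have hYle : ∀ i ∈ Icc 1 K, ∀ ω, Y i ω ≤ 1 := fun i hi ω => by
      simp only [hY]
      split_ifs
      · have a1 := (_root_.abs_le.1 (h.abs_le i hi ω)).2
        have a2 := h.v_nonneg i hi ω
        have a3 : 0 ≤ lam ^ 2 * v i ω := mul_nonneg (sq_nonneg _) a2
        nlinarith
      · exact zero_le_one
    set G : Ω → ℝ := fun ω => Real.exp (∑ i ∈ Icc 1 n, Y i ω) with hG
    have hGm : Measurable[𝒢 k] G :=
      Real.measurable_exp.comp (Finset.measurable_sum _ fun i hi => hYm i hi)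
    have hG0 : ∀ ω, 0 ≤ G ω := fun ω => (Real.exp_pos _).le
    have hGC : ∀ ω, G ω ≤ Real.exp n := fun ω => by
      refine Real.exp_le_exp.2 ?_
      refine (sum_le_card_nsmul _ _ 1 fun i hi => hYle i
        (mem_Icc.2 ⟨(mem_Icc.1 hi).1, (mem_Icc.1 hi).2.trans (by omega)⟩) ω).trans ?_
      simp
    have hbm : MeasurableSet[𝒢 k] {ω | b k ω} := hb k hmem k (mem_Icc.2 ⟨by omega, le_rfl⟩)
    have hvm : Measurable[𝒢 k] (v k) := h.meas_v k hmem k (mem_Icc.2 ⟨by omega, le_rfl⟩)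
    -- the weight on the part of the space where the sum is not yet stopped
    set F : Ω → ℝ := fun ω => if b k ω then G ω * Real.exp (-(lam ^ 2 * v k ω)) else 0 with hF
    have hFm : Measurable[𝒢 k] F := Measurable.ite hbm
      (hGm.mul (Real.measurable_exp.comp (hvm.const_mul _).neg)) measurable_const
    have hF0 : ∀ ω, 0 ≤ F ω := fun ω => by
      simp only [hF]; split_ifs
      · exact mul_nonneg (hG0 ω) (Real.exp_pos _).le
      · exact le_rfl
    have hFG : ∀ ω, F ω ≤ G ω := fun ω => by
      simp only [hF]; split_ifs
      · refine mul_le_of_le_one_right (hG0 ω) (Real.exp_le_one_iff.2 ?_)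
        have := mul_nonneg (sq_nonneg lam) (h.v_nonneg k hmem ω)
        linarith
      · exact hG0 ω
    have hFC : ∀ ω, F ω ≤ Real.exp n := fun ω => (hFG ω).trans (hGC ω)
    have hξm := h.meas k hmem
    have hle := h.le k
    have iG : Integrable G μ := integrable_of_bounded (hGm.mono hle le_rfl)
      (fun ω => by rw [abs_of_nonneg (hG0 ω)]; exact hGC ω)
    have iF : Integrable F μ := integrable_of_bounded (hFm.mono hle le_rfl)
      (fun ω => by rw [abs_of_nonneg (hF0 ω)]; exact hFC ω)
    have iFξ : Integrable (fun ω => F ω * ξ k ω) μ :=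
      integrable_of_bounded ((hFm.mono hle le_rfl).mul hξm) (C := Real.exp n * 1) fun ω => by
        rw [abs_mul, abs_of_nonneg (hF0 ω)]
        exact mul_le_mul (hFC ω) (h.abs_le k hmem ω) (abs_nonneg _) (Real.exp_pos _).le
    have iFξ2 : Integrable (fun ω => F ω * ξ k ω ^ 2) μ :=
      integrable_of_bounded ((hFm.mono hle le_rfl).mul (hξm.pow_const 2)) (C := Real.exp n * 1)
        fun ω => by
        rw [abs_mul, abs_of_nonneg (hF0 ω), abs_of_nonneg (sq_nonneg _)]
        refine mul_le_mul (hFC ω) ?_ (sq_nonneg _) (Real.exp_pos _).le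
        rw [← sq_abs]
        exact pow_le_one₀ (abs_nonneg _) (h.abs_le k hmem ω)
    have iFv : Integrable (fun ω => F ω * v k ω) μ :=
      integrable_of_bounded ((hFm.mul hvm).mono hle le_rfl) (C := Real.exp n * 1) fun ω => by
        rw [abs_mul, abs_of_nonneg (hF0 ω), abs_of_nonneg (h.v_nonneg k hmem ω)]
        exact mul_le_mul (hFC ω) (h.v_le k hmem ω) (h.v_nonneg k hmem ω) (Real.exp_pos _).le
    have hpt : ∀ ω, Real.exp (∑ i ∈ Icc 1 k, Y i ω) ≤
        G ω - (if b k ω then G ω else 0) + (F ω + lam * (F ω * ξ k ω) +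
          lam ^ 2 * (F ω * ξ k ω ^ 2)) := fun ω => by
      rw [hk, sum_Icc_succ_top (by omega), Real.exp_add]
      simp only [hY, hF]
      split_ifs with hbω
      · have a1 : |lam * ξ k ω| ≤ 1 := by
          rw [abs_mul, abs_of_nonneg h0]
          exact mul_le_one₀ h1 (abs_nonneg _) (h.abs_le k hmem ω)
        have a2 := exp_le_one_add_add_sq a1
        rw [sub_eq_add_neg, Real.exp_add]
        have a3 : 0 ≤ G ω * Real.exp (-(lam ^ 2 * v k ω)) :=
          mul_nonneg (hG0 ω) (Real.exp_pos _).le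
        have a4 := mul_le_mul_of_nonneg_left a2 a3
        have e : G ω = Real.exp (∑ i ∈ Icc 1 n, Y i ω) := rfl
        simp only [hY] at e
        rw [← e]
        nlinarith
      · have e : G ω = Real.exp (∑ i ∈ Icc 1 n, Y i ω) := rfl
        simp only [hY] at e
        rw [← e]
        simp
    have hbG : ∀ ω, F ω + lam ^ 2 * (F ω * v k ω) ≤ if b k ω then G ω else 0 := fun ω => by
      simp only [hF]
      split_ifs
      · have a1 := Real.add_one_le_exp (lam ^ 2 * v k ω)
        have a2 := mul_le_mul_of_nonneg_left a1
          (mul_nonneg (hG0 ω) (Real.exp_pos (-(lam ^ 2 * v k ω))).le)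
        rw [mul_assoc (G ω), mul_assoc (G ω), ← Real.exp_add, neg_add_cancel, Real.exp_zero,
          mul_one] at a2
        linarith
      · simp
    have ibG : Integrable (fun ω => if b k ω then G ω else 0) μ :=
      integrable_of_bounded ((Measurable.ite hbm hGm measurable_const).mono hle le_rfl)
        (C := Real.exp n) fun ω => by
        split_ifs
        · rw [abs_of_nonneg (hG0 ω)]; exact hGC ω
        · rw [abs_zero]; exact (Real.exp_pos _).le
    have hmean := h.mean k hmem F hFm hF0 ⟨_, hFC⟩
    have hvar := h.var k hmem F hFm hF0 ⟨_, hFC⟩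
    have i1 : Integrable (fun ω => G ω - (if b k ω then G ω else 0)) μ := iG.sub ibG
    have i2 : Integrable (fun ω => F ω + lam * (F ω * ξ k ω)) μ := iF.add (iFξ.const_mul _)
    have i3 : Integrable (fun ω => F ω + lam * (F ω * ξ k ω) + lam ^ 2 * (F ω * ξ k ω ^ 2)) μ :=
      i2.add (iFξ2.const_mul _)
    have step1 := integral_mono_of_nonneg (μ := μ)
      (Filter.Eventually.of_forall fun ω => (Real.exp_pos (∑ i ∈ Icc 1 k, Y i ω)).le)
      (i1.add i3) (Filter.Eventually.of_forall hpt)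
    have step2 := integral_mono (iF.add (iFv.const_mul (lam ^ 2))) ibG hbG
    simp only [Pi.add_apply] at step1 step2
    rw [integral_add i1 i3, integral_sub iG ibG, integral_add i2 (iFξ2.const_mul _),
      integral_add iF (iFξ.const_mul _), integral_const_mul, integral_const_mul, hmean] at step1
    rw [integral_add iF (iFv.const_mul _), integral_const_mul] at step2
    have := mul_le_mul_of_nonneg_left hvar (sq_nonneg lam)
    linarith

theorem IncrementBounds.measure_exceed_le (h : IncrementBounds μ 𝒢 ξ v K) {lam x : ℝ}
    (h0 : 0 < lam) (h1 : lam ≤ 1) :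
    μ {ω | ∃ n ≤ K, lam * ∑ i ∈ Icc 1 n, v i ω + x / lam < ∑ i ∈ Icc 1 n, ξ i ω} ≤
      ENNReal.ofReal (Real.exp (-x)) := by
  classical
  set Y : ℕ → Ω → ℝ := fun i ω => lam * ξ i ω - lam ^ 2 * v i ω with hY
  -- the sum is stopped once it exceeds `x`
  set b : ℕ → Ω → Prop := fun i ω => ∀ j < i, ∑ l ∈ Icc 1 j, Y l ω ≤ x with hb
  have hbm : ∀ k ∈ Icc 1 K, ∀ i ∈ Icc 1 k, MeasurableSet[𝒢 k] {ω | b i ω} := by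
    intro k hk i hi
    have e : {ω | b i ω} = ⋂ j ∈ range i, {ω | ∑ l ∈ Icc 1 j, Y l ω ≤ x} := by
      ext ω; simp [hb]
    rw [e]
    refine Finset.measurableSet_biInter _ fun j hj => ?_
    refine measurableSet_le (Finset.measurable_sum _ fun l hl => ?_) measurable_const
    have hj' := mem_range.1 hj
    obtain ⟨hl1, hl2⟩ := mem_Icc.1 hl
    obtain ⟨hi1, hi2⟩ := mem_Icc.1 hi
    exact ((h.past k hk l (mem_Ico.2 ⟨hl1, by omega⟩)).const_mul _).sub
      ((h.meas_v k hk l (mem_Icc.2 ⟨hl1, by omega⟩)).const_mul _)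
  have hint := h.integral_exp_le h0.le h1 hbm K le_rfl
  set Z : Ω → ℝ := fun ω => ∑ i ∈ Icc 1 K, if b i ω then Y i ω else 0 with hZ
  have hsub : {ω | ∃ n ≤ K, lam * ∑ i ∈ Icc 1 n, v i ω + x / lam < ∑ i ∈ Icc 1 n, ξ i ω} ⊆
      {ω | Real.exp x ≤ Real.exp (Z ω)} := by
    rintro ω ⟨n, hnK, hn⟩
    have hex : ∃ n, n ≤ K ∧ x < ∑ i ∈ Icc 1 n, Y i ω := by
      refine ⟨n, hnK, ?_⟩
      simp only [hY]
      rw [sum_sub_distrib, ← mul_sum, ← mul_sum]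
      have := mul_lt_mul_of_pos_left hn h0
      rw [mul_add, mul_div_cancel₀ _ h0.ne'] at this
      linarith
    -- at the first exceedance the stopped sum agrees with the sum
    set m := Nat.find hex with hm
    obtain ⟨hmK, hmx⟩ := Nat.find_spec hex
    rw [← hm] at hmK hmx
    have hbefore : ∀ i ≤ m, b i ω := fun i hi j hj => by
      have := Nat.find_min hex (lt_of_lt_of_le hj hi)
      push Not at this
      exact this (by omega)
    have hafter : ∀ i, m < i → ¬ b i ω := fun i hi hbi => absurd (hbi m hi) (not_le.2 hmx)
    have hZm : Z ω = ∑ i ∈ Icc 1 m, Y i ω := by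
      simp only [hZ]
      rw [← sum_filter]
      refine sum_congr ?_ fun _ _ => rfl
      ext i
      simp only [mem_filter, mem_Icc]
      constructor
      · rintro ⟨⟨a1, a2⟩, a3⟩
        refine ⟨a1, ?_⟩
        by_contra hlt
        exact hafter i (by omega) a3
      · rintro ⟨a1, a2⟩
        exact ⟨⟨a1, by omega⟩, hbefore i a2⟩
    change Real.exp x ≤ Real.exp (Z ω)
    rw [hZm]
    exact Real.exp_le_exp.2 hmx.le
  have hbm0 : ∀ i ∈ Icc 1 K, MeasurableSet {ω | b i ω} := fun i hi =>
    h.le i _ (hbm i hi i (mem_Icc.2 ⟨(mem_Icc.1 hi).1, le_rfl⟩))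
  have hZm : Measurable Z := Finset.measurable_sum _ fun i hi => by
    refine Measurable.ite (hbm0 i hi) ?_ measurable_const
    exact ((h.meas i hi).const_mul _).sub
      (((h.meas_v i hi i (mem_Icc.2 ⟨(mem_Icc.1 hi).1, le_rfl⟩)).mono (h.le i) le_rfl).const_mul _)
  have hZle : ∀ ω, Z ω ≤ K := fun ω => by
    refine (sum_le_card_nsmul _ _ 1 fun i hi => ?_).trans (by simp)
    split_ifs
    · have a1 := (_root_.abs_le.1 (h.abs_le i hi ω)).2
      have a2 := mul_nonneg (sq_nonneg lam) (h.v_nonneg i hi ω)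
      simp only [hY]
      nlinarith
    · exact zero_le_one
  have iZ : Integrable (fun ω => Real.exp (Z ω)) μ :=
    integrable_of_bounded (Real.measurable_exp.comp hZm) (C := Real.exp K) fun ω => by
      rw [abs_of_pos (Real.exp_pos _)]
      exact Real.exp_le_exp.2 (hZle ω)
  have hmarkov := mul_meas_ge_le_integral_of_nonneg (μ := μ)
    (Filter.Eventually.of_forall fun ω => (Real.exp_pos (Z ω)).le) iZ (Real.exp x)
  refine (measure_mono hsub).trans ?_
  rw [← ENNReal.ofReal_toReal (measure_ne_top μ {ω | Real.exp x ≤ Real.exp (Z ω)})]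
  refine ENNReal.ofReal_le_ofReal ?_
  rw [Real.exp_neg, ← one_div, le_div_iff₀ (Real.exp_pos x), mul_comm]
  exact hmarkov.trans hint

omit m0 [IsProbabilityMeasure μ] in
/-- Optimizing `2^{-j} V + 2^j x` over the dyadic grid. -/
theorem le_of_dyadic {s V x : ℝ} {K : ℕ} (hx : 1 ≤ x) (hV0 : 0 ≤ V) (hV : V ≤ K)
    (h : ∀ j ≤ Nat.log 2 K, s ≤ (1 / 2) ^ j * V + x / (1 / 2) ^ j) :
    s ≤ 3 * √(V * x) + 2 * x := by
  have hx0 : 0 < x := by linarith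
  rcases le_total V x with hVx | hVx
  · have := h 0 (Nat.zero_le _)
    simp only [pow_zero, one_mul, div_one] at this
    have := Real.sqrt_nonneg (V * x)
    linarith
  · have hVpos : 0 < V := by linarith
    set r := √(V / x) with hr
    have hr1 : 1 ≤ r := Real.one_le_sqrt.2 ((one_le_div hx0).2 hVx)
    have hr2 : r ^ 2 = V / x := Real.sq_sqrt (by positivity)
    have hrK : r ≤ K := by
      have : V / x ≤ K := (div_le_self hV0 hx).trans hV
      nlinarith
    set j := Nat.log 2 ⌊r⌋₊ with hj
    have hfl : ⌊r⌋₊ ≠ 0 := (Nat.floor_pos.2 hr1).ne'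
    have hjK : j ≤ Nat.log 2 K := Nat.log_mono_right (Nat.floor_le_of_le hrK)
    have h1 : (2 : ℝ) ^ j ≤ r := by
      have := Nat.pow_log_le_self 2 hfl
      calc (2 : ℝ) ^ j ≤ ⌊r⌋₊ := by exact_mod_cast this
        _ ≤ r := Nat.floor_le (by linarith)
    have h2 : r ≤ 2 * 2 ^ j := by
      have := Nat.lt_pow_succ_log_self (b := 2) (by norm_num) ⌊r⌋₊
      have h3 : ((⌊r⌋₊ + 1 : ℕ) : ℝ) ≤ 2 ^ (j + 1) := by exact_mod_cast this
      have h4 := Nat.lt_floor_add_one r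
      rw [pow_succ] at h3
      push_cast at h3
      linarith
    have h3 := h j hjK
    have hsq : √(V * x) = r * x := by
      rw [show V * x = r ^ 2 * x ^ 2 by rw [hr2]; field_simp, Real.sqrt_mul (by positivity),
        Real.sqrt_sq (by linarith), Real.sqrt_sq (by linarith)]
    have hVr : V = r ^ 2 * x := by rw [hr2]; field_simp
    have hp : (0 : ℝ) < 2 ^ j := by positivity
    have h4 : (1 / 2 : ℝ) ^ j * V ≤ 2 * (r * x) := by
      rw [one_div, inv_pow, inv_mul_eq_div, div_le_iff₀ hp, hVr]
      have := mul_le_mul_of_nonneg_left h2 (by positivity : 0 ≤ r * x)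
      linarith
    have h5 : x / (1 / 2 : ℝ) ^ j ≤ r * x := by
      rw [one_div, inv_pow, div_inv_eq_mul, mul_comm]
      exact mul_le_mul_of_nonneg_right h1 hx0.le
    rw [hsq]
    linarith

/-- Maximal Bernstein inequality, with an error probability that grows only logarithmically
with the number of summands. -/
theorem IncrementBounds.measure_bernstein_le (h : IncrementBounds μ 𝒢 ξ v K) {x : ℝ} (hx : 1 ≤ x) :
    μ {ω | ∃ n ≤ K, 3 * √((∑ i ∈ Icc 1 n, v i ω) * x) + 2 * x < ∑ i ∈ Icc 1 n, ξ i ω} ≤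
      ENNReal.ofReal ((Nat.log 2 K + 1) * Real.exp (-x)) := by
  have hsub : {ω | ∃ n ≤ K, 3 * √((∑ i ∈ Icc 1 n, v i ω) * x) + 2 * x < ∑ i ∈ Icc 1 n, ξ i ω} ⊆
      ⋃ j ∈ range (Nat.log 2 K + 1), {ω | ∃ n ≤ K, (1 / 2 : ℝ) ^ j * ∑ i ∈ Icc 1 n, v i ω +
        x / (1 / 2 : ℝ) ^ j < ∑ i ∈ Icc 1 n, ξ i ω} := by
    rintro ω ⟨n, hn, hlt⟩
    by_contra hcon
    simp only [Set.mem_iUnion, Set.mem_ofPred_eq, not_exists, not_and, not_lt, mem_range] at hcon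
    have hmem : ∀ i ∈ Icc 1 n, i ∈ Icc 1 K := fun i hi =>
      mem_Icc.2 ⟨(mem_Icc.1 hi).1, (mem_Icc.1 hi).2.trans hn⟩
    refine absurd (le_of_dyadic (K := K) hx
      (sum_nonneg fun i hi => h.v_nonneg i (hmem i hi) ω) ?_ fun j hj =>
      hcon j (by omega) n hn) (not_le.2 hlt)
    refine (sum_le_card_nsmul _ _ 1 fun i hi => h.v_le i (hmem i hi) ω).trans ?_
    simp only [Nat.card_Icc, Nat.add_sub_cancel, nsmul_eq_mul, mul_one]
    exact_mod_cast hn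
  refine (measure_mono hsub).trans ((measure_biUnion_finset_le _ _).trans ?_)
  refine (sum_le_sum fun j _ => h.measure_exceed_le (by positivity)
    (pow_le_one₀ (by norm_num) (by norm_num))).trans ?_
  rw [sum_const, card_range, nsmul_eq_mul, ENNReal.ofReal_mul (by positivity)]
  refine mul_le_mul_left (le_of_eq ?_) _
  rw [← Nat.cast_succ, ENNReal.ofReal_natCast]

end Adapted

/-! ### Measurability of the algorithm -/

theorem measurable_mdStep {A : Type*} [Fintype A] [Nonempty A] (η : ℝ) (a : A) :
    Measurable fun x : (A → ℝ) × (A → ℝ) => mdStep η x.1 x.2 a :=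
  (continuous_mdStep η a).measurable

section Measurability

variable {S A : Type*} [Fintype S] [Fintype A] [DecidableEq S] [DecidableEq A]
variable {Ω : Type*}

/-- The data of the episodes `1, …, k` are measurable with respect to `ℱ`. -/
structure DataMeasurable (ℱ : MeasurableSpace Ω) (p : Params) (X : ℕ → Ω → Episode S A) (k : ℕ) :
    Prop where
  state : ∀ i ∈ Icc 1 k, ∀ h ≤ p.H, ∀ s, MeasurableSet[ℱ] {ω | (X i ω).state h = s}
  action : ∀ i ∈ Icc 1 k, ∀ h < p.H, ∀ a, MeasurableSet[ℱ] {ω | (X i ω).action h = a}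
  cost : ∀ i ∈ Icc 1 k, ∀ h < p.H, Measurable[ℱ] fun ω => (X i ω).cost h

variable [ℱ : MeasurableSpace Ω] {p : Params} {X : ℕ → Ω → Episode S A}

omit [Fintype S] [Fintype A] [DecidableEq S] [DecidableEq A] in
theorem DataMeasurable.mono {j k : ℕ} (hX : DataMeasurable ℱ p X k) (hjk : j ≤ k) :
    DataMeasurable ℱ p X j where
  state i hi := hX.state i (Icc_subset_Icc_right hjk hi)
  action i hi := hX.action i (Icc_subset_Icc_right hjk hi)
  cost i hi := hX.cost i (Icc_subset_Icc_right hjk hi)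

theorem measurable_card_filter {P : ℕ → Ω → Prop} [∀ i ω, Decidable (P i ω)] {k : ℕ}
    (hP : ∀ i ∈ Icc 1 k, MeasurableSet {ω | P i ω}) :
    Measurable fun ω => ((#{i ∈ Icc 1 k | P i ω} : ℕ) : ℝ) := by
  have e : (fun ω => ((#{i ∈ Icc 1 k | P i ω} : ℕ) : ℝ)) =
      fun ω => ∑ i ∈ Icc 1 k, if P i ω then (1 : ℝ) else 0 := by
    funext ω
    rw [sum_boole]
  rw [e]
  exact Finset.measurable_sum _ fun i hi => Measurable.ite (hP i hi) measurable_const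
    measurable_const

variable {k : ℕ} (hX : DataMeasurable ℱ p X k)
include hX

omit [Fintype S] [Fintype A] [DecidableEq A] in
theorem DataMeasurable.visitS {h : ℕ} (hh : h ≤ p.H) (s : S) :
    Measurable fun ω => (visitS (fun i => X i ω) k h s : ℝ) :=
  measurable_card_filter fun i hi => hX.state i hi h hh s

omit [Fintype S] [Fintype A] in
theorem DataMeasurable.visitSA {h : ℕ} (hh : h < p.H) (s : S) (a : A) :
    Measurable fun ω => (visitSA (fun i => X i ω) k h s a : ℝ) :=
  measurable_card_filter fun i hi => (hX.state i hi h hh.le s).inter (hX.action i hi h hh a)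

omit [Fintype S] [Fintype A] in
theorem DataMeasurable.visitSAS {h : ℕ} (hh : h < p.H) (s : S) (a : A) (y : S) :
    Measurable fun ω => (visitSAS (fun i => X i ω) k h s a y : ℝ) :=
  measurable_card_filter fun i hi => (hX.state i hi h hh.le s).inter
    ((hX.action i hi h hh a).inter (hX.state i hi (h + 1) hh y))

omit [Fintype S] [Fintype A] in
theorem DataMeasurable.PBar {h : ℕ} (hh : h < p.H) (s : S) (a : A) (y : S) :
    Measurable fun ω => PBar (fun i => X i ω) k h s a y :=
  (hX.visitSAS hh s a y).div (hX.visitSA hh s a)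

omit [Fintype S] [Fintype A] in
theorem DataMeasurable.cBar {h : ℕ} (hh : h < p.H) (s : S) (a : A) :
    Measurable fun ω => cBar (fun i => X i ω) k h s a := by
  unfold RPOSAT.cBar
  refine Measurable.div ?_ (hX.visitSA hh s a)
  simp_rw [sum_filter]
  exact Finset.measurable_sum _ fun i hi => Measurable.ite
    ((hX.state i hi h hh.le s).inter (hX.action i hi h hh a)) (hX.cost i hi h hh) measurable_const

theorem DataMeasurable.qStep {h : ℕ} (hh : h < p.H) {V R : Ω → S → ℝ}
    (hV : ∀ s, Measurable fun ω => V ω s) (hR : ∀ s, Measurable fun ω => R ω s) (s : S) (a : A) :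
    Measurable fun ω => qStep p (fun i => X i ω) k h (V ω) (R ω) s a := by
  have h1 := hX.cBar hh s a
  have h2 := fun y => hX.PBar hh s a y
  have h3 := hX.visitSA hh s a
  have h4 : Measurable fun ω => variance (RPOSAT.PBar (fun i => X i ω) k h s a) (R ω) := by
    unfold variance
    fun_prop
  unfold RPOSAT.qStep bonus refBonus coarseBonus costWidth
  fun_prop

/-- Measurability of the estimated values from that of the policy and of the reference values. -/
theorem DataMeasurable.evalToGo {π : Ω → ℕ → S → A → ℝ} {R : Ω → ℕ → S → ℝ}
    (hπ : ∀ h < p.H, ∀ s a, Measurable fun ω => π ω h s a)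
    (hR : ∀ h ≤ p.H, ∀ s, Measurable fun ω => R ω h s) :
    ∀ m ≤ p.H, ∀ s, Measurable fun ω => evalToGo p (fun i => X i ω) k (π ω) (R ω) m s := by
  intro m
  induction m with
  | zero => intro _ s; simp only [RPOSAT.evalToGo]; exact measurable_const
  | succ m ih =>
    intro hm s
    simp only [RPOSAT.evalToGo]
    refine Finset.measurable_sum _ fun a _ => Measurable.mul ?_ (hπ _ (by omega) s a)
    exact hX.qStep (by omega) (ih (by omega)) (hR _ (by omega)) s a

theorem DataMeasurable.evalV {π : Ω → ℕ → S → A → ℝ} {R : Ω → ℕ → S → ℝ}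
    (hπ : ∀ h < p.H, ∀ s a, Measurable fun ω => π ω h s a)
    (hR : ∀ h ≤ p.H, ∀ s, Measurable fun ω => R ω h s) (h : ℕ) (s : S) :
    Measurable fun ω => evalV p (fun i => X i ω) k (π ω) (R ω) h s :=
  hX.evalToGo hπ hR _ (Nat.sub_le _ _) s

variable [Nonempty A]

/-- The memory of the algorithm after `k` episodes is measurable with respect to their data. -/
theorem DataMeasurable.run :
    (∀ h < p.H, ∀ s a, Measurable fun ω => (run p (fun i => X i ω) k).policy h s a) ∧
    (∀ h ≤ p.H, ∀ s, Measurable fun ω => (run p (fun i => X i ω) k).vref h s) ∧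
    (∀ h ≤ p.H, ∀ s, Measurable fun ω => (run p (fun i => X i ω) k).vsum h s) := by
  induction k with
  | zero => exact ⟨fun _ _ _ _ => measurable_const, fun _ _ _ => measurable_const,
      fun _ _ _ => measurable_const⟩
  | succ k ih =>
    obtain ⟨h1, h2, h3⟩ := ih (hX.mono (Nat.le_succ k))
    have hV := fun h s => hX.evalV h1 h2 h s
    have hsum : ∀ h ≤ p.H, ∀ s, Measurable fun ω => (RPOSAT.run p (fun i => X i ω) (k + 1)).vsum h s :=
      fun h hh s => (h3 h hh s).add (Measurable.ite (hX.state (k + 1) (mem_Icc.2 ⟨by omega, le_rfl⟩)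
        h hh s) (hV h s) measurable_const)
    refine ⟨fun h hh s a => ?_, fun h hh s => ?_, hsum⟩
    · have hQ : Measurable fun ω => (fun a => RPOSAT.qStep p (fun i => X i ω) (k + 1) h
          (RPOSAT.evalV p (fun i => X i ω) (k + 1) (RPOSAT.run p (fun i => X i ω) k).policy
            (RPOSAT.run p (fun i => X i ω) k).vref (h + 1))
          ((RPOSAT.run p (fun i => X i ω) k).vref (h + 1)) s a,
          fun a => (RPOSAT.run p (fun i => X i ω) k).policy h s a) :=
        Measurable.prodMk
          (measurable_pi_lambda _ fun a =>
            hX.qStep hh (fun s => hV (h + 1) s) (h2 (h + 1) hh) s a)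
          (measurable_pi_lambda _ fun a => h1 h hh s a)
      have hc := (measurable_mdStep (p.η (k + 1)) a)
      have hcc := hc.comp hQ
      have e : (fun ω => (RPOSAT.run p (fun i => X i ω) (k + 1)).policy h s a) = fun ω =>
        mdStep (p.η (k + 1)) (fun a => RPOSAT.qStep p (fun i => X i ω) (k + 1) h
          (RPOSAT.evalV p (fun i => X i ω) (k + 1) (RPOSAT.run p (fun i => X i ω) k).policy
            (RPOSAT.run p (fun i => X i ω) k).vref (h + 1))
          ((RPOSAT.run p (fun i => X i ω) k).vref (h + 1)) s a)
          (fun a => (RPOSAT.run p (fun i => X i ω) k).policy h s a) a := by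
        funext ω
        rfl
      rw [e]
      exact hcc
    · have e : (fun ω => (RPOSAT.run p (fun i => X i ω) (k + 1)).vref h s) = fun ω =>
          if C0 S A p * √((k + 1 : ℕ) : ℝ) ≤ RPOSAT.visitS (fun i => X i ω) (k + 1) h s then
            (RPOSAT.run p (fun i => X i ω) (k + 1)).vsum h s /
              RPOSAT.visitS (fun i => X i ω) (k + 1) h s
          else (RPOSAT.run p (fun i => X i ω) k).vref h s := rfl
      rw [e]
      have hm : MeasurableSet {ω | C0 S A p * √((k + 1 : ℕ) : ℝ) ≤
          RPOSAT.visitS (fun i => X i ω) (k + 1) h s} :=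
        measurableSet_le (f := fun _ => C0 S A p * √((k + 1 : ℕ) : ℝ)) measurable_const
          (hX.visitS hh s)
      have hd : Measurable fun ω => (RPOSAT.run p (fun i => X i ω) (k + 1)).vsum h s /
          (RPOSAT.visitS (fun i => X i ω) (k + 1) h s : ℝ) :=
        Measurable.div (hsum h hh s) (hX.visitS hh s)
      exact Measurable.ite hm hd (h2 h hh s)

end Measurability

/-! ### The information available during the interaction -/

section History

variable {S A Ω : Type*} {H : ℕ} {X : ℕ → Ω → Episode S A}

theorem history_state_past {k h i j : ℕ} (hi : i ∈ Ico 1 k) (hj : j ≤ H) (s : S) :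
    MeasurableSet[history H X k h] {ω | (X i ω).state j = s} := by
  have h1 : MeasurableSpace.comap (fun ω => (X i ω).state j) ⊤ ≤ history H X k h := by
    refine le_trans ?_ (le_sup_left.trans (le_sup_left.trans le_sup_left))
    exact le_trans (le_iSup₂_of_le j (mem_range.2 (by omega)) le_rfl)
      (le_iSup₂ (f := fun i (_ : i ∈ Ico 1 k) => ⨆ j ∈ range (H + 1),
        MeasurableSpace.comap (fun ω => (X i ω).state j) ⊤) i hi)
  exact h1 _ ⟨{s}, trivial, rfl⟩

theorem comap_action_cost_le {k h i j : ℕ} (hi : i ∈ Ico 1 k) (hj : j < H) :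
    MeasurableSpace.comap (fun ω => (X i ω).action j) ⊤ ⊔
      MeasurableSpace.comap (fun ω => (X i ω).cost j) inferInstance ≤ history H X k h := by
  refine le_trans ?_ (le_sup_right.trans (le_sup_left.trans le_sup_left))
  exact le_trans (le_iSup₂_of_le j (mem_range.2 hj) le_rfl)
    (le_iSup₂ (f := fun i (_ : i ∈ Ico 1 k) => ⨆ j ∈ range H,
      MeasurableSpace.comap (fun ω => (X i ω).action j) ⊤ ⊔
      MeasurableSpace.comap (fun ω => (X i ω).cost j) inferInstance) i hi)

theorem history_action_past {k h i j : ℕ} (hi : i ∈ Ico 1 k) (hj : j < H) (a : A) :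
    MeasurableSet[history H X k h] {ω | (X i ω).action j = a} :=
  (le_sup_left.trans (comap_action_cost_le hi hj)) _ ⟨{a}, trivial, rfl⟩

theorem history_cost_past {k h i j : ℕ} (hi : i ∈ Ico 1 k) (hj : j < H) :
    Measurable[history H X k h] fun ω => (X i ω).cost j :=
  (comap_measurable _).mono (le_sup_right.trans (comap_action_cost_le hi hj)) le_rfl

theorem history_state {k h j : ℕ} (hj : j ≤ h) (s : S) :
    MeasurableSet[history H X k h] {ω | (X k ω).state j = s} := by
  have h1 : MeasurableSpace.comap (fun ω => (X k ω).state j) ⊤ ≤ history H X k h :=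
    le_trans (le_iSup₂ (f := fun j (_ : j ∈ range (h + 1)) =>
      MeasurableSpace.comap (fun ω => (X k ω).state j) ⊤) j (mem_range.2 (by omega)))
      (le_sup_right.trans le_sup_left)
  exact h1 _ ⟨{s}, trivial, rfl⟩

theorem history_zero_le (k h : ℕ) : history H X k 0 ≤ history H X k h := by
  refine sup_le (sup_le (le_sup_left.trans le_sup_left) ?_) ?_
  · refine le_trans (iSup₂_mono' fun j hj => ⟨j, ?_, le_rfl⟩) (le_sup_right.trans le_sup_left)
    exact mem_range.2 (by have := mem_range.1 hj; omega)
  · simp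

theorem historyAction_action (k h : ℕ) (a : A) :
    MeasurableSet[historyAction H X k h] {ω | (X k ω).action h = a} :=
  (le_sup_right : _ ≤ historyAction H X k h) _ ⟨{a}, trivial, rfl⟩

theorem historyAction_state (k h : ℕ) (s : S) :
    MeasurableSet[historyAction H X k h] {ω | (X k ω).state h = s} :=
  (le_sup_left : _ ≤ historyAction H X k h) _ (history_state le_rfl s)

theorem dataMeasurable_of_history_le {ℱ : MeasurableSpace Ω} {p : Params} {k h : ℕ}
    (hle : history p.H X k h ≤ ℱ) : DataMeasurable ℱ p X (k - 1) where
  state i hi j hj s := hle _ (history_state_past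
    (mem_Ico.2 ⟨(mem_Icc.1 hi).1, by have := mem_Icc.1 hi; omega⟩) hj s)
  action i hi j hj a := hle _ (history_action_past
    (mem_Ico.2 ⟨(mem_Icc.1 hi).1, by have := mem_Icc.1 hi; omega⟩) hj a)
  cost i hi j hj := (history_cost_past
    (mem_Ico.2 ⟨(mem_Icc.1 hi).1, by have := mem_Icc.1 hi; omega⟩) hj).mono hle le_rfl

theorem comap_top_le {α : Type*} [Finite α] {m : MeasurableSpace Ω} {f : Ω → α}
    (hf : ∀ a, MeasurableSet[m] {ω | f ω = a}) : MeasurableSpace.comap f ⊤ ≤ m := by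
  rintro _ ⟨B, -, rfl⟩
  have e : f ⁻¹' B = ⋃ a ∈ B, {ω | f ω = a} := by
    ext ω; simp
  rw [e]
  exact MeasurableSet.biUnion B.to_countable fun a _ => hf a

end History

/-- Testing a conditional probability against a bounded function. -/
theorem integral_mul_indicator {Ω : Type*} {𝒢 m0 : MeasurableSpace Ω} {μ : Measure Ω}
    [IsProbabilityMeasure μ] (h𝒢 : 𝒢 ≤ m0) {B : Set Ω}
    (hB : MeasurableSet[m0] B) {φ : Ω → ℝ}
    (hφ : μ[B.indicator (fun _ => (1 : ℝ)) | 𝒢] =ᵐ[μ] φ) {G : Ω → ℝ} (hG : Measurable[𝒢] G)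
    {C : ℝ} (hC : ∀ ω, |G ω| ≤ C) :
    ∫ ω, G ω * B.indicator (fun _ => (1 : ℝ)) ω ∂μ = ∫ ω, G ω * φ ω ∂μ := by
  have hGm : Measurable G := hG.mono h𝒢 le_rfl
  have i1 : Integrable (B.indicator fun _ => (1 : ℝ)) μ :=
    (integrable_const (1 : ℝ)).indicator hB
  have i2 : Integrable (G * B.indicator fun _ => (1 : ℝ)) μ :=
    i1.bdd_mul hGm.aestronglyMeasurable
      (Filter.Eventually.of_forall fun ω => by rw [Real.norm_eq_abs]; exact hC ω)
  have h1 := condExp_mul_of_stronglyMeasurable_left (μ := μ) hG.stronglyMeasurable i2 i1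
  have h2 := integral_condExp (μ := μ) (f := G * B.indicator fun _ => (1 : ℝ)) h𝒢
  change ∫ ω, (G * B.indicator fun _ => (1 : ℝ)) ω ∂μ = _
  rw [← h2]
  refine integral_congr_ae (h1.trans ?_)
  filter_upwards [hφ] with ω hω
  simp [hω]

section Interaction

variable {S A Ω : Type*} [Fintype S] [Fintype A] [DecidableEq S] [DecidableEq A] [Nonempty A]
variable [m0 : MeasurableSpace Ω] {μ : Measure Ω}
variable {M : MDP S A} {p : Params} {s₁ : S} {X : ℕ → Ω → Episode S A}
variable (hI : IsInteraction M p s₁ μ X)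
include hI

theorem IsInteraction.history_le (k h : ℕ) : history p.H X k h ≤ m0 := by
  have hs := fun k j => comap_top_le (hI.measurable_state k j)
  have ha := fun k j => comap_top_le (hI.measurable_action k j)
  have hc := fun k j => (hI.measurable_cost k j).comap_le
  refine sup_le (sup_le (sup_le ?_ ?_) ?_) ?_
  · exact iSup₂_le fun i _ => iSup₂_le fun j _ => hs i j
  · exact iSup₂_le fun i _ => iSup₂_le fun j _ => sup_le (ha i j) (hc i j)
  · exact iSup₂_le fun j _ => hs k j
  · exact iSup₂_le fun j _ => sup_le (ha k j) (hc k j)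

theorem IsInteraction.historyAction_le (k h : ℕ) : historyAction p.H X k h ≤ m0 :=
  sup_le (hI.history_le k h) (comap_top_le (hI.measurable_action k h))

variable [IsProbabilityMeasure μ]

theorem IsInteraction.integral_mul_action {k h : ℕ} (hk : k ∈ Icc 1 p.K) (hh : h < p.H) (a : A)
    {G : Ω → ℝ} (hG : Measurable[history p.H X k h] G) {C : ℝ} (hC : ∀ ω, |G ω| ≤ C) :
    ∫ ω, G ω * (if (X k ω).action h = a then 1 else 0) ∂μ =
      ∫ ω, G ω * policyAt p (fun i => X i ω) k h ((X k ω).state h) a ∂μ := by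
  rw [← integral_mul_indicator (hI.history_le k h) (hI.measurable_action k h a)
    (hI.action_law k hk h hh a) hG hC]
  simp only [Set.indicator_apply, Set.mem_ofPred_eq]

theorem IsInteraction.integral_mul_state {k h : ℕ} (hk : k ∈ Icc 1 p.K) (hh : h < p.H) (y : S)
    {G : Ω → ℝ} (hG : Measurable[historyAction p.H X k h] G) {C : ℝ} (hC : ∀ ω, |G ω| ≤ C) :
    ∫ ω, G ω * (if (X k ω).state (h + 1) = y then 1 else 0) ∂μ =
      ∫ ω, G ω * M.P h ((X k ω).state h) ((X k ω).action h) y ∂μ := by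
  rw [← integral_mul_indicator (hI.historyAction_le k h) (hI.measurable_state k (h + 1) y)
    (hI.state_law k hk h hh y) hG hC]
  simp only [Set.indicator_apply, Set.mem_ofPred_eq]

omit m0 hI [Fintype S] [Fintype A] [Nonempty A] [DecidableEq S] [DecidableEq A] in
theorem measurable_visits {ℱ : MeasurableSpace Ω} {k h : ℕ} {s : S} {a : A}
    (hs : MeasurableSet[ℱ] {ω | (X k ω).state h = s})
    (ha : MeasurableSet[ℱ] {ω | (X k ω).action h = a}) :
    MeasurableSet[ℱ] {ω | (X k ω).visits h s a} := hs.inter ha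

/-- The next state of a visited pair follows the transition probabilities. -/
theorem IsInteraction.integral_mul_visits_state {k h : ℕ} (hk : k ∈ Icc 1 p.K) (hh : h < p.H)
    (s : S) (a : A) (y : S) {G : Ω → ℝ} (hG : Measurable[historyAction p.H X k h] G) {C : ℝ}
    (hC : ∀ ω, |G ω| ≤ C) :
    ∫ ω, G ω * (if (X k ω).visits h s a ∧ (X k ω).state (h + 1) = y then 1 else 0) ∂μ =
      M.P h s a y * ∫ ω, G ω * (if (X k ω).visits h s a then 1 else 0) ∂μ := by
  have hv : MeasurableSet[historyAction p.H X k h] {ω | (X k ω).visits h s a} :=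
    measurable_visits (historyAction_state k h s) (historyAction_action k h a)
  have h1 := hI.integral_mul_state hk hh y
    (G := fun ω => G ω * (if (X k ω).visits h s a then 1 else 0))
    (hG.mul (Measurable.ite hv measurable_const measurable_const)) (C := C) (fun ω => by
      split_ifs
      · rw [mul_one]; exact hC ω
      · rw [mul_zero, abs_zero]; exact (abs_nonneg _).trans (hC ω))
  rw [← integral_const_mul]
  calc _ = ∫ ω, G ω * (if (X k ω).visits h s a then 1 else 0) *
        (if (X k ω).state (h + 1) = y then 1 else 0) ∂μ := by
        refine integral_congr_ae (Filter.Eventually.of_forall fun ω => ?_)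
        by_cases c1 : (X k ω).visits h s a <;> by_cases c2 : (X k ω).state (h + 1) = y <;>
          simp [c1, c2]
    _ = _ := by
        rw [h1]
        refine integral_congr_ae (Filter.Eventually.of_forall fun ω => ?_)
        by_cases c1 : (X k ω).visits h s a
        · have c2 := c1
          obtain ⟨e1, e2⟩ := c2
          simp only [c1, if_true, e1, e2]
          ring
        · simp [c1]

omit m0 hI [IsProbabilityMeasure μ] in
theorem measurable_policyAt {ℱ : MeasurableSpace Ω} {k h : ℕ}
    (hX : DataMeasurable ℱ p X (k - 1)) (hh : h < p.H) (s : S) (a : A) :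
    Measurable[ℱ] fun ω => policyAt p (fun i => X i ω) k h s a :=
  hX.run.1 h hh s a

omit m0 hI [IsProbabilityMeasure μ] in
theorem measurable_occ {ℱ : MeasurableSpace Ω} {k h : ℕ}
    (hX : DataMeasurable ℱ p X (k - 1)) (hh : h ≤ p.H) (s : S) :
    Measurable[ℱ] fun ω => occ M.P (policyAt p (fun i => X i ω) k) s₁ h s := by
  induction h generalizing s with
  | zero => exact measurable_const
  | succ h ih =>
    refine Finset.measurable_sum _ fun s' _ => Finset.measurable_sum _ fun a _ => ?_
    exact ((ih (by omega) s').mul (measurable_policyAt hX (by omega) s' a)).mul_const _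

omit m0 hI [IsProbabilityMeasure μ] in
theorem measurable_visitProb {ℱ : MeasurableSpace Ω} {k h : ℕ}
    (hX : DataMeasurable ℱ p X (k - 1)) (hh : h < p.H) (s : S) (a : A) :
    Measurable[ℱ] fun ω => visitProb M p (fun i => X i ω) s₁ k h s a :=
  (measurable_occ hX hh.le s).mul (measurable_policyAt hX hh s a)

omit m0 hI [IsProbabilityMeasure μ] in
theorem measurable_gapBound {ℱ : MeasurableSpace Ω} {k : ℕ}
    (hX : DataMeasurable ℱ p X (k - 1)) :
    ∀ h ≤ p.H, ∀ s, Measurable[ℱ] fun ω => gapBound M p (fun i => X i ω) k h s := by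
  refine backward_induction (fun s => ?_) fun h hh ih s => ?_
  · simp only [gapBound, ret_end]; exact measurable_const
  · simp_rw [gapBound_step k hh]
    refine Finset.measurable_sum _ fun a _ => (measurable_policyAt hX hh s a).mul ?_
    refine Measurable.add (Measurable.add ?_ measurable_const)
      (Finset.measurable_sum _ fun y _ => (ih y).const_mul _)
    have h1 : Measurable[ℱ] fun ω => pastVisits (fun i => X i ω) k h s a :=
      measurable_const.max (hX.visitSA hh s a)
    unfold coarseBonus costWidth
    fun_prop

/-- Given the earlier episodes, the state at step `h` is distributed according to the occupancy
measure of the current policy, and so is the state-action pair. -/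
theorem IsInteraction.integral_mul_visit {k : ℕ} (hk : k ∈ Icc 1 p.K) (h : ℕ) :
    (h ≤ p.H → ∀ s, ∀ G : Ω → ℝ, Measurable[history p.H X k 0] G → (∃ C, ∀ ω, |G ω| ≤ C) →
      ∫ ω, G ω * (if (X k ω).state h = s then 1 else 0) ∂μ =
        ∫ ω, G ω * occ M.P (policyAt p (fun i => X i ω) k) s₁ h s ∂μ) ∧
    (h < p.H → ∀ s a, ∀ G : Ω → ℝ, Measurable[history p.H X k 0] G → (∃ C, ∀ ω, |G ω| ≤ C) →
      ∫ ω, G ω * (if (X k ω).visits h s a then 1 else 0) ∂μ =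
        ∫ ω, G ω * visitProb M p (fun i => X i ω) s₁ k h s a ∂μ) := by
  have hdata : DataMeasurable (history p.H X k 0) p X (k - 1) :=
    dataMeasurable_of_history_le le_rfl
  -- passing from states to state-action pairs
  have hpair : ∀ h, (h ≤ p.H → ∀ s, ∀ G : Ω → ℝ, Measurable[history p.H X k 0] G →
      (∃ C, ∀ ω, |G ω| ≤ C) → ∫ ω, G ω * (if (X k ω).state h = s then 1 else 0) ∂μ =
        ∫ ω, G ω * occ M.P (policyAt p (fun i => X i ω) k) s₁ h s ∂μ) →
      (h < p.H → ∀ s a, ∀ G : Ω → ℝ, Measurable[history p.H X k 0] G → (∃ C, ∀ ω, |G ω| ≤ C) →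
      ∫ ω, G ω * (if (X k ω).visits h s a then 1 else 0) ∂μ =
        ∫ ω, G ω * visitProb M p (fun i => X i ω) s₁ k h s a ∂μ) := by
    intro h hstate hh s a G hG hC
    obtain ⟨C, hC⟩ := hC
    have hs : MeasurableSet[history p.H X k h] {ω | (X k ω).state h = s} := history_state le_rfl s
    have h1 := hI.integral_mul_action hk hh a
      (G := fun ω => G ω * (if (X k ω).state h = s then 1 else 0))
      ((hG.mono (history_zero_le k h) le_rfl).mul
        (Measurable.ite hs measurable_const measurable_const)) (C := C) (fun ω => by
        split_ifs
        · rw [mul_one]; exact hC ω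
        · rw [mul_zero, abs_zero]; exact (abs_nonneg _).trans (hC ω))
    have h2 := hstate hh.le s (fun ω => G ω * policyAt p (fun i => X i ω) k h s a)
      (hG.mul (measurable_policyAt hdata hh s a)) ⟨C, fun ω => by
        rw [abs_mul]
        have a1 := (policyAt_mem p (fun i => X i ω) k h s).1 a
        have a2 := simplex_le_one (policyAt_mem p (fun i => X i ω) k h s) a
        rw [abs_of_nonneg a1]
        exact (mul_le_of_le_one_right (abs_nonneg _) a2).trans (hC ω)⟩
    calc _ = ∫ ω, G ω * (if (X k ω).state h = s then 1 else 0) *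
          (if (X k ω).action h = a then 1 else 0) ∂μ := by
          refine integral_congr_ae (Filter.Eventually.of_forall fun ω => ?_)
          by_cases c1 : (X k ω).state h = s <;> by_cases c2 : (X k ω).action h = a <;>
            simp [Episode.visits, c1, c2]
      _ = ∫ ω, G ω * policyAt p (fun i => X i ω) k h s a *
          (if (X k ω).state h = s then 1 else 0) ∂μ := by
          rw [h1]
          refine integral_congr_ae (Filter.Eventually.of_forall fun ω => ?_)
          by_cases c1 : (X k ω).state h = s
          · simp only [c1, if_true]; ring
          · simp [c1]
      _ = _ := by
          rw [h2]
          refine integral_congr_ae (Filter.Eventually.of_forall fun ω => ?_)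
          simp only [visitProb]
          ring
  induction h with
  | zero =>
    have hz : 0 ≤ p.H → ∀ s, ∀ G : Ω → ℝ, Measurable[history p.H X k 0] G →
        (∃ C, ∀ ω, |G ω| ≤ C) → ∫ ω, G ω * (if (X k ω).state 0 = s then 1 else 0) ∂μ =
        ∫ ω, G ω * occ M.P (policyAt p (fun i => X i ω) k) s₁ 0 s ∂μ := by
      intro _ s G _ _
      refine integral_congr_ae ?_
      filter_upwards [hI.initial k hk] with ω hω
      simp only [occ, hω]
      congr 2
      exact propext eq_comm
    exact ⟨hz, hpair 0 hz⟩
  | succ h ih =>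
    have hz : h + 1 ≤ p.H → ∀ y, ∀ G : Ω → ℝ, Measurable[history p.H X k 0] G →
        (∃ C, ∀ ω, |G ω| ≤ C) → ∫ ω, G ω * (if (X k ω).state (h + 1) = y then 1 else 0) ∂μ =
        ∫ ω, G ω * occ M.P (policyAt p (fun i => X i ω) k) s₁ (h + 1) y ∂μ := by
      rintro hh y G hG ⟨C, hC⟩
      have hGm : Measurable G := hG.mono (hI.history_le k 0) le_rfl
      have hGA : Measurable[historyAction p.H X k h] G :=
        hG.mono ((history_zero_le k h).trans le_sup_left) le_rfl
      have hint : ∀ B : Ω → Prop, ∀ [DecidablePred B], MeasurableSet {ω | B ω} →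
          Integrable (fun ω => G ω * (if B ω then 1 else 0)) μ := fun B _ hB =>
        integrable_of_bounded (hGm.mul (Measurable.ite hB measurable_const measurable_const))
          (C := C) fun ω => by
          split_ifs
          · rw [mul_one]; exact hC ω
          · rw [mul_zero, abs_zero]; exact (abs_nonneg _).trans (hC ω)
      have hq : ∀ s a, Integrable (fun ω => M.P h s a y *
          (G ω * visitProb M p (fun i => X i ω) s₁ k h s a)) μ := fun s a => by
        refine Integrable.const_mul (integrable_of_bounded (C := C) (hGm.mul
          ((measurable_visitProb hdata hh s a).mono (hI.history_le k 0) le_rfl)) fun ω => ?_) _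
        rw [Pi.mul_apply, abs_mul, abs_of_nonneg (visitProb_nonneg k h s a)]
        exact (mul_le_of_le_one_right (abs_nonneg _) (visitProb_le_one k h s a)).trans (hC ω)
      calc _ = ∫ ω, ∑ s, ∑ a, G ω *
            (if (X k ω).visits h s a ∧ (X k ω).state (h + 1) = y then 1 else 0) ∂μ := by
            refine integral_congr_ae (Filter.Eventually.of_forall fun ω => ?_)
            simp only
            rw [sum_eq_single ((X k ω).state h), sum_eq_single ((X k ω).action h)]
            · simp [Episode.visits]
            · intro b _ hb
              simp [Episode.visits, hb.symm]
            · simp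
            · intro b _ hb
              simp [Episode.visits, hb.symm]
            · simp
        _ = ∑ s, ∑ a, ∫ ω, G ω *
            (if (X k ω).visits h s a ∧ (X k ω).state (h + 1) = y then 1 else 0) ∂μ := by
            have hm : ∀ s a, MeasurableSet {ω | (X k ω).visits h s a ∧ (X k ω).state (h + 1) = y} :=
              fun s a => (measurable_visits (hI.measurable_state k h s)
                (hI.measurable_action k h a)).inter (hI.measurable_state k (h + 1) y)
            rw [integral_finsetSum _ fun s _ => integrable_finsetSum _ fun a _ => hint _ (hm s a)]
            exact sum_congr rfl fun s _ => integral_finsetSum _ fun a _ => hint _ (hm s a)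
        _ = ∑ s, ∑ a, ∫ ω, M.P h s a y *
            (G ω * visitProb M p (fun i => X i ω) s₁ k h s a) ∂μ := by
            refine sum_congr rfl fun s _ => sum_congr rfl fun a _ => ?_
            rw [hI.integral_mul_visits_state hk hh s a y hGA hC, ih.2 hh s a G hG ⟨C, hC⟩,
              integral_const_mul]
        _ = ∫ ω, ∑ s, ∑ a, M.P h s a y *
            (G ω * visitProb M p (fun i => X i ω) s₁ k h s a) ∂μ := by
            rw [integral_finsetSum _ fun s _ => integrable_finsetSum _ fun a _ => hq s a]
            exact sum_congr rfl fun s _ => (integral_finsetSum _ fun a _ => hq s a).symm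
        _ = _ := by
            refine integral_congr_ae (Filter.Eventually.of_forall fun ω => ?_)
            simp only [occ, visitProb, mul_sum]
            exact sum_congr rfl fun s _ => sum_congr rfl fun a _ => by ring
    exact ⟨hz, hpair (h + 1) hz⟩

end Interaction

/-! ### The increments to which the Bernstein inequality is applied -/

section Abstract

variable {Ω : Type*} [m0 : MeasurableSpace Ω] {μ : Measure Ω} [IsProbabilityMeasure μ]

/-- If `Y` has the law `ν` under the measure `W · μ`, up to normalization, then the integrals of all
functions of `Y` against `W · μ` are those against `ν`, up to the same normalization. -/
theorem integral_mul_comp_of_law {Y W : Ω → ℝ} (hY : Measurable Y) (hW : Measurable W)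
    (hW0 : ∀ ω, 0 ≤ W ω) {C : ℝ} (hWC : ∀ ω, W ω ≤ C) {ν : Measure ℝ} [IsProbabilityMeasure ν]
    (hlaw : ∀ B : Set ℝ, MeasurableSet B →
      ∫ ω, W ω * {ω | Y ω ∈ B}.indicator (fun _ => (1 : ℝ)) ω ∂μ = ν.real B * ∫ ω, W ω ∂μ)
    {f : ℝ → ℝ} (hf : Measurable f) :
    ∫ ω, W ω * f (Y ω) ∂μ = (∫ y, f y ∂ν) * ∫ ω, W ω ∂μ := by
  have iW : Integrable W μ :=
    integrable_of_bounded hW fun ω => by rw [abs_of_nonneg (hW0 ω)]; exact hWC ω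
  have hWd : Measurable fun ω => ENNReal.ofReal (W ω) := hW.ennreal_ofReal
  have hme : (μ.withDensity fun ω => ENNReal.ofReal (W ω)).map Y =
      ENNReal.ofReal (∫ ω, W ω ∂μ) • ν := by
    ext B hB
    rw [Measure.map_apply hY hB, withDensity_apply _ (hY hB), Measure.smul_apply, smul_eq_mul,
      ← ofReal_integral_eq_lintegral_ofReal iW.integrableOn
        (Filter.Eventually.of_forall fun ω => hW0 ω), ← integral_indicator (hY hB)]
    have e : (Y ⁻¹' B).indicator W =
        fun ω => W ω * {ω | Y ω ∈ B}.indicator (fun _ => (1 : ℝ)) ω := by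
      funext ω
      by_cases h : Y ω ∈ B
      · simp [h]
      · simp [h]
    rw [e, hlaw B hB, mul_comm, ENNReal.ofReal_mul (integral_nonneg hW0), ofReal_measureReal]
  have h1 := integral_map (μ := μ.withDensity fun ω => ENNReal.ofReal (W ω)) hY.aemeasurable
    (f := f) hf.aestronglyMeasurable
  rw [hme, integral_smul_measure, ENNReal.toReal_ofReal (integral_nonneg hW0), smul_eq_mul,
    integral_withDensity_eq_integral_toReal_smul hWd
      (Filter.Eventually.of_forall fun ω => ENNReal.ofReal_lt_top)] at h1
  rw [mul_comm, h1]
  refine integral_congr_ae (Filter.Eventually.of_forall fun ω => ?_)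
  simp [ENNReal.toReal_ofReal (hW0 ω)]

/-- Centered and weighted indicators of events with conditional probabilities `q k`. -/
theorem incrementBounds_indicator {𝒢 : ℕ → MeasurableSpace Ω} {K : ℕ} {B : ℕ → Ω → Prop}
    [∀ k ω, Decidable (B k ω)] {q w : ℕ → Ω → ℝ} (hle : ∀ k, 𝒢 k ≤ m0)
    (hB : ∀ k ∈ Icc 1 K, MeasurableSet {ω | B k ω})
    (hBp : ∀ k ∈ Icc 1 K, ∀ i ∈ Ico 1 k, MeasurableSet[𝒢 k] {ω | B i ω})
    (hq : ∀ k ∈ Icc 1 K, ∀ i ∈ Icc 1 k, Measurable[𝒢 k] (q i))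
    (hw : ∀ k ∈ Icc 1 K, ∀ i ∈ Icc 1 k, Measurable[𝒢 k] (w i))
    (hq01 : ∀ k ω, q k ω ∈ Set.Icc (0 : ℝ) 1) (hw01 : ∀ k ω, w k ω ∈ Set.Icc (0 : ℝ) 1)
    (hlaw : ∀ k ∈ Icc 1 K, ∀ G : Ω → ℝ, Measurable[𝒢 k] G → (∃ C, ∀ ω, |G ω| ≤ C) →
      ∫ ω, G ω * (if B k ω then 1 else 0) ∂μ = ∫ ω, G ω * q k ω ∂μ) :
    IncrementBounds μ 𝒢 (fun k ω => ((if B k ω then 1 else 0) - q k ω) * w k ω)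
      (fun k ω => q k ω * w k ω) K where
  le := hle
  meas k hk := by
    have hkk : k ∈ Icc 1 k := mem_Icc.2 ⟨(mem_Icc.1 hk).1, le_rfl⟩
    exact ((Measurable.ite (hB k hk) measurable_const measurable_const).sub
      ((hq k hk k hkk).mono (hle k) le_rfl)).mul ((hw k hk k hkk).mono (hle k) le_rfl)
  past k hk i hi := by
    have hik : i ∈ Icc 1 k := mem_Icc.2 ⟨(mem_Ico.1 hi).1, (mem_Ico.1 hi).2.le⟩
    exact ((Measurable.ite (hBp k hk i hi) measurable_const measurable_const).sub
      (hq k hk i hik)).mul (hw k hk i hik)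
  meas_v k hk i hi := (hq k hk i hi).mul (hw k hk i hi)
  abs_le k _ ω := by
    obtain ⟨a1, a2⟩ := hq01 k ω
    obtain ⟨b1, b2⟩ := hw01 k ω
    rw [abs_mul, abs_of_nonneg b1]
    refine mul_le_one₀ ?_ b1 b2
    rw [_root_.abs_le]
    split_ifs <;> constructor <;> linarith
  v_nonneg k _ ω := mul_nonneg (hq01 k ω).1 (hw01 k ω).1
  v_le k _ ω := mul_le_one₀ (hq01 k ω).2 (hw01 k ω).1 (hw01 k ω).2
  mean k hk G hG h0 hC := by
    obtain ⟨C, hC⟩ := hC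
    have hkk : k ∈ Icc 1 k := mem_Icc.2 ⟨(mem_Icc.1 hk).1, le_rfl⟩
    have hGw : Measurable[𝒢 k] fun ω => G ω * w k ω := hG.mul (hw k hk k hkk)
    have hGwC : ∀ ω, |G ω * w k ω| ≤ C := fun ω => by
      rw [abs_of_nonneg (mul_nonneg (h0 ω) (hw01 k ω).1)]
      exact (mul_le_of_le_one_right (h0 ω) (hw01 k ω).2).trans (hC ω)
    have h1 := hlaw k hk _ hGw ⟨C, hGwC⟩
    have i1 : Integrable (fun ω => G ω * w k ω * (if B k ω then 1 else 0)) μ :=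
      integrable_of_bounded ((hGw.mono (hle k) le_rfl).mul
        (Measurable.ite (hB k hk) measurable_const measurable_const)) (C := C) fun ω => by
        rw [abs_mul]
        refine (mul_le_of_le_one_right (abs_nonneg _) ?_).trans (hGwC ω)
        split_ifs <;> simp
    have i2 : Integrable (fun ω => G ω * w k ω * q k ω) μ :=
      integrable_of_bounded ((hGw.mul (hq k hk k hkk)).mono (hle k) le_rfl) (C := C) fun ω => by
        rw [abs_mul, abs_of_nonneg (hq01 k ω).1]
        exact (mul_le_of_le_one_right (abs_nonneg _) (hq01 k ω).2).trans (hGwC ω)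
    have e : (fun ω => G ω * (((if B k ω then 1 else 0) - q k ω) * w k ω)) =
        fun ω => G ω * w k ω * (if B k ω then 1 else 0) - G ω * w k ω * q k ω := by
      funext ω; ring
    rw [e, integral_sub i1 i2, h1, sub_self]
  var k hk G hG h0 hC := by
    obtain ⟨C, hC⟩ := hC
    have hkk : k ∈ Icc 1 k := mem_Icc.2 ⟨(mem_Icc.1 hk).1, le_rfl⟩
    have hqk := hq k hk k hkk
    have hwk := hw k hk k hkk
    -- the square of the increment is affine in the indicator: `w² (1 - 2 q) 1_B + w² q²`
    have hF : Measurable[𝒢 k] fun ω => G ω * (w k ω ^ 2 * (1 - 2 * q k ω)) :=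
      hG.mul ((hwk.pow_const 2).mul (measurable_const.sub (hqk.const_mul 2)))
    have hw2 : ∀ ω, w k ω ^ 2 ≤ 1 := fun ω => pow_le_one₀ (hw01 k ω).1 (hw01 k ω).2
    have hFC : ∀ ω, |G ω * (w k ω ^ 2 * (1 - 2 * q k ω))| ≤ C := fun ω => by
      rw [abs_mul, abs_of_nonneg (h0 ω), abs_mul, abs_of_nonneg (sq_nonneg _)]
      refine (mul_le_of_le_one_right (h0 ω) (mul_le_one₀ (hw2 ω) (abs_nonneg _) ?_)).trans (hC ω)
      obtain ⟨a1, a2⟩ := hq01 k ω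
      rw [_root_.abs_le]
      constructor <;> linarith
    have hR : Measurable[𝒢 k] fun ω => G ω * (w k ω ^ 2 * q k ω ^ 2) :=
      hG.mul ((hwk.pow_const 2).mul (hqk.pow_const 2))
    have i1 : Integrable (fun ω => G ω * (w k ω ^ 2 * (1 - 2 * q k ω)) *
        (if B k ω then 1 else 0)) μ :=
      integrable_of_bounded ((hF.mono (hle k) le_rfl).mul
        (Measurable.ite (hB k hk) measurable_const measurable_const)) (C := C) fun ω => by
        rw [abs_mul]
        refine (mul_le_of_le_one_right (abs_nonneg _) ?_).trans (hFC ω)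
        split_ifs <;> simp
    have i2 : Integrable (fun ω => G ω * (w k ω ^ 2 * q k ω ^ 2)) μ :=
      integrable_of_bounded (hR.mono (hle k) le_rfl) (C := C) fun ω => by
        rw [abs_of_nonneg (mul_nonneg (h0 ω) (by positivity))]
        refine (mul_le_of_le_one_right (h0 ω) (mul_le_one₀ (hw2 ω) (sq_nonneg _) ?_)).trans (hC ω)
        exact pow_le_one₀ (hq01 k ω).1 (hq01 k ω).2
    have i3 : Integrable (fun ω => G ω * (w k ω ^ 2 * (1 - 2 * q k ω)) * q k ω) μ :=
      integrable_of_bounded ((hF.mul hqk).mono (hle k) le_rfl) (C := C) fun ω => by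
        rw [abs_mul, abs_of_nonneg (hq01 k ω).1]
        exact (mul_le_of_le_one_right (abs_nonneg _) (hq01 k ω).2).trans (hFC ω)
    have i4 : Integrable (fun ω => G ω * (q k ω * w k ω)) μ :=
      integrable_of_bounded ((hG.mul (hqk.mul hwk)).mono (hle k) le_rfl) (C := C) fun ω => by
        rw [
          abs_of_nonneg (mul_nonneg (h0 ω) (mul_nonneg (hq01 k ω).1 (hw01 k ω).1))]
        exact (mul_le_of_le_one_right (h0 ω) (mul_le_one₀ (hq01 k ω).2 (hw01 k ω).1
          (hw01 k ω).2)).trans (hC ω)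
    have e : (fun ω => G ω * (((if B k ω then 1 else 0) - q k ω) * w k ω) ^ 2) =
        fun ω => G ω * (w k ω ^ 2 * (1 - 2 * q k ω)) * (if B k ω then 1 else 0) +
          G ω * (w k ω ^ 2 * q k ω ^ 2) := by
      funext ω
      split_ifs <;> ring
    rw [e, integral_add i1 i2, hlaw k hk _ hF ⟨C, hFC⟩, ← integral_add i3 i2]
    refine integral_mono (i3.add i2) i4 fun ω => ?_
    obtain ⟨a1, a2⟩ := hq01 k ω
    obtain ⟨b1, b2⟩ := hw01 k ω
    have h1 : w k ω ^ 2 * (1 - 2 * q k ω) * q k ω + w k ω ^ 2 * q k ω ^ 2 ≤ q k ω * w k ω := by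
      have h2 : w k ω ^ 2 * (q k ω - q k ω ^ 2) ≤ w k ω * q k ω :=
        mul_le_mul (by nlinarith) (by nlinarith) (by nlinarith) b1
      nlinarith
    calc _ = G ω * (w k ω ^ 2 * (1 - 2 * q k ω) * q k ω + w k ω ^ 2 * q k ω ^ 2) := by ring
      _ ≤ _ := mul_le_mul_of_nonneg_left h1 (h0 ω)

end Abstract

section Interaction

variable {S A Ω : Type*} [Fintype S] [Fintype A] [DecidableEq S] [DecidableEq A] [Nonempty A]
variable [m0 : MeasurableSpace Ω] {μ : Measure Ω} [IsProbabilityMeasure μ]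
variable {M : MDP S A} {p : Params} {s₁ : S} {X : ℕ → Ω → Episode S A}

omit m0 [Fintype S] [Fintype A] [DecidableEq S] [DecidableEq A] [Nonempty A] in
theorem history_visits_past {k h h' i : ℕ} {H : ℕ} (hi : i ∈ Ico 1 k) (hh : h < H) (s : S)
    (a : A) : MeasurableSet[history H X k h'] {ω | (X i ω).visits h s a} :=
  measurable_visits (history_state_past hi hh.le s) (history_action_past hi hh a)

omit m0 [Fintype S] [Fintype A] [DecidableEq S] [DecidableEq A] [Nonempty A] in
theorem historyAction_visits {k h i : ℕ} {H : ℕ} (hi : i ∈ Icc 1 k) (hh : h < H) (s : S)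
    (a : A) : MeasurableSet[historyAction H X k h] {ω | (X i ω).visits h s a} := by
  obtain ⟨h1, h2⟩ := mem_Icc.1 hi
  rcases h2.eq_or_lt with rfl | h3
  · exact measurable_visits (historyAction_state i h s) (historyAction_action i h a)
  · exact (le_sup_left : _ ≤ historyAction H X k h) _
      (history_visits_past (mem_Ico.2 ⟨h1, h3⟩) hh s a)

variable (hI : IsInteraction M p s₁ μ X)
include hI

/-- The fluctuations of `f` at the next states of a pair. -/
theorem IsInteraction.incrementBounds_state {h : ℕ} (hh : h < p.H) (s : S) (a : A) {f : S → ℝ}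
    (hf : ∀ y, f y ∈ Set.Icc (0 : ℝ) 1) :
    IncrementBounds μ (fun k => historyAction p.H X k h)
      (fun k ω => ∑ y, (f y - ∑ z, M.P h s a z * f z) *
        (if (X k ω).visits h s a ∧ (X k ω).state (h + 1) = y then 1 else 0))
      (fun k ω => variance (M.P h s a) f * (if (X k ω).visits h s a then 1 else 0)) p.K := by
  set m := ∑ z, M.P h s a z * f z with hm
  have hm0 : 0 ≤ m := le_sum_simplex_mul (M.P_mem h s a) fun y => (hf y).1
  have hm1 : m ≤ 1 := sum_simplex_mul_le (M.P_mem h s a) fun y => (hf y).2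
  have hd : ∀ y, |f y - m| ≤ 1 := fun y => by
    rw [_root_.abs_le]; constructor <;> linarith [(hf y).1, (hf y).2]
  have hvs : ∀ k, MeasurableSet {ω | (X k ω).visits h s a} := fun k =>
    measurable_visits (hI.measurable_state k h s) (hI.measurable_action k h a)
  have hnext : ∀ k y, MeasurableSet {ω | (X k ω).visits h s a ∧ (X k ω).state (h + 1) = y} :=
    fun k y => (hvs k).inter (hI.measurable_state k (h + 1) y)
  have hval : ∀ (g : S → ℝ) (k : ℕ) (ω : Ω), ∑ y, g y *
      (if (X k ω).visits h s a ∧ (X k ω).state (h + 1) = y then 1 else 0) =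
      if (X k ω).visits h s a then g ((X k ω).state (h + 1)) else 0 := fun g k ω => by
    by_cases c : (X k ω).visits h s a <;> simp [c]
  have hint : ∀ k ∈ Icc 1 p.K, ∀ (g : S → ℝ) (G : Ω → ℝ),
      Measurable[historyAction p.H X k h] G → (∀ ω, 0 ≤ G ω) → (∃ C, ∀ ω, G ω ≤ C) →
      ∫ ω, G ω * (∑ y, g y *
        (if (X k ω).visits h s a ∧ (X k ω).state (h + 1) = y then 1 else 0)) ∂μ =
      (∑ y, M.P h s a y * g y) * ∫ ω, G ω * (if (X k ω).visits h s a then 1 else 0) ∂μ := by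
    rintro k hk g G hG h0 ⟨C, hC⟩
    have hGC : ∀ ω, |G ω| ≤ C := fun ω => by rw [abs_of_nonneg (h0 ω)]; exact hC ω
    have hi : ∀ y, Integrable (fun ω => g y * (G ω *
        (if (X k ω).visits h s a ∧ (X k ω).state (h + 1) = y then 1 else 0))) μ := fun y =>
      (integrable_of_bounded ((hG.mono (hI.historyAction_le k h) le_rfl).mul
        (Measurable.ite (hnext k y) measurable_const measurable_const)) (C := C) fun ω => by
          rw [Pi.mul_apply, abs_mul]
          refine (mul_le_of_le_one_right (abs_nonneg _) ?_).trans (hGC ω)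
          split_ifs <;> simp).const_mul _
    have e : (fun ω => G ω * (∑ y, g y *
        (if (X k ω).visits h s a ∧ (X k ω).state (h + 1) = y then 1 else 0))) =
        fun ω => ∑ y, g y * (G ω *
          (if (X k ω).visits h s a ∧ (X k ω).state (h + 1) = y then 1 else 0)) := by
      funext ω
      rw [mul_sum]
      exact sum_congr rfl fun y _ => by ring
    rw [e, integral_finsetSum _ fun y _ => hi y, sum_mul]
    refine sum_congr rfl fun y _ => ?_
    rw [integral_const_mul, hI.integral_mul_visits_state hk hh s a y hG hGC]
    ring
  exact {
    le := fun k => hI.historyAction_le k h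
    meas := fun k _ => Finset.measurable_sum _ fun y _ => (Measurable.ite (hnext k y)
      measurable_const measurable_const).const_mul _
    past := fun k hk i hi => Finset.measurable_sum _ fun y _ => (Measurable.ite
      ((le_sup_left : _ ≤ historyAction p.H X k h) _
        ((history_visits_past hi hh s a).inter (history_state_past hi hh y)))
      measurable_const measurable_const).const_mul _
    meas_v := fun k hk i hi => (Measurable.ite (historyAction_visits hi hh s a)
      measurable_const measurable_const).const_mul _
    abs_le := fun k hk ω => by
      rw [hval (fun y => f y - m)]
      split_ifs
      · exact hd _
      · simp
    v_nonneg := fun k hk ω => mul_nonneg (variance_nonneg (M.P_mem h s a).1 f)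
      (by split_ifs <;> simp)
    v_le := fun k hk ω => by
      have := variance_le_sq (M.P_mem h s a) hf
      split_ifs
      · linarith
      · simp
    mean := fun k hk G hG h0 hC => by
      rw [hint k hk (fun y => f y - m) G hG h0 hC]
      have : ∑ y, M.P h s a y * (f y - m) = 0 := by
        simp_rw [mul_sub, sum_sub_distrib, ← sum_mul, (M.P_mem h s a).2, one_mul, hm, sub_self]
      rw [this, zero_mul]
    var := fun k hk G hG h0 hC => by
      have e : (fun ω => G ω * (∑ y, (f y - m) *
          (if (X k ω).visits h s a ∧ (X k ω).state (h + 1) = y then 1 else 0)) ^ 2) =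
          fun ω => G ω * ∑ y, (f y - m) ^ 2 *
          (if (X k ω).visits h s a ∧ (X k ω).state (h + 1) = y then 1 else 0) := by
        funext ω
        rw [hval (fun y => f y - m), hval (fun y => (f y - m) ^ 2)]
        split_ifs <;> simp
      rw [e, hint k hk (fun y => (f y - m) ^ 2) G hG h0 hC, ← integral_const_mul]
      refine (integral_congr_ae (Filter.Eventually.of_forall fun ω => ?_)).le
      simp only [variance, hm]
      ring }

/-- The costs of a visited pair follow their distribution. -/
theorem IsInteraction.integral_mul_cost {k h : ℕ} (hk : k ∈ Icc 1 p.K) (hh : h < p.H) (s : S)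
    (a : A) {G : Ω → ℝ} (hG : Measurable[historyAction p.H X k h] G) (h0 : ∀ ω, 0 ≤ G ω) {C : ℝ}
    (hC : ∀ ω, G ω ≤ C) {f : ℝ → ℝ} (hf : Measurable f) :
    ∫ ω, G ω * (if (X k ω).visits h s a then f ((X k ω).cost h) else 0) ∂μ =
      (∫ y, f y ∂(M.costLaw h s a)) *
        ∫ ω, G ω * (if (X k ω).visits h s a then 1 else 0) ∂μ := by
  have := M.costLaw_prob h s a
  have hv := historyAction_visits (X := X) (mem_Icc.2 ⟨(mem_Icc.1 hk).1, le_rfl⟩) hh s a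
  have hle := hI.historyAction_le k h
  have hW : Measurable[historyAction p.H X k h]
      fun ω => G ω * (if (X k ω).visits h s a then 1 else 0) :=
    hG.mul (Measurable.ite hv measurable_const measurable_const)
  have hW0 : ∀ ω, 0 ≤ G ω * (if (X k ω).visits h s a then (1 : ℝ) else 0) := fun ω =>
    mul_nonneg (h0 ω) (by split_ifs <;> simp)
  have hWC : ∀ ω, G ω * (if (X k ω).visits h s a then (1 : ℝ) else 0) ≤ C := fun ω =>
    (mul_le_of_le_one_right (h0 ω) (by split_ifs <;> simp)).trans (hC ω)
  rw [← integral_mul_comp_of_law (hI.measurable_cost k h) (hW.mono hle le_rfl) hW0 hWC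
    (ν := M.costLaw h s a) (fun B hB => ?_) hf]
  · refine integral_congr_ae (Filter.Eventually.of_forall fun ω => ?_)
    by_cases c : (X k ω).visits h s a <;> simp [c]
  · refine (integral_mul_indicator hle (hI.measurable_cost k h hB) (hI.cost_law k hk h hh B hB) hW
      (fun ω => by rw [abs_of_nonneg (hW0 ω)]; exact hWC ω)).trans ?_
    rw [← integral_const_mul]
    refine integral_congr_ae (Filter.Eventually.of_forall fun ω => ?_)
    by_cases c : (X k ω).visits h s a
    · have c2 := c
      obtain ⟨e1, e2⟩ := c2
      simp only [c, if_true, e1, e2]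
      ring
    · simp [c]

/-- The fluctuations of the costs of a pair. Costs outside `[0, 1]`, which have probability `0`,
are projected to this interval. -/
theorem IsInteraction.incrementBounds_cost {h : ℕ} (hh : h < p.H) (s : S) (a : A) :
    IncrementBounds μ (fun k => historyAction p.H X k h)
      (fun k ω => if (X k ω).visits h s a then
        max 0 (min 1 ((X k ω).cost h)) - M.c h s a else 0)
      (fun k ω => if (X k ω).visits h s a then 1 else 0) p.K := by
  have hc := mean_costLaw_mem M h s a
  have hvs : ∀ k, MeasurableSet {ω | (X k ω).visits h s a} := fun k =>
    measurable_visits (hI.measurable_state k h s) (hI.measurable_action k h a)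
  have hclip : Measurable fun y : ℝ => max 0 (min 1 y) - M.c h s a := by fun_prop
  have habs : ∀ k ω, |if (X k ω).visits h s a then
      max 0 (min 1 ((X k ω).cost h)) - M.c h s a else 0| ≤ 1 := fun k ω => by
    split_ifs
    · have h1 : 0 ≤ max 0 (min 1 ((X k ω).cost h)) := le_max_left _ _
      have h2 : max 0 (min 1 ((X k ω).cost h)) ≤ 1 := max_le zero_le_one (min_le_left _ _)
      rw [_root_.abs_le]; constructor <;> linarith [hc.1, hc.2]
    · simp
  exact {
    le := fun k => hI.historyAction_le k h
    meas := fun k _ => Measurable.ite (hvs k) (hclip.comp (hI.measurable_cost k h))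
      measurable_const
    past := fun k hk i hi => Measurable.ite ((le_sup_left : _ ≤ historyAction p.H X k h) _
        (history_visits_past hi hh s a))
      (hclip.comp ((history_cost_past hi hh).mono le_sup_left le_rfl)) measurable_const
    meas_v := fun k hk i hi => Measurable.ite (historyAction_visits hi hh s a)
      measurable_const measurable_const
    abs_le := fun k _ ω => habs k ω
    v_nonneg := fun k _ ω => by split_ifs <;> simp
    v_le := fun k _ ω => by split_ifs <;> simp
    mean := fun k hk G hG h0 ⟨C, hC⟩ => by
      have := M.costLaw_prob h s a
      have hIcc := M.costLaw_Icc h s a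
      have hint : Integrable (fun x : ℝ => x) (M.costLaw h s a) :=
        (integrable_const (1 : ℝ)).mono' measurable_id.aestronglyMeasurable
          (hIcc.mono fun x hx => by rw [Real.norm_eq_abs, abs_of_nonneg hx.1]; exact hx.2)
      rw [hI.integral_mul_cost hk hh s a hG h0 hC hclip]
      have e : ∫ y, (max 0 (min 1 y) - M.c h s a) ∂(M.costLaw h s a) = 0 := by
        have e1 : (fun y : ℝ => max 0 (min 1 y) - M.c h s a) =ᵐ[M.costLaw h s a]
            fun y => y - M.c h s a := by
          filter_upwards [hIcc] with y hy
          rw [min_eq_right hy.2, max_eq_right hy.1]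
        rw [integral_congr_ae e1, integral_sub hint (integrable_const _)]
        simp [MDP.c]
      rw [e, zero_mul]
    var := fun k hk G hG h0 ⟨C, hC⟩ => by
      have hGm := hG.mono (hI.historyAction_le k h) le_rfl
      have hsq : ∀ ω, (if (X k ω).visits h s a then
          max 0 (min 1 ((X k ω).cost h)) - M.c h s a else 0) ^ 2 ≤
          if (X k ω).visits h s a then (1 : ℝ) else 0 := fun ω => by
        have h1 := habs k ω
        split_ifs at h1 ⊢
        · rw [← sq_abs]; exact pow_le_one₀ (abs_nonneg _) h1
        · simp
      refine integral_mono_of_nonneg (Filter.Eventually.of_forall fun ω =>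
        mul_nonneg (h0 ω) (sq_nonneg _)) ?_ (Filter.Eventually.of_forall fun ω =>
          mul_le_mul_of_nonneg_left (hsq ω) (h0 ω))
      refine integrable_of_bounded (hGm.mul (Measurable.ite (hvs k) measurable_const
        measurable_const)) (C := C) fun ω => ?_
      rw [abs_mul, abs_of_nonneg (h0 ω)]
      refine (mul_le_of_le_one_right (h0 ω) ?_).trans (hC ω)
      split_ifs <;> simp }

theorem IsInteraction.ae_cost_mem {k h : ℕ} (hk : k ∈ Icc 1 p.K) (hh : h < p.H) :
    ∀ᵐ ω ∂μ, (X k ω).cost h ∈ Set.Icc (0 : ℝ) 1 := by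
  have hB : MeasurableSet (Set.Icc (0 : ℝ) 1)ᶜ := measurableSet_Icc.compl
  have h1 := integral_mul_indicator (hI.historyAction_le k h) (hI.measurable_cost k h hB)
    (hI.cost_law k hk h hh _ hB) (G := fun _ => (1 : ℝ)) measurable_const (C := 1) (by simp)
  have h2 : ∀ s a, (M.costLaw h s a).real (Set.Icc (0 : ℝ) 1)ᶜ = 0 := fun s a => by
    have := M.costLaw_Icc h s a
    rw [Measure.real, (mem_ae_iff.1 this : M.costLaw h s a (Set.Icc (0 : ℝ) 1)ᶜ = 0)]
    rfl
  simp only [one_mul, h2, integral_zero] at h1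
  rw [integral_indicator (hI.measurable_cost k h hB)] at h1
  simp only [integral_const, smul_eq_mul, mul_one, measureReal_restrict_apply_univ] at h1
  rw [ae_iff]
  exact (measureReal_eq_zero_iff).1 h1

/-- The visits of a pair, centered at their conditional probabilities given the past episodes. -/
theorem IsInteraction.incrementBounds_visits {h : ℕ} (hh : h < p.H) (s : S) (a : A) :
    IncrementBounds μ (fun k => history p.H X k 0)
      (fun k ω => ((if (X k ω).visits h s a then 1 else 0) -
        visitProb M p (fun i => X i ω) s₁ k h s a) * 1)
      (fun k ω => visitProb M p (fun i => X i ω) s₁ k h s a * 1) p.K := by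
  refine incrementBounds_indicator (w := fun _ _ => 1) (fun k => hI.history_le k 0)
    (fun k _ => measurable_visits (hI.measurable_state k h s) (hI.measurable_action k h a))
    (fun k _ i hi => history_visits_past hi hh s a) (fun k _ i hi => ?_)
    (fun k _ i _ => measurable_const)
    (fun k ω => ⟨visitProb_nonneg k h s a, visitProb_le_one k h s a⟩)
    (fun k ω => ⟨zero_le_one, le_rfl⟩)
    (fun k hk G hG hC => (hI.integral_mul_visit hk h).2 hh s a G hG hC)
  exact measurable_visitProb (DataMeasurable.mono (ℱ := history p.H X k 0)
    (dataMeasurable_of_history_le le_rfl) (Nat.sub_le_sub_right (mem_Icc.1 hi).2 1)) hh s a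

omit hI m0 [IsProbabilityMeasure μ] in
theorem gapBound_nonneg {D : ℕ → Episode S A} (k : ℕ) :
    ∀ h ≤ p.H, ∀ s, 0 ≤ gapBound M p D k h s :=
  ret_nonneg (fun h s a => (M.P_mem h s a).1) (fun h s => (policyAt_mem p D k h s).1)
    fun _ hh s a => add_nonneg (mul_nonneg zero_le_two
      (add_nonneg (Real.sqrt_nonneg _) (mul_nonneg (Nat.cast_nonneg _) (Real.sqrt_nonneg _))))
      (sub_nonneg.2 (opt_le_optQ M hh s a))

omit [Fintype A] [Nonempty A] [DecidableEq A] hI m0 [IsProbabilityMeasure μ] in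
theorem occ_le_one {P : ℕ → S → A → S → ℝ} [Fintype A] {π : ℕ → S → A → ℝ} (s₁ : S)
    (hP : ∀ h s a, P h s a ∈ stdSimplex ℝ S) (hπ : IsPolicy π) (h : ℕ) (s : S) :
    occ P π s₁ h s ≤ 1 := by
  rw [← sum_occ s₁ hP hπ h]
  exact single_le_sum (f := fun s => occ P π s₁ h s) (fun s _ => occ_nonneg s₁
    (fun h s a => (hP h s a).1) (fun h s => (hπ h s).1) h s) (mem_univ s)

/-- The visits of a state, centered at their conditional probabilities given the past episodes
and weighted by the truncated gap bound. -/
theorem IsInteraction.incrementBounds_gap {h : ℕ} (hh : h < p.H) (s : S) :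
    IncrementBounds μ (fun k => history p.H X k 0)
      (fun k ω => ((if (X k ω).state h = s then 1 else 0) -
        occ M.P (policyAt p (fun i => X i ω) k) s₁ h s) *
          min (gapBound M p (fun i => X i ω) k h s / p.H) 1)
      (fun k ω => occ M.P (policyAt p (fun i => X i ω) k) s₁ h s *
        min (gapBound M p (fun i => X i ω) k h s / p.H) 1) p.K := by
  have hdata : ∀ k, ∀ i ∈ Icc 1 k, DataMeasurable (history p.H X k 0) p X (i - 1) :=
    fun k i hi => DataMeasurable.mono (ℱ := history p.H X k 0)
      (dataMeasurable_of_history_le le_rfl) (Nat.sub_le_sub_right (mem_Icc.1 hi).2 1)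
  refine incrementBounds_indicator (fun k => hI.history_le k 0)
    (fun k _ => hI.measurable_state k h s)
    (fun k _ i hi => history_state_past hi hh.le s)
    (fun k _ i hi => measurable_occ (hdata k i hi) hh.le s) (fun k _ i hi => ?_)
    (fun k ω => ⟨occ_policyAt_nonneg k h s,
      occ_le_one s₁ M.P_mem (policyAt_mem p _ k) h s⟩)
    (fun k ω => ⟨le_min (div_nonneg (gapBound_nonneg k h hh.le s) (Nat.cast_nonneg _))
      zero_le_one, min_le_right _ _⟩)
    (fun k hk G hG hC => (hI.integral_mul_visit hk h).1 hh.le s G hG hC)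
  exact ((measurable_gapBound (hdata k i hi) h hh.le s).div_const _).min measurable_const

end Interaction

/-! ### The probability of accurate estimates -/

section Measure

variable {Ω : Type*} [m0 : MeasurableSpace Ω] {μ : Measure Ω}

theorem measure_not_forall_le {ι : Type*} (t : Finset ι) {P : ι → Ω → Prop} {β : ENNReal}
    (h : ∀ i ∈ t, μ {ω | ¬ P i ω} ≤ β) : μ {ω | ¬ ∀ i ∈ t, P i ω} ≤ #t * β := by
  have e : {ω | ¬ ∀ i ∈ t, P i ω} ⊆ ⋃ i ∈ t, {ω | ¬ P i ω} := by
    intro ω hω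
    simpa using hω
  refine (measure_mono e).trans ((measure_biUnion_finset_le _ _).trans ?_)
  refine (sum_le_sum h).trans ?_
  rw [sum_const, nsmul_eq_mul]

theorem measure_not_and_le {P Q : Ω → Prop} {a b : ENNReal} (hP : μ {ω | ¬ P ω} ≤ a)
    (hQ : μ {ω | ¬ Q ω} ≤ b) : μ {ω | ¬ (P ω ∧ Q ω)} ≤ a + b := by
  have e : {ω | ¬ (P ω ∧ Q ω)} ⊆ {ω | ¬ P ω} ∪ {ω | ¬ Q ω} := by
    intro ω hω
    exact not_and_or.1 hω
  exact (measure_mono e).trans ((measure_union_le _ _).trans (add_le_add hP hQ))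

theorem measure_not_mono {P Q : Ω → Prop} {a : ENNReal} (hP : μ {ω | ¬ P ω} ≤ a)
    (h : ∀ ω, P ω → Q ω) : μ {ω | ¬ Q ω} ≤ a :=
  (measure_mono fun ω (hω : ¬ Q ω) => show ¬ P ω from fun hp => hω (h ω hp)).trans hP

/-- The bound for the error probability of a single application of the Bernstein inequality. -/
noncomputable def bernsteinError (K : ℕ) (x : ℝ) : ENNReal :=
  ENNReal.ofReal ((Nat.log 2 K + 1) * Real.exp (-x))

theorem ofReal_exp_le_bernsteinError (K : ℕ) (x : ℝ) :
    ENNReal.ofReal (Real.exp (-x)) ≤ bernsteinError K x :=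
  ENNReal.ofReal_le_ofReal (le_mul_of_one_le_left (Real.exp_pos _).le
    (by linarith [Nat.cast_nonneg (α := ℝ) (Nat.log 2 K)]))

variable [IsProbabilityMeasure μ] {𝒢 : ℕ → MeasurableSpace Ω} {ξ v : ℕ → Ω → ℝ} {K : ℕ}

theorem IncrementBounds.measure_abs_le (h : IncrementBounds μ 𝒢 ξ v K) {x : ℝ} (hx : 1 ≤ x) :
    μ {ω | ¬ ∀ n ≤ K, |∑ i ∈ Icc 1 n, ξ i ω| ≤ 3 * √((∑ i ∈ Icc 1 n, v i ω) * x) + 2 * x} ≤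
      2 * bernsteinError K x := by
  have h1 : μ {ω | ¬ ∀ n ≤ K, ∑ i ∈ Icc 1 n, ξ i ω ≤
      3 * √((∑ i ∈ Icc 1 n, v i ω) * x) + 2 * x} ≤ bernsteinError K x := by
    refine (measure_mono ?_).trans (h.measure_bernstein_le hx)
    intro ω hω
    simpa using hω
  have h2 : μ {ω | ¬ ∀ n ≤ K, ∑ i ∈ Icc 1 n, -ξ i ω ≤
      3 * √((∑ i ∈ Icc 1 n, v i ω) * x) + 2 * x} ≤ bernsteinError K x := by
    refine (measure_mono ?_).trans (h.neg.measure_bernstein_le hx)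
    intro ω hω
    simpa using hω
  rw [two_mul (bernsteinError K x)]
  refine measure_not_mono (measure_not_and_le h1 h2) fun ω hω n hn => ?_
  have := hω.2 n hn
  rw [sum_neg_distrib] at this
  exact _root_.abs_le.2 ⟨by linarith, hω.1 n hn⟩

end Measure

/-- Dividing a Bernstein bound by the number of observations. -/
theorem abs_le_of_mul_bernstein {n v x d : ℝ} (hn : 0 < n)
    (h : |n * d| ≤ 3 * √(n * v * x) + 2 * x) : |d| ≤ 3 * √(v * (x / n)) + 2 * (x / n) := by
  have e : √(n * v * x) = n * √(v * (x / n)) := by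
    rw [show n * v * x = n ^ 2 * (v * (x / n)) by field_simp, Real.sqrt_mul (sq_nonneg n),
      Real.sqrt_sq hn.le]
  rw [abs_mul, abs_of_pos hn, e] at h
  refine le_of_mul_le_mul_left ?_ hn
  rw [mul_add, show n * (2 * (x / n)) = 2 * x by field_simp]
  linarith

section Counts

variable {S A : Type*} [Fintype S] [DecidableEq S] [DecidableEq A]

omit [Fintype S] in
theorem visitSAS_eq_sum (D : ℕ → Episode S A) (k h : ℕ) (s : S) (a : A) (y : S) :
    (visitSAS D k h s a y : ℝ) =
      ∑ i ∈ Icc 1 k, if (D i).visits h s a ∧ (D i).state (h + 1) = y then 1 else 0 := by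
  rw [visitSAS, card_filter]
  push_cast
  simp only [Episode.visits, and_assoc]

theorem sum_state_increments {D : ℕ → Episode S A} {k h : ℕ} {s : S} {a : A}
    (hn : visitSA D k h s a ≠ 0) (w f : S → ℝ) :
    ∑ i ∈ Icc 1 k, ∑ y, (f y - ∑ z, w z * f z) *
      (if (D i).visits h s a ∧ (D i).state (h + 1) = y then 1 else 0) =
    visitSA D k h s a * ∑ y, (PBar D k h s a y - w y) * f y := by
  have hn' : (visitSA D k h s a : ℝ) ≠ 0 := by exact_mod_cast hn
  rw [sum_comm]
  simp_rw [← mul_sum, ← visitSAS_eq_sum, sub_mul, sum_sub_distrib]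
  rw [← mul_sum, ← Nat.cast_sum, sum_visitSAS, mul_sub, mul_sum]
  congr 1
  · refine sum_congr rfl fun y _ => ?_
    rw [PBar]
    field_simp
  · ring

omit [Fintype S] in
theorem sum_cost_increments {D : ℕ → Episode S A} {k h : ℕ} {s : S} {a : A}
    (hn : visitSA D k h s a ≠ 0) (hc : ∀ i ∈ Icc 1 k, (D i).cost h ∈ Set.Icc (0 : ℝ) 1) (c : ℝ) :
    ∑ i ∈ Icc 1 k, (if (D i).visits h s a then max 0 (min 1 ((D i).cost h)) - c else 0) =
    visitSA D k h s a * (cBar D k h s a - c) := by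
  have hn' : (visitSA D k h s a : ℝ) ≠ 0 := by exact_mod_cast hn
  rw [cBar, mul_sub, mul_div_cancel₀ _ hn', visitSA_eq_sum, sum_filter, sum_mul,
    ← sum_sub_distrib]
  refine sum_congr rfl fun i hi => ?_
  rw [min_eq_right (hc i hi).2, max_eq_right (hc i hi).1]
  by_cases h1 : (D i).visits h s a
  · simp only [h1, if_true, one_mul]
    rw [if_pos (show (D i).state h = s ∧ (D i).action h = a from h1)]
  · simp only [h1, if_false, zero_mul, sub_zero]
    rw [if_neg (show ¬ ((D i).state h = s ∧ (D i).action h = a) from h1)]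

end Counts

section Interaction

variable {S A Ω : Type*} [Fintype S] [Fintype A] [DecidableEq S] [DecidableEq A] [Nonempty A]
variable [m0 : MeasurableSpace Ω] {μ : Measure Ω} [IsProbabilityMeasure μ]
variable {M : MDP S A} {p : Params} {s₁ : S} {X : ℕ → Ω → Episode S A}
variable (hI : IsInteraction M p s₁ μ X) {x : ℝ} (hx : 1 ≤ x)
include hI hx

theorem IsInteraction.measure_state_dev {h : ℕ} (hh : h < p.H) (s : S) (a : A) {f : S → ℝ}
    (hf : ∀ y, f y ∈ Set.Icc (0 : ℝ) 1) :
    μ {ω | ¬ ∀ k ≤ p.K, visitSA (fun i => X i ω) k h s a ≠ 0 →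
      |∑ y, (PBar (fun i => X i ω) k h s a y - M.P h s a y) * f y| ≤
        3 * √(variance (M.P h s a) f * (x / visitSA (fun i => X i ω) k h s a)) +
          2 * (x / visitSA (fun i => X i ω) k h s a)} ≤ 2 * bernsteinError p.K x := by
  refine measure_not_mono ((hI.incrementBounds_state hh s a hf).measure_abs_le hx)
    fun ω hω k hk hn => ?_
  have h1 := hω k hk
  rw [sum_state_increments (D := fun i => X i ω) hn, ← mul_sum,
    ← visitSA_eq_sum (fun i => X i ω), mul_comm (variance _ _)] at h1
  exact abs_le_of_mul_bernstein (by exact_mod_cast Nat.pos_of_ne_zero hn) h1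

theorem IsInteraction.measure_cost_dev {h : ℕ} (hh : h < p.H) (s : S) (a : A) :
    μ {ω | ¬ ((∀ i ∈ Icc 1 p.K, (X i ω).cost h ∈ Set.Icc (0 : ℝ) 1) →
      ∀ k ≤ p.K, visitSA (fun i => X i ω) k h s a ≠ 0 →
      |cBar (fun i => X i ω) k h s a - M.c h s a| ≤
        3 * √(x / visitSA (fun i => X i ω) k h s a) +
          2 * (x / visitSA (fun i => X i ω) k h s a))} ≤ 2 * bernsteinError p.K x := by
  refine measure_not_mono ((hI.incrementBounds_cost hh s a).measure_abs_le hx)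
    fun ω hω hc k hk hn => ?_
  have h1 := hω k hk
  rw [sum_cost_increments (D := fun i => X i ω) hn
    (fun i hi => hc i (Icc_subset_Icc_right hk hi)), ← visitSA_eq_sum (fun i => X i ω)] at h1
  have := abs_le_of_mul_bernstein (v := 1) (x := x) (d := cBar (fun i => X i ω) k h s a - M.c h s a)
    (by exact_mod_cast Nat.pos_of_ne_zero hn : (0 : ℝ) < visitSA (fun i => X i ω) k h s a)
    (by rwa [mul_one])
  rwa [one_mul] at this

omit hx in
theorem IsInteraction.measure_visits_lower {h : ℕ} (hh : h < p.H) (s : S) (a : A) :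
    μ {ω | ¬ ∀ k ≤ p.K, (∑ i ∈ Icc 1 k, visitProb M p (fun i => X i ω) s₁ i h s a) / 2 - 2 * x ≤
      visitSA (fun i => X i ω) k h s a} ≤ bernsteinError p.K x := by
  refine le_trans (measure_mono ?_)
    (((hI.incrementBounds_visits hh s a).neg.measure_exceed_le (x := x)
      (by norm_num : (0 : ℝ) < 1 / 2) (by norm_num)).trans (ofReal_exp_le_bernsteinError _ _))
  intro ω hω
  simp only [Set.mem_ofPred_eq, not_forall, not_le] at hω
  obtain ⟨k, hk, hlt⟩ := hω
  refine ⟨k, hk, ?_⟩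
  simp only [mul_one]
  rw [sum_neg_distrib, sum_sub_distrib, ← visitSA_eq_sum (fun i => X i ω)]
  linarith

omit hx in
theorem IsInteraction.measure_visits_upper {h : ℕ} (hh : h < p.H) (s : S) :
    μ {ω | ¬ ∑ i ∈ Icc 1 p.K, (if (X i ω).state h = s then
        min (gapBound M p (fun i => X i ω) i h s / p.H) 1 else 0) ≤
      2 * ∑ i ∈ Icc 1 p.K, occ M.P (policyAt p (fun i => X i ω) i) s₁ h s *
        min (gapBound M p (fun i => X i ω) i h s / p.H) 1 + x} ≤ bernsteinError p.K x := by
  refine le_trans (measure_mono ?_)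
    (((hI.incrementBounds_gap hh s).measure_exceed_le (x := x)
      zero_lt_one le_rfl).trans (ofReal_exp_le_bernsteinError _ _))
  intro ω hω
  simp only [Set.mem_ofPred_eq, not_le] at hω
  refine ⟨p.K, le_rfl, ?_⟩
  simp only [sub_mul, ite_mul, one_mul, zero_mul, div_one]
  rw [sum_sub_distrib]
  linarith

/-- All empirical estimates are accurate up to an error probability proportional to `e^{-x}`. -/
theorem IsInteraction.measure_not_accurate_le (hH : 0 < p.H) :
    μ {ω | ¬ (Accurate M p (fun i => X i ω) x ∧ VisitsAccurate M p (fun i => X i ω) x s₁)} ≤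
      p.H * (Fintype.card S * (Fintype.card A *
        (2 + Fintype.card S * 2 + 2 + 1 + 1 : ℕ))) * bernsteinError p.K x := by
  set β := bernsteinError p.K x with hβ
  have hH' : (0 : ℝ) < p.H := by exact_mod_cast hH
  -- the test functions for the next state: the optimal value, scaled to `[0, 1]`, and indicators
  have hopt : ∀ h < p.H, ∀ y, M.opt p.H (h + 1) y / p.H ∈ Set.Icc (0 : ℝ) 1 := fun h hh y => by
    obtain ⟨a1, a2⟩ := opt_mem M p.H (h + 1) hh y
    refine ⟨div_nonneg a1 hH'.le, (div_le_one hH').2 (a2.trans ?_)⟩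
    linarith [Nat.cast_nonneg (α := ℝ) (h + 1)]
  have hsingle : ∀ y z, (Pi.single y 1 : S → ℝ) z ∈ Set.Icc (0 : ℝ) 1 := fun y z => by
    by_cases h : z = y
    · subst h; simp
    · simp [h]
  have hcost : μ {ω | ¬ ∀ k ∈ Icc 1 p.K, ∀ h ∈ range p.H, (X k ω).cost h ∈ Set.Icc (0 : ℝ) 1} ≤
      0 := by
    refine (measure_not_forall_le (β := 0) _ fun k hk => ?_).trans (by simp)
    refine (measure_not_forall_le (β := 0) _ fun h hh => ?_).trans (by simp)
    exact (ae_iff.1 (hI.ae_cost_mem hk (mem_range.1 hh))).le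
  have hpair : ∀ h ∈ range p.H, ∀ s ∈ (univ : Finset S), ∀ a ∈ (univ : Finset A), _ :=
    fun h hh s _ a _ =>
    measure_not_and_le (measure_not_and_le (measure_not_and_le (measure_not_and_le
      (hI.measure_cost_dev hx (mem_range.1 hh) s a)
      (measure_not_forall_le univ fun y _ =>
        hI.measure_state_dev hx (mem_range.1 hh) s a (hsingle y)))
      (hI.measure_state_dev hx (mem_range.1 hh) s a (hopt h (mem_range.1 hh))))
      (hI.measure_visits_lower (x := x) (mem_range.1 hh) s a))
      (hI.measure_visits_upper (x := x) (mem_range.1 hh) s)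
  have htotal := measure_not_forall_le (range p.H) fun h hh =>
    measure_not_forall_le univ fun s hs => measure_not_forall_le univ fun a ha =>
      hpair h hh s hs a ha
  have hfin := measure_not_and_le hcost htotal
  refine (measure_not_mono hfin ?_).trans (le_of_eq ?_)
  · rintro ω ⟨hc, hall⟩
    have hall' := fun h (hh : h < p.H) s a =>
      hall h (mem_range.2 hh) s (mem_univ s) a (mem_univ a)
    refine ⟨⟨fun k hk h hh => hc k hk h (mem_range.2 hh), fun k hk h hh s a hn => ?_,
      fun k hk h hh s a y hn => ?_, fun k hk h hh s a hn => ?_⟩,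
      ⟨fun k hk h hh s a => ?_, fun h hh s => ?_⟩⟩
    · exact (hall' h hh s a).1.1.1.1 (fun i hi => hc i hi h (mem_range.2 hh)) k hk hn
    · have h1 := (hall' h hh s a).1.1.1.2 y (mem_univ y) k hk hn
      have e : ∑ z, (PBar (fun i => X i ω) k h s a z - M.P h s a z) *
          (Pi.single y 1 : S → ℝ) z = PBar (fun i => X i ω) k h s a y - M.P h s a y := by
        rw [sum_eq_single y]
        · simp
        · intro z _ hz; simp [hz]
        · simp
      rw [e, variance_single (M.P_mem h s a)] at h1
      refine h1.trans ?_
      have hP := (M.P_mem h s a).1 y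
      have hle : M.P h s a y * (1 - M.P h s a y) ≤ M.P h s a y := by nlinarith
      have := Real.sqrt_le_sqrt (mul_le_mul_of_nonneg_right hle
        (by positivity : 0 ≤ x / visitSA (fun i => X i ω) k h s a))
      linarith
    · have h1 := (hall' h hh s a).1.1.2 k hk hn
      have e1 : ∑ y, (PBar (fun i => X i ω) k h s a y - M.P h s a y) *
          (M.opt p.H (h + 1) y / p.H) = (∑ y, (PBar (fun i => X i ω) k h s a y - M.P h s a y) *
          M.opt p.H (h + 1) y) / p.H := by
        rw [sum_div]
        exact sum_congr rfl fun y _ => by ring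
      have e2 : variance (M.P h s a) (fun y => M.opt p.H (h + 1) y / p.H) =
          variance (M.P h s a) (M.opt p.H (h + 1)) / (p.H : ℝ) ^ 2 := by
        simp only [variance, sum_div]
        refine sum_congr rfl fun y _ => ?_
        have : ∑ z, M.P h s a z * (M.opt p.H (h + 1) z / p.H) =
            (∑ z, M.P h s a z * M.opt p.H (h + 1) z) / p.H := by
          rw [sum_div]
          exact sum_congr rfl fun y _ => by ring
        rw [this]
        field_simp
      rw [e1, e2, abs_div, abs_of_pos hH', div_le_iff₀ hH', div_mul_eq_mul_div,
        Real.sqrt_div' _ (sq_nonneg _), Real.sqrt_sq hH'.le] at h1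
      refine h1.trans (le_of_eq ?_)
      field_simp
    · exact (hall' h hh s a).1.2 k hk
    · exact (hall' h hh s (Classical.arbitrary A)).2
  · simp only [card_range, card_univ]
    push_cast
    ring

end Interaction

/-! ### Large numbers of episodes -/

/-- The number of episodes beyond which powers of `K` dominate the logarithmic terms. -/
noncomputable def minEpisodes : ℝ := Real.exp (10 ^ 14)

section Numeric

variable {K : ℕ} {N : ℝ}

theorem log_bounds_of_large (hN : 1 ≤ N) (hK : minEpisodes * N ^ 400 ≤ K) :
    10 ^ 14 ≤ Real.log K ∧ 400 * Real.log N ≤ Real.log K := by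
  have hK0 : 0 < minEpisodes := Real.exp_pos _
  have hN0 : 0 < N := by linarith
  have h1 : Real.log (minEpisodes * N ^ 400) ≤ Real.log K := Real.log_le_log (by positivity) hK
  rw [Real.log_mul hK0.ne' (by positivity), Real.log_pow, minEpisodes, Real.log_exp] at h1
  have := Real.log_nonneg hN
  push_cast at h1
  constructor <;> linarith

/-- The exponent of the error probability is a small fraction of the logarithmic factor. -/
theorem log_error_le (hN : 1 ≤ N) (hK : minEpisodes * N ^ 400 ≤ K) :
    100 * Real.log (8 * N ^ 2 * (Nat.log 2 K + 1)) ≤ Real.log K := by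
  obtain ⟨hy, hyN⟩ := log_bounds_of_large hN hK
  set y := Real.log K with hydef
  have hK0 : (0 : ℝ) < K := by
    by_contra h
    have : (K : ℝ) = 0 := le_antisymm (not_lt.1 h) (Nat.cast_nonneg _)
    rw [hydef, this, Real.log_zero] at hy
    norm_num at hy
  have hN0 : 0 < N := by linarith
  have hJ : (Nat.log 2 K : ℝ) ≤ 2 * y := by
    have h1 : 2 ^ Nat.log 2 K ≤ K := Nat.pow_log_le_self 2 (by exact_mod_cast hK0.ne')
    have h2 : (2 : ℝ) ^ Nat.log 2 K ≤ K := by exact_mod_cast h1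
    have h3 := Real.log_le_log (by positivity) h2
    rw [Real.log_pow] at h3
    have h4 : (1 / 2 : ℝ) ≤ Real.log 2 := by linarith [Real.log_two_gt_d9]
    have h5 := mul_le_mul_of_nonneg_left h4 (Nat.cast_nonneg (α := ℝ) (Nat.log 2 K))
    linarith
  have h8 : Real.log 8 ≤ 3 := by
    rw [show (8 : ℝ) = 2 ^ 3 by norm_num, Real.log_pow]
    push_cast
    linarith [Real.log_two_lt_d9]
  have hJ1 : (0 : ℝ) < Nat.log 2 K + 1 := by positivity
  -- the number of dyadic scales contributes only a double logarithm
  have hlog : Real.log (Nat.log 2 K + 1) ≤ 2 * (y / 500) := by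
    have h1 : (Nat.log 2 K : ℝ) + 1 ≤ (y / 500) ^ 2 := by nlinarith
    have h2 := Real.log_le_log hJ1 h1
    rw [Real.log_pow] at h2
    have h3 := Real.log_le_sub_one_of_pos (by linarith : 0 < y / 500)
    push_cast at h2
    linarith
  rw [Real.log_mul (by positivity) hJ1.ne', Real.log_mul (by norm_num) (by positivity),
    Real.log_pow]
  push_cast
  linarith

/-- A small power of `K` dominates the parameters and the logarithmic factor. -/
theorem rpow_ge_of_large (hN : 1 ≤ N) (hK : minEpisodes * N ^ 400 ≤ K) :
    N ^ 5 ≤ (K : ℝ) ^ (1 / 16 : ℝ) ∧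
      1400 * Real.log (10 * N * K) ^ 4 ≤ (K : ℝ) ^ (1 / 16 : ℝ) := by
  obtain ⟨hy, hyN⟩ := log_bounds_of_large hN hK
  have hN0 : 0 < N := by linarith
  have hK0 : (0 : ℝ) < K := lt_of_lt_of_le
    (mul_pos (Real.exp_pos _) (by positivity : (0 : ℝ) < N ^ 400)) hK
  have hlogN := Real.log_nonneg hN
  set y := Real.log K with hydef
  have hZ : (K : ℝ) ^ (1 / 16 : ℝ) = Real.exp (y / 16) := by
    rw [Real.rpow_def_of_pos hK0]
    congr 1
    ring
  rw [hZ]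
  constructor
  · rw [← Real.exp_log (pow_pos hN0 5), Real.log_pow]
    refine Real.exp_le_exp.2 ?_
    push_cast
    linarith
  · have h10 : Real.log 10 ≤ 9 := by
      have := Real.log_le_sub_one_of_pos (by norm_num : (0 : ℝ) < 10)
      linarith
    have hL0 : 0 ≤ Real.log (10 * N * K) := by
      rw [Real.log_mul (by positivity) hK0.ne', Real.log_mul (by norm_num) hN0.ne']
      have := Real.log_nonneg (by norm_num : (1 : ℝ) ≤ 10)
      linarith
    have hL : Real.log (10 * N * K) ≤ 2 * y := by
      rw [Real.log_mul (by positivity) hK0.ne', Real.log_mul (by norm_num) hN0.ne']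
      linarith
    have h1 := pow_le_pow_left₀ hL0 hL 4
    -- `exp (y / 16)` exceeds the term of degree five of its series, and `y` is at least `10 ^ 14`
    have h2 := Real.pow_div_factorial_le_exp (y / 16) (by linarith) 5
    refine le_trans ?_ h2
    have h3 : 10 ^ 14 * y ^ 4 ≤ y ^ 5 := by
      have := mul_le_mul_of_nonneg_right hy (by positivity : 0 ≤ y ^ 4)
      linarith
    have e : (y / 16) ^ 5 / (Nat.factorial 5 : ℝ) = y ^ 5 / 125829120 := by
      norm_num [Nat.factorial]
      ring
    rw [e, le_div_iff₀ (by norm_num)]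
    have : 0 ≤ y ^ 4 := by positivity
    nlinarith

/-- Polynomials of low degree in the parameters and in the logarithm `L` are dominated by powers
of `Z`, which stands for `K ^ (1 / 16)`. -/
theorem dominated_by_large {s a H Z L : ℝ} (hs : 1 ≤ s) (ha : 1 ≤ a) (hH : 1 ≤ H)
    (hN1 : s * a * H ≤ N) (hN5 : N ^ 5 ≤ Z) (hL : 1 ≤ L) (hLZ : 1400 * L ^ 4 ≤ Z) :
    (Z ^ 2)⁻¹ * H ≤ 1 / 2 ∧ 16 * s * H ^ 2 * L ≤ Z ^ 8 ∧
      1400 * (Z ^ 2)⁻¹ * (s ^ 5 * a ^ 2 * H ^ 4 * L ^ 2) ≤ 1 ∧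
      s ^ 3 * a ^ 2 * H ^ 3 * L ^ 4 * Z ^ 4 ≤ Z ^ 8 := by
  have hsa : 1 ≤ s * a := one_le_mul_of_one_le_of_one_le hs ha
  have hN : 1 ≤ N := (one_le_mul_of_one_le_of_one_le hsa hH).trans hN1
  have hL4 : ∀ j ≤ 4, L ^ j ≤ L ^ 4 := fun j hj => pow_le_pow_right₀ hL hj
  have hNZ : ∀ j ≤ 5, N ^ j ≤ Z := fun j hj => (pow_le_pow_right₀ hN hj).trans hN5
  have hZ1 : 1400 ≤ Z := by linarith [one_le_pow₀ hL (n := 4)]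
  have hZ0 : 0 < Z := by linarith
  have hL1 : 1400 * L ≤ Z := by
    have := hL4 1 (by norm_num)
    rw [pow_one] at this
    linarith
  have hL2 : 1400 * L ^ 2 ≤ Z := by linarith [hL4 2 (by norm_num)]
  have hL0 : 0 ≤ L := by linarith
  refine ⟨?_, ?_, ?_, ?_⟩
  · have h1 : H ≤ Z := by
      have h2 := hNZ 1 (by norm_num)
      have h3 : H ≤ s * a * H := le_mul_of_one_le_left (by linarith) hsa
      linarith
    rw [inv_mul_le_iff₀ (by positivity)]
    nlinarith
  · have h1 : s * H ^ 2 ≤ N ^ 2 := by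
      refine le_trans ?_ (pow_le_pow_left₀ (by positivity) hN1 2)
      rw [mul_pow, mul_pow]
      refine mul_le_mul_of_nonneg_right ?_ (by positivity)
      exact (le_self_pow₀ hs two_ne_zero).trans
        (le_mul_of_one_le_right (by positivity) (one_le_pow₀ ha))
    have h2 : s * H ^ 2 * (16 * L) ≤ Z * Z :=
      mul_le_mul (h1.trans (hNZ 2 (by norm_num))) (by linarith) (by linarith) hZ0.le
    have h3 : Z ^ 2 ≤ Z ^ 8 := pow_le_pow_right₀ (by linarith) (by norm_num)
    linarith
  · have h1 : s ^ 5 * a ^ 2 * H ^ 4 ≤ N ^ 5 := by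
      refine le_trans ?_ (pow_le_pow_left₀ (by positivity) hN1 5)
      rw [mul_pow, mul_pow]
      exact mul_le_mul (mul_le_mul_of_nonneg_left (pow_le_pow_right₀ ha (by norm_num))
        (by positivity)) (pow_le_pow_right₀ hH (by norm_num)) (by positivity) (by positivity)
    have h2 : s ^ 5 * a ^ 2 * H ^ 4 * (1400 * L ^ 2) ≤ Z * Z :=
      mul_le_mul (h1.trans hN5) hL2 (by positivity) hZ0.le
    rw [show 1400 * (Z ^ 2)⁻¹ * (s ^ 5 * a ^ 2 * H ^ 4 * L ^ 2) =
      (Z ^ 2)⁻¹ * (s ^ 5 * a ^ 2 * H ^ 4 * (1400 * L ^ 2)) by ring,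
      inv_mul_le_iff₀ (by positivity)]
    linarith
  · have h2 : s ^ 3 * a ^ 2 * H ^ 3 ≤ N ^ 3 := by
      refine le_trans ?_ (pow_le_pow_left₀ (by positivity) hN1 3)
      rw [mul_pow, mul_pow]
      exact mul_le_mul_of_nonneg_right (mul_le_mul_of_nonneg_left
        (pow_le_pow_right₀ ha (by norm_num)) (by positivity)) (by positivity)
    have hL4' : L ^ 4 ≤ Z := by
      have : 0 ≤ L ^ 4 := by positivity
      linarith
    have h3 : s ^ 3 * a ^ 2 * H ^ 3 * L ^ 4 ≤ Z * Z :=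
      mul_le_mul (h2.trans (hNZ 3 (by norm_num))) hL4' (by positivity) hZ0.le
    have h4 : Z * Z ≤ Z ^ 4 := by
      have := pow_le_pow_right₀ (by linarith : (1 : ℝ) ≤ Z) (by norm_num : 2 ≤ 4)
      linarith
    calc _ ≤ Z ^ 4 * Z ^ 4 := mul_le_mul_of_nonneg_right (h3.trans h4) (by positivity)
      _ = Z ^ 8 := by ring

/-- Collecting the three contributions to the regret; the middle one is of lower order. -/
theorem collect_bounds {L ℓ b g R₁ R₂ W : ℝ} (hL0 : 0 ≤ L) (hLℓ : L ≤ 2 * ℓ) (hℓ : 1 ≤ ℓ)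
    (hb : 0 ≤ b) (hg : 0 ≤ g) (hR₁ : 0 ≤ R₁) (hR₂ : 0 ≤ R₂) (hW : W ≤ R₁) :
    17 * L ^ 2 * R₁ + g * W + b * R₂ ≤ ℓ ^ 2 * ((68 + g) * R₁ + b * R₂) := by
  have hL2 : L ^ 2 ≤ (2 * ℓ) ^ 2 := pow_le_pow_left₀ hL0 hLℓ 2
  have hℓ2 : 1 ≤ ℓ ^ 2 := one_le_pow₀ hℓ
  have t1 : 17 * L ^ 2 * R₁ ≤ 68 * ℓ ^ 2 * R₁ := mul_le_mul_of_nonneg_right (by linarith) hR₁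
  have t2 : g * W ≤ ℓ ^ 2 * (g * R₁) := (mul_le_mul_of_nonneg_left hW hg).trans
    (le_mul_of_one_le_left (by positivity) hℓ2)
  have t3 : b * R₂ ≤ ℓ ^ 2 * (b * R₂) := le_mul_of_one_le_left (by positivity) hℓ2
  linarith

end Numeric

section Final

variable {S A : Type*} [Fintype S] [Fintype A] [DecidableEq S] [DecidableEq A] [Nonempty A]

omit [DecidableEq S] [DecidableEq A] [Nonempty A] in
theorem logL_eq (p : Params) : logL S A p =
    Real.log (10 * ((Fintype.card S : ℝ) * Fintype.card A * p.H / p.δ) * p.K) := by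
  unfold logL logTerm
  congr 1
  rw [div_div_eq_mul_div]
  ring

/-- The exponent `x` for which the total error probability is at most `δ`. -/
noncomputable def errorExponent (S A : Type*) [Fintype S] [Fintype A] (p : Params) : ℝ :=
  Real.log (8 * p.H * (Fintype.card S : ℝ) ^ 2 * Fintype.card A * (Nat.log 2 p.K + 1) / p.δ)

theorem one_le_cast_card (α : Type*) [Fintype α] [Nonempty α] : (1 : ℝ) ≤ Fintype.card α := by
  exact_mod_cast Fintype.card_pos

variable [Nonempty S] {p : Params} (hp : p.Valid)
include hp

omit [DecidableEq S] [DecidableEq A] in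
theorem one_le_errorExponent : 1 ≤ errorExponent S A p := by
  have hS := one_le_cast_card S
  have hA := one_le_cast_card A
  have hH : (1 : ℝ) ≤ p.H := by exact_mod_cast hp.H_pos
  have hδ := hp.δ_pos
  rw [errorExponent, Real.le_log_iff_exp_le (by positivity), le_div_iff₀ hδ]
  have h1 : (1 : ℝ) ≤ p.H * (Fintype.card S : ℝ) ^ 2 * Fintype.card A * (Nat.log 2 p.K + 1) := by
    refine one_le_mul_of_one_le_of_one_le (one_le_mul_of_one_le_of_one_le
      (one_le_mul_of_one_le_of_one_le hH (one_le_pow₀ hS)) hA) ?_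
    linarith [Nat.cast_nonneg (α := ℝ) (Nat.log 2 p.K)]
  have h2 := Real.exp_one_lt_d9
  have h3 : Real.exp 1 * p.δ ≤ 8 := by nlinarith [hp.δ_lt, Real.exp_pos 1]
  linarith

omit [DecidableEq S] [DecidableEq A] in
theorem mul_bernsteinError_le : (p.H * (Fintype.card S * (Fintype.card A *
    (2 + Fintype.card S * 2 + 2 + 1 + 1 : ℕ))) : ENNReal) *
      bernsteinError p.K (errorExponent S A p) ≤ ENNReal.ofReal p.δ := by
  have hS := one_le_cast_card S
  have hA := one_le_cast_card A
  have hH : (1 : ℝ) ≤ p.H := by exact_mod_cast hp.H_pos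
  have hδ := hp.δ_pos
  have e : (p.H * (Fintype.card S * (Fintype.card A *
      (2 + Fintype.card S * 2 + 2 + 1 + 1 : ℕ))) : ENNReal) = ENNReal.ofReal
      (p.H * (Fintype.card S * (Fintype.card A * (Fintype.card S * 2 + 6)))) := by
    rw [show (p.H * (Fintype.card S * (Fintype.card A * ((Fintype.card S : ℝ) * 2 + 6)))) =
      ((p.H * (Fintype.card S * (Fintype.card A *
        (2 + Fintype.card S * 2 + 2 + 1 + 1))) : ℕ) : ℝ) by push_cast; ring,
      ENNReal.ofReal_natCast]
    push_cast
    rfl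
  rw [e, bernsteinError, ← ENNReal.ofReal_mul (by positivity)]
  refine ENNReal.ofReal_le_ofReal ?_
  have hJ : (0 : ℝ) < Nat.log 2 p.K + 1 := by positivity
  rw [errorExponent, Real.exp_neg, Real.exp_log (by positivity), inv_div, mul_div_assoc',
    mul_div_assoc', div_le_iff₀ (by positivity)]
  have h1 : (Fintype.card S : ℝ) * 2 + 6 ≤ 8 * Fintype.card S := by linarith
  have := mul_le_mul_of_nonneg_left h1
    (by positivity : 0 ≤ p.H * Fintype.card S * Fintype.card A * (Nat.log 2 p.K + 1) * p.δ)
  linarith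

omit [DecidableEq S] [DecidableEq A] in
/-- The relations between the parameters for a large number of episodes. -/
theorem parameters_of_large
    (hK : minEpisodes * ((Fintype.card S : ℝ) * Fintype.card A * p.H / p.δ) ^ 400 ≤ p.K) :
    let N : ℝ := (Fintype.card S : ℝ) * Fintype.card A * p.H / p.δ
    let ℓ := Real.log ((Fintype.card S : ℝ) * Fintype.card A * p.H * p.K / p.δ)
    (Fintype.card S : ℝ) * Fintype.card A * p.H ≤ N ∧ 1 ≤ N ∧ 1 ≤ errorExponent S A p ∧
      100 * errorExponent S A p ≤ logL S A p ∧ logL S A p ≤ 2 * ℓ ∧ 1 ≤ ℓ ∧ 1 ≤ logL S A p ∧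
      N ^ 5 ≤ (p.K : ℝ) ^ (1 / 16 : ℝ) ∧ 1400 * logL S A p ^ 4 ≤ (p.K : ℝ) ^ (1 / 16 : ℝ) := by
  intro N ℓ
  have hS := one_le_cast_card S
  have hA := one_le_cast_card A
  have hH : (1 : ℝ) ≤ p.H := by exact_mod_cast hp.H_pos
  have hδ := hp.δ_pos
  have hK0 : (0 : ℝ) < p.K := by exact_mod_cast hp.K_pos
  have hSAH : (Fintype.card S : ℝ) * Fintype.card A * p.H ≤ N :=
    le_div_self (by positivity) hδ hp.δ_lt.le
  have hN : 1 ≤ N := (one_le_mul_of_one_le_of_one_le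
    (one_le_mul_of_one_le_of_one_le hS hA) hH).trans hSAH
  have hSN : (Fintype.card S : ℝ) ≤ N := le_trans (by
    rw [mul_assoc]; exact le_mul_of_one_le_right (by linarith)
      (one_le_mul_of_one_le_of_one_le hA hH)) hSAH
  obtain ⟨hy, hyN⟩ := log_bounds_of_large hN hK
  obtain ⟨hZN, hZL⟩ := rpow_ge_of_large hN hK
  have hxy := log_error_le hN hK
  have hlog10 : 0 ≤ Real.log 10 := Real.log_nonneg (by norm_num)
  have hlog10' : Real.log 10 ≤ 9 := by
    have := Real.log_le_sub_one_of_pos (by norm_num : (0 : ℝ) < 10)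
    linarith
  have hlogN := Real.log_nonneg hN
  have hLeq : logL S A p = Real.log (10 * N * p.K) := logL_eq p
  have hLsum : Real.log (10 * N * p.K) = Real.log 10 + Real.log N + Real.log p.K := by
    rw [Real.log_mul (by positivity) hK0.ne', Real.log_mul (by norm_num) (by linarith)]
  have hℓ : ℓ = Real.log N + Real.log p.K := by
    rw [← Real.log_mul (by linarith) hK0.ne']
    simp only [ℓ, N]
    congr 1
    ring
  have hxle : errorExponent S A p ≤ Real.log (8 * N ^ 2 * (Nat.log 2 p.K + 1)) := by
    rw [errorExponent]
    refine Real.log_le_log (by positivity) ?_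
    have h1 : (Fintype.card S : ℝ) * N ≤ N ^ 2 := by
      rw [sq]; exact mul_le_mul_of_nonneg_right hSN (by linarith)
    calc _ = 8 * ((Fintype.card S : ℝ) * N) * (Nat.log 2 p.K + 1) := by
          simp only [N]; ring
      _ ≤ _ := mul_le_mul_of_nonneg_right (mul_le_mul_of_nonneg_left h1 (by norm_num))
          (by positivity)
  rw [hLeq, hℓ, hLsum]
  rw [hLsum] at hZL
  exact ⟨hSAH, hN, one_le_errorExponent hp, by linarith, by linarith, by linarith, by linarith,
    hZN, hZL⟩

variable {M : MDP S A} {D : ℕ → Episode S A} {s₁ : S}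

/-- The regret bound for accurate data and a large number of episodes. -/
theorem regret_le_of_large
    (hK : minEpisodes * ((Fintype.card S : ℝ) * Fintype.card A * p.H / p.δ) ^ 400 ≤ p.K)
    (hD : Accurate M p D (errorExponent S A p))
    (hv : VisitsAccurate M p D (errorExponent S A p) s₁) {c₁ c₂ : ℝ} (hc₁ : 0 < c₁) (hc₂ : 0 ≤ c₂)
    (hη : ∀ t ∈ Icc 1 p.K, c₁ * √(1 / ((p.H : ℝ) ^ 2 * Fintype.card A * t)) ≤ p.η t ∧
      p.η t ≤ c₂ * √(1 / ((p.H : ℝ) ^ 2 * Fintype.card A * t)))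
    (hanti : AntitoneOn p.η (Set.Icc 1 p.K)) :
    regret M p s₁ D ≤
      Real.log ((Fintype.card S : ℝ) * Fintype.card A * p.H * p.K / p.δ) ^ 2 *
        ((88 + 15 * √(63 + 3 * (6 / c₁ + c₂))) *
            √(Fintype.card S * Fintype.card A * (p.H : ℝ) ^ 3 * p.K) +
          (6 / c₁ + c₂) * √(Fintype.card A * (p.H : ℝ) ^ 4 * p.K)) := by
  have hS := one_le_cast_card S
  have hA := one_le_cast_card A
  have hH : (1 : ℝ) ≤ p.H := by exact_mod_cast hp.H_pos
  have hK0 : (0 : ℝ) < p.K := by exact_mod_cast hp.K_pos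
  obtain ⟨hSN, hN, hx1, hxL, hLℓ, hℓ, hL1, hZN, hLZ⟩ := parameters_of_large (S := S) (A := A) hp hK
  -- everything is compared with the power `1 / 16` of `K`
  have hZ4 : (p.K : ℝ) ^ (1 / 4 : ℝ) = ((p.K : ℝ) ^ (1 / 16 : ℝ)) ^ 4 := by
    rw [← Real.rpow_natCast, ← Real.rpow_mul hK0.le]
    norm_num
  have hZ8 : √(p.K : ℝ) = ((p.K : ℝ) ^ (1 / 16 : ℝ)) ^ 8 := by
    rw [← Real.rpow_natCast, ← Real.rpow_mul hK0.le, Real.sqrt_eq_rpow]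
    norm_num
  obtain ⟨q1, q2, q3, q4⟩ := dominated_by_large hS hA hH hSN hZN hL1 hLZ
  rw [← hZ8] at q2 q4
  rw [← hZ4] at q4
  have hZ1 : 1400 ≤ (p.K : ℝ) ^ (1 / 16 : ℝ) := by linarith [one_le_pow₀ hL1 (n := 4)]
  have hL4 := pow_le_pow_right₀ hL1 (by norm_num : 1 ≤ 4)
  rw [pow_one] at hL4
  generalize (p.K : ℝ) ^ (1 / 16 : ℝ) = Z at *
  have hlamx : 25 * errorExponent S A p ≤ (Z ^ 2)⁻¹ * (p.K : ℝ) ^ (1 / 4 : ℝ) := by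
    have hZ0 : 0 < Z := by linarith
    rw [hZ4, show (Z ^ 2)⁻¹ * Z ^ 4 = Z ^ 2 by field_simp]
    have := le_self_pow₀ (by linarith : 1 ≤ Z) two_ne_zero
    linarith
  refine (hv.regret_le hp hx1 hxL hD (by positivity)
    (inv_le_one_of_one_le₀ (one_le_pow₀ (by linarith))) q1 hc₁ hc₂ hlamx q2 q3 hη hanti).trans ?_
  have hb : 0 ≤ 6 / c₁ + c₂ := by positivity
  have hW := q4.trans (Real.sqrt_le_sqrt (le_mul_of_one_le_left hK0.le
    (one_le_mul_of_one_le_of_one_le (one_le_mul_of_one_le_of_one_le hS hA)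
      (one_le_pow₀ hH (n := 3)))))
  have := collect_bounds (by linarith) hLℓ hℓ hb
    (by positivity : 0 ≤ 20 + 15 * √(63 + 3 * (6 / c₁ + c₂))) (Real.sqrt_nonneg _)
    (Real.sqrt_nonneg (Fintype.card A * (p.H : ℝ) ^ 4 * p.K)) hW
  rw [← add_assoc] at this
  norm_num only at this
  rw [mul_assoc (20 + _)]
  exact this

end Final

end RPOSAT

theorem theorem1 (c₁ c₂ : ℝ) (hc₁ : 0 < c₁) (hc₂ : c₁ ≤ c₂) :
    ∃ (C K₀ : ℝ) (r q : ℕ), 0 < C ∧ 0 < K₀ ∧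
      ∀ (S A : Type*) [Fintype S] [Fintype A] [DecidableEq S] [DecidableEq A] [Nonempty A]
        (H K : ℕ) (δ : ℝ) (η : ℕ → ℝ) (M : RPOSAT.MDP S A) (s₁ : S)
        (Ω : Type*) [MeasurableSpace Ω] (μ : Measure Ω) [IsProbabilityMeasure μ]
        (X : ℕ → Ω → RPOSAT.Episode S A),
        0 < H → 0 < δ → δ < 1 →
        (∀ t ∈ Finset.Icc 1 K,
          c₁ * √(1 / ((H : ℝ) ^ 2 * Fintype.card A * t)) ≤ η t ∧
          η t ≤ c₂ * √(1 / ((H : ℝ) ^ 2 * Fintype.card A * t))) →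
        AntitoneOn η (Set.Icc 1 K) →
        RPOSAT.IsInteraction M ⟨H, K, δ, η⟩ s₁ μ X →
        K₀ * ((Fintype.card S : ℝ) * Fintype.card A * H / δ) ^ q ≤ K →
        μ {ω | ¬ RPOSAT.regret M ⟨H, K, δ, η⟩ s₁ (fun k => X k ω) ≤
            C * Real.log ((Fintype.card S : ℝ) * Fintype.card A * H * K / δ) ^ r *
              RPOSAT.regretRate (Fintype.card S) (Fintype.card A) H K} ≤ ENNReal.ofReal δ ∧
        (H < Fintype.card S →
          μ {ω | ¬ RPOSAT.regret M ⟨H, K, δ, η⟩ s₁ (fun k => X k ω) ≤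
            C * Real.log ((Fintype.card S : ℝ) * Fintype.card A * H * K / δ) ^ r *
              √((Fintype.card S : ℝ) * Fintype.card A * (H : ℝ) ^ 3 * K)} ≤ ENNReal.ofReal δ) := by
  have hc₂0 : 0 ≤ c₂ := hc₁.le.trans hc₂
  have hb0 : 0 ≤ 6 / c₁ + c₂ := by positivity
  set b := 6 / c₁ + c₂ with hb
  set g := 88 + 15 * √(63 + 3 * b) with hg
  have hg0 : 0 < g := by positivity
  -- the term with `K ^ (1 / 4)` is not used: for `K` this large the others dominate it
  refine ⟨g + b, RPOSAT.minEpisodes, 2, 400, by positivity, Real.exp_pos _, ?_⟩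
  intro S A _ _ _ _ _ H K δ η M s₁ Ω _ μ _ X hH hδ hδ1 hη hanti hI hK
  have : Nonempty S := ⟨s₁⟩
  have hS := RPOSAT.one_le_cast_card S
  have hA := RPOSAT.one_le_cast_card A
  have hH1 : (1 : ℝ) ≤ H := by exact_mod_cast hH
  have hKpos : 0 < K := by
    have h1 : (0 : ℝ) < RPOSAT.minEpisodes *
        ((Fintype.card S : ℝ) * Fintype.card A * H / δ) ^ 400 :=
      mul_pos (Real.exp_pos _) (by positivity)
    exact_mod_cast h1.trans_le hK
  have hp : RPOSAT.Params.Valid ⟨H, K, δ, η⟩ := ⟨hH, hKpos, hδ, hδ1⟩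
  set x := RPOSAT.errorExponent S A ⟨H, K, δ, η⟩ with hx
  have hfail := (hI.measure_not_accurate_le (RPOSAT.one_le_errorExponent hp) hH).trans
    (RPOSAT.mul_bernsteinError_le hp)
  have hregret : ∀ ω, RPOSAT.Accurate M ⟨H, K, δ, η⟩ (fun i => X i ω) x ∧
      RPOSAT.VisitsAccurate M ⟨H, K, δ, η⟩ (fun i => X i ω) x s₁ → _ := fun ω hω =>
    RPOSAT.regret_le_of_large hp hK hω.1 hω.2 hc₁ hc₂0 hη hanti
  simp only [← hb, ← hg] at hregret
  set ℓ := Real.log ((Fintype.card S : ℝ) * Fintype.card A * H * K / δ) with hℓ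
  have hR₁0 : 0 ≤ √((Fintype.card S : ℝ) * Fintype.card A * (H : ℝ) ^ 3 * K) := Real.sqrt_nonneg _
  have hR₂0 : 0 ≤ √((Fintype.card A : ℝ) * (H : ℝ) ^ 4 * K) := Real.sqrt_nonneg _
  constructor
  · refine RPOSAT.measure_not_mono hfail fun ω hω => (hregret ω hω).trans ?_
    have h3 : 0 ≤ (Fintype.card S : ℝ) ^ (5 / 2 : ℝ) * (Fintype.card A : ℝ) ^ (5 / 4 : ℝ) *
      (H : ℝ) ^ (3 / 2 : ℝ) * (K : ℝ) ^ (1 / 4 : ℝ) := by positivity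
    rw [mul_comm (g + b), mul_assoc (ℓ ^ 2), RPOSAT.regretRate]
    refine mul_le_mul_of_nonneg_left ?_ (sq_nonneg ℓ)
    nlinarith [mul_nonneg hg0.le hR₂0, mul_nonneg hb0 hR₁0, mul_nonneg hg0.le h3,
      mul_nonneg hb0 h3]
  · intro hHS
    refine RPOSAT.measure_not_mono hfail fun ω hω => (hregret ω hω).trans ?_
    have hR : √((Fintype.card A : ℝ) * (H : ℝ) ^ 4 * K) ≤
        √((Fintype.card S : ℝ) * Fintype.card A * (H : ℝ) ^ 3 * K) := by
      refine Real.sqrt_le_sqrt ?_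
      have h1 : (H : ℝ) ≤ Fintype.card S := by exact_mod_cast hHS.le
      have := mul_le_mul_of_nonneg_right h1
        (by positivity : (0 : ℝ) ≤ Fintype.card A * (H : ℝ) ^ 3 * K)
      linarith
    rw [mul_comm (g + b), mul_assoc (ℓ ^ 2)]
    refine mul_le_mul_of_nonneg_left ?_ (sq_nonneg ℓ)
    have := mul_le_mul_of_nonneg_left hR hb0
    linarith
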